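/- **Setting.** Let $M$ be a globally hyperbolic time-oriented Lorentzian manifold and use a fixed positive measure $\mu$ (e.g. the metric volume) to trivialize densities. The even fields $\varphi^0$ and the odd fields (ghosts etc.) $\varphi^1$ are smooth real sections of finite-rank vector bundles $B_0$, $B_1$ over $M$; the antifields $\varphi^\ddagger_0$ (odd) and $\varphi^\ddagger_1$ (even) are smooth sections of the dual bundles. Functionals are complex valued (Bastiani-)smooth superfunctions of all fields and antifields: their component of degree $n$ in the odd variables is a function of the even variables with values in alternating $n$-linear forms in the odd variables, jointly smooth for the Fréchet topologies. Let $\mathfrak F[[\lambda]]$ be the space of formal power series in $\lambda$ with such functionals as coefficients; it contains the multilocal functionals $\mathcal{BV}$. With $\delta_r,\delta_l$ the right and left functional derivatives, the antibracket is $$\{X,Y\}=\sum_\alpha\Big\langle\frac{\delta_rX}{\delta\varphi^\alpha},\frac{\delta_lY}{\delta\varphi^\ddagger_\alpha}\Big\rangle-\Big\langle\frac{\delta_rX}{\delta\varphi^\ddagger_\alpha},\frac{\delta_lY}{\delta\varphi^\alpha}\Big\rangle .$$ Let $S_0=S_{00}+\theta_0$ be an even quadratic action, with $S_{00}=\frac12\int\varphi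 P\varphi\,d\mu$ free of antifields and $\theta_0=\int\varphi^\ddagger K\varphi\,d\mu$ linear in antifields, where $P$, $K$ are linear differential operators with complex coefficients, $K$ having a formal transpose, and $P$ formally (graded) symmetric, so that $\delta_lS_{00}/\delta\varphi=P\varphi$. Assume that $P$ is Green hyperbolic, i.e. has retarded and advanced Green operators $\Delta^{\rm R}$, $\Delta^{\rm A}$: linear and continuous from compactly supported sections to smooth sections, inverse to $P$ on compactly supported sections, with $\operatorname{supp}\Delta^{\rm R/A}f\subset J^{\pm}(\operatorname{supp} f)$. Let $V=\sum_{k\ge1}\lambda^kV_k$, where each $V_k$ is an even smooth functional whose left functional derivatives are smooth sections supported in a compact subset of $M$ depending only on $k$ and depend smoothly on the fields and antifields (for instance a compactly supported local functional). Put $S=S_0+V$, $s_0=\{\cdot,S_0\}$, $s=\{\cdot,S\}$. The inverse classical Møller map is $$(r_V^{-1}X)(\varphi,\varphi^\ddagger)=X\Big(\varphi+\Delta^{\rm R}\frac{\delta_lV}{\delta\varphi}(\varphi,\varphi^\ddagger),\ \varphi^\ddagger\Big),$$ understood through the Taylor expansion, as a formal power series in $\lambda$. **Claim.** Assume the classical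 master equation $\{S,S\}=0$ of the full theory, in all orders of $\lambda$ (on compactly supported configurations, i.e. modulo terms that vanish where the cutoff in $S_0$ is constant). Then $s_0$ and $s$ map $\mathfrak F[[\lambda]]$ to itself, $r_V^{-1}$ is a bijection of $\mathfrak F[[\lambda]]$, whose inverse is the classical Møller map $r_V$, and on $\mathfrak F[[\lambda]]$ $$s=r_V^{-1}\circ s_0\circ r_V .$$ -/

import Mathlib

open Set Filter Topology Bundle MeasureTheory
open scoped Manifold ContDiff

noncomputable section

namespace ClassicalBV

/-! ## Smooth maps between topological vector spaces -/

/-- Bastiani smoothness: all iterated directional derivatives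
`D k x (h₀, …, h_{k-1})` exist and are jointly continuous in the base point and the directions. -/
def BastianiSmooth {E W : Type*} [AddCommGroup E] [Module ℝ E] [TopologicalSpace E]
    [AddCommGroup W] [Module ℝ W] [TopologicalSpace W] (f : E → W) : Prop :=
  ∃ D : (k : ℕ) → E → (Fin k → E) → W,
    (∀ x v, D 0 x v = f x) ∧
    (∀ k, Continuous fun p : E × (Fin k → E) => D k p.1 p.2) ∧
    ∀ k x h v, Tendsto (fun t : ℝ => t⁻¹ • (D k (x + t • v) h - D k x h)) (𝓝[≠] 0)
      (𝓝 (D (k + 1) x (Fin.snoc h v)))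

/-! ## Complexifications -/

/-- The complexification `W ⊕ iW` of a real vector space, as pairs (real part, imaginary part). -/
abbrev Cx (W : Type*) := W × W

/-- Multiplication by `i` on a complexification. -/
def mulI {W : Type*} [AddCommGroup W] (w : Cx W) : Cx W := (-w.2, w.1)

/-- The complex linear extension of a real linear map with values in a complexification. -/
def extendC {W W' : Type*} [AddCommGroup W'] (A : W → Cx W') (w : Cx W) : Cx W' :=
  A w.1 + mulI (A w.2)

/-- The complex linear extension of a real linear complex valued map. -/
def evalC {W : Type*} (L : W → ℂ) (w : Cx W) : ℂ := L w.1 + Complex.I * L w.2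

/-! ## Superfunctions on a super vector space `S₀ ⊕ S₁` -/

/-- The data of a `W`-valued superfunction on the super vector space with even part `S₀` and odd
part `S₁`: its component `X n` of degree `n` in the odd variables is a function of the even
variable with values in the `n`-forms on `S₁`. See `IsSmooth` for the conditions. -/
abbrev SFun (S₀ S₁ W : Type*) := (n : ℕ) → S₀ → (Fin n → S₁) → W

/-- Smooth superfunctions: every component is alternating multilinear in the odd variables and
jointly (Bastiani) smooth. -/
def IsSmooth {S₀ S₁ W : Type*} [AddCommGroup S₀] [Module ℝ S₀] [TopologicalSpace S₀]
    [AddCommGroup S₁] [Module ℝ S₁] [TopologicalSpace S₁]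
    [AddCommGroup W] [Module ℝ W] [TopologicalSpace W] (X : SFun S₀ S₁ W) : Prop :=
  ∀ n, (∀ φ, ∃ A : S₁ [⋀^Fin n]→ₗ[ℝ] W, ∀ o, X n φ o = A o) ∧
    BastianiSmooth fun p : S₀ × (Fin n → S₁) => X n p.1 p.2

/-- Even superfunctions: only even powers of the odd variables occur. -/
def IsEven {S₀ S₁ W : Type*} [Zero W] (X : SFun S₀ S₁ W) : Prop :=
  ∀ n, Odd n → ∀ φ o, X n φ o = 0

/-- A complex vector field on a super vector space: its components along the even and the odd
directions, which are superfunctions with values in the complexified even and odd part. -/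
structure SVec (S₀ S₁ : Type*) where
  ev : SFun S₀ S₁ (Cx S₀)
  od : SFun S₀ S₁ (Cx S₁)

/-- The contraction `∑_A (∂_r X / ∂z^A) · Y^A` of the right derivative of a superfunction with a
vector field. The right derivative along an even direction is the directional derivative and the
one along an odd direction fills the last slot. The product of a `q`-form and an `r`-form is the
wedge product, i.e. `1 / (q! r!)` times the signed sum over the permutations of the arguments. -/
def contract {S₀ S₁ : Type*} [AddCommGroup S₀] [Module ℝ S₀]
    (X : SFun S₀ S₁ ℂ) (Y : SVec S₀ S₁) : SFun S₀ S₁ ℂ := fun p φ o =>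
  ∑ q : Fin (p + 1), ((q.1.factorial * (p - q.1).factorial : ℕ) : ℂ)⁻¹ *
    ∑ σ : Equiv.Perm (Fin p), ((Equiv.Perm.sign σ : ℤ) : ℂ) *
      (let u : Fin q.1 → S₁ := fun i => o (σ ⟨i.1, by omega⟩)
       let v : Fin (p - q.1) → S₁ := fun j => o (σ ⟨q.1 + j.1, by omega⟩)
       evalC (fun h => lineDeriv ℝ (fun φ' => X q.1 φ' u) φ h) (Y.ev (p - q.1) φ v) +
       evalC (fun e => X (q.1 + 1) φ (Fin.snoc u e)) (Y.od (p - q.1) φ v))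

/-! ## Formal power series in the coupling constant and substitution -/

/-- Formal power series in the coupling constant `λ` with superfunctions as coefficients. -/
abbrev FSeries (S₀ S₁ W : Type*) := ℕ → SFun S₀ S₁ W

/-- Formal power series all of whose coefficients are smooth superfunctions. -/
def smoothSeries (S₀ S₁ : Type*) [AddCommGroup S₀] [Module ℝ S₀] [TopologicalSpace S₀]
    [AddCommGroup S₁] [Module ℝ S₁] [TopologicalSpace S₁] : Set (FSeries S₀ S₁ ℂ) :=
  {X | ∀ k, IsSmooth (X k)}

/-- The contraction of a formal power series of functionals with one of vector fields. -/
def contractSeries {S₀ S₁ : Type*} [AddCommGroup S₀] [Module ℝ S₀]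
    (X : FSeries S₀ S₁ ℂ) (Y : ℕ → SVec S₀ S₁) : FSeries S₀ S₁ ℂ := fun n =>
  ∑ ij ∈ Finset.HasAntidiagonal.antidiagonal n, contract (X ij.1) (Y ij.2)

/-- `X(z)`, regarded as a function of two variables `(z, z')`. -/
def liftFst {S₀ S₁ : Type*} (X : FSeries S₀ S₁ ℂ) : FSeries (S₀ × S₀) (S₁ × S₁) ℂ :=
  fun k n φ o => X k n φ.1 fun i => (o i).1

/-- The vector field `η(z')` along the first of two variables `(z, z')`. -/
def frozen {S₀ S₁ : Type*} [Zero S₀] [Zero S₁] (η : SVec S₀ S₁) :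
    SVec (S₀ × S₀) (S₁ × S₁) where
  ev n φ o := (((η.ev n φ.2 fun i => (o i).2).1, 0), ((η.ev n φ.2 fun i => (o i).2).2, 0))
  od n φ o := (((η.od n φ.2 fun i => (o i).2).1, 0), ((η.od n φ.2 fun i => (o i).2).2, 0))

/-- The substitution `X(z) ↦ X(z + η(z))`, for a formal power series `η` of even vector fields
without constant term. It is the Taylor series `∑ₘ (1/m!) ⟨X⁽ᵐ⁾(z), η(z')^{⊗ m}⟩` in which the
displacement is kept frozen at `z'`, evaluated on the diagonal `z' = z`. As `η` is of order `λ`,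
only `m ≤ n` contribute to the coefficient of `λⁿ`. -/
def translate {S₀ S₁ : Type*} [AddCommGroup S₀] [Module ℝ S₀] [AddCommGroup S₁] [Module ℝ S₁]
    (η : ℕ → SVec S₀ S₁) (X : FSeries S₀ S₁ ℂ) : FSeries S₀ S₁ ℂ := fun n p φ o =>
  ∑ m ∈ Finset.range (n + 1), ((m.factorial : ℕ) : ℂ)⁻¹ *
    ((fun Z => contractSeries Z fun k => frozen (η k))^[m] (liftFst X)) n p (φ, φ)
      fun i => (o i, o i)

/-! ## Spaces of sections -/

section Sections

variable {d : ℕ} {M : Type*} [TopologicalSpace M] [ChartedSpace (EuclideanSpace ℝ (Fin d)) M]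
  {F : Type*} [NormedAddCommGroup F] [NormedSpace ℝ F]
  {B : M → Type*} [TopologicalSpace (TotalSpace F B)] [∀ x, TopologicalSpace (B x)]
  [FiberBundle F B] [∀ x, AddCommGroup (B x)] [∀ x, Module ℝ (B x)]

/-- The part of the chart at `p` over which the bundle is trivialized by the trivialization
at `p`. -/
def chartDomain (d : ℕ) {M : Type*} [TopologicalSpace M]
    [ChartedSpace (EuclideanSpace ℝ (Fin d)) M] (F : Type*) [NormedAddCommGroup F]
    (B : M → Type*) [TopologicalSpace (TotalSpace F B)] [∀ x, TopologicalSpace (B x)]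
    [FiberBundle F B] (p : M) : Set (EuclideanSpace ℝ (Fin d)) :=
  (extChartAt (𝓡 d) p).target ∩
    (extChartAt (𝓡 d) p).symm ⁻¹' (trivializationAt F B p).baseSet

/-- The coordinate expression near `p` of a section. -/
def localRep (p : M) (s : Cₛ^∞⟮𝓡 d; F, B⟯) (y : EuclideanSpace ℝ (Fin d)) : F :=
  (trivializationAt F B p ⟨(extChartAt (𝓡 d) p).symm y, s ((extChartAt (𝓡 d) p).symm y)⟩).2

/-- The Fréchet topology on smooth sections: uniform convergence on compact sets of all
derivatives of the coordinate expressions. -/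
instance sectionTopology : TopologicalSpace Cₛ^∞⟮𝓡 d; F, B⟯ :=
  ⨅ (p : M) (k : ℕ), TopologicalSpace.induced
    (fun s => UniformOnFun.ofFun {K : Set (chartDomain d F B p) | IsCompact K}
      fun y => iteratedFDeriv ℝ k (localRep p s) y.1) inferInstance

/-- The (closed) support of a section. -/
def sSupport (s : Cₛ^∞⟮𝓡 d; F, B⟯) : Set M := closure {x | s x ≠ 0}

/-- Compactly supported sections. -/
def IsCompactlySupported (s : Cₛ^∞⟮𝓡 d; F, B⟯) : Prop := IsCompact (sSupport s)

variable [IsManifold (𝓡 d) ∞ M] [VectorBundle ℝ F B] [ContMDiffVectorBundle ∞ F B (𝓡 d)]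
  [∀ x, IsTopologicalAddGroup (B x)] [∀ x, ContinuousSMul ℝ (B x)]

/-- The smooth sections of a vector bundle. -/
abbrev Sec (d : ℕ) {M : Type*} [TopologicalSpace M]
    [ChartedSpace (EuclideanSpace ℝ (Fin d)) M]
    (F : Type*) [NormedAddCommGroup F] [NormedSpace ℝ F]
    (B : M → Type*) [TopologicalSpace (TotalSpace F B)] [∀ x, TopologicalSpace (B x)]
    [FiberBundle F B] [∀ x, AddCommGroup (B x)] [∀ x, Module ℝ (B x)] :=
  Cₛ^∞⟮𝓡 d; F, B⟯

/-- The smooth sections of the dual bundle. With the help of a fixed measure on `M` they are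
identified with the sections of the dual bundle tensored with the densities. -/
abbrev CoSec (d : ℕ) {M : Type*} [TopologicalSpace M]
    [ChartedSpace (EuclideanSpace ℝ (Fin d)) M]
    (F : Type*) [NormedAddCommGroup F] [NormedSpace ℝ F]
    (B : M → Type*) [TopologicalSpace (TotalSpace F B)] [∀ x, TopologicalSpace (B x)]
    [FiberBundle F B] [∀ x, AddCommGroup (B x)] [∀ x, Module ℝ (B x)] [VectorBundle ℝ F B] :=
  Cₛ^∞⟮𝓡 d; F →L[ℝ] ℝ, fun x => B x →L[ℝ] ℝ⟯

variable [MeasurableSpace M] (μ : Measure M)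

/-- The pairing `∫ ⟨ξ, u⟩ dμ` of a complex covector field and a real field. -/
def pair (ξ : Cx (CoSec d F B)) (u : Sec d F B) : ℂ :=
  ((∫ x, ξ.1 x (u x) ∂μ : ℝ) : ℂ) + Complex.I * ((∫ x, ξ.2 x (u x) ∂μ : ℝ) : ℂ)

/-- The pairing `∫ ⟨ξ, u⟩ dμ` of a real covector field and a complex field. -/
def copair (ξ : CoSec d F B) (u : Cx (Sec d F B)) : ℂ :=
  ((∫ x, ξ x (u.1 x) ∂μ : ℝ) : ℂ) + Complex.I * ((∫ x, ξ x (u.2 x) ∂μ : ℝ) : ℂ)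

/-- An operator between spaces of sections is local if it does not increase supports. By Peetre's
theorem the local linear operators are exactly the linear differential operators (of locally
finite order). -/
def IsLocalOp {F' : Type*} [NormedAddCommGroup F'] [NormedSpace ℝ F']
    {B' : M → Type*} [TopologicalSpace (TotalSpace F' B')] [∀ x, TopologicalSpace (B' x)]
    [FiberBundle F' B'] [∀ x, AddCommGroup (B' x)] [∀ x, Module ℝ (B' x)]
    (A : Cₛ^∞⟮𝓡 d; F, B⟯ → Cx Cₛ^∞⟮𝓡 d; F', B'⟯) : Prop :=
  ∀ s, sSupport (A s).1 ⊆ sSupport s ∧ sSupport (A s).2 ⊆ sSupport s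

/-- `Δ` is a Green operator for `P` with supports controlled by `J` (which is `J⁺` for the retarded
and `J⁻` for the advanced Green operator): on compactly supported sources it is linear and
continuous, it is inverse to `P`, and `supp (Δ ξ) ⊆ J (supp ξ)`. Its values on other sources play
no role. -/
structure IsGreenOperator (J : Set M → Set M) (P : Sec d F B → Cx (CoSec d F B))
    (Δ : CoSec d F B → Cx (Sec d F B)) : Prop where
  linear : ∀ (a b : ℝ) (ξ ζ : CoSec d F B), IsCompactlySupported ξ → IsCompactlySupported ζ →
    Δ (a • ξ + b • ζ) = a • Δ ξ + b • Δ ζ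
  continuousOn : ∀ K : Set M, IsCompact K → ContinuousOn Δ {ξ | sSupport ξ ⊆ K}
  right_inv : ∀ ξ, IsCompactlySupported ξ → extendC P (Δ ξ) = (ξ, 0)
  left_inv : ∀ u, IsCompactlySupported u → extendC Δ (P u) = (u, 0)
  support : ∀ ξ, IsCompactlySupported ξ →
    sSupport (Δ ξ).1 ⊆ J (sSupport ξ) ∧ sSupport (Δ ξ).2 ⊆ J (sSupport ξ)

end Sections

/-! ## Spacetimes -/

/-- A time-oriented Lorentzian metric (signature `(+,-,…,-)`) on `M`; the time orientation is given
by a smooth timelike vector field. -/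
structure Spacetime (d : ℕ) (M : Type*) [TopologicalSpace M]
    [ChartedSpace (EuclideanSpace ℝ (Fin d)) M] [IsManifold (𝓡 d) ∞ M] where
  metric (x : M) : TangentSpace (𝓡 d) x →L[ℝ] TangentSpace (𝓡 d) x →L[ℝ] ℝ
  symm (x : M) (v w : TangentSpace (𝓡 d) x) : metric x v w = metric x w v
  contMDiff_metric : ContMDiff (𝓡 d)
    ((𝓡 d).prod 𝓘(ℝ, EuclideanSpace ℝ (Fin d) →L[ℝ] EuclideanSpace ℝ (Fin d) →L[ℝ] ℝ)) ∞
    fun x => TotalSpace.mk' (EuclideanSpace ℝ (Fin d) →L[ℝ] EuclideanSpace ℝ (Fin d) →L[ℝ] ℝ)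
      (E := fun x => TangentSpace (𝓡 d) x →L[ℝ] TangentSpace (𝓡 d) x →L[ℝ] ℝ) x (metric x)
  time (x : M) : TangentSpace (𝓡 d) x
  contMDiff_time : ContMDiff (𝓡 d) ((𝓡 d).prod 𝓘(ℝ, EuclideanSpace ℝ (Fin d))) ∞
    fun x => TotalSpace.mk' (EuclideanSpace ℝ (Fin d)) (E := fun x => TangentSpace (𝓡 d) x)
      x (time x)
  time_pos (x : M) : 0 < metric x (time x) (time x)
  neg_def (x : M) (w : TangentSpace (𝓡 d) x) :
    metric x (time x) w = 0 → w ≠ 0 → metric x w w < 0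

namespace Spacetime

variable {d : ℕ} {M : Type*} [TopologicalSpace M]
  [ChartedSpace (EuclideanSpace ℝ (Fin d)) M] [IsManifold (𝓡 d) ∞ M] (g : Spacetime d M)

/-- There is a smooth future directed causal curve from `p` to `q`. -/
def CausalCurve (p q : M) : Prop :=
  ∃ γ : ℝ → M, ContMDiffOn 𝓘(ℝ, ℝ) (𝓡 d) ∞ γ (Icc 0 1) ∧ γ 0 = p ∧ γ 1 = q ∧
    ∀ t ∈ Icc (0 : ℝ) 1,
      let v : TangentSpace (𝓡 d) (γ t) := mfderivWithin 𝓘(ℝ, ℝ) (𝓡 d) γ (Icc 0 1) t (1 : ℝ)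
      0 ≤ g.metric (γ t) v v ∧ 0 < g.metric (γ t) (g.time (γ t)) v

/-- The causal relation: `p = q` or there is a piecewise smooth future directed causal curve from
`p` to `q`. -/
def Causal : M → M → Prop := Relation.ReflTransGen g.CausalCurve

/-- The causal future of a set. -/
def Jplus (A : Set M) : Set M := {q | ∃ p ∈ A, g.Causal p q}

/-- The causal past of a set. -/
def Jminus (A : Set M) : Set M := {q | ∃ p ∈ A, g.Causal q p}

/-- Global hyperbolicity: there are no closed causal curves, and the causal diamonds spanned by
compact sets are compact. -/
def GloballyHyperbolic : Prop :=
  (∀ p q, g.Causal p q → g.Causal q p → p = q) ∧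
  ∀ K L : Set M, IsCompact K → IsCompact L → IsCompact (g.Jplus K ∩ g.Jminus L)

end Spacetime

/-! ## Fields, antifields, and the antibracket

The even fields `φ⁰` are the sections of a bundle `B₀`, the odd fields `φ¹` (ghosts, …) the sections
of a bundle `B₁`. The antifields have the opposite parity. Thus the even part of `T*[-1]` of the
space of fields consists of the pairs (even field, antifield of the odd fields), and the odd part
of the pairs (odd field, antifield of the even fields). -/

section BV

variable {d : ℕ} {M : Type*} [TopologicalSpace M] [ChartedSpace (EuclideanSpace ℝ (Fin d)) M]
  [IsManifold (𝓡 d) ∞ M]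
  {F₀ : Type*} [NormedAddCommGroup F₀] [NormedSpace ℝ F₀]
  {B₀ : M → Type*} [TopologicalSpace (TotalSpace F₀ B₀)] [∀ x, TopologicalSpace (B₀ x)]
  [FiberBundle F₀ B₀] [∀ x, AddCommGroup (B₀ x)] [∀ x, Module ℝ (B₀ x)] [VectorBundle ℝ F₀ B₀]
  [ContMDiffVectorBundle ∞ F₀ B₀ (𝓡 d)]
  [∀ x, IsTopologicalAddGroup (B₀ x)] [∀ x, ContinuousSMul ℝ (B₀ x)]
  {F₁ : Type*} [NormedAddCommGroup F₁] [NormedSpace ℝ F₁]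
  {B₁ : M → Type*} [TopologicalSpace (TotalSpace F₁ B₁)] [∀ x, TopologicalSpace (B₁ x)]
  [FiberBundle F₁ B₁] [∀ x, AddCommGroup (B₁ x)] [∀ x, Module ℝ (B₁ x)] [VectorBundle ℝ F₁ B₁]
  [ContMDiffVectorBundle ∞ F₁ B₁ (𝓡 d)]
  [∀ x, IsTopologicalAddGroup (B₁ x)] [∀ x, ContinuousSMul ℝ (B₁ x)]

/-- The even part of the space of fields and antifields: pairs `(φ⁰, φ‡₁)`. -/
abbrev EvenPart (d : ℕ) {M : Type*} [TopologicalSpace M]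
    [ChartedSpace (EuclideanSpace ℝ (Fin d)) M]
    (F₀ : Type*) [NormedAddCommGroup F₀] [NormedSpace ℝ F₀]
    (B₀ : M → Type*) [TopologicalSpace (TotalSpace F₀ B₀)] [∀ x, TopologicalSpace (B₀ x)]
    [FiberBundle F₀ B₀] [∀ x, AddCommGroup (B₀ x)] [∀ x, Module ℝ (B₀ x)]
    (F₁ : Type*) [NormedAddCommGroup F₁] [NormedSpace ℝ F₁]
    (B₁ : M → Type*) [TopologicalSpace (TotalSpace F₁ B₁)] [∀ x, TopologicalSpace (B₁ x)]
    [FiberBundle F₁ B₁] [∀ x, AddCommGroup (B₁ x)] [∀ x, Module ℝ (B₁ x)] [VectorBundle ℝ F₁ B₁]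
    [∀ x, IsTopologicalAddGroup (B₁ x)] [∀ x, ContinuousSMul ℝ (B₁ x)] :=
  Sec d F₀ B₀ × CoSec d F₁ B₁

/-- The odd part of the space of fields and antifields: pairs `(φ¹, φ‡₀)`. -/
abbrev OddPart (d : ℕ) {M : Type*} [TopologicalSpace M]
    [ChartedSpace (EuclideanSpace ℝ (Fin d)) M]
    (F₀ : Type*) [NormedAddCommGroup F₀] [NormedSpace ℝ F₀]
    (B₀ : M → Type*) [TopologicalSpace (TotalSpace F₀ B₀)] [∀ x, TopologicalSpace (B₀ x)]
    [FiberBundle F₀ B₀] [∀ x, AddCommGroup (B₀ x)] [∀ x, Module ℝ (B₀ x)] [VectorBundle ℝ F₀ B₀]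
    [∀ x, IsTopologicalAddGroup (B₀ x)] [∀ x, ContinuousSMul ℝ (B₀ x)]
    (F₁ : Type*) [NormedAddCommGroup F₁] [NormedSpace ℝ F₁]
    (B₁ : M → Type*) [TopologicalSpace (TotalSpace F₁ B₁)] [∀ x, TopologicalSpace (B₁ x)]
    [FiberBundle F₁ B₁] [∀ x, AddCommGroup (B₁ x)] [∀ x, Module ℝ (B₁ x)] :=
  Sec d F₁ B₁ × CoSec d F₀ B₀

/-- The left functional derivatives of a functional with respect to the fields and antifields, as
functionals with values in complex sections. -/
structure Grad (d : ℕ) {M : Type*} [TopologicalSpace M]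
    [ChartedSpace (EuclideanSpace ℝ (Fin d)) M]
    (F₀ : Type*) [NormedAddCommGroup F₀] [NormedSpace ℝ F₀]
    (B₀ : M → Type*) [TopologicalSpace (TotalSpace F₀ B₀)] [∀ x, TopologicalSpace (B₀ x)]
    [FiberBundle F₀ B₀] [∀ x, AddCommGroup (B₀ x)] [∀ x, Module ℝ (B₀ x)] [VectorBundle ℝ F₀ B₀]
    [∀ x, IsTopologicalAddGroup (B₀ x)] [∀ x, ContinuousSMul ℝ (B₀ x)]
    (F₁ : Type*) [NormedAddCommGroup F₁] [NormedSpace ℝ F₁]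
    (B₁ : M → Type*) [TopologicalSpace (TotalSpace F₁ B₁)] [∀ x, TopologicalSpace (B₁ x)]
    [FiberBundle F₁ B₁] [∀ x, AddCommGroup (B₁ x)] [∀ x, Module ℝ (B₁ x)] [VectorBundle ℝ F₁ B₁]
    [∀ x, IsTopologicalAddGroup (B₁ x)] [∀ x, ContinuousSMul ℝ (B₁ x)] where
  /-- derivative with respect to `φ⁰` -/
  f₀ : SFun (EvenPart d F₀ B₀ F₁ B₁) (OddPart d F₀ B₀ F₁ B₁) (Cx (CoSec d F₀ B₀))
  /-- derivative with respect to `φ¹` -/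
  f₁ : SFun (EvenPart d F₀ B₀ F₁ B₁) (OddPart d F₀ B₀ F₁ B₁) (Cx (CoSec d F₁ B₁))
  /-- derivative with respect to `φ‡₀` -/
  a₀ : SFun (EvenPart d F₀ B₀ F₁ B₁) (OddPart d F₀ B₀ F₁ B₁) (Cx (Sec d F₀ B₀))
  /-- derivative with respect to `φ‡₁` -/
  a₁ : SFun (EvenPart d F₀ B₀ F₁ B₁) (OddPart d F₀ B₀ F₁ B₁) (Cx (Sec d F₁ B₁))

/-- The Hamiltonian vector field of the antibracket: `φ^α ↦ δ_l Y/δφ‡_α`,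
`φ‡_α ↦ - δ_l Y/δφ^α`, where `G` is the gradient of `Y`. -/
def ham (G : Grad d F₀ B₀ F₁ B₁) :
    SVec (EvenPart d F₀ B₀ F₁ B₁) (OddPart d F₀ B₀ F₁ B₁) where
  ev n φ o := (((G.a₀ n φ o).1, -(G.f₁ n φ o).1), ((G.a₀ n φ o).2, -(G.f₁ n φ o).2))
  od n φ o := (((G.a₁ n φ o).1, -(G.f₀ n φ o).1), ((G.a₁ n φ o).2, -(G.f₀ n φ o).2))

/-- The antibracket `{X, Y} = ⟨δ_r X/δφ^α, δ_l Y/δφ‡_α⟩ - ⟨δ_r X/δφ‡_α, δ_l Y/δφ^α⟩`, where `G` is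
the gradient of `Y`; for formal power series in the coupling constant. -/
def antibracket (X : FSeries (EvenPart d F₀ B₀ F₁ B₁) (OddPart d F₀ B₀ F₁ B₁) ℂ)
    (G : ℕ → Grad d F₀ B₀ F₁ B₁) :
    FSeries (EvenPart d F₀ B₀ F₁ B₁) (OddPart d F₀ B₀ F₁ B₁) ℂ :=
  contractSeries X fun k => ham (G k)

variable [MeasurableSpace M] (μ : Measure M)

/-- `G` consists of the left functional derivatives of `V`: the derivative with respect to an even
variable is the directional derivative, the left derivative with respect to an odd variable fills
the first slot. -/
def IsGradient (V : SFun (EvenPart d F₀ B₀ F₁ B₁) (OddPart d F₀ B₀ F₁ B₁) ℂ)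
    (G : Grad d F₀ B₀ F₁ B₁) : Prop :=
  ∀ n φ o,
    (∀ h, lineDeriv ℝ (fun φ' => V n φ' o) φ (h, 0) = pair μ (G.f₀ n φ o) h) ∧
    (∀ h, V (n + 1) φ (Fin.cons (h, 0) o) = pair μ (G.f₁ n φ o) h) ∧
    (∀ k, V (n + 1) φ (Fin.cons (0, k) o) = copair μ k (G.a₀ n φ o)) ∧
    (∀ k, lineDeriv ℝ (fun φ' => V n φ' o) φ (0, k) = copair μ k (G.a₁ n φ o))

/-- An admissible interaction term: an even smooth functional `V` of fields and antifields whose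
functional derivatives `G` are smooth sections, depend smoothly on the fields and antifields, and
are all supported in one compact subset of `M`. Every even compactly supported local functional is
of this kind. -/
structure IsInteraction (V : SFun (EvenPart d F₀ B₀ F₁ B₁) (OddPart d F₀ B₀ F₁ B₁) ℂ)
    (G : Grad d F₀ B₀ F₁ B₁) : Prop where
  smooth : IsSmooth V
  even : IsEven V
  gradient : IsGradient μ V G
  smooth_f₀ : IsSmooth G.f₀
  smooth_f₁ : IsSmooth G.f₁
  smooth_a₀ : IsSmooth G.a₀
  smooth_a₁ : IsSmooth G.a₁
  compact : ∃ K : Set M, IsCompact K ∧ ∀ n φ o,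
    (sSupport (G.f₀ n φ o).1 ⊆ K ∧ sSupport (G.f₀ n φ o).2 ⊆ K) ∧
    (sSupport (G.f₁ n φ o).1 ⊆ K ∧ sSupport (G.f₁ n φ o).2 ⊆ K) ∧
    (sSupport (G.a₀ n φ o).1 ⊆ K ∧ sSupport (G.a₀ n φ o).2 ⊆ K) ∧
    (sSupport (G.a₁ n φ o).1 ⊆ K ∧ sSupport (G.a₁ n φ o).2 ⊆ K)

/-- A free (quadratic) action `S₀ = S₀₀ + θ₀`, with
`S₀₀ = ½ ∫ (φ⁰ P₀ φ⁰ + φ¹ P₁ φ¹)` and `θ₀ = ∫ (φ‡₀ K₀₁ φ¹ + φ‡₁ K₁₀ φ⁰)`,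
for linear differential operators `P₀, P₁, K₀₁, K₁₀` with complex coefficients. `P₀` is formally
symmetric and `P₁` formally skew, so that `δ_l S₀₀/δφ = P φ`. The operators `K₀₁ᵗ, K₁₀ᵗ` are the
formal transposes, which give `δ_l θ₀/δφ`. -/
structure FreeAction (d : ℕ) {M : Type*} [TopologicalSpace M]
    [ChartedSpace (EuclideanSpace ℝ (Fin d)) M]
    (F₀ : Type*) [NormedAddCommGroup F₀] [NormedSpace ℝ F₀]
    (B₀ : M → Type*) [TopologicalSpace (TotalSpace F₀ B₀)] [∀ x, TopologicalSpace (B₀ x)]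
    [FiberBundle F₀ B₀] [∀ x, AddCommGroup (B₀ x)] [∀ x, Module ℝ (B₀ x)] [VectorBundle ℝ F₀ B₀]
    [∀ x, IsTopologicalAddGroup (B₀ x)] [∀ x, ContinuousSMul ℝ (B₀ x)]
    (F₁ : Type*) [NormedAddCommGroup F₁] [NormedSpace ℝ F₁]
    (B₁ : M → Type*) [TopologicalSpace (TotalSpace F₁ B₁)] [∀ x, TopologicalSpace (B₁ x)]
    [FiberBundle F₁ B₁] [∀ x, AddCommGroup (B₁ x)] [∀ x, Module ℝ (B₁ x)] [VectorBundle ℝ F₁ B₁]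
    [∀ x, IsTopologicalAddGroup (B₁ x)] [∀ x, ContinuousSMul ℝ (B₁ x)]
    [MeasurableSpace M] (μ : Measure M) where
  P₀ : Sec d F₀ B₀ →L[ℝ] Cx (CoSec d F₀ B₀)
  P₁ : Sec d F₁ B₁ →L[ℝ] Cx (CoSec d F₁ B₁)
  K₀₁ : Sec d F₁ B₁ →L[ℝ] Cx (Sec d F₀ B₀)
  K₁₀ : Sec d F₀ B₀ →L[ℝ] Cx (Sec d F₁ B₁)
  K₀₁t : CoSec d F₀ B₀ →L[ℝ] Cx (CoSec d F₁ B₁)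
  K₁₀t : CoSec d F₁ B₁ →L[ℝ] Cx (CoSec d F₀ B₀)
  local_P₀ : IsLocalOp P₀
  local_P₁ : IsLocalOp P₁
  local_K₀₁ : IsLocalOp K₀₁
  local_K₁₀ : IsLocalOp K₁₀
  local_K₀₁t : IsLocalOp K₀₁t
  local_K₁₀t : IsLocalOp K₁₀t
  symm_P₀ : ∀ u v, IsCompactlySupported u → IsCompactlySupported v →
    pair μ (P₀ u) v = pair μ (P₀ v) u
  skew_P₁ : ∀ u v, IsCompactlySupported u → IsCompactlySupported v →
    pair μ (P₁ u) v = -pair μ (P₁ v) u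
  transpose_K₀₁ : ∀ ξ u, IsCompactlySupported ξ → IsCompactlySupported u →
    pair μ (K₀₁t ξ) u = copair μ ξ (K₀₁ u)
  transpose_K₁₀ : ∀ ξ u, IsCompactlySupported ξ → IsCompactlySupported u →
    pair μ (K₁₀t ξ) u = copair μ ξ (K₁₀ u)

namespace FreeAction

variable {μ} (S₀ : FreeAction d F₀ B₀ F₁ B₁ μ)

/-- The free action as a functional. It is meaningful on compactly supported configurations, where
the integrals converge. -/
def toFun : SFun (EvenPart d F₀ B₀ F₁ B₁) (OddPart d F₀ B₀ F₁ B₁) ℂ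
  | 0, φ, _ => (1 / 2) * pair μ (S₀.P₀ φ.1) φ.1 + copair μ φ.2 (S₀.K₁₀ φ.1)
  | 2, _, o => (1 / 2) * (pair μ (S₀.P₁ (o 1).1) (o 0).1 - pair μ (S₀.P₁ (o 0).1) (o 1).1) +
      (copair μ (o 0).2 (S₀.K₀₁ (o 1).1) - copair μ (o 1).2 (S₀.K₀₁ (o 0).1))
  | _, _, _ => 0

/-- The left functional derivatives of the free action (meaningful on all configurations):
`δ_l S₀/δφ⁰ = P₀ φ⁰ + K₁₀ᵗ φ‡₁`, `δ_l S₀/δφ¹ = P₁ φ¹ - K₀₁ᵗ φ‡₀`, `δ_l S₀/δφ‡₀ = K₀₁ φ¹`,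
`δ_l S₀/δφ‡₁ = K₁₀ φ⁰`. -/
def grad : Grad d F₀ B₀ F₁ B₁ where
  f₀ := fun
    | 0, φ, _ => S₀.P₀ φ.1 + S₀.K₁₀t φ.2
    | _, _, _ => 0
  f₁ := fun
    | 1, _, o => S₀.P₁ (o 0).1 - S₀.K₀₁t (o 0).2
    | _, _, _ => 0
  a₀ := fun
    | 1, _, o => S₀.K₀₁ (o 0).1
    | _, _, _ => 0
  a₁ := fun
    | 0, φ, _ => S₀.K₁₀ φ.1
    | _, _, _ => 0

/-- The gradients of `S₀`, as a constant formal power series. -/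
def gradSeries : ℕ → Grad d F₀ B₀ F₁ B₁
  | 0 => S₀.grad
  | _ + 1 => ⟨0, 0, 0, 0⟩

/-- The total action `S₀ + ∑_{k ≥ 0} λ^{k+1} V k`. -/
def totalAction (V : FSeries (EvenPart d F₀ B₀ F₁ B₁) (OddPart d F₀ B₀ F₁ B₁) ℂ) :
    FSeries (EvenPart d F₀ B₀ F₁ B₁) (OddPart d F₀ B₀ F₁ B₁) ℂ
  | 0 => S₀.toFun
  | k + 1 => V k

/-- The gradients of the total action `S₀ + ∑_{k ≥ 0} λ^{k+1} V k`, where `G k` is the gradient of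
`V k`. -/
def totalGrad (G : ℕ → Grad d F₀ B₀ F₁ B₁) : ℕ → Grad d F₀ B₀ F₁ B₁
  | 0 => S₀.grad
  | k + 1 => G k

/-- The free classical BV operator `s₀ = {·, S₀}`. -/
def freeBV (X : FSeries (EvenPart d F₀ B₀ F₁ B₁) (OddPart d F₀ B₀ F₁ B₁) ℂ) :
    FSeries (EvenPart d F₀ B₀ F₁ B₁) (OddPart d F₀ B₀ F₁ B₁) ℂ :=
  antibracket X S₀.gradSeries

/-- The classical BV operator `s = {·, S₀ + V}` of the interacting theory. -/
def fullBV (G : ℕ → Grad d F₀ B₀ F₁ B₁)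
    (X : FSeries (EvenPart d F₀ B₀ F₁ B₁) (OddPart d F₀ B₀ F₁ B₁) ℂ) :
    FSeries (EvenPart d F₀ B₀ F₁ B₁) (OddPart d F₀ B₀ F₁ B₁) ℂ :=
  antibracket X (S₀.totalGrad G)

/-- The classical master equation `{S, S} = 0` of the full theory `S = S₀ + V`, in every order of
the coupling constant. As the integral defining `S₀` need not converge (equivalently, modulo terms
that vanish where the cutoff of `S₀` is constant), it is required on compactly supported
configurations. -/
def ClassicalMasterEquation
    (V : FSeries (EvenPart d F₀ B₀ F₁ B₁) (OddPart d F₀ B₀ F₁ B₁) ℂ)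
    (G : ℕ → Grad d F₀ B₀ F₁ B₁) : Prop :=
  ∀ k n φ o, IsCompactlySupported φ.1 → IsCompactlySupported φ.2 →
    (∀ i, IsCompactlySupported (o i).1 ∧ IsCompactlySupported (o i).2) →
    antibracket (S₀.totalAction V) (S₀.totalGrad G) k n φ o = 0

end FreeAction

/-- The displacement `φ^α ↦ Δᴿ^{αβ} δ_l V/δφ^β`, `φ‡_α ↦ 0`, for the interaction
`∑_{k ≥ 0} λ^{k+1} V k` with gradients `G k` and the retarded Green operators `Δ₀, Δ₁` of the even
and the odd fields. -/
def displacement (Δ₀ : CoSec d F₀ B₀ → Cx (Sec d F₀ B₀)) (Δ₁ : CoSec d F₁ B₁ → Cx (Sec d F₁ B₁))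
    (G : ℕ → Grad d F₀ B₀ F₁ B₁) :
    ℕ → SVec (EvenPart d F₀ B₀ F₁ B₁) (OddPart d F₀ B₀ F₁ B₁)
  | 0 => ⟨0, 0⟩
  | k + 1 =>
    { ev := fun n φ o => (((extendC Δ₀ ((G k).f₀ n φ o)).1, 0), ((extendC Δ₀ ((G k).f₀ n φ o)).2, 0))
      od := fun n φ o => (((extendC Δ₁ ((G k).f₁ n φ o)).1, 0), ((extendC Δ₁ ((G k).f₁ n φ o)).2, 0)) }

/-- The inverse classical Møller map
`(r_V⁻¹ X)(φ, φ‡) = X(φ + Δᴿ δ_l V/δφ (φ, φ‡), φ‡)`. -/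
def mollerInv (Δ₀ : CoSec d F₀ B₀ → Cx (Sec d F₀ B₀)) (Δ₁ : CoSec d F₁ B₁ → Cx (Sec d F₁ B₁))
    (G : ℕ → Grad d F₀ B₀ F₁ B₁)
    (X : FSeries (EvenPart d F₀ B₀ F₁ B₁) (OddPart d F₀ B₀ F₁ B₁) ℂ) :
    FSeries (EvenPart d F₀ B₀ F₁ B₁) (OddPart d F₀ B₀ F₁ B₁) ℂ :=
  translate (displacement Δ₀ Δ₁ G) X

/-- The classical Møller map `r_V`: the inverse of `r_V⁻¹` on formal power series of smooth
functionals. -/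
def moller (Δ₀ : CoSec d F₀ B₀ → Cx (Sec d F₀ B₀)) (Δ₁ : CoSec d F₁ B₁ → Cx (Sec d F₁ B₁))
    (G : ℕ → Grad d F₀ B₀ F₁ B₁) :
    FSeries (EvenPart d F₀ B₀ F₁ B₁) (OddPart d F₀ B₀ F₁ B₁) ℂ →
    FSeries (EvenPart d F₀ B₀ F₁ B₁) (OddPart d F₀ B₀ F₁ B₁) ℂ :=
  Function.invFunOn (mollerInv Δ₀ Δ₁ G)
    (smoothSeries (EvenPart d F₀ B₀ F₁ B₁) (OddPart d F₀ B₀ F₁ B₁))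

end BV

end ClassicalBV

end

/-!
The BV differentials `s₀ = {·, S₀}` and `s = {·, S}` act on functionals as vector fields, the
Hamiltonian vector fields `L` (linear, since `S₀` is quadratic) and `Q` of the antibracket, and the
inverse Møller map is the substitution `z ↦ z + η(z)` with the even displacement `η = Δᴿ δV/δφ` of
order `λ`. Hence the inverse Møller map differs in each order of `λ` from the identity by a
function of the lower orders only, and is bijective (`bijOn_of_causal`, `bijOn_translate`).

A substitution intertwines two vector fields if it maps one into the other, that is, if
`Q + Q(η) = L + L ∘ η`, where `Q(η)` is the derivative of `η` along `Q`. As the substitution is defined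
by its Taylor series, this is proved algebraically (`contractSeries_translate`): the series is the
exponential of the contraction with `η` on a doubled space of variables, one copy for the argument of
the functional and one for that of `η`, followed by the restriction to the diagonal. The graded
commutator of two contractions is the contraction with the graded commutator of the fields
(`vcontract_commutator`), and the commutators with the exponent that occur here commute with it
(`mul_texp`).

The equation for `η` comes from the master equation. By the graded symmetry of the antibracket,
the derivative of `{S, S} = 0` says that the derivative of `Q` along itself vanishes
(`sum_actV_eq_zero`). This argument needs `S` as a functional, so it applies on the spaces of
configurations with support in a fixed compact set, on which the integrals converge; since compactly
supported sections are dense, it follows everywhere (`FreeAction.sqV_ham_eq_zero`). The components of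
`Q(Q) = 0` are, in order zero, the intertwining relations `P₀ K₀₁ = K₁₀ᵗ P₁` and
`P₁ K₁₀ = -K₀₁ᵗ P₀` of the free operators, and, in higher orders, `Q(δV/δφ) = Kᵗ δV/δφ - P δV/δφ‡`
with signs depending on the parity (`FreeAction.grad_identity₀`, `FreeAction.grad_identity₁`).

Applying `Δᴿ` to the latter gives `Q(η) = Δᴿ Kᵗ δV/δφ - δV/δφ‡`, as `Δᴿ P = 1` on compactly supported
sections. A solution of `P u = 0` with support in the future of a compact set vanishes
(`green_unique`, by pairing with `Δᴬ f`, which is where global hyperbolicity enters), so that the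
intertwining relations carry over to the Green operators, `Δᴿ Kᵗ = K Δᴿ` (`green_intertwine`). This
turns `Q(η)` into `K η - δV/δφ‡`, which is the required equation
(`FreeAction.contractSeries_translate_displacement`).

Smoothness of superfunctions is handled through iterated tangent maps (`SmoothB`), for which the chain
rule is immediate; the equivalence with Bastiani smoothness enters only in `isSmooth_iff_reg`.
-/

set_option linter.unusedSectionVars false

noncomputable section

namespace ClassicalBV

universe u

/-! ### Smooth maps between locally convex spaces -/

/-- Hausdorff locally convex topological vector spaces over `ℝ`. -/
class LCTVS (E : Type*) [AddCommGroup E] [Module ℝ E] [TopologicalSpace E] : Prop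
    extends IsTopologicalAddGroup E, ContinuousSMul ℝ E, LocallyConvexSpace ℝ E, T2Space E

instance {E F : Type*} [AddCommGroup E] [Module ℝ E] [TopologicalSpace E] [LCTVS E]
    [AddCommGroup F] [Module ℝ F] [TopologicalSpace F] [LCTVS F] : LCTVS (E × F) where

instance {ι : Type*} {E : Type*} [AddCommGroup E] [Module ℝ E] [TopologicalSpace E] [LCTVS E] :
    LCTVS (ι → E) where

instance {E : Type*} [AddCommGroup E] [Module ℝ E] [TopologicalSpace E] [LCTVS E]
    (S : Submodule ℝ E) : LCTVS S where

instance : LCTVS ℂ where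
  toLocallyConvexSpace := NormedSpace.toLocallyConvexSpace

section Calculus

variable {W : Type*} [AddCommGroup W] [Module ℝ W] [TopologicalSpace W]

/-- `w` is the directional derivative of `f` at `x` along `v`. -/
def HasDD {E : Type*} [AddCommGroup E] [Module ℝ E] (f : E → W) (x v : E) (w : W) : Prop :=
  Tendsto (fun t : ℝ => t⁻¹ • (f (x + t • v) - f x)) (𝓝[≠] 0) (𝓝 w)

open Classical in
/-- The directional derivative of `f` at `x` along `v`, with value `0` where it does not exist. -/
def dirD {E : Type*} [AddCommGroup E] [Module ℝ E] (f : E → W) (x v : E) : W :=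
  if h : ∃ w, HasDD f x v w then h.choose else 0

theorem HasDD.unique [T2Space W] {E : Type*} [AddCommGroup E] [Module ℝ E] {f : E → W} {x v : E}
    {w w' : W} (h : HasDD f x v w) (h' : HasDD f x v w') : w = w' :=
  tendsto_nhds_unique h h'

theorem HasDD.dirD_eq [T2Space W] {E : Type*} [AddCommGroup E] [Module ℝ E] {f : E → W} {x v : E}
    {w : W} (h : HasDD f x v w) : dirD f x v = w := by
  have h' : ∃ w, HasDD f x v w := ⟨w, h⟩
  rw [dirD, dif_pos h']
  exact h'.choose_spec.unique h

/-- Difference quotients only see the restriction of the function to the line. -/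
theorem hasDD_congr_line {E E' : Type*} [AddCommGroup E] [Module ℝ E] [AddCommGroup E']
    [Module ℝ E'] {f : E → W} {f' : E' → W} {x v : E} {x' v' : E'}
    (h : ∀ t : ℝ, f (x + t • v) = f' (x' + t • v')) (w : W) :
    HasDD f x v w ↔ HasDD f' x' v' w := by
  have h0 : f x = f' x' := by simpa using h 0
  simp only [HasDD, h, h0]

theorem dirD_congr_line {E E' : Type*} [AddCommGroup E] [Module ℝ E] [AddCommGroup E']
    [Module ℝ E'] {f : E → W} {f' : E' → W} {x v : E} {x' v' : E'}
    (h : ∀ t : ℝ, f (x + t • v) = f' (x' + t • v')) : dirD f x v = dirD f' x' v' := by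
  have : HasDD f x v = HasDD f' x' v' := funext fun w => propext (hasDD_congr_line h w)
  unfold dirD
  rw [this]

theorem lineDeriv_eq_dirD {E : Type*} [AddCommGroup E] [Module ℝ E] (f : E → ℂ) (x v : E) :
    lineDeriv ℝ f x v = dirD f x v := by
  have key : ∀ w, HasDD f x v w ↔ HasDerivAt (fun t : ℝ => f (x + t • v)) w 0 := by
    intro w
    rw [hasDerivAt_iff_tendsto_slope_zero]
    simp [HasDD]
  by_cases h : ∃ w, HasDD f x v w
  · obtain ⟨w, hw⟩ := h
    rw [hw.dirD_eq]
    exact ((key w).1 hw).deriv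
  · rw [dirD, dif_neg h]
    exact lineDeriv_zero_of_not_lineDifferentiableAt fun hd =>
      h ⟨_, (key _).2 (DifferentiableAt.hasDerivAt hd)⟩

section Lines

variable {E : Type*} [AddCommGroup E] [Module ℝ E]

theorem hasDD_const (c : W) (x v : E) : HasDD (fun _ => c) x v 0 := by
  simpa [HasDD] using tendsto_const_nhds

theorem hasDD_zero_dir (f : E → W) (x : E) : HasDD f x 0 0 := by
  simpa [HasDD] using tendsto_const_nhds

theorem dirD_zero_dir [T2Space W] (f : E → W) (x : E) : dirD f x 0 = 0 :=
  (hasDD_zero_dir f x).dirD_eq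

theorem HasDD.add [ContinuousAdd W] {f g : E → W} {x v : E} {a b : W} (hf : HasDD f x v a)
    (hg : HasDD g x v b) : HasDD (fun y => f y + g y) x v (a + b) := by
  refine (Tendsto.add hf hg).congr fun t => ?_
  rw [← smul_add, add_sub_add_comm]

theorem HasDD.clm {W' : Type*} [AddCommGroup W'] [Module ℝ W'] [TopologicalSpace W']
    {f : E → W} {x v : E} {a : W} (hf : HasDD f x v a) (L : W →L[ℝ] W') :
    HasDD (fun y => L (f y)) x v (L a) := by
  refine ((L.continuous.tendsto a).comp hf).congr fun t => ?_
  simp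

theorem HasDD.const_smul_dir [ContinuousSMul ℝ W] {f : E → W} {x v : E} {a : W}
    (hf : HasDD f x v a) (c : ℝ) : HasDD f x (c • v) (c • a) := by
  rcases eq_or_ne c 0 with rfl | hc
  · simpa using hasDD_zero_dir f x
  have h1 : Tendsto (fun t : ℝ => t * c) (𝓝[≠] 0) (𝓝[≠] 0) := by
    refine tendsto_nhdsWithin_of_tendsto_nhds_of_eventually_within _ ?_ ?_
    · exact tendsto_nhdsWithin_of_tendsto_nhds
        (by simpa using (continuous_mul_const c).tendsto (0 : ℝ))
    · filter_upwards [self_mem_nhdsWithin] with t ht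
      exact mul_ne_zero ht hc
  refine ((hf.comp h1).const_smul c).congr fun t => ?_
  simp only [Function.comp, smul_smul, mul_inv]
  congr 1
  field_simp

/-- The derivative along the line `t ↦ x + t v` at a later time. -/
theorem hasDD_line_tendsto {f : E → W} {x v : E} {s : ℝ} {w : W} (h : HasDD f (x + s • v) v w) :
    Tendsto (fun t : ℝ => t⁻¹ • (f (x + (s + t) • v) - f (x + s • v))) (𝓝[≠] 0) (𝓝 w) := by
  refine h.congr fun t => ?_
  rw [add_smul, add_assoc]

end Lines

/-- Mean value theorem: a difference quotient lies in every closed convex set that contains the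
derivatives. By the Hahn-Banach theorem, this is the mean value theorem for real functions. -/
theorem mean_value_mem [LCTVS W] {F F' : ℝ → W} {C : Set W} (hC : Convex ℝ C) (hC' : IsClosed C)
    (hF : ∀ s, Tendsto (fun t : ℝ => t⁻¹ • (F (s + t) - F s)) (𝓝[≠] 0) (𝓝 (F' s)))
    {t : ℝ} (ht : t ≠ 0) (hmem : ∀ r ∈ Icc (0 : ℝ) 1, F' (r * t) ∈ C) :
    t⁻¹ • (F t - F 0) ∈ C := by
  by_contra hnot
  obtain ⟨ℓ, u, h1, h2⟩ := geometric_hahn_banach_closed_point hC hC' hnot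
  have hd : ∀ s, HasDerivAt (fun r => ℓ (F r)) (ℓ (F' s)) s := by
    intro s
    rw [hasDerivAt_iff_tendsto_slope_zero]
    refine ((ℓ.continuous.tendsto _).comp (hF s)).congr fun r => ?_
    simp
  have hd' : ∀ s, HasDerivAt (fun r => ℓ (F (r * t))) (ℓ (F' (s * t)) * t) s := by
    intro s
    have := (hd (s * t)).comp s (h := fun r => r * t) (h' := t)
      (by simpa using (hasDerivAt_id s).mul_const t)
    exact this
  obtain ⟨c, hc, hc'⟩ := exists_hasDerivAt_eq_slope (fun r => ℓ (F (r * t)))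
    (fun s => ℓ (F' (s * t)) * t) zero_lt_one
    (fun s _ => (hd' s).continuousAt.continuousWithinAt) (fun s _ => hd' s)
  have h3 := h1 _ (hmem c (Ioo_subset_Icc_self hc))
  have h4 : ℓ (t⁻¹ • (F t - F 0)) = ℓ (F' (c * t)) := by
    simp only [one_mul, zero_mul, sub_zero, div_one] at hc'
    rw [map_smul, map_sub, ← hc', smul_eq_mul]
    field_simp
  rw [h4] at h2
  linarith

theorem exists_closed_convex_nhds [LCTVS W] {w : W} {U : Set W} (hU : U ∈ 𝓝 w) :
    ∃ C ∈ 𝓝 w, Convex ℝ C ∧ IsClosed C ∧ C ⊆ U := by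
  obtain ⟨V, hV, hVc, hVU⟩ := exists_mem_nhds_isClosed_subset hU
  obtain ⟨S, hS, hSc, hSV⟩ := (locallyConvexSpace_iff_exists_convex_subset ℝ W).1 inferInstance w V hV
  exact ⟨closure S, mem_of_superset hS subset_closure, hSc.closure, isClosed_closure,
    (closure_minimal hSV hVc).trans hVU⟩

/-- A map with jointly continuous directional derivatives, depending on a parameter, is strictly
differentiable: difference quotients converge along moving base points and directions. -/
theorem tendsto_quotient [LCTVS W] {E : Type*} [AddCommGroup E] [Module ℝ E] [TopologicalSpace E]
    [IsTopologicalAddGroup E] [ContinuousSMul ℝ E] {P : Type*} [TopologicalSpace P]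
    {f : P → E → W} {df : P → E → E → W} (hd : ∀ p x v, HasDD (f p) x v (df p x v))
    (hc : Continuous fun q : P × E × E => df q.1 q.2.1 q.2.2)
    {ι : Type*} {l : Filter ι} {t : ι → ℝ} {p : ι → P} {x v : ι → E} {p₀ : P} {x₀ v₀ : E}
    (ht : Tendsto t l (𝓝[≠] 0)) (hp : Tendsto p l (𝓝 p₀)) (hx : Tendsto x l (𝓝 x₀))
    (hv : Tendsto v l (𝓝 v₀)) :
    Tendsto (fun i => (t i)⁻¹ • (f (p i) (x i + t i • v i) - f (p i) (x i))) l
      (𝓝 (df p₀ x₀ v₀)) := by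
  intro U hU
  obtain ⟨C, hC, hCc, hCl, hCU⟩ := exists_closed_convex_nhds hU
  have ht0 : Tendsto t l (𝓝 0) := ht.mono_right nhdsWithin_le_nhds
  have h1 : Tendsto (fun q : ι × ℝ => (p q.1, x q.1 + (q.2 * t q.1) • v q.1, v q.1))
      (l ×ˢ 𝓟 (Icc (0 : ℝ) 1)) (𝓝 (p₀, x₀, v₀)) := by
    have hst : Tendsto (fun q : ι × ℝ => q.2 * t q.1) (l ×ˢ 𝓟 (Icc (0 : ℝ) 1)) (𝓝 0) := by
      refine squeeze_zero_norm' (a := fun q : ι × ℝ => ‖t q.1‖) ?_ ?_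
      · have : ∀ᶠ q : ι × ℝ in l ×ˢ 𝓟 (Icc (0 : ℝ) 1), q.2 ∈ Icc (0 : ℝ) 1 :=
          tendsto_snd.eventually (eventually_principal.2 fun _ h => h)
        filter_upwards [this] with q hq
        rw [norm_mul, Real.norm_of_nonneg hq.1]
        exact mul_le_of_le_one_left (norm_nonneg _) hq.2
      · exact (tendsto_norm_zero.comp ht0).comp tendsto_fst
    refine (hp.comp tendsto_fst).prodMk_nhds (Tendsto.prodMk_nhds ?_ (hv.comp tendsto_fst))
    simpa using (hx.comp tendsto_fst).add (hst.smul (hv.comp tendsto_fst))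
  have h2 := ((hc.tendsto (p₀, x₀, v₀)).comp h1) hC
  have h3 : ∀ᶠ i in l, ∀ s ∈ Icc (0 : ℝ) 1,
      df (p i) (x i + (s * t i) • v i) (v i) ∈ C := by
    rw [mem_map, mem_prod_principal] at h2
    exact h2
  have h4 : ∀ᶠ i in l, t i ∈ ({0}ᶜ : Set ℝ) := ht.eventually self_mem_nhdsWithin
  show ∀ᶠ i in l, _ ∈ U
  filter_upwards [h3, h4] with i hi hti
  refine hCU ?_
  have := mean_value_mem (F := fun s => f (p i) (x i + s • v i))
    (F' := fun s => df (p i) (x i + s • v i) (v i)) hCc hCl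
    (fun s => hasDD_line_tendsto (hd _ _ _)) hti hi
  simpa using this

/-- `f` has continuous iterated directional derivatives up to order `n`, in the sense that `f` and
its tangent map `(x, v) ↦ D f(x) v` do. -/
def CkB : ℕ → ∀ {E : Type u} [AddCommGroup E] [Module ℝ E] [TopologicalSpace E], (E → W) → Prop
  | 0, _, _, _, _, f => Continuous f
  | n + 1, _, _, _, _, f => Continuous f ∧ (∀ x v, HasDD f x v (dirD f x v)) ∧
      CkB n fun p : _ × _ => dirD f p.1 p.2

/-- Smoothness in terms of iterated tangent maps; equivalent to `BastianiSmooth` on locally convex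
spaces. -/
def SmoothB {E : Type u} [AddCommGroup E] [Module ℝ E] [TopologicalSpace E] (f : E → W) : Prop :=
  ∀ n, CkB n f

section

variable {E : Type u} [AddCommGroup E] [Module ℝ E] [TopologicalSpace E]

theorem CkB.continuous {n : ℕ} {f : E → W} (h : CkB n f) : Continuous f := by
  cases n with
  | zero => exact h
  | succ n => exact h.1

theorem CkB.intro [T2Space W] {n : ℕ} {f : E → W} (df : E × E → W) (hf : Continuous f)
    (hd : ∀ x v, HasDD f x v (df (x, v))) (hdf : CkB n df) : CkB (n + 1) f := by
  have h : (fun p : E × E => dirD f p.1 p.2) = df := funext fun p => (hd p.1 p.2).dirD_eq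
  refine ⟨hf, fun x v => ?_, by rw [h]; exact hdf⟩
  rw [(hd x v).dirD_eq]; exact hd x v

theorem CkB.pred {n : ℕ} {E : Type u} [AddCommGroup E] [Module ℝ E] [TopologicalSpace E]
    {f : E → W} (h : CkB (n + 1) f) : CkB n f := by
  induction n generalizing E with
  | zero => exact h.1
  | succ n ih => exact ⟨h.1, h.2.1, ih h.2.2⟩

theorem SmoothB.continuous {f : E → W} (h : SmoothB f) : Continuous f := h 0

theorem SmoothB.hasDD {f : E → W} (h : SmoothB f) (x v : E) : HasDD f x v (dirD f x v) :=
  (h 1).2.1 x v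

theorem SmoothB.tangent {f : E → W} (h : SmoothB f) :
    SmoothB fun p : E × E => dirD f p.1 p.2 := fun n => (h (n + 1)).2.2

end

theorem CkB.of_clm [T2Space W] {n : ℕ} {E : Type u} [AddCommGroup E] [Module ℝ E]
    [TopologicalSpace E] (L : E →L[ℝ] W) : CkB n (fun x => L x) := by
  induction n generalizing E with
  | zero => exact L.continuous
  | succ n ih =>
    refine CkB.intro (fun p => L p.2) L.continuous (fun x v => ?_)
      (ih (L.comp (ContinuousLinearMap.snd ℝ E E)))
    refine tendsto_const_nhds.congr' ?_
    filter_upwards [self_mem_nhdsWithin] with t ht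
    simp only [map_add, map_smul, add_sub_cancel_left, smul_smul]
    rw [inv_mul_cancel₀ ht, one_smul]

theorem CkB.const [T2Space W] {n : ℕ} {E : Type u} [AddCommGroup E]
    [Module ℝ E] [TopologicalSpace E] (c : W) : CkB n (fun _ : E => c) := by
  induction n generalizing E c with
  | zero => exact continuous_const
  | succ n ih => exact CkB.intro (fun _ => 0) continuous_const (fun x v => hasDD_const c x v) (ih 0)

theorem CkB.prodMk {W' : Type*} [AddCommGroup W'] [Module ℝ W'] [TopologicalSpace W']
    [T2Space W] [T2Space W'] {n : ℕ} {E : Type u} [AddCommGroup E] [Module ℝ E]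
    [TopologicalSpace E] {f : E → W} {g : E → W'} (hf : CkB n f) (hg : CkB n g) :
    CkB n (fun x => (f x, g x)) := by
  induction n generalizing E with
  | zero => exact Continuous.prodMk hf hg
  | succ n ih =>
    exact CkB.intro (fun p => (dirD f p.1 p.2, dirD g p.1 p.2)) (hf.1.prodMk hg.1)
      (fun x v => (hf.2.1 x v).prodMk_nhds (hg.2.1 x v)) (ih hf.2.2 hg.2.2)

theorem CkB.pi [T2Space W] {ι : Type*} {n : ℕ} {E : Type u} [AddCommGroup E] [Module ℝ E]
    [TopologicalSpace E] {f : E → ι → W} (hf : ∀ i, CkB n fun x => f x i) : CkB n f := by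
  induction n generalizing E with
  | zero => exact continuous_pi hf
  | succ n ih =>
    exact CkB.intro (fun p i => dirD (fun x => f x i) p.1 p.2) (continuous_pi fun i => (hf i).1)
      (fun x v => tendsto_pi_nhds.2 fun i => (hf i).2.1 x v) (ih fun i => (hf i).2.2)

/-- Chain rule for directional derivatives. -/
theorem HasDD.comp [LCTVS W] {E E' : Type*} [AddCommGroup E] [Module ℝ E]
    [AddCommGroup E'] [Module ℝ E'] [TopologicalSpace E'] [IsTopologicalAddGroup E']
    [ContinuousSMul ℝ E'] {f : E' → W} (hd : ∀ x v, HasDD f x v (dirD f x v))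
    (hc : Continuous fun p : E' × E' => dirD f p.1 p.2) {g : E → E'} {x v : E} {w : E'}
    (hg : HasDD g x v w) : HasDD (fun y => f (g y)) x v (dirD f (g x) w) := by
  have := tendsto_quotient (P := Unit) (f := fun _ => f) (df := fun _ x v => dirD f x v)
    (fun _ => hd) (hc.comp continuous_snd) (tendsto_id (x := 𝓝[≠] (0 : ℝ)))
    (tendsto_const_nhds (x := ())) (tendsto_const_nhds (x := g x)) hg
  refine this.congr' ?_
  filter_upwards [self_mem_nhdsWithin] with t ht
  simp only [id_eq, smul_smul]
  rw [mul_inv_cancel₀ ht, one_smul, add_sub_cancel]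

theorem CkB.comp_clm [T2Space W] {n : ℕ} {E E' : Type u} [AddCommGroup E] [Module ℝ E]
    [TopologicalSpace E] [AddCommGroup E'] [Module ℝ E'] [TopologicalSpace E']
    {f : E' → W} (hf : CkB n f) (L : E →L[ℝ] E') : CkB n (fun x => f (L x)) := by
  induction n generalizing E E' with
  | zero => exact Continuous.comp (g := f) hf L.continuous
  | succ n ih =>
    refine CkB.intro (fun p => dirD f (L p.1) (L p.2)) (hf.1.comp L.continuous) (fun x v => ?_) ?_
    · exact (hasDD_congr_line (fun t => by simp) _).1 (hf.2.1 (L x) (L v))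
    · exact ih (f := fun p : E' × E' => dirD f p.1 p.2) hf.2.2 (L.prodMap L)

theorem CkB.comp [LCTVS W] {n : ℕ} {E E' : Type u} [AddCommGroup E] [Module ℝ E]
    [TopologicalSpace E] [AddCommGroup E'] [Module ℝ E'] [TopologicalSpace E'] [LCTVS E']
    {f : E' → W} {g : E → E'} (hf : CkB n f) (hg : CkB n g) : CkB n (fun x => f (g x)) := by
  induction n generalizing E E' with
  | zero => exact Continuous.comp (g := f) hf hg
  | succ n ih =>
    refine CkB.intro (fun p => dirD f (g p.1) (dirD g p.1 p.2)) (hf.1.comp hg.1)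
      (fun x v => HasDD.comp hf.2.1 hf.2.2.continuous (hg.2.1 x v)) ?_
    have h1 : CkB n (fun p : E × E => g p.1) := hg.pred.comp_clm (ContinuousLinearMap.fst ℝ E E)
    exact ih (f := fun p : E' × E' => dirD f p.1 p.2)
      (g := fun p : E × E => (g p.1, dirD g p.1 p.2)) hf.2.2 (h1.prodMk hg.2.2)

/-! ### Algebraic operations on smooth maps -/

section

variable {E : Type u} [AddCommGroup E] [Module ℝ E] [TopologicalSpace E]

theorem SmoothB.of_clm [T2Space W] (L : E →L[ℝ] W) : SmoothB (fun x => L x) :=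
  fun _ => CkB.of_clm L

theorem SmoothB.const [T2Space W] (c : W) : SmoothB (fun _ : E => c) :=
  fun _ => CkB.const c

theorem SmoothB.prodMk {W' : Type*} [AddCommGroup W'] [Module ℝ W'] [TopologicalSpace W']
    [T2Space W] [T2Space W'] {f : E → W} {g : E → W'} (hf : SmoothB f) (hg : SmoothB g) :
    SmoothB (fun x => (f x, g x)) := fun n => (hf n).prodMk (hg n)

theorem SmoothB.pi [T2Space W] {ι : Type*} {f : E → ι → W} (hf : ∀ i, SmoothB fun x => f x i) :
    SmoothB f := fun n => CkB.pi fun i => hf i n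

theorem SmoothB.comp [LCTVS W] {E' : Type u} [AddCommGroup E'] [Module ℝ E'] [TopologicalSpace E']
    [LCTVS E'] {f : E' → W} {g : E → E'} (hf : SmoothB f) (hg : SmoothB g) :
    SmoothB (fun x => f (g x)) := fun n => (hf n).comp (hg n)

theorem CkB.clm_comp {n : ℕ} {E : Type u} [AddCommGroup E] [Module ℝ E] [TopologicalSpace E]
    {W' : Type*} [AddCommGroup W'] [Module ℝ W'] [TopologicalSpace W']
    [T2Space W'] {f : E → W} (L : W →L[ℝ] W') (hf : CkB n f) : CkB n (fun x => L (f x)) := by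
  induction n generalizing E with
  | zero => exact L.continuous.comp hf
  | succ n ih =>
    exact CkB.intro (fun p => L (dirD f p.1 p.2)) (L.continuous.comp hf.1)
      (fun x v => (hf.2.1 x v).clm L) (ih hf.2.2)

theorem SmoothB.clm_comp {W' : Type*} [AddCommGroup W'] [Module ℝ W'] [TopologicalSpace W']
    [T2Space W'] {f : E → W} (L : W →L[ℝ] W') (hf : SmoothB f) : SmoothB (fun x => L (f x)) :=
  fun n => (hf n).clm_comp L

theorem SmoothB.add [LCTVS W] {f g : E → W} (hf : SmoothB f) (hg : SmoothB g) :
    SmoothB (fun x => f x + g x) :=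
  (hf.prodMk hg).clm_comp (ContinuousLinearMap.fst ℝ W W + ContinuousLinearMap.snd ℝ W W)

theorem SmoothB.sum [LCTVS W] {ι : Type*} (s : Finset ι) {f : ι → E → W}
    (hf : ∀ i ∈ s, SmoothB (f i)) : SmoothB (fun x => ∑ i ∈ s, f i x) := by
  classical
  induction s using Finset.induction_on with
  | empty => simpa using SmoothB.const (0 : W)
  | insert i s hi ih =>
    simp only [Finset.sum_insert hi]
    exact (hf i (by simp)).add (ih fun j hj => hf j (by simp [hj]))

end

theorem CkB.id {n : ℕ} {E : Type u} [AddCommGroup E] [Module ℝ E]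
    [TopologicalSpace E] [T2Space E] : CkB n (fun x : E => x) :=
  CkB.of_clm (ContinuousLinearMap.id ℝ E)

theorem CkB.fst {n : ℕ} {E : Type u} [AddCommGroup E] [Module ℝ E]
    [TopologicalSpace E] {W' : Type*} [AddCommGroup W'] [Module ℝ W'] [TopologicalSpace W']
    [T2Space W] {f : E → W × W'} (hf : CkB n f) : CkB n (fun x => (f x).1) :=
  hf.clm_comp (ContinuousLinearMap.fst ℝ W W')

theorem CkB.snd {n : ℕ} {E : Type u} [AddCommGroup E] [Module ℝ E]
    [TopologicalSpace E] {W' : Type*} [AddCommGroup W'] [Module ℝ W'] [TopologicalSpace W']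
    [T2Space W'] {f : E → W × W'} (hf : CkB n f) : CkB n (fun x => (f x).2) :=
  hf.clm_comp (ContinuousLinearMap.snd ℝ W W')

theorem CkB.apply {n : ℕ} {E : Type u} [AddCommGroup E] [Module ℝ E]
    [TopologicalSpace E] {ι : Type*} [T2Space W] {f : E → ι → W} (hf : CkB n f) (i : ι) :
    CkB n (fun x => f x i) :=
  hf.clm_comp (ContinuousLinearMap.proj (R := ℝ) (φ := fun _ : ι => W) i)

theorem SmoothB.id {E : Type u} [AddCommGroup E] [Module ℝ E]
    [TopologicalSpace E] [T2Space E] : SmoothB (fun x : E => x) :=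
  SmoothB.of_clm (ContinuousLinearMap.id ℝ E)

theorem SmoothB.fst {E : Type u} [AddCommGroup E] [Module ℝ E]
    [TopologicalSpace E] {W' : Type*} [AddCommGroup W'] [Module ℝ W'] [TopologicalSpace W']
    [T2Space W] {f : E → W × W'} (hf : SmoothB f) : SmoothB (fun x => (f x).1) :=
  fun n => (hf n).fst

theorem SmoothB.snd {E : Type u} [AddCommGroup E] [Module ℝ E]
    [TopologicalSpace E] {W' : Type*} [AddCommGroup W'] [Module ℝ W'] [TopologicalSpace W']
    [T2Space W'] {f : E → W × W'} (hf : SmoothB f) : SmoothB (fun x => (f x).2) :=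
  fun n => (hf n).snd

theorem SmoothB.apply {E : Type u} [AddCommGroup E] [Module ℝ E]
    [TopologicalSpace E] {ι : Type*} [T2Space W] {f : E → ι → W} (hf : SmoothB f) (i : ι) :
    SmoothB (fun x => f x i) := fun n => (hf n).apply i

theorem CkB.sum [LCTVS W] {n : ℕ} {E : Type u} [AddCommGroup E] [Module ℝ E] [TopologicalSpace E]
    {ι : Type*} (s : Finset ι) {f : ι → E → W} (hf : ∀ i ∈ s, CkB n (f i)) :
    CkB n (fun x => ∑ i ∈ s, f i x) := by
  classical
  induction s using Finset.induction_on with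
  | empty => simpa using CkB.const (0 : W)
  | insert i s hi ih =>
    simp only [Finset.sum_insert hi]
    exact ((hf i (by simp)).prodMk (ih fun j hj => hf j (by simp [hj]))).clm_comp
      (ContinuousLinearMap.fst ℝ W W + ContinuousLinearMap.snd ℝ W W)

/-- Continuous bilinear maps are smooth. -/
theorem CkB.bilin [LCTVS W] {n : ℕ} {E F : Type u} [AddCommGroup E] [Module ℝ E]
    [TopologicalSpace E] [LCTVS E] [AddCommGroup F] [Module ℝ F] [TopologicalSpace F] [LCTVS F]
    (b : E →ₗ[ℝ] F →ₗ[ℝ] W) (hb : Continuous fun p : E × F => b p.1 p.2) :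
    CkB n (fun p : E × F => b p.1 p.2) := by
  induction n with
  | zero => exact hb
  | succ n ih =>
    refine CkB.intro (fun p => b p.1.1 p.2.2 + b p.2.1 p.1.2) hb (fun x v => ?_) ?_
    · have h : Tendsto (fun t : ℝ => b x.1 v.2 + b v.1 x.2 + t • b v.1 v.2) (𝓝[≠] 0)
          (𝓝 (b x.1 v.2 + b v.1 x.2)) := by
        have : Continuous fun t : ℝ => b x.1 v.2 + b v.1 x.2 + t • b v.1 v.2 := by fun_prop
        simpa using (this.tendsto 0).mono_left nhdsWithin_le_nhds
      refine h.congr' ?_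
      filter_upwards [self_mem_nhdsWithin] with t ht
      have ht' : t ≠ 0 := ht
      simp only [Prod.fst_add, Prod.snd_add, Prod.smul_fst, Prod.smul_snd, map_add, map_smul,
        LinearMap.add_apply, LinearMap.smul_apply]
      simp only [smul_add, smul_sub, smul_smul]
      have e1 : t⁻¹ * t = 1 := inv_mul_cancel₀ ht'
      have e2 : t⁻¹ * (t * t) = t := by field_simp
      simp only [e1, e2, one_smul]
      abel
    · have key : ∀ L : (E × F) × (E × F) →L[ℝ] E × F,
          CkB n (fun p : (E × F) × (E × F) => b (L p).1 (L p).2) :=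
        fun L => CkB.comp (f := fun p : E × F => b p.1 p.2) ih (CkB.of_clm L)
      have k1 := key (((ContinuousLinearMap.fst ℝ E F).comp (ContinuousLinearMap.fst ℝ _ _)).prod
        ((ContinuousLinearMap.snd ℝ E F).comp (ContinuousLinearMap.snd ℝ _ _)))
      have k2 := key (((ContinuousLinearMap.fst ℝ E F).comp (ContinuousLinearMap.snd ℝ _ _)).prod
        ((ContinuousLinearMap.snd ℝ E F).comp (ContinuousLinearMap.fst ℝ _ _)))
      exact (k1.prodMk k2).clm_comp
        (ContinuousLinearMap.fst ℝ W W + ContinuousLinearMap.snd ℝ W W)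

theorem SmoothB.bilin [LCTVS W] {E F : Type u} [AddCommGroup E] [Module ℝ E]
    [TopologicalSpace E] [LCTVS E] [AddCommGroup F] [Module ℝ F] [TopologicalSpace F] [LCTVS F]
    (b : E →ₗ[ℝ] F →ₗ[ℝ] W) (hb : Continuous fun p : E × F => b p.1 p.2) :
    SmoothB (fun p : E × F => b p.1 p.2) := fun _ => CkB.bilin b hb

/-! ### Linearity of the derivative and symmetry of second derivatives -/

theorem SmoothB.dirD_add [LCTVS W] {E : Type u} [AddCommGroup E] [Module ℝ E] [TopologicalSpace E]
    [LCTVS E] {f : E → W} (hf : SmoothB f) (x v w : E) :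
    dirD f x (v + w) = dirD f x v + dirD f x w := by
  have h1 := tendsto_quotient (P := Unit) (f := fun _ => f) (df := fun _ x v => dirD f x v)
    (fun _ => hf.hasDD) (hf.tangent.continuous.comp continuous_snd)
    (tendsto_id (x := 𝓝[≠] (0 : ℝ))) (tendsto_const_nhds (x := ()))
    (x := fun t => x + t • w) (x₀ := x) (v := fun _ => v) (v₀ := v)
    (by
      have : Continuous fun t : ℝ => x + t • w := by fun_prop
      simpa using (this.tendsto 0).mono_left nhdsWithin_le_nhds)
    tendsto_const_nhds
  refine HasDD.dirD_eq ((h1.add (hf.hasDD x w)).congr fun t => ?_)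
  simp only [id_eq]
  rw [← smul_add, sub_add_sub_cancel, smul_add, add_assoc, add_comm (t • w)]

theorem SmoothB.dirD_smul [LCTVS W] {E : Type u} [AddCommGroup E] [Module ℝ E] [TopologicalSpace E]
    {f : E → W} (hf : SmoothB f) (x v : E) (c : ℝ) :
    dirD f x (c • v) = c • dirD f x v :=
  ((hf.hasDD x v).const_smul_dir c).dirD_eq

/-- The iterated difference quotient `t⁻² (f(x + tv + tw) - f(x + tv) - f(x + tw) + f(x))`, which is
symmetric in `v` and `w`, converges to the second derivative. -/
theorem SmoothB.second_symm [LCTVS W] {E : Type u} [AddCommGroup E] [Module ℝ E]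
    [TopologicalSpace E] [LCTVS E] {f : E → W} (hf : SmoothB f) (x v w : E) :
    dirD (fun y => dirD f y v) x w = dirD (fun y => dirD f y w) x v := by
  have hsm : ∀ v, SmoothB fun y => dirD f y v := fun v =>
    hf.tangent.comp (g := fun y => (y, v))
      ((SmoothB.of_clm (ContinuousLinearMap.id ℝ E)).prodMk (SmoothB.const v))
  have hf' : ∀ v y w, HasDD (fun y => dirD f y v) y w (dirD (fun y => dirD f y v) y w) :=
    fun v => (hsm v).hasDD
  -- The mean value theorem, applied along `v` and then along `w`, places the difference quotient in
  -- every closed convex neighbourhood of the second derivative that contains its nearby values.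
  have key : ∀ v w, Tendsto (fun t : ℝ => t⁻¹ • t⁻¹ •
      ((f (x + t • v + t • w) - f (x + t • v)) - (f (x + t • w) - f x))) (𝓝[≠] 0)
      (𝓝 (dirD (fun y => dirD f y v) x w)) := by
    intro v w U hU
    obtain ⟨C, hC, hCc, hCl, hCU⟩ := exists_closed_convex_nhds hU
    have hcont : Continuous fun q : ℝ × ℝ => dirD (fun y => dirD f y v) (x + q.1 • v + q.2 • w) w :=
      (hsm v).tangent.continuous.comp
        (f := fun q : ℝ × ℝ => (x + q.1 • v + q.2 • w, w)) (by fun_prop)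
    have h0 : ∀ᶠ q : ℝ × ℝ in 𝓝 0,
        dirD (fun y => dirD f y v) (x + q.1 • v + q.2 • w) w ∈ C := by
      have := hcont.tendsto 0
      simp only [Prod.fst_zero, Prod.snd_zero, zero_smul, add_zero] at this
      exact this hC
    rw [Metric.eventually_nhds_iff] at h0
    obtain ⟨ε, hε, h0⟩ := h0
    have h1 : ∀ᶠ t : ℝ in 𝓝[≠] 0, |t| < ε := by
      refine nhdsWithin_le_nhds ?_
      filter_upwards [Metric.ball_mem_nhds (0 : ℝ) hε] with t ht
      simpa using ht
    have h2 : ∀ᶠ t : ℝ in 𝓝[≠] 0, t ∈ ({0}ᶜ : Set ℝ) := self_mem_nhdsWithin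
    show ∀ᶠ t : ℝ in 𝓝[≠] 0, _ ∈ U
    filter_upwards [h1, h2] with t ht ht0
    refine hCU ?_
    have hbd : ∀ r ∈ Icc (0 : ℝ) 1, |r * t| < ε := fun r hr => by
      rw [abs_mul, abs_of_nonneg hr.1]
      exact (mul_le_of_le_one_left (abs_nonneg _) hr.2).trans_lt ht
    -- along `w`, for the derivative in the direction `v`
    have step : ∀ r ∈ Icc (0 : ℝ) 1,
        t⁻¹ • (dirD f (x + (r * t) • v + t • w) v - dirD f (x + (r * t) • v) v) ∈ C := by
      intro r hr
      have hm : ∀ r' ∈ Icc (0 : ℝ) 1,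
          dirD (fun y => dirD f y v) (x + (r * t) • v + (r' * t) • w) w ∈ C := by
        intro r' hr'
        refine h0 (y := (r * t, r' * t)) ?_
        rw [Prod.dist_eq, max_lt_iff]
        simpa only [Prod.fst_zero, Prod.snd_zero, dist_zero_right, Real.norm_eq_abs] using
          And.intro (hbd r hr) (hbd r' hr')
      have := mean_value_mem (F := fun s => dirD f (x + (r * t) • v + s • w) v)
        (F' := fun s => dirD (fun y => dirD f y v) (x + (r * t) • v + s • w) w) hCc hCl
        (fun s => hasDD_line_tendsto (f := fun y => dirD f y v) (hf' v _ _)) ht0 hm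
      simpa only [zero_smul, add_zero] using this
    -- along `v`, for the quotient of the difference in the direction `w`
    have := mean_value_mem
      (F := fun s => t⁻¹ • (f (x + s • v + t • w) - f (x + s • v)))
      (F' := fun s => t⁻¹ • (dirD f (x + s • v + t • w) v - dirD f (x + s • v) v)) hCc hCl
      (fun s => by
        have a1 := hasDD_line_tendsto (x := x + t • w) (s := s) (hf.hasDD (x + t • w + s • v) v)
        have a2 := hasDD_line_tendsto (hf.hasDD (x + s • v) v)
        have e : ∀ r : ℝ, x + r • v + t • w = x + t • w + r • v := fun r => by abel
        simp only [e]
        refine ((a1.sub a2).const_smul t⁻¹).congr fun r => ?_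
        rw [← smul_sub r⁻¹, sub_sub_sub_comm, ← smul_sub t⁻¹ (f _ - f _), smul_comm])
      ht0 step
    simpa only [zero_smul, add_zero, ← smul_sub] using this
  refine tendsto_nhds_unique (key v w) ((key w v).congr fun t => ?_)
  congr 2
  rw [add_right_comm x (t • w) (t • v)]
  abel

/-! ### Comparison with Bastiani smoothness -/

theorem continuous_snoc (E : Type*) [TopologicalSpace E] (k : ℕ) :
    Continuous fun q : E × (Fin k → E) × E =>
      (q.1, (Fin.snoc q.2.1 q.2.2 : Fin (k + 1) → E)) := by
  refine continuous_fst.prodMk (continuous_pi fun i => ?_)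
  refine Fin.lastCases ?_ (fun i => ?_) i
  · simpa using continuous_snd.snd
  · simp only [Fin.snoc_castSucc]
    exact (continuous_apply i).comp continuous_snd.fst

/-- Iterated derivatives are multilinear: linearity in the last direction holds because it is a
direction of differentiation, in the others because it is preserved by derivatives. -/
theorem bastiani_multilinear [LCTVS W] {E : Type u} [AddCommGroup E] [Module ℝ E]
    [TopologicalSpace E] [LCTVS E] {D : (k : ℕ) → E → (Fin k → E) → W}
    (hc : ∀ k, Continuous fun p : E × (Fin k → E) => D k p.1 p.2)
    (hd : ∀ k x h v, HasDD (fun y => D k y h) x v (D (k + 1) x (Fin.snoc h v))) (k : ℕ) (x : E) :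
    ∃ m : MultilinearMap ℝ (fun _ : Fin k => E) W, ∀ h, D k x h = m h := by
  induction k generalizing x with
  | zero => exact ⟨MultilinearMap.constOfIsEmpty ℝ _ (D 0 x default), fun h => by
      rw [Subsingleton.elim h default]; rfl⟩
  | succ k ih =>
    have hlin_add : ∀ h v w, D (k + 1) x (Fin.snoc h (v + w)) =
        D (k + 1) x (Fin.snoc h v) + D (k + 1) x (Fin.snoc h w) := by
      intro h v w
      have h1 := tendsto_quotient (P := Unit) (f := fun _ y => D k y h)
        (df := fun _ x v => D (k + 1) x (Fin.snoc h v)) (fun _ y v => hd k y h v)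
        (((hc (k + 1)).comp (continuous_snoc E k)).comp
          (f := fun q : Unit × E × E => ((q.2.1, h, q.2.2) : E × (Fin k → E) × E)) (by fun_prop))
        (tendsto_id (x := 𝓝[≠] (0 : ℝ))) (tendsto_const_nhds (x := ()))
        (x := fun t => x + t • w) (x₀ := x) (v := fun _ => v) (v₀ := v)
        (by
          have : Continuous fun t : ℝ => x + t • w := by fun_prop
          simpa using (this.tendsto 0).mono_left nhdsWithin_le_nhds)
        tendsto_const_nhds
      refine HasDD.unique (hd k x h (v + w)) ((h1.add (hd k x h w)).congr fun t => ?_)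
      simp only [id_eq]
      rw [← smul_add, sub_add_sub_cancel, smul_add, add_assoc, add_comm (t • w)]
    have hlin_smul : ∀ h (c : ℝ) v, D (k + 1) x (Fin.snoc h (c • v)) =
        c • D (k + 1) x (Fin.snoc h v) := fun h c v =>
      HasDD.unique (hd k x h (c • v)) ((hd k x h v).const_smul_dir c)
    choose m hm using ih
    refine ⟨⟨D (k + 1) x, ?_, ?_⟩, fun h => rfl⟩
    · intro inst h i a b
      have : inst = instDecidableEqFin (k + 1) := Subsingleton.elim _ _
      subst this
      rw [← Fin.snoc_init_self h]
      generalize Fin.init h = h', h (Fin.last k) = l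
      refine Fin.lastCases ?_ (fun i => ?_) i
      · simp only [Fin.update_snoc_last]
        exact hlin_add _ _ _
      · simp only [← Fin.snoc_update]
        refine HasDD.unique (hd k x _ l) ((hd k x _ l).add (hd k x _ l) |>.congr fun t => ?_)
        simp only [hm, MultilinearMap.map_update_add]
    · intro inst h i c a
      have : inst = instDecidableEqFin (k + 1) := Subsingleton.elim _ _
      subst this
      rw [← Fin.snoc_init_self h]
      generalize Fin.init h = h', h (Fin.last k) = l
      refine Fin.lastCases ?_ (fun i => ?_) i
      · simp only [Fin.update_snoc_last]
        exact hlin_smul _ _ _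
      · simp only [← Fin.snoc_update]
        refine HasDD.unique (hd k x _ l) (((hd k x _ l).const_smul c).congr fun t => ?_)
        simp only [hm, MultilinearMap.map_update_smul]
        rw [← smul_sub, smul_comm]

/-- A multilinear map has directional derivatives: in the expansion of `m (h + t b)` in powers of
`t`, the terms of first order are those with one argument replaced. -/
theorem _root_.MultilinearMap.hasDD [LCTVS W] {E : Type*} [AddCommGroup E] [Module ℝ E] {k : ℕ}
    (m : MultilinearMap ℝ (fun _ : Fin k => E) W) (h b : Fin k → E) :
    HasDD m h b (∑ s : Finset (Fin k), if sᶜ.card = 1 then m (s.piecewise h b) else 0) := by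
  have hx : ∀ t : ℝ, m (h + t • b) =
      ∑ s : Finset (Fin k), t ^ sᶜ.card • m (s.piecewise h b) := by
    intro t
    rw [m.map_add_univ]
    refine Finset.sum_congr rfl fun s _ => ?_
    have := m.map_piecewise_smul (fun _ => t) (s.piecewise h b) sᶜ
    rw [Finset.prod_const] at this
    rw [← this]
    congr 1
    ext i
    by_cases hi : i ∈ s <;> simp [hi]
  have h0 : m h = ∑ s : Finset (Fin k), if sᶜ.card = 0 then m (s.piecewise h b) else 0 := by
    rw [Finset.sum_eq_single Finset.univ] <;> simp +contextual
  have hlim : ∀ s : Finset (Fin k), Tendsto (fun t : ℝ => t⁻¹ • (t ^ sᶜ.card • m (s.piecewise h b) -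
      if sᶜ.card = 0 then m (s.piecewise h b) else 0)) (𝓝[≠] 0)
      (𝓝 (if sᶜ.card = 1 then m (s.piecewise h b) else 0)) := by
    intro s
    generalize m (s.piecewise h b) = c
    rcases hs : sᶜ.card with _ | j
    · simp
    · have hc : Continuous fun t : ℝ => t ^ j • c := by fun_prop
      have : Tendsto (fun t : ℝ => t ^ j • c) (𝓝[≠] 0) (𝓝 (if j + 1 = 1 then c else 0)) := by
        refine tendsto_nhdsWithin_of_tendsto_nhds ((hc.tendsto 0).congr' ?_ |>.trans ?_)
        · exact EventuallyEq.rfl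
        · rcases j with _ | j <;> simp
      refine this.congr' ?_
      filter_upwards [self_mem_nhdsWithin] with t ht
      have ht' : t ≠ 0 := ht
      rw [if_neg (Nat.succ_ne_zero j), sub_zero, smul_smul, pow_succ', inv_mul_cancel_left₀ ht']
  refine (tendsto_finsetSum Finset.univ fun s _ => hlim s).congr fun t => ?_
  rw [hx, h0, ← Finset.sum_sub_distrib, Finset.smul_sum]

theorem BastianiSmooth.smoothB [LCTVS W] {E : Type u} [AddCommGroup E] [Module ℝ E]
    [TopologicalSpace E] [LCTVS E] {f : E → W} (hf : BastianiSmooth f) : SmoothB f := by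
  obtain ⟨D, hD0, hc, hd⟩ := hf
  choose m hm using fun k x => bastiani_multilinear hc hd k x
  -- All derivatives are treated together, as functions of the base point and of the directions: the
  -- tangent map of one involves the next derivative and, by multilinearity, the same derivative with
  -- one direction replaced.
  have key : ∀ n k, CkB n fun p : E × (Fin k → E) => D k p.1 p.2 := by
    intro n
    induction n with
    | zero => exact hc
    | succ n ih =>
      intro k
      refine CkB.intro (fun p => D (k + 1) p.1.1 (Fin.snoc p.1.2 p.2.1) +
        ∑ s : Finset (Fin k), if sᶜ.card = 1 then D k p.1.1 (s.piecewise p.1.2 p.2.2) else 0)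
        (hc k) (fun p v => ?_) ?_
      · obtain ⟨x, h⟩ := p
        obtain ⟨a, b⟩ := v
        have h1 := ClassicalBV.tendsto_quotient (P := Fin k → E) (f := fun h y => D k y h)
          (df := fun h x v => D (k + 1) x (Fin.snoc h v)) (fun h y v => hd k y h v)
          (((hc (k + 1)).comp (continuous_snoc E k)).comp
            (f := fun q : (Fin k → E) × E × E => ((q.2.1, q.1, q.2.2) : E × (Fin k → E) × E))
            (by fun_prop))
          (tendsto_id (x := 𝓝[≠] (0 : ℝ))) (p := fun t => h + t • b) (p₀ := h)
          (x := fun _ => x) (x₀ := x) (v := fun _ => a) (v₀ := a)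
          (by
            have : Continuous fun t : ℝ => h + t • b := by fun_prop
            simpa using (this.tendsto 0).mono_left nhdsWithin_le_nhds)
          tendsto_const_nhds tendsto_const_nhds
        have h2 := (m k x).hasDD h b
        simp only [← hm] at h2
        refine (h1.add h2).congr fun t => ?_
        simp only [id_eq, Prod.mk_add_mk, Prod.smul_mk, ← hm]
        rw [← smul_add, sub_add_sub_cancel]
      · have hS : CkB n fun p : (E × (Fin k → E)) × (E × (Fin k → E)) =>
            D (k + 1) p.1.1 (Fin.snoc p.1.2 p.2.1) := by
          have hL : CkB n fun p : (E × (Fin k → E)) × (E × (Fin k → E)) =>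
              (p.1.1, (Fin.snoc p.1.2 p.2.1 : Fin (k + 1) → E)) := by
            refine CkB.id.fst.fst.prodMk (CkB.pi fun i => ?_)
            refine Fin.lastCases ?_ (fun i => ?_) i
            · simpa only [Fin.snoc_last] using CkB.id.snd.fst
            · simpa only [Fin.snoc_castSucc] using CkB.id.fst.snd.apply i
          exact (ih (k + 1)).comp hL
        have hT : CkB n fun p : (E × (Fin k → E)) × (E × (Fin k → E)) =>
            ∑ s : Finset (Fin k),
              if sᶜ.card = 1 then D k p.1.1 (s.piecewise p.1.2 p.2.2) else 0 := by
          refine CkB.sum _ fun s _ => ?_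
          by_cases hs : sᶜ.card = 1
          · simp only [hs, if_true]
            have hL : CkB n fun p : (E × (Fin k → E)) × (E × (Fin k → E)) =>
                (p.1.1, s.piecewise p.1.2 p.2.2) := by
              refine CkB.id.fst.fst.prodMk (CkB.pi fun i => ?_)
              by_cases hi : i ∈ s
              · simpa only [Finset.piecewise_eq_of_mem _ _ _ hi] using CkB.id.fst.snd.apply i
              · simpa only [Finset.piecewise_eq_of_notMem _ _ _ hi] using CkB.id.snd.snd.apply i
            exact (ih k).comp hL
          · simp only [hs, if_false]
            exact CkB.const 0
        exact (hS.prodMk hT).clm_comp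
          (ContinuousLinearMap.fst ℝ W W + ContinuousLinearMap.snd ℝ W W)
  intro n
  have := (key n 0).comp (g := fun x : E => (x, (Fin.elim0 : Fin 0 → E)))
    ((CkB.of_clm (ContinuousLinearMap.id ℝ E)).prodMk (CkB.const _))
  simpa only [hD0] using this

/-- The iterated directional derivatives of a function on `E`. -/
def iterDir {E : Type u} [AddCommGroup E] [Module ℝ E] (f : E → W) : (k : ℕ) → E → (Fin k → E) → W
  | 0, x, _ => f x
  | k + 1, x, h => dirD (fun y => iterDir f k y (Fin.init h)) x (h (Fin.last k))

theorem SmoothB.iterDir [LCTVS W] {E : Type u} [AddCommGroup E] [Module ℝ E]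
    [TopologicalSpace E] [LCTVS E] {f : E → W} (hf : SmoothB f) (k : ℕ) :
    SmoothB fun p : E × (Fin k → E) => ClassicalBV.iterDir f k p.1 p.2 := by
  induction k with
  | zero => exact hf.comp (SmoothB.of_clm (ContinuousLinearMap.fst ℝ E (Fin 0 → E)))
  | succ k ih =>
    have h1 : SmoothB fun p : E × (Fin (k + 1) → E) =>
        (((p.1, Fin.init p.2), (p.2 (Fin.last k), 0)) :
          (E × (Fin k → E)) × (E × (Fin k → E))) := by
      have hp : SmoothB fun p : E × (Fin (k + 1) → E) => p := SmoothB.id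
      have hi : SmoothB fun p : E × (Fin (k + 1) → E) => (Fin.init p.2 : Fin k → E) :=
        SmoothB.pi fun i => hp.snd.apply (Fin.castSucc i)
      exact (hp.fst.prodMk hi).prodMk ((hp.snd.apply (Fin.last k)).prodMk (SmoothB.const 0))
    have h2 := ih.tangent.comp h1
    have e : (fun p : E × (Fin (k + 1) → E) => ClassicalBV.iterDir f (k + 1) p.1 p.2) = fun p =>
        dirD (fun q : E × (Fin k → E) => ClassicalBV.iterDir f k q.1 q.2) (p.1, Fin.init p.2)
          (p.2 (Fin.last k), 0) := by
      funext p
      exact dirD_congr_line fun t => by simp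
    rw [e]
    exact h2

theorem SmoothB.bastianiSmooth [LCTVS W] {E : Type u} [AddCommGroup E] [Module ℝ E]
    [TopologicalSpace E] [LCTVS E] {f : E → W} (hf : SmoothB f) : BastianiSmooth f := by
  refine ⟨ClassicalBV.iterDir f, fun x v => rfl, fun k => (hf.iterDir k).continuous,
    fun k x h v => ?_⟩
  have h1 := (hf.iterDir k).hasDD (x, h) (v, 0)
  have h2 : HasDD (fun y => ClassicalBV.iterDir f k y h) x v _ :=
    (hasDD_congr_line (fun t => by simp) _).1 h1
  have h3 : ClassicalBV.iterDir f (k + 1) x (Fin.snoc h v) =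
      dirD (fun y => ClassicalBV.iterDir f k y h) x v := by
    simp [ClassicalBV.iterDir]
  rw [h3, h2.dirD_eq]
  exact h2

end Calculus

/-! ### Antisymmetric functions and their products -/

section Antisymmetric

variable {S W : Type*} [AddCommGroup W]

/-- Functions of `n` arguments that change by the sign under permutations of the arguments. -/
def AntiS {n : ℕ} (f : (Fin n → S) → W) : Prop :=
  ∀ (σ : Equiv.Perm (Fin n)) (o : Fin n → S), f (o ∘ σ) = (Equiv.Perm.sign σ : ℤ) • f o

theorem AntiS.zero {n : ℕ} : AntiS (fun _ : Fin n → S => (0 : W)) := fun _ _ => by simp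

theorem AntiS.add {n : ℕ} {f g : (Fin n → S) → W} (hf : AntiS f) (hg : AntiS g) :
    AntiS (fun o => f o + g o) := fun σ o => by
  simp only [hf σ o, hg σ o, smul_add]

theorem AntiS.sum {n : ℕ} {ι : Type*} (s : Finset ι) {f : ι → (Fin n → S) → W}
    (hf : ∀ i ∈ s, AntiS (f i)) : AntiS (fun o => ∑ i ∈ s, f i o) := fun σ o => by
  rw [Finset.smul_sum]; exact Finset.sum_congr rfl fun i hi => hf i hi σ o

theorem AntiS.map {W' : Type*} [AddCommGroup W'] {n : ℕ} {f : (Fin n → S) → W} (hf : AntiS f)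
    (L : W →+ W') : AntiS (fun o => L (f o)) := fun σ o => by
  simp only [hf σ o, map_zsmul]

/-- The permutation of `n + 1` letters that fixes `0`. -/
def permSucc {n : ℕ} (τ : Equiv.Perm (Fin n)) : Equiv.Perm (Fin (n + 1)) :=
  Equiv.Perm.decomposeFin.symm (0, τ)

@[simp] theorem permSucc_zero {n : ℕ} (τ : Equiv.Perm (Fin n)) : permSucc τ 0 = 0 := by
  simp [permSucc]

@[simp] theorem permSucc_succ {n : ℕ} (τ : Equiv.Perm (Fin n)) (i : Fin n) :
    permSucc τ i.succ = (τ i).succ := by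
  simp [permSucc]

@[simp] theorem sign_permSucc {n : ℕ} (τ : Equiv.Perm (Fin n)) :
    Equiv.Perm.sign (permSucc τ) = Equiv.Perm.sign τ := by
  simp [permSucc]

/-- A permutation of `n + 1` letters is determined by the letter `i` that it sends to `0` and a
permutation of `n` letters. -/
theorem bijective_permSucc_mul_cycleRange (n : ℕ) :
    Function.Bijective fun x : Fin (n + 1) × Equiv.Perm (Fin n) =>
      permSucc x.2 * x.1.cycleRange := by
  rw [Fintype.bijective_iff_injective_and_card]
  constructor
  · rintro ⟨i, τ⟩ ⟨j, ρ⟩ h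
    have h' : permSucc τ * i.cycleRange = permSucc ρ * j.cycleRange := h
    have hij : i = j := by
      have h1 : (permSucc τ * i.cycleRange) i = 0 := by simp
      rw [h', Equiv.Perm.mul_apply] at h1
      have h2 : j.cycleRange i = 0 := by
        apply (permSucc ρ).injective
        rw [h1, permSucc_zero]
      apply j.cycleRange.injective
      rw [h2, Fin.cycleRange_self]
    subst hij
    have h1 := mul_right_cancel h'
    congr 1
    ext k : 1
    have := congrArg (fun f => f k.succ) h1
    simpa using this
  · rw [Fintype.card_prod, Fintype.card_perm, Fintype.card_perm, Fintype.card_fin, Fintype.card_fin,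
      Nat.factorial_succ]

theorem cons_permSucc_cycleRange {n : ℕ} (i : Fin (n + 1)) (τ : Equiv.Perm (Fin n)) (w : S)
    (o : Fin n → S) :
    (Fin.cons w o : Fin (n + 1) → S) ∘ (permSucc τ * i.cycleRange) =
      i.insertNth w (o ∘ τ) := by
  funext k
  rcases Fin.eq_self_or_eq_succAbove i k with rfl | ⟨j, rfl⟩
  · simp
  · simp

theorem AntiS.insertNth {n : ℕ} {f : (Fin (n + 1) → S) → W} (hf : AntiS f) (i : Fin (n + 1))
    (w : S) (o : Fin n → S) :
    f (i.insertNth w o) = (-1 : ℤ) ^ i.1 • f (Fin.cons w o) := by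
  have h := cons_permSucc_cycleRange i 1 w o
  have e : o ∘ (1 : Equiv.Perm (Fin n)) = o := rfl
  rw [e] at h
  rw [← h, hf]
  simp

theorem AntiS.snoc {n : ℕ} {f : (Fin (n + 1) → S) → W} (hf : AntiS f) (w : S) (o : Fin n → S) :
    f (Fin.snoc o w) = (-1 : ℤ) ^ n • f (Fin.cons w o) := by
  rw [← Fin.insertNth_last']
  simpa using hf.insertNth (Fin.last n) w o

theorem AntiS.cons {n : ℕ} {f : (Fin (n + 1) → S) → W} (hf : AntiS f) (w : S) :
    AntiS (fun o => f (Fin.cons w o)) := fun σ o => by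
  have h : (Fin.cons w (o ∘ σ) : Fin (n + 1) → S) = Fin.cons w o ∘ permSucc σ := by
    funext k
    refine Fin.cases ?_ (fun k => ?_) k <;> simp
  show f (Fin.cons w (o ∘ σ)) = _
  rw [h, hf, sign_permSucc]

theorem AntiS.snoc_right {n : ℕ} {f : (Fin (n + 1) → S) → W} (hf : AntiS f) (w : S) :
    AntiS (fun o => f (Fin.snoc o w)) := fun σ o => by
  have := hf.cons w σ o
  simp only at this
  simp only [hf.snoc, this]
  rw [smul_comm]

/-- The signed sum over the distributions of `p` arguments to a function of `q` and a function of
`r` arguments. -/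
def wedgeSum (p q r : ℕ) (h : q + r = p) (B : (Fin q → S) → (Fin r → S) → W) (o : Fin p → S) : W :=
  ∑ σ : Equiv.Perm (Fin p), (Equiv.Perm.sign σ : ℤ) •
    B (fun i => o (σ ⟨i.1, by omega⟩)) (fun j => o (σ ⟨q + j.1, by omega⟩))

theorem wedgeSum_antiS (p q r : ℕ) (h : q + r = p) (B : (Fin q → S) → (Fin r → S) → W) :
    AntiS (wedgeSum p q r h B) := fun ρ o => by
  rw [wedgeSum, wedgeSum, Finset.smul_sum]
  refine Fintype.sum_equiv (Equiv.mulLeft ρ) _ _ fun σ => ?_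
  simp only [Equiv.coe_mulLeft, Equiv.Perm.mul_apply, Function.comp, Equiv.Perm.sign_mul,
    Units.val_mul, smul_smul]
  rw [← mul_assoc, Int.units_coe_mul_self, one_mul]

theorem sum_fin_split {p q r : ℕ} (h : q + r = p) (t : Fin p → W) {α β : W}
    (hα : ∀ i : Fin p, i.1 < q → t i = α) (hβ : ∀ i : Fin p, ¬ i.1 < q → t i = β) :
    ∑ i, t i = q • α + r • β := by
  subst h
  rw [Fin.sum_univ_add]
  congr 1
  · rw [Finset.sum_congr rfl fun i _ => hα _ (by simp)]
    simp
  · rw [Finset.sum_congr rfl fun i _ => hβ _ (by simp)]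
    simp

/-- Inserting a vector into the first slot of a product is a graded derivation. -/
theorem wedgeSum_cons {p q r : ℕ} (h : q + r = p + 1) {B : (Fin q → S) → (Fin r → S) → W}
    (hB1 : ∀ v, AntiS fun u => B u v) (hB2 : ∀ u, AntiS (B u)) (w : S) (o : Fin p → S) {α β : W}
    (hα : ∀ q' (e : q = q' + 1), α = wedgeSum p q' r (by omega)
      (fun u v => B (Fin.cons (α := fun _ => S) w u ∘ Fin.cast e) v) o)
    (hβ : ∀ r' (e : r = r' + 1), β = (-1 : ℤ) ^ q • wedgeSum p q r' (by omega)
      (fun u v => B u (Fin.cons (α := fun _ => S) w v ∘ Fin.cast e)) o) :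
    wedgeSum (p + 1) q r h B (Fin.cons w o) = q • α + r • β := by
  -- A permutation of `p + 1` letters is a permutation fixing `0` followed by the cycle that moves `0`
  -- to a slot `i`, and the sum is split according to whether `i` is a slot of the first factor.
  rw [wedgeSum, ← (bijective_permSucc_mul_cycleRange p).sum_comp, Fintype.sum_prod_type]
  refine sum_fin_split h _ (fun i hi => ?_) (fun i hi => ?_)
  · obtain ⟨q, rfl⟩ : ∃ q', q = q' + 1 := ⟨q - 1, by omega⟩
    rw [hα q rfl, wedgeSum]
    refine Finset.sum_congr rfl fun τ _ => ?_
    have hz := cons_permSucc_cycleRange i τ w o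
    have e1 : (fun k : Fin (q + 1) => (Fin.cons w o : Fin (p + 1) → S)
        ((permSucc τ * i.cycleRange) ⟨k.1, by omega⟩)) =
        Fin.insertNth (α := fun _ => S) ⟨i.1, hi⟩ w (fun k : Fin q => o (τ ⟨k.1, by omega⟩)) := by
      funext k
      have := congrFun hz ⟨k.1, by omega⟩
      simp only [Function.comp] at this
      rw [this]
      rcases Fin.eq_self_or_eq_succAbove (⟨i.1, hi⟩ : Fin (q + 1)) k with rfl | ⟨j, rfl⟩
      · simp
      · rw [Fin.insertNth_apply_succAbove]
        have : (⟨((⟨i.1, hi⟩ : Fin (q + 1)).succAbove j).1, by omega⟩ : Fin (p + 1)) =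
            i.succAbove ⟨j.1, by omega⟩ := by
          ext
          simp only [Fin.succAbove, Fin.lt_def]
          split_ifs <;> simp_all <;> omega
        rw [this, Fin.insertNth_apply_succAbove]
        rfl
    have e2 : (fun k : Fin r => (Fin.cons w o : Fin (p + 1) → S)
        ((permSucc τ * i.cycleRange) ⟨q + 1 + k.1, by omega⟩)) =
        fun k : Fin r => o (τ ⟨q + k.1, by omega⟩) := by
      funext k
      have := congrFun hz ⟨q + 1 + k.1, by omega⟩
      simp only [Function.comp] at this
      rw [this]
      have : (⟨q + 1 + k.1, by omega⟩ : Fin (p + 1)) = i.succAbove ⟨q + k.1, by omega⟩ := by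
        ext
        simp only [Fin.succAbove, Fin.lt_def]
        split_ifs <;> simp_all <;> omega
      rw [this, Fin.insertNth_apply_succAbove]
      rfl
    rw [e1, e2]
    rw [(hB1 _).insertNth, smul_smul]
    simp only [Equiv.Perm.sign_mul, sign_permSucc, Fin.sign_cycleRange, Units.val_mul,
      Units.val_pow_eq_pow_val, Units.val_neg, Units.val_one]
    rw [mul_assoc, ← mul_pow]
    simp
  · obtain ⟨r, rfl⟩ : ∃ r', r = r' + 1 := ⟨r - 1, by omega⟩
    rw [hβ r rfl, wedgeSum, Finset.smul_sum]
    refine Finset.sum_congr rfl fun τ _ => ?_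
    have hz := cons_permSucc_cycleRange i τ w o
    have e2 : (fun k : Fin (r + 1) => (Fin.cons w o : Fin (p + 1) → S)
        ((permSucc τ * i.cycleRange) ⟨q + k.1, by omega⟩)) =
        Fin.insertNth (α := fun _ => S) ⟨i.1 - q, by omega⟩ w
          (fun k : Fin r => o (τ ⟨q + k.1, by omega⟩)) := by
      funext k
      have := congrFun hz ⟨q + k.1, by omega⟩
      simp only [Function.comp] at this
      rw [this]
      rcases Fin.eq_self_or_eq_succAbove (⟨i.1 - q, by omega⟩ : Fin (r + 1)) k with rfl | ⟨j, rfl⟩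
      · have : (⟨q + (i.1 - q), by omega⟩ : Fin (p + 1)) = i := by ext; simp; omega
        rw [this]
        simp
      · rw [Fin.insertNth_apply_succAbove]
        have : (⟨q + ((⟨i.1 - q, by omega⟩ : Fin (r + 1)).succAbove j).1, by omega⟩ : Fin (p + 1)) =
            i.succAbove ⟨q + j.1, by omega⟩ := by
          ext
          simp only [Fin.succAbove, Fin.lt_def]
          split_ifs <;> simp_all <;> omega
        rw [this, Fin.insertNth_apply_succAbove]
        rfl
    have e1 : (fun k : Fin q => (Fin.cons w o : Fin (p + 1) → S)
        ((permSucc τ * i.cycleRange) ⟨k.1, by omega⟩)) =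
        fun k : Fin q => o (τ ⟨k.1, by omega⟩) := by
      funext k
      have := congrFun hz ⟨k.1, by omega⟩
      simp only [Function.comp] at this
      rw [this]
      have : (⟨k.1, by omega⟩ : Fin (p + 1)) = i.succAbove ⟨k.1, by omega⟩ := by
        ext
        simp only [Fin.succAbove, Fin.lt_def]
        split_ifs <;> simp_all <;> omega
      rw [this, Fin.insertNth_apply_succAbove]
      rfl
    rw [e1, e2]
    rw [(hB2 _).insertNth, smul_smul, smul_smul]
    simp only [Equiv.Perm.sign_mul, sign_permSucc, Fin.sign_cycleRange, Units.val_mul,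
      Units.val_pow_eq_pow_val, Units.val_neg, Units.val_one]
    have hi' : (-1 : ℤ) ^ i.1 = (-1) ^ q * (-1) ^ (i.1 - q) := by
      rw [← pow_add]; congr 1; omega
    rw [hi']
    have h1 : (-1 : ℤ) ^ (i.1 - q) * (-1) ^ (i.1 - q) = 1 := by rw [← mul_pow]; simp
    have h2 : ∀ a : ℤ, a * ((-1) ^ q * (-1) ^ (i.1 - q)) * (-1) ^ (i.1 - q) = (-1) ^ q * a := by
      intro a
      rw [mul_assoc, mul_assoc, h1]; ring
    rw [h2]
    rfl

end Antisymmetric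

/-! ### Contraction of superfunctions with vector fields -/

section Dir

variable {W : Type*} [AddCommGroup W] [Module ℝ W] [TopologicalSpace W] [IsTopologicalAddGroup W]
  [T2Space W] {E : Type*} [AddCommGroup E] [Module ℝ E]

theorem HasDD.neg {f : E → W} {x v : E} {a : W} (hf : HasDD f x v a) :
    HasDD (fun y => -f y) x v (-a) := by
  refine (Tendsto.neg hf).congr fun t => ?_
  rw [← smul_neg, neg_sub, neg_sub_neg]

theorem dirD_neg (f : E → W) (x v : E) : dirD (fun y => -f y) x v = -dirD f x v := by
  by_cases h : ∃ w, HasDD f x v w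
  · obtain ⟨w, hw⟩ := h
    rw [hw.dirD_eq, hw.neg.dirD_eq]
  · have h' : ¬ ∃ w, HasDD (fun y => -f y) x v w := by
      rintro ⟨w, hw⟩
      exact h ⟨-w, by simpa using hw.neg⟩
    rw [dirD, dif_neg h', dirD, dif_neg h, neg_zero]

theorem dirD_sign_smul (s : ℤˣ) (f : E → W) (x v : E) :
    dirD (fun y => (s : ℤ) • f y) x v = (s : ℤ) • dirD f x v := by
  rcases Int.units_eq_one_or s with rfl | rfl
  · simp
  · simp [dirD_neg]

end Dir

section Defs

variable {S₀ S₁ W : Type*} [AddCommGroup S₀] [Module ℝ S₀] [AddCommGroup S₁] [Module ℝ S₁]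
  [AddCommGroup W] [Module ℝ W]

/-- The complex linear extension of a map `L`, where `J` is the multiplication by `i`. -/
def evalJ {S : Type*} (J : W →ₗ[ℝ] W) (L : S → W) (w : Cx S) : W := L w.1 + J (L w.2)

/-- Multiplication by `i` on `ℂ`, as a real linear map. -/
def mulIℂ : ℂ →ₗ[ℝ] ℂ := LinearMap.mulLeft ℝ Complex.I

/-- Multiplication by `i` on a complexification, as a real linear map. -/
def mulICx (S : Type*) [AddCommGroup S] [Module ℝ S] : Cx S →ₗ[ℝ] Cx S where
  toFun := mulI
  map_add' a b := by simp [mulI, add_comm]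
  map_smul' c a := by simp [mulI]

@[simp] theorem mulIℂ_apply (z : ℂ) : mulIℂ z = Complex.I * z := rfl

@[simp] theorem mulICx_apply {S : Type*} [AddCommGroup S] [Module ℝ S] (w : Cx S) :
    mulICx S w = (-w.2, w.1) := rfl

/-- The terms of a contraction in which `q` odd arguments enter the function and `r` odd arguments
enter the vector field. -/
def cterm [TopologicalSpace W] (J : W →ₗ[ℝ] W) (X : SFun S₀ S₁ W) (Y : SVec S₀ S₁) (φ : S₀) (q r : ℕ)
    (u : Fin q → S₁) (v : Fin r → S₁) : W :=
  evalJ J (fun h => dirD (fun φ' => X q φ' u) φ h) (Y.ev r φ v) +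
    evalJ J (fun e => X (q + 1) φ (Fin.snoc u e)) (Y.od r φ v)

/-- A version of `wedgeSum` that is defined for all degrees. -/
def wsum {S : Type*} (p q r : ℕ) (B : (Fin q → S) → (Fin r → S) → W) (o : Fin p → S) : W :=
  if h : q + r = p then wedgeSum p q r h B o else 0

/-- The normalization of the wedge product of a `q`-form and an `r`-form. -/
def wcoef (q r : ℕ) : ℝ := ((q.factorial * r.factorial : ℕ) : ℝ)⁻¹

theorem wcoef_succ_left (q r : ℕ) : wcoef (q + 1) r * (q + 1 : ℕ) = wcoef q r := by
  have h1 : ((q + 1 : ℕ) : ℝ) ≠ 0 := by positivity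
  rw [wcoef, wcoef, Nat.factorial_succ, mul_assoc, Nat.cast_mul (q + 1), mul_inv, mul_comm,
    ← mul_assoc, mul_inv_cancel₀ h1, one_mul]

theorem wcoef_succ_right (q r : ℕ) : wcoef q (r + 1) * (r + 1 : ℕ) = wcoef q r := by
  have h : ∀ q r, wcoef q r = wcoef r q := fun q r => by rw [wcoef, wcoef, mul_comm r.factorial]
  rw [h, h q, wcoef_succ_left]

/-- The contraction of a vector valued superfunction with a vector field. It generalizes
`contract`, which is the case of complex valued functions. -/
def vcontract [TopologicalSpace W] (J : W →ₗ[ℝ] W) (X : SFun S₀ S₁ W) (Y : SVec S₀ S₁) :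
    SFun S₀ S₁ W := fun p φ o =>
  ∑ x ∈ Finset.HasAntidiagonal.antidiagonal p, wcoef x.1 x.2 • wsum p x.1 x.2 (cterm J X Y φ x.1 x.2) o

theorem contract_eq_vcontract (X : SFun S₀ S₁ ℂ) (Y : SVec S₀ S₁) :
    contract X Y = vcontract mulIℂ X Y := by
  funext p φ o
  rw [vcontract, Finset.Nat.sum_antidiagonal_eq_sum_range_succ
    (fun q r => wcoef q r • wsum p q r (cterm mulIℂ X Y φ q r) o), contract, Finset.sum_range]
  refine Finset.sum_congr rfl fun q _ => ?_
  have h : q.1 + (p - q.1) = p := by omega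
  rw [wsum, dif_pos h, wedgeSum, Complex.real_smul, wcoef, Complex.ofReal_inv,
    Complex.ofReal_natCast]
  congr 1
  refine Finset.sum_congr rfl fun σ _ => ?_
  rw [zsmul_eq_mul]
  simp only [cterm, evalJ, evalC, lineDeriv_eq_dirD, mulIℂ_apply]

/-- The insertion of an odd vector into the first slot of a superfunction, i.e. its left derivative
along an odd direction. -/
def iota (w : S₁) (X : SFun S₀ S₁ W) : SFun S₀ S₁ W := fun n φ o => X (n + 1) φ (Fin.cons w o)

/-- Multiplication of the component of degree `n` by `εⁿ`; for `ε = -1` this is the parity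
automorphism. -/
def tw (ε : ℤˣ) (X : SFun S₀ S₁ W) : SFun S₀ S₁ W := fun n φ o => ((ε ^ n : ℤˣ) : ℤ) • X n φ o

/-- The left derivative of a vector field along an odd direction, with the signs of the recursion
`vcontract_cons`. -/
def iotaV (w : S₁) (Y : SVec S₀ S₁) : SVec S₀ S₁ :=
  ⟨iota w Y.ev, fun n φ o => -iota w Y.od n φ o⟩

/-- The action of the parity automorphism on vector fields. -/
def twV (ε : ℤˣ) (Y : SVec S₀ S₁) : SVec S₀ S₁ :=
  ⟨tw ε Y.ev, fun n φ o => (ε : ℤ) • tw ε Y.od n φ o⟩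

end Defs

/-- Smooth superfunctions, in terms of `SmoothB`: all components are smooth, antisymmetric, and linear
in the first odd argument. -/
structure Reg {S₀ S₁ W : Type*} [AddCommGroup S₀] [Module ℝ S₀] [TopologicalSpace S₀]
    [AddCommGroup S₁] [Module ℝ S₁] [TopologicalSpace S₁]
    [AddCommGroup W] [Module ℝ W] [TopologicalSpace W] (X : SFun S₀ S₁ W) : Prop where
  anti : ∀ n φ, AntiS (X n φ)
  lin : ∀ n φ o, IsLinearMap ℝ fun w => X (n + 1) φ (Fin.cons w o)
  smooth : ∀ n, SmoothB fun p : S₀ × (Fin n → S₁) => X n p.1 p.2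

/-- Antisymmetric superfunctions. -/
def AltS {S₀ S₁ W : Type*} [AddCommGroup W] (X : SFun S₀ S₁ W) : Prop := ∀ n φ, AntiS (X n φ)

/-- A vector field with antisymmetric components. -/
structure AltV {S₀ S₁ : Type*} [AddCommGroup S₀] [AddCommGroup S₁] (Y : SVec S₀ S₁) : Prop where
  ev : AltS Y.ev
  od : AltS Y.od

/-- A smooth vector field. -/
structure RegV {S₀ S₁ : Type*} [AddCommGroup S₀] [Module ℝ S₀] [TopologicalSpace S₀]
    [AddCommGroup S₁] [Module ℝ S₁] [TopologicalSpace S₁] (Y : SVec S₀ S₁) : Prop where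
  ev : Reg Y.ev
  od : Reg Y.od

section Basic

variable {S₀ S₁ : Type u} {W : Type*} [AddCommGroup S₀] [Module ℝ S₀] [TopologicalSpace S₀]
  [LCTVS S₀] [AddCommGroup S₁] [Module ℝ S₁] [TopologicalSpace S₁] [LCTVS S₁]
  [AddCommGroup W] [Module ℝ W] [TopologicalSpace W] [LCTVS W]

theorem RegV.altV {Y : SVec S₀ S₁} (h : RegV Y) : AltV Y := ⟨h.ev.anti, h.od.anti⟩

theorem Reg.lin_snoc {X : SFun S₀ S₁ W} (h : Reg X) (n : ℕ) (φ : S₀) (o : Fin n → S₁) :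
    IsLinearMap ℝ fun w => X (n + 1) φ (Fin.snoc o w) := by
  have e : (fun w => X (n + 1) φ (Fin.snoc o w)) =
      fun w => (-1 : ℤ) ^ n • X (n + 1) φ (Fin.cons w o) := funext fun w => (h.anti _ _).snoc w o
  rw [e]
  exact ⟨fun a b => by rw [(h.lin n φ o).map_add, smul_add],
    fun c a => by rw [(h.lin n φ o).map_smul, smul_comm]⟩

theorem dirD_even_eq (X : SFun S₀ S₁ W) (n : ℕ) (φ h : S₀) (o : Fin n → S₁) :
    dirD (fun φ' => X n φ' o) φ h =
      dirD (fun p : S₀ × (Fin n → S₁) => X n p.1 p.2) (φ, o) (h, 0) :=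
  dirD_congr_line fun t => by simp

theorem Reg.hasDD {X : SFun S₀ S₁ W} (hX : Reg X) (n : ℕ) (φ h : S₀) (o : Fin n → S₁) :
    HasDD (fun φ' => X n φ' o) φ h (dirD (fun φ' => X n φ' o) φ h) := by
  rw [dirD_even_eq]
  exact (hasDD_congr_line (fun t => by simp) _).1 ((hX.smooth n).hasDD (φ, o) (h, 0))

theorem Reg.smooth_even {X : SFun S₀ S₁ W} (hX : Reg X) (n : ℕ) (o : Fin n → S₁) :
    SmoothB fun φ => X n φ o :=
  (hX.smooth n).comp (g := fun φ => (φ, o)) (SmoothB.id.prodMk (SmoothB.const o))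

theorem Reg.smooth_dirD {X : SFun S₀ S₁ W} (hX : Reg X) (n : ℕ) {E : Type u} [AddCommGroup E]
    [Module ℝ E] [TopologicalSpace E] [LCTVS E] {f : E → S₀} {g : E → Fin n → S₁} {h : E → S₀}
    (hf : SmoothB f) (hg : SmoothB g) (hh : SmoothB h) :
    SmoothB fun x => dirD (fun φ' => X n φ' (g x)) (f x) (h x) := by
  simp only [dirD_even_eq]
  exact (hX.smooth n).tangent.comp (g := fun x => ((f x, g x), (h x, 0)))
    ((hf.prodMk hg).prodMk (hh.prodMk (SmoothB.const 0)))

theorem Reg.lin_dirD {X : SFun S₀ S₁ W} (hX : Reg X) (n : ℕ) (φ : S₀) (o : Fin n → S₁) :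
    IsLinearMap ℝ fun h => dirD (fun φ' => X n φ' o) φ h :=
  ⟨(hX.smooth_even n o).dirD_add φ, fun c v => (hX.smooth_even n o).dirD_smul φ v c⟩

theorem cterm_anti_left {X : SFun S₀ S₁ W} (hX : AltS X) (J : W →ₗ[ℝ] W) (Y : SVec S₀ S₁) (φ : S₀)
    (q r : ℕ) (v : Fin r → S₁) : AntiS fun u => cterm J X Y φ q r u v := by
  intro σ u
  have h1 : (fun φ' => X q φ' (u ∘ σ)) = fun φ' => (Equiv.Perm.sign σ : ℤ) • X q φ' u :=
    funext fun φ' => hX q φ' σ u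
  have h2 : ∀ e, X (q + 1) φ (Fin.snoc (u ∘ σ) e) =
      (Equiv.Perm.sign σ : ℤ) • X (q + 1) φ (Fin.snoc u e) := fun e => (hX _ φ).snoc_right e σ u
  simp only [cterm, evalJ, h1, h2, dirD_sign_smul, map_zsmul, smul_add]

theorem cterm_anti_right {X : SFun S₀ S₁ W} (hX : Reg X) (J : W →ₗ[ℝ] W) {Y : SVec S₀ S₁}
    (hY : AltV Y) (φ : S₀) (q r : ℕ) (u : Fin q → S₁) : AntiS (cterm J X Y φ q r u) := by
  intro σ v
  have h1 : ∀ s : ℤˣ, ∀ h, dirD (fun φ' => X q φ' u) φ ((s : ℤ) • h) =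
      (s : ℤ) • dirD (fun φ' => X q φ' u) φ h := fun s h =>
    map_zsmul (hX.lin_dirD q φ u).mk' (s : ℤ) h
  have h2 : ∀ s : ℤˣ, ∀ e, X (q + 1) φ (Fin.snoc u ((s : ℤ) • e)) =
      (s : ℤ) • X (q + 1) φ (Fin.snoc u e) := fun s e =>
    map_zsmul (hX.lin_snoc q φ u).mk' (s : ℤ) e
  simp only [cterm, evalJ, hY.ev r φ σ v, hY.od r φ σ v, Prod.smul_fst, Prod.smul_snd, h1, h2,
    map_zsmul, smul_add]

theorem wsum_antiS {S : Type*} (p q r : ℕ) (B : (Fin q → S) → (Fin r → S) → W) :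
    AntiS (wsum p q r B) := by
  by_cases h : q + r = p
  · have : wsum p q r B = wedgeSum p q r h B := funext fun o => by rw [wsum, dif_pos h]
    rw [this]; exact wedgeSum_antiS p q r h B
  · have : wsum p q r B = fun _ => 0 := funext fun o => by rw [wsum, dif_neg h]
    rw [this]; exact AntiS.zero

theorem vcontract_altS (J : W →ₗ[ℝ] W) (X : SFun S₀ S₁ W) (Y : SVec S₀ S₁) :
    AltS (vcontract J X Y) := fun p φ =>
  AntiS.sum _ fun x _ => (wsum_antiS p x.1 x.2 _).map
    (DistribSMul.toAddMonoidHom W (wcoef x.1 x.2))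

/-- The recursion that characterizes the contraction: a left derivative along an odd direction
is a graded derivation with respect to contractions. -/
theorem vcontract_cons (J : W →ₗ[ℝ] W) {X : SFun S₀ S₁ W} (hX : Reg X) {Y : SVec S₀ S₁}
    (hY : AltV Y) (p : ℕ) (φ : S₀) (w : S₁) (o : Fin p → S₁) :
    vcontract J X Y (p + 1) φ (Fin.cons w o) =
      vcontract J (iota w X) Y p φ o + vcontract J (tw (-1) X) (iotaV w Y) p φ o := by
  have e1 : ∀ q r, cterm J (iota w X) Y φ q r =
      fun u v => cterm J X Y φ (q + 1) r (Fin.cons (α := fun _ => S₁) w u) v := by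
    intro q r
    funext u v
    simp only [cterm, iota, Fin.cons_snoc_eq_snoc_cons]
  have e2 : ∀ q r, cterm J (tw (-1) X) (iotaV w Y) φ q r =
      fun u v => (-1 : ℤ) ^ q • cterm J X Y φ q (r + 1) u (Fin.cons (α := fun _ => S₁) w v) := by
    intro q r
    funext u v
    have h2 : ∀ e, X (q + 1) φ (Fin.snoc u (-e)) = -X (q + 1) φ (Fin.snoc u e) := fun e =>
      (hX.lin_snoc q φ u).map_neg e
    have h3 : ∀ a : W, (((-1 : ℤˣ) ^ (q + 1) : ℤˣ) : ℤ) • a = -((-1 : ℤ) ^ q • a) := by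
      intro a; rw [pow_succ]; simp
    have h4 : ∀ a : W, (((-1 : ℤˣ) ^ q : ℤˣ) : ℤ) • a = (-1 : ℤ) ^ q • a := by
      intro a; simp
    have h5 : ∀ h, dirD (fun φ' => (-1 : ℤ) ^ q • X q φ' u) φ h =
        (-1 : ℤ) ^ q • dirD (fun φ' => X q φ' u) φ h := fun h => by
      simpa using dirD_sign_smul ((-1) ^ q) (fun φ' => X q φ' u) φ h
    simp only [cterm, evalJ, tw, iotaV, iota, h5, Prod.fst_neg, Prod.snd_neg, h2, h3,
      smul_neg, neg_neg, h4, map_zsmul, smul_add]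
  -- the two terms of the graded derivation, padded by zero where the slot to be filled is missing
  let α : ℕ → ℕ → W := fun q r => match q with
    | 0 => 0
    | q + 1 => wsum p q r (cterm J (iota w X) Y φ q r) o
  let β : ℕ → ℕ → W := fun q r => match r with
    | 0 => 0
    | r + 1 => wsum p q r (cterm J (tw (-1) X) (iotaV w Y) φ q r) o
  have key : ∀ x ∈ Finset.HasAntidiagonal.antidiagonal (p + 1),
      wcoef x.1 x.2 • wsum (p + 1) x.1 x.2 (cterm J X Y φ x.1 x.2) (Fin.cons w o) =
      wcoef x.1 x.2 • (x.1 • α x.1 x.2) + wcoef x.1 x.2 • (x.2 • β x.1 x.2) := by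
    rintro ⟨q, r⟩ hx
    have h : q + r = p + 1 := Finset.HasAntidiagonal.mem_antidiagonal.1 hx
    rw [← smul_add]
    congr 1
    rw [wsum, dif_pos h]
    refine wedgeSum_cons h (cterm_anti_left hX.anti J Y φ q r) (cterm_anti_right hX J hY φ q r) w o
      (fun q' e => ?_) (fun r' e => ?_)
    · subst e
      have h' : q' + r = p := by omega
      simp only [α, wsum, dif_pos h', e1]
      rfl
    · subst e
      have h' : q + r' = p := by omega
      simp only [β, wsum, dif_pos h', e2, wedgeSum, Finset.smul_sum]
      refine Finset.sum_congr rfl fun σ _ => ?_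
      rw [smul_comm]
      rfl
  -- the factors `q` and `r` turn the normalization in degree `p + 1` into that in degree `p`
  rw [vcontract, Finset.sum_congr rfl key, Finset.sum_add_distrib]
  congr 1
  · rw [Finset.Nat.sum_antidiagonal_succ, vcontract]
    simp only [zero_smul, smul_zero, zero_add]
    refine Finset.sum_congr rfl fun x _ => ?_
    rw [← Nat.cast_smul_eq_nsmul ℝ, smul_smul, wcoef_succ_left]
  · rw [Finset.Nat.sum_antidiagonal_succ', vcontract]
    simp only [zero_smul, smul_zero, zero_add]
    refine Finset.sum_congr rfl fun x _ => ?_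
    rw [← Nat.cast_smul_eq_nsmul ℝ, smul_smul, wcoef_succ_right]

theorem vcontract_zero_deg (J : W →ₗ[ℝ] W) (X : SFun S₀ S₁ W) (Y : SVec S₀ S₁) (φ : S₀)
    (o : Fin 0 → S₁) : vcontract J X Y 0 φ o =
      evalJ J (fun h => dirD (fun φ' => X 0 φ' o) φ h) (Y.ev 0 φ o) +
        evalJ J (fun e => X 1 φ (Fin.snoc o e)) (Y.od 0 φ o) := by
  have h : ∀ z : Fin 0 → S₁, z = o := fun z => Subsingleton.elim _ _
  simp [vcontract, wsum, wedgeSum, cterm, wcoef, h]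

end Basic

section Linear

variable {S₀ S₁ : Type u} {W : Type*} [AddCommGroup S₀] [Module ℝ S₀] [TopologicalSpace S₀]
  [LCTVS S₀] [AddCommGroup S₁] [Module ℝ S₁] [TopologicalSpace S₁] [LCTVS S₁]
  [AddCommGroup W] [Module ℝ W] [TopologicalSpace W] [LCTVS W]

/-! ### Linearity and naturality of the contraction -/

theorem Reg.add {X X' : SFun S₀ S₁ W} (hX : Reg X) (hX' : Reg X') : Reg (X + X') where
  anti n φ := (hX.anti n φ).add (hX'.anti n φ)
  lin n φ o := ⟨fun a b => by
      simp only [Pi.add_apply, (hX.lin n φ o).map_add, (hX'.lin n φ o).map_add]; abel,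
    fun c a => by simp only [Pi.add_apply, (hX.lin n φ o).map_smul, (hX'.lin n φ o).map_smul, smul_add]⟩
  smooth n := (hX.smooth n).add (hX'.smooth n)

theorem Reg.clm {W' : Type*} [AddCommGroup W'] [Module ℝ W'] [TopologicalSpace W'] [LCTVS W']
    {X : SFun S₀ S₁ W} (hX : Reg X) (L : W →L[ℝ] W') : Reg fun n φ o => L (X n φ o) where
  anti n φ := (hX.anti n φ).map L.toLinearMap.toAddMonoidHom
  lin n φ o := ⟨fun a b => by rw [(hX.lin n φ o).map_add, map_add],
    fun c a => by rw [(hX.lin n φ o).map_smul, map_smul]⟩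
  smooth n := (hX.smooth n).clm_comp L

theorem Reg.prodMk {W' : Type*} [AddCommGroup W'] [Module ℝ W'] [TopologicalSpace W'] [LCTVS W']
    {X : SFun S₀ S₁ W} {X' : SFun S₀ S₁ W'} (hX : Reg X) (hX' : Reg X') :
    Reg fun n φ o => (X n φ o, X' n φ o) where
  anti n φ := fun σ o => by
    simp only [hX.anti n φ σ o, hX'.anti n φ σ o, Prod.smul_mk]
  lin n φ o := ⟨fun a b => by
      rw [(hX.lin n φ o).map_add, (hX'.lin n φ o).map_add, Prod.mk_add_mk],
    fun c a => by rw [(hX.lin n φ o).map_smul, (hX'.lin n φ o).map_smul, Prod.smul_mk]⟩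
  smooth n := (hX.smooth n).prodMk (hX'.smooth n)

theorem Reg.smul {X : SFun S₀ S₁ W} (hX : Reg X) (c : ℝ) : Reg (c • X) :=
  hX.clm (c • ContinuousLinearMap.id ℝ W)

theorem Reg.neg {X : SFun S₀ S₁ W} (hX : Reg X) : Reg fun n φ o => -X n φ o :=
  hX.clm (-ContinuousLinearMap.id ℝ W)

theorem Reg.zero : Reg (0 : SFun S₀ S₁ W) where
  anti _ _ := AntiS.zero
  lin _ _ _ := ⟨fun _ _ => by simp, fun _ _ => by simp⟩
  smooth _ := SmoothB.const 0

theorem Reg.sum {ι : Type*} (s : Finset ι) {X : ι → SFun S₀ S₁ W} (hX : ∀ i ∈ s, Reg (X i)) :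
    Reg (∑ i ∈ s, X i) := by
  classical
  induction s using Finset.induction_on with
  | empty => simpa using Reg.zero
  | insert i s hi ih =>
    rw [Finset.sum_insert hi]
    exact (hX i (by simp)).add (ih fun j hj => hX j (by simp [hj]))

theorem Reg.iota {X : SFun S₀ S₁ W} (hX : Reg X) (w : S₁) : Reg (iota w X) where
  anti n φ := (hX.anti (n + 1) φ).cons w
  lin n φ o := by
    have e : ∀ a, X (n + 2) φ (Fin.cons w (Fin.cons a o)) =
        -X (n + 2) φ (Fin.cons a (Fin.cons w o)) := by
      intro a
      have h := hX.anti (n + 2) φ (Equiv.swap 0 1) (Fin.cons a (Fin.cons w o))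
      have e2 : (Fin.cons a (Fin.cons w o) : Fin (n + 2) → S₁) ∘ Equiv.swap 0 1 =
          Fin.cons w (Fin.cons a o) := by
        funext k
        refine Fin.cases ?_ (fun k => ?_) k
        · simp
        · refine Fin.cases ?_ (fun k => ?_) k
          · simp
          · rw [Function.comp, Equiv.swap_apply_of_ne_of_ne (Fin.succ_ne_zero _)
              (by intro h; exact Fin.succ_ne_zero k (Fin.succ_injective _ h))]
            simp
      rw [e2, Equiv.Perm.sign_swap (by simp)] at h
      simpa using h
    refine ⟨fun a b => ?_, fun c a => ?_⟩
    · simp only [ClassicalBV.iota, e, (hX.lin (n + 1) φ _).map_add, neg_add]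
    · simp only [ClassicalBV.iota, e, (hX.lin (n + 1) φ _).map_smul, smul_neg]
  smooth n := by
    have h : SmoothB fun p : S₀ × (Fin n → S₁) => (p.1, (Fin.cons w p.2 : Fin (n + 1) → S₁)) := by
      have hp : SmoothB fun p : S₀ × (Fin n → S₁) => p := SmoothB.id
      refine hp.fst.prodMk (SmoothB.pi fun i => ?_)
      refine Fin.cases ?_ (fun i => ?_) i
      · simpa using SmoothB.const w
      · simpa using hp.snd.apply i
    exact (hX.smooth (n + 1)).comp h

theorem Reg.tw {X : SFun S₀ S₁ W} (hX : Reg X) (ε : ℤˣ) : Reg (tw ε X) where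
  anti n φ := (hX.anti n φ).map (DistribSMul.toAddMonoidHom W (((ε ^ n : ℤˣ) : ℤ)))
  lin n φ o := ⟨fun a b => by
      simp only [ClassicalBV.tw, (hX.lin n φ o).map_add, smul_add],
    fun c a => by simp only [ClassicalBV.tw, (hX.lin n φ o).map_smul]; rw [smul_comm]⟩
  smooth n := by
    have := (hX.smooth n).clm_comp ((((ε ^ n : ℤˣ) : ℤ) : ℝ) • ContinuousLinearMap.id ℝ W)
    simp only [ClassicalBV.tw, ← Int.cast_smul_eq_zsmul ℝ]
    exact this

theorem RegV.iotaV {Y : SVec S₀ S₁} (hY : RegV Y) (w : S₁) : RegV (iotaV w Y) :=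
  ⟨hY.ev.iota w, (hY.od.iota w).neg⟩

theorem RegV.twV {Y : SVec S₀ S₁} (hY : RegV Y) (ε : ℤˣ) : RegV (twV ε Y) := by
  refine ⟨hY.ev.tw ε, ?_⟩
  rcases Int.units_eq_one_or ε with rfl | rfl
  · simpa [ClassicalBV.twV] using hY.od.tw 1
  · simpa [ClassicalBV.twV] using (hY.od.tw (-1)).neg

theorem AltV.iotaV {Y : SVec S₀ S₁} (hY : AltV Y) (w : S₁) : AltV (iotaV w Y) :=
  ⟨fun n φ => (hY.ev (n + 1) φ).cons w, fun n φ => by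
    have := ((hY.od (n + 1) φ).cons w).map (-AddMonoidHom.id (Cx S₁))
    exact this⟩

/-! ### Additivity of the contraction in both arguments -/

theorem wsum_congr_add {S : Type*} {p q r : ℕ} {B B₁ B₂ : (Fin q → S) → (Fin r → S) → W}
    (h : ∀ u v, B u v = B₁ u v + B₂ u v) (o : Fin p → S) :
    wsum p q r B o = wsum p q r B₁ o + wsum p q r B₂ o := by
  by_cases hp : q + r = p
  · simp only [wsum, dif_pos hp, wedgeSum, h, smul_add, Finset.sum_add_distrib]
  · simp only [wsum, dif_neg hp, add_zero]

theorem wsum_map {W' : Type*} [AddCommGroup W'] [Module ℝ W'] (L : W →+ W') {S : Type*} {p q r : ℕ}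
    (B : (Fin q → S) → (Fin r → S) → W) (o : Fin p → S) :
    wsum p q r (fun u v => L (B u v)) o = L (wsum p q r B o) := by
  by_cases hp : q + r = p
  · simp only [wsum, dif_pos hp, wedgeSum, map_sum, map_zsmul]
  · simp only [wsum, dif_neg hp, map_zero]

theorem vcontract_congr_add (J : W →ₗ[ℝ] W) {X X₁ X₂ : SFun S₀ S₁ W} {Y Y₁ Y₂ : SVec S₀ S₁}
    {φ : S₀} (h : ∀ q r u v, cterm J X Y φ q r u v = cterm J X₁ Y₁ φ q r u v + cterm J X₂ Y₂ φ q r u v)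
    (p : ℕ) (o : Fin p → S₁) :
    vcontract J X Y p φ o = vcontract J X₁ Y₁ p φ o + vcontract J X₂ Y₂ p φ o := by
  simp only [vcontract, ← Finset.sum_add_distrib, ← smul_add]
  exact Finset.sum_congr rfl fun x _ => by rw [wsum_congr_add (h x.1 x.2)]

theorem vcontract_add_left (J : W →ₗ[ℝ] W) {X X' : SFun S₀ S₁ W} (hX : Reg X) (hX' : Reg X')
    (Y : SVec S₀ S₁) : vcontract J (X + X') Y = vcontract J X Y + vcontract J X' Y := by
  funext p φ o
  refine vcontract_congr_add J (fun q r u v => ?_) p o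
  have h : ∀ h, dirD (fun φ' => (X + X') q φ' u) φ h =
      dirD (fun φ' => X q φ' u) φ h + dirD (fun φ' => X' q φ' u) φ h := fun h =>
    ((hX.hasDD q φ h u).add (hX'.hasDD q φ h u)).dirD_eq
  simp only [cterm, evalJ, h, map_add]
  simp only [Pi.add_apply, map_add]
  abel

theorem vcontract_add_right (J : W →ₗ[ℝ] W) {X : SFun S₀ S₁ W} (hX : Reg X)
    {Y Y₁ Y₂ : SVec S₀ S₁} (hev : Y.ev = Y₁.ev + Y₂.ev) (hod : Y.od = Y₁.od + Y₂.od) :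
    vcontract J X Y = vcontract J X Y₁ + vcontract J X Y₂ := by
  funext p φ o
  refine vcontract_congr_add J (fun q r u v => ?_) p o
  simp only [cterm, evalJ, hev, hod, Pi.add_apply, Prod.fst_add, Prod.snd_add,
    (hX.lin_dirD q φ u).map_add, (hX.lin_snoc q φ u).map_add, map_add]
  abel

/-- Contractions commute with continuous complex linear maps of the values. -/
theorem vcontract_map {W' : Type*} [AddCommGroup W'] [Module ℝ W'] [TopologicalSpace W'] [LCTVS W']
    {J : W →ₗ[ℝ] W} {J' : W' →ₗ[ℝ] W'} (L : W →L[ℝ] W') (hL : ∀ w, L (J w) = J' (L w))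
    {X : SFun S₀ S₁ W} (hX : Reg X) (Y : SVec S₀ S₁) (p : ℕ) (φ : S₀) (o : Fin p → S₁) :
    vcontract J' (fun n φ o => L (X n φ o)) Y p φ o = L (vcontract J X Y p φ o) := by
  have h : ∀ q u h, dirD (fun φ' => L (X q φ' u)) φ h = L (dirD (fun φ' => X q φ' u) φ h) :=
    fun q u h => ((hX.hasDD q φ h u).clm L).dirD_eq
  simp only [vcontract, map_sum, map_smul]
  refine Finset.sum_congr rfl fun x _ => ?_
  rw [← ContinuousLinearMap.coe_coe, ← LinearMap.toAddMonoidHom_coe, ← wsum_map]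
  congr 2
  funext u v
  simp only [cterm, evalJ, h, LinearMap.toAddMonoidHom_coe, ContinuousLinearMap.coe_coe, map_add, hL]

/-- Contractions commute with pullback along linear maps that relate the vector fields. -/
theorem vcontract_comp {T₀ T₁ : Type*} [AddCommGroup T₀] [Module ℝ T₀] [AddCommGroup T₁]
    [Module ℝ T₁] (J : W →ₗ[ℝ] W) (j₀ : T₀ →ₗ[ℝ] S₀) (j₁ : T₁ →ₗ[ℝ] S₁) (X : SFun S₀ S₁ W)
    {Y : SVec S₀ S₁} {Z : SVec T₀ T₁} {p : ℕ} {φ : T₀} {o : Fin p → T₁}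
    (hev : ∀ r (v : Fin r → T₁), (∀ i, v i ∈ Set.range o) →
      j₀ (Z.ev r φ v).1 = (Y.ev r (j₀ φ) (j₁ ∘ v)).1 ∧
      j₀ (Z.ev r φ v).2 = (Y.ev r (j₀ φ) (j₁ ∘ v)).2)
    (hod : ∀ r (v : Fin r → T₁), (∀ i, v i ∈ Set.range o) →
      j₁ (Z.od r φ v).1 = (Y.od r (j₀ φ) (j₁ ∘ v)).1 ∧
      j₁ (Z.od r φ v).2 = (Y.od r (j₀ φ) (j₁ ∘ v)).2) :
    vcontract J (fun n φ o => X n (j₀ φ) (j₁ ∘ o)) Z p φ o = vcontract J X Y p (j₀ φ) (j₁ ∘ o) := by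
  rw [vcontract, vcontract]
  refine Finset.sum_congr rfl fun x hx => ?_
  congr 1
  have hp : x.1 + x.2 = p := Finset.HasAntidiagonal.mem_antidiagonal.1 hx
  simp only [wsum, dif_pos hp, wedgeSum]
  refine Finset.sum_congr rfl fun σ _ => ?_
  congr 1
  have hv : ∀ i : Fin x.2, o (σ ⟨x.1 + i.1, by omega⟩) ∈ Set.range o := fun i => ⟨_, rfl⟩
  have hd : ∀ h, dirD (fun φ' : T₀ => X x.1 (j₀ φ') (j₁ ∘ fun i => o (σ ⟨i.1, by omega⟩))) φ h =
      dirD (fun φ' => X x.1 φ' (fun i => (j₁ ∘ o) (σ ⟨i.1, by omega⟩))) (j₀ φ) (j₀ h) := fun h =>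
    dirD_congr_line fun t => by simp only [map_add, map_smul]; rfl
  have hs : ∀ (u : Fin x.1 → T₁) e, j₁ ∘ (Fin.snoc u e : Fin (x.1 + 1) → T₁) =
      Fin.snoc (j₁ ∘ u) (j₁ e) := fun u e => by
    funext k
    refine Fin.lastCases ?_ (fun k => ?_) k <;> simp
  have h1 := hev x.2 _ hv
  have h2 := hod x.2 _ hv
  simp only [cterm, evalJ, hd, hs, h1.1, h1.2, h2.1, h2.2]
  rfl

/-- The vanishing vector field contracts to zero. -/
theorem vcontract_zero_right (J : W →ₗ[ℝ] W) {X : SFun S₀ S₁ W} (hX : Reg X)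
    {Y : SVec S₀ S₁} (hev : Y.ev = 0) (hod : Y.od = 0) : vcontract J X Y = 0 := by
  have := vcontract_add_right J hX (Y := Y) (Y₁ := Y) (Y₂ := Y) (by simp [hev]) (by simp [hod])
  simpa using this

theorem vcontract_zero_left (J : W →ₗ[ℝ] W) (Y : SVec S₀ S₁) :
    vcontract J (0 : SFun S₀ S₁ W) Y = 0 := by
  have := vcontract_add_left J Reg.zero Reg.zero Y (W := W)
  simpa using this

theorem vcontract_smul_left (J : W →ₗ[ℝ] W) {X : SFun S₀ S₁ W} (hX : Reg X) (c : ℝ)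
    (Y : SVec S₀ S₁) : vcontract J (c • X) Y = c • vcontract J X Y := by
  funext p φ o
  exact vcontract_map (J := J) (J' := J) (c • ContinuousLinearMap.id ℝ W) (fun w => by simp) hX Y p φ o

theorem vcontract_neg_left (J : W →ₗ[ℝ] W) {X : SFun S₀ S₁ W} (hX : Reg X)
    (Y : SVec S₀ S₁) : vcontract J (-X) Y = -vcontract J X Y := by
  have := vcontract_smul_left J hX (-1) Y
  simpa using this

theorem vcontract_sum_left (J : W →ₗ[ℝ] W) {ι : Type*} (s : Finset ι) {X : ι → SFun S₀ S₁ W}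
    (hX : ∀ i ∈ s, Reg (X i)) (Y : SVec S₀ S₁) :
    vcontract J (∑ i ∈ s, X i) Y = ∑ i ∈ s, vcontract J (X i) Y := by
  classical
  induction s using Finset.induction_on with
  | empty => simpa using vcontract_zero_left J Y
  | insert i s hi ih =>
    rw [Finset.sum_insert hi, Finset.sum_insert hi,
      vcontract_add_left J (hX i (by simp)) (Reg.sum s fun j hj => hX j (by simp [hj])),
      ih fun j hj => hX j (by simp [hj])]

theorem vcontract_neg_right (J : W →ₗ[ℝ] W) {X : SFun S₀ S₁ W} (hX : Reg X)
    {Y Y' : SVec S₀ S₁} (hev : Y'.ev = -Y.ev) (hod : Y'.od = -Y.od) :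
    vcontract J X Y' = -vcontract J X Y := by
  have := vcontract_add_right J hX (Y := ⟨0, 0⟩) (Y₁ := Y') (Y₂ := Y) (by simp [hev]) (by simp [hod])
  rw [vcontract_zero_right J hX rfl rfl] at this
  exact eq_neg_of_add_eq_zero_left this.symm

/-- The contraction of a smooth superfunction with a smooth vector field is smooth. -/
theorem Reg.vcontract {J : W →ₗ[ℝ] W} (hJ : Continuous J) {X : SFun S₀ S₁ W} (hX : Reg X)
    {Y : SVec S₀ S₁} (hY : RegV Y) : Reg (vcontract J X Y) where
  anti := vcontract_altS J X Y
  lin n φ o := by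
    have hi : ∀ a b : S₁, ClassicalBV.iota (a + b) X =
        ClassicalBV.iota a X + ClassicalBV.iota b X := fun a b => by
      funext n φ o; exact (hX.lin n φ o).map_add a b
    have hi' : ∀ (c : ℝ) (a : S₁), ClassicalBV.iota (c • a) X = c • ClassicalBV.iota a X :=
      fun c a => by funext n φ o; exact (hX.lin n φ o).map_smul c a
    -- Linearity in the first slot is read off from `vcontract_cons`.
    have hlY : ∀ n φ (o : Fin n → S₁), IsLinearMap ℝ fun w =>
        ClassicalBV.vcontract J (ClassicalBV.tw (-1) X) (ClassicalBV.iotaV w Y) n φ o := by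
      intro n φ o
      refine ⟨fun a b => ?_, fun c a => ?_⟩
      · rw [vcontract_add_right J (hX.tw (-1)) (Y₁ := ClassicalBV.iotaV a Y)
          (Y₂ := ClassicalBV.iotaV b Y)]
        · rfl
        · funext n φ o; exact (hY.ev.lin n φ o).map_add a b
        · funext n φ o
          simp only [ClassicalBV.iotaV, ClassicalBV.iota, Pi.add_apply,
            (hY.od.lin n φ o).map_add, neg_add]
      · have hd := fun q (u : Fin q → S₁) => ((hX.tw (-1)).lin_dirD q φ u).map_smul c
        have hs := fun q (u : Fin q → S₁) => ((hX.tw (-1)).lin_snoc q φ u).map_smul c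
        simp only [ClassicalBV.vcontract, Finset.smul_sum]
        refine Finset.sum_congr rfl fun x _ => ?_
        rw [smul_comm c]
        congr 1
        have := wsum_map (p := n) (DistribSMul.toAddMonoidHom W c)
          (cterm J (ClassicalBV.tw (-1) X) (ClassicalBV.iotaV a Y) φ x.1 x.2) o
        refine Eq.trans ?_ this
        congr 1
        funext u v
        simp only [cterm, evalJ, ClassicalBV.iotaV, ClassicalBV.iota, (hY.ev.lin _ φ v).map_smul,
          (hY.od.lin _ φ v).map_smul, ← smul_neg, Prod.smul_fst, Prod.smul_snd, hd, hs, map_smul,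
          DistribSMul.toAddMonoidHom_apply, smul_add]
    refine ⟨fun a b => ?_, fun c a => ?_⟩
    · simp only [vcontract_cons J hX hY.altV, hi, vcontract_add_left J (hX.iota a) (hX.iota b),
        (hlY n φ o).map_add]
      simp only [Pi.add_apply]
      abel
    · simp only [vcontract_cons J hX hY.altV, hi', vcontract_smul_left J (hX.iota a),
        (hlY n φ o).map_smul]
      simp only [Pi.smul_apply, smul_add]
  smooth p := by
    refine SmoothB.sum _ fun x hx => ?_
    have hp : x.1 + x.2 = p := Finset.HasAntidiagonal.mem_antidiagonal.1 hx
    simp only [wsum, dif_pos hp, wedgeSum]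
    have hs : ∀ (c : ℝ) {f : S₀ × (Fin p → S₁) → W}, SmoothB f → SmoothB fun x => c • f x :=
      fun c f hf => hf.clm_comp (c • ContinuousLinearMap.id ℝ W)
    refine hs _ (SmoothB.sum _ fun σ _ => ?_)
    simp only [← Int.cast_smul_eq_zsmul ℝ]
    refine hs _ ?_
    have hid : SmoothB fun z : S₀ × (Fin p → S₁) => z := SmoothB.id
    have hu : SmoothB fun z : S₀ × (Fin p → S₁) => fun i : Fin x.1 => z.2 (σ ⟨i.1, by omega⟩) :=
      SmoothB.pi fun i => hid.snd.apply _
    have hv : SmoothB fun z : S₀ × (Fin p → S₁) =>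
        fun i : Fin x.2 => z.2 (σ ⟨x.1 + i.1, by omega⟩) :=
      SmoothB.pi fun i => hid.snd.apply _
    have hE := (hY.ev.smooth x.2).comp (hid.fst.prodMk hv)
    have hO := (hY.od.smooth x.2).comp (hid.fst.prodMk hv)
    have hsn : ∀ {e : S₀ × (Fin p → S₁) → S₁}, SmoothB e → SmoothB fun z : S₀ × (Fin p → S₁) =>
        X (x.1 + 1) z.1 (Fin.snoc (fun i : Fin x.1 => z.2 (σ ⟨i.1, by omega⟩)) (e z)) := by
      intro e he
      refine (hX.smooth (x.1 + 1)).comp (g := fun z : S₀ × (Fin p → S₁) =>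
        (z.1, (Fin.snoc (fun i : Fin x.1 => z.2 (σ ⟨i.1, by omega⟩)) (e z) :
          Fin (x.1 + 1) → S₁))) (hid.fst.prodMk (SmoothB.pi fun i => ?_))
      refine Fin.lastCases ?_ (fun i => ?_) i
      · simpa using he
      · simpa using hu.apply i
    -- a composition of the components of `X`, their derivatives and the components of `Y`
    let J' : W →L[ℝ] W := ⟨J, hJ⟩
    have hJ' : ∀ {f : S₀ × (Fin p → S₁) → W}, SmoothB f → SmoothB fun x => J (f x) :=
      fun hf => hf.clm_comp J'
    simp only [cterm, evalJ]
    exact ((hX.smooth_dirD x.1 hid.fst hu hE.fst).add (hJ' (hX.smooth_dirD x.1 hid.fst hu hE.snd))).add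
      ((hsn hO.fst).add (hJ' (hsn hO.snd)))

end Linear

/-! ### The commutator of two contractions -/

section Smooth

variable {S₀ S₁ : Type u} {W : Type*} [AddCommGroup S₀] [Module ℝ S₀] [TopologicalSpace S₀]
  [LCTVS S₀] [AddCommGroup S₁] [Module ℝ S₁] [TopologicalSpace S₁] [LCTVS S₁]
  [AddCommGroup W] [Module ℝ W] [TopologicalSpace W] [LCTVS W]

theorem Reg.map_update {X : SFun S₀ S₁ W} (hX : Reg X) (n : ℕ) (φ : S₀) (o : Fin (n + 1) → S₁)
    (i : Fin (n + 1)) (a : S₁) : X (n + 1) φ (Function.update o i a) =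
      (Equiv.Perm.sign (Equiv.swap 0 i) : ℤ) • X (n + 1) φ (Fin.cons a (Fin.tail (o ∘ Equiv.swap 0 i))) := by
  rw [← hX.anti (n + 1) φ]
  congr 1
  funext k
  rw [Function.comp]
  by_cases hk : k = i
  · subst hk; simp
  · rw [Function.update_of_ne hk]
    have h0 : Equiv.swap 0 i k ≠ 0 := fun h => hk (by
      rw [Equiv.swap_apply_eq_iff, Equiv.swap_apply_left] at h; exact h)
    obtain ⟨j, hj⟩ := Fin.exists_succ_eq.2 h0
    rw [← hj, Fin.cons_succ, Fin.tail, Function.comp, hj, Equiv.swap_apply_self]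

/-- `Reg` describes the same superfunctions as `IsSmooth`: an antisymmetric function that is linear
in its first argument is alternating multilinear. -/
theorem isSmooth_iff_reg {X : SFun S₀ S₁ W} : IsSmooth X ↔ Reg X := by
  constructor
  · intro h
    refine ⟨fun n φ σ o => ?_, fun n φ o => ?_, fun n => (h n).2.smoothB⟩
    · obtain ⟨A, hA⟩ := (h n).1 φ
      rw [hA, hA, A.map_perm]; rfl
    · obtain ⟨A, hA⟩ := (h (n + 1)).1 φ
      simp only [hA]
      have e : ∀ a, A (Fin.cons a o) =
          A (Function.update (Fin.cons 0 o : Fin (n + 1) → S₁) 0 a) := fun a => by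
        rw [Fin.update_cons_zero (α := fun _ => S₁)]
      simp only [e]
      exact ⟨fun a b => A.map_update_add _ _ _ _, fun c a => A.map_update_smul _ _ _ _⟩
  · intro h n
    refine ⟨fun φ => ?_, (h.smooth n).bastianiSmooth⟩
    cases n with
    | zero =>
      refine ⟨AlternatingMap.constOfIsEmpty ℝ S₁ (Fin 0) (X 0 φ default), fun o => ?_⟩
      rw [Subsingleton.elim o default]; rfl
    | succ n =>
      refine ⟨⟨⟨X (n + 1) φ, ?_, ?_⟩, ?_⟩, fun o => rfl⟩
      · intro inst o i a b
        have : inst = instDecidableEqFin (n + 1) := Subsingleton.elim _ _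
        subst this
        simp only [h.map_update, (h.lin n φ _).map_add, smul_add]
      · intro inst o i c a
        have : inst = instDecidableEqFin (n + 1) := Subsingleton.elim _ _
        subst this
        simp only [h.map_update, (h.lin n φ _).map_smul]
        rw [smul_comm]
      -- alternating: twice the value at `o` with `o i = o j` vanishes by antisymmetry
      · intro o i j hij hne
        have h1 := h.anti (n + 1) φ (Equiv.swap i j) o
        have e : o ∘ Equiv.swap i j = o := by
          funext k
          rw [Function.comp]
          rcases eq_or_ne k i with rfl | hi
          · rw [Equiv.swap_apply_left, hij]
          · rcases eq_or_ne k j with rfl | hj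
            · rw [Equiv.swap_apply_right, hij]
            · rw [Equiv.swap_apply_of_ne_of_ne hi hj]
        rw [e, Equiv.Perm.sign_swap hne] at h1
        have h2 : X (n + 1) φ o = -X (n + 1) φ o := by simpa using h1
        have h3 : (2 : ℝ) • X (n + 1) φ o = 0 := by
          rw [two_smul]; nth_rewrite 2 [h2]; exact add_neg_cancel _
        exact (smul_eq_zero.1 h3).resolve_left two_ne_zero

end Smooth

section Commutator

variable {S₀ S₁ : Type u} [AddCommGroup S₀] [Module ℝ S₀] [TopologicalSpace S₀]
  [LCTVS S₀] [AddCommGroup S₁] [Module ℝ S₁] [TopologicalSpace S₁] [LCTVS S₁]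

theorem continuous_mulIℂ : Continuous mulIℂ := continuous_const.mul continuous_id

theorem continuous_mulICx : Continuous (mulICx S₀) := by
  show Continuous fun w : Cx S₀ => (-w.2, w.1)
  fun_prop

/-- The derivative of the vector field `Q` along the vector field `E`. -/
def actV (E Q : SVec S₀ S₁) : SVec S₀ S₁ :=
  ⟨vcontract (mulICx S₀) Q.ev E, vcontract (mulICx S₁) Q.od E⟩

/-- Vector fields of parity `ε`: even for `ε = 1` and odd for `ε = -1`. -/
structure HasParity (ε : ℤˣ) (Y : SVec S₀ S₁) : Prop where
  ev : ∀ n φ o, (((-1 : ℤˣ) ^ n : ℤˣ) : ℤ) • Y.ev n φ o = (ε : ℤ) • Y.ev n φ o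
  od : ∀ n φ o, (((-1 : ℤˣ) ^ (n + 1) : ℤˣ) : ℤ) • Y.od n φ o = (ε : ℤ) • Y.od n φ o

theorem HasParity.iotaV {ε : ℤˣ} {Y : SVec S₀ S₁} (h : HasParity ε Y) (w : S₁) :
    HasParity (-ε) (iotaV w Y) := by
  constructor
  · intro n φ o
    have := h.ev (n + 1) φ (Fin.cons w o)
    rw [pow_succ] at this
    simp only [ClassicalBV.iotaV, iota]
    rw [Units.val_neg, neg_smul, ← this]
    simp
  · intro n φ o
    have := h.od (n + 1) φ (Fin.cons w o)
    rw [pow_succ] at this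
    simp only [ClassicalBV.iotaV, iota]
    rw [smul_neg, smul_neg, Units.val_neg, neg_smul, ← this]
    simp

/-- The derivative of `F(φ, z(φ))`, for `F` linear in the second argument. -/
theorem HasDD.comp_linear {E : Type u} [AddCommGroup E] [Module ℝ E] [TopologicalSpace E] [LCTVS E]
    {F : S₀ → E → ℂ} (hF : SmoothB fun p : S₀ × E => F p.1 p.2)
    (hl : ∀ φ, IsLinearMap ℝ (F φ)) {z : S₀ → E} {φ h : S₀} {z' : E} (hz : HasDD z φ h z') :
    HasDD (fun φ => F φ (z φ)) φ h (dirD (fun φ' => F φ' (z φ)) φ h + F φ z') := by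
  have h1 : HasDD (fun φ => (φ, z φ)) φ h (h, z') :=
    Tendsto.prodMk_nhds (by
      refine tendsto_const_nhds.congr' ?_
      filter_upwards [self_mem_nhdsWithin] with t ht
      have ht' : t ≠ 0 := ht
      show h = t⁻¹ • (φ + t • h - φ)
      rw [add_sub_cancel_left, smul_smul, inv_mul_cancel₀ ht', one_smul]) hz
  have h2 := HasDD.comp hF.hasDD hF.tangent.continuous h1
  have e : ((h, z') : S₀ × E) = (h, 0) + (0, z') := by simp
  rw [e, hF.dirD_add] at h2
  have e1 : dirD (fun p : S₀ × E => F p.1 p.2) (φ, z φ) (h, 0) = dirD (fun φ' => F φ' (z φ)) φ h :=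
    dirD_congr_line fun t => by simp
  have e2 : dirD (fun p : S₀ × E => F p.1 p.2) (φ, z φ) (0, z') = F φ z' := by
    refine HasDD.dirD_eq ?_
    refine tendsto_const_nhds.congr' ?_
    filter_upwards [self_mem_nhdsWithin] with t ht
    have ht' : t ≠ 0 := ht
    simp only [Prod.mk_add_mk, Prod.smul_mk, smul_zero, add_zero, (hl φ).map_add, (hl φ).map_smul,
      add_sub_cancel_left]
    rw [smul_smul, inv_mul_cancel₀ ht', one_smul]
  rw [e1, e2] at h2
  exact h2

/-- The second derivative of `X` (in degree zero) in the directions of two vectors with complex even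
and odd components: the part of an iterated contraction in which both vector fields act on `X`. -/
def hess (X : SFun S₀ S₁ ℂ) (φ : S₀) (a : Cx S₀) (b : Cx S₁) (c : Cx S₀) (d : Cx S₁) : ℂ :=
  evalC (fun k => evalC (fun h => dirD (fun φ' => dirD (fun φ'' => X 0 φ'' Fin.elim0) φ' h) φ k) a) c +
  evalC (fun k => evalC (fun e => dirD (fun φ' => X 1 φ' (Fin.cons e Fin.elim0)) φ k) b) c +
  evalC (fun e => evalC (fun h => dirD (fun φ' => X 1 φ' (Fin.cons e Fin.elim0)) φ h) a) d +
  evalC (fun e => evalC (fun e' => X 2 φ (Fin.cons e (Fin.cons e' Fin.elim0))) b) d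

theorem vcontract_zero_deg_elim0 (X : SFun S₀ S₁ ℂ) (Y : SVec S₀ S₁) (φ : S₀) (o : Fin 0 → S₁) :
    vcontract mulIℂ X Y 0 φ o =
      evalC (fun h => dirD (fun φ' => X 0 φ' Fin.elim0) φ h) (Y.ev 0 φ Fin.elim0) +
        evalC (fun e => X 1 φ (Fin.cons e Fin.elim0)) (Y.od 0 φ Fin.elim0) := by
  have h : ∀ e : S₁, (Fin.snoc Fin.elim0 e : Fin 1 → S₁) = Fin.cons e Fin.elim0 := fun e => by
    funext i
    obtain rfl : i = 0 := Subsingleton.elim (α := Fin 1) i 0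
    rfl
  rw [Subsingleton.elim o Fin.elim0, vcontract_zero_deg]
  simp only [h]
  rfl

/-- In degree zero, two successive contractions differ from the contraction with the derivative of
`Q` along `E` by the second derivative of `X`. -/
theorem vcontract_vcontract_zero_deg {X : SFun S₀ S₁ ℂ} (hX : Reg X) {E Q : SVec S₀ S₁}
    (hQ : RegV Q) (φ : S₀) (o : Fin 0 → S₁) :
    vcontract mulIℂ (vcontract mulIℂ X Q) E 0 φ o = vcontract mulIℂ X (actV E Q) 0 φ o +
      hess X φ (Q.ev 0 φ Fin.elim0) (Q.od 0 φ Fin.elim0) (E.ev 0 φ Fin.elim0)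
        (E.od 0 φ Fin.elim0) := by
  have hsn : ∀ e : S₁, (Fin.snoc Fin.elim0 e : Fin 1 → S₁) = Fin.cons e Fin.elim0 := fun e => by
    funext i
    obtain rfl : i = 0 := Subsingleton.elim (α := Fin 1) i 0
    rfl
  have hX0 : SmoothB fun p : S₀ × S₀ => dirD (fun φ' => X 0 φ' Fin.elim0) p.1 p.2 :=
    hX.smooth_dirD 0 SmoothB.id.fst (SmoothB.const _) SmoothB.id.snd
  have hX1 : SmoothB fun p : S₀ × S₁ => X 1 p.1 (Fin.cons p.2 Fin.elim0) := by
    refine (hX.smooth 1).comp (g := fun p : S₀ × S₁ =>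
      (p.1, (Fin.cons p.2 Fin.elim0 : Fin 1 → S₁))) (SmoothB.id.fst.prodMk (SmoothB.pi fun i => ?_))
    obtain rfl : i = 0 := Subsingleton.elim (α := Fin 1) i 0
    exact SmoothB.id.snd
  -- the derivative of the degree zero component of `C_Q X`
  have hD : ∀ k, dirD (fun φ' => vcontract mulIℂ X Q 0 φ' Fin.elim0) φ k =
      evalC (fun h => dirD (fun φ' => dirD (fun φ'' => X 0 φ'' Fin.elim0) φ' h) φ k)
        (Q.ev 0 φ Fin.elim0) +
      evalC (fun h => dirD (fun φ' => X 0 φ' Fin.elim0) φ h)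
        (dirD (fun φ' => Q.ev 0 φ' Fin.elim0) φ k) +
      evalC (fun e => dirD (fun φ' => X 1 φ' (Fin.cons e Fin.elim0)) φ k) (Q.od 0 φ Fin.elim0) +
      evalC (fun e => X 1 φ (Fin.cons e Fin.elim0)) (dirD (fun φ' => Q.od 0 φ' Fin.elim0) φ k) := by
    intro k
    have q0 := hQ.ev.hasDD 0 φ k Fin.elim0
    have q1 := hQ.od.hasDD 0 φ k Fin.elim0
    have a1 := HasDD.comp_linear hX0 (fun φ => hX.lin_dirD 0 φ _)
      (q0.clm (ContinuousLinearMap.fst ℝ S₀ S₀))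
    have a2 := (HasDD.comp_linear hX0 (fun φ => hX.lin_dirD 0 φ _)
      (q0.clm (ContinuousLinearMap.snd ℝ S₀ S₀))).clm ⟨mulIℂ, continuous_mulIℂ⟩
    have a3 := HasDD.comp_linear hX1 (fun φ => hX.lin 0 φ _)
      (q1.clm (ContinuousLinearMap.fst ℝ S₁ S₁))
    have a4 := (HasDD.comp_linear hX1 (fun φ => hX.lin 0 φ _)
      (q1.clm (ContinuousLinearMap.snd ℝ S₁ S₁))).clm ⟨mulIℂ, continuous_mulIℂ⟩
    have := ((a1.add a2).add (a3.add a4)).dirD_eq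
    simp only [vcontract_zero_deg_elim0]
    refine Eq.trans ?_ (this.trans ?_)
    · rfl
    · simp only [evalC, ContinuousLinearMap.coe_mk', mulIℂ_apply, ContinuousLinearMap.coe_fst',
        ContinuousLinearMap.coe_snd']
      ring
  -- the degree one component of `C_Q X`
  have hI : ∀ e, vcontract mulIℂ X Q 1 φ (Fin.cons e Fin.elim0) =
      evalC (fun h => dirD (fun φ' => X 1 φ' (Fin.cons e Fin.elim0)) φ h) (Q.ev 0 φ Fin.elim0) +
      evalC (fun e' => X 2 φ (Fin.cons e (Fin.cons e' Fin.elim0))) (Q.od 0 φ Fin.elim0) +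
      evalC (fun h => dirD (fun φ' => X 0 φ' Fin.elim0) φ h) (Q.ev 1 φ (Fin.cons e Fin.elim0)) +
      evalC (fun e' => X 1 φ (Fin.cons e' Fin.elim0)) (Q.od 1 φ (Fin.cons e Fin.elim0)) := by
    intro e
    rw [vcontract_cons mulIℂ hX hQ.altV, vcontract_zero_deg_elim0, vcontract_zero_deg_elim0]
    have h2 : ∀ a, X 1 φ (Fin.cons (-a) Fin.elim0) = -X 1 φ (Fin.cons a Fin.elim0) := fun a =>
      (hX.lin 0 φ Fin.elim0).map_neg a
    simp [evalC, iota, tw, iotaV, h2]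
    ring
  rw [vcontract_zero_deg_elim0]
  simp only [hD, hI]
  rw [hess, actV]
  simp only [Subsingleton.elim o Fin.elim0, vcontract_zero_deg]
  simp only [hsn]
  have l0 := hX.lin_dirD 0 φ Fin.elim0
  have l1 : IsLinearMap ℝ fun w => X 1 φ (Fin.cons w Fin.elim0) := hX.lin 0 φ Fin.elim0
  simp only [evalC, evalJ, mulICx_apply, mulIℂ_apply, Prod.fst_add, Prod.snd_add, l0.map_add, l0.map_neg, l1.map_add,
    l1.map_neg]
  -- the imaginary parts meet in products `I * I`
  linear_combination (-(dirD (fun φ' => X 0 φ' Fin.elim0) φ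
      (dirD (fun φ' => Q.ev 0 φ' Fin.elim0) φ (E.ev 0 φ Fin.elim0).2).2) -
    X 1 φ (Fin.cons (dirD (fun φ' => Q.od 0 φ' Fin.elim0) φ (E.ev 0 φ Fin.elim0).2).2 Fin.elim0) -
    dirD (fun φ' => X 0 φ' Fin.elim0) φ (Q.ev 1 φ (Fin.cons (E.od 0 φ Fin.elim0).2 Fin.elim0)).2 -
    X 1 φ (Fin.cons (Q.od 1 φ (Fin.cons (E.od 0 φ Fin.elim0).2 Fin.elim0)).2 Fin.elim0)) *
      (-Complex.I_sq)

/-- The graded symmetry of the second derivative. In degree zero a field of parity `ε` has only an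
even part (`ε = 1`) or only an odd part (`ε = -1`), which is what `hc` and `hd` say. -/
theorem hess_symm {X : SFun S₀ S₁ ℂ} (hX : Reg X) (φ : S₀) {ε : ℤˣ} {a c : Cx S₀} {b d : Cx S₁}
    (hc : c = (ε : ℤ) • c) (hd : -d = (ε : ℤ) • d) :
    hess X φ a b c d = hess X φ c d a ((ε : ℤ) • b) := by
  have l1 := hX.lin 0 φ Fin.elim0
  have hT1 : ∀ h k, dirD (fun φ' => dirD (fun φ'' => X 0 φ'' Fin.elim0) φ' h) φ k =
      dirD (fun φ' => dirD (fun φ'' => X 0 φ'' Fin.elim0) φ' k) φ h := fun h k =>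
    (hX.smooth_even 0 Fin.elim0).second_symm φ h k
  have hT4 : ∀ e e', X 2 φ (Fin.cons e (Fin.cons e' Fin.elim0)) =
      -X 2 φ (Fin.cons e' (Fin.cons e Fin.elim0)) := by
    intro e e'
    have h := hX.anti 2 φ (Equiv.swap 0 1) (Fin.cons e' (Fin.cons e Fin.elim0))
    have e2 : (Fin.cons e' (Fin.cons e Fin.elim0) : Fin 2 → S₁) ∘ Equiv.swap 0 1 =
        Fin.cons e (Fin.cons e' Fin.elim0) := by
      funext k; fin_cases k <;> rfl
    rw [e2] at h
    simpa using h
  have hz : ∀ {V : Type u} [AddCommGroup V] [Module ℝ V] (v : V), v = -v → v = 0 := by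
    intro V _ _ v h
    have h3 : (2 : ℝ) • v = 0 := by rw [two_smul]; nth_rewrite 2 [h]; exact add_neg_cancel _
    exact (smul_eq_zero.1 h3).resolve_left two_ne_zero
  have z1 : ∀ k : S₀, dirD (fun φ' => X 1 φ' (Fin.cons (0 : S₁) Fin.elim0)) φ k = 0 := by
    intro k
    have : (fun φ' => X 1 φ' (Fin.cons (0 : S₁) Fin.elim0)) = fun _ => 0 :=
      funext fun φ' => (hX.lin 0 φ' Fin.elim0).map_zero
    rw [this]; exact (hasDD_const _ _ _).dirD_eq
  have z2 : ∀ o, X 2 φ (Fin.cons (0 : S₁) o) = 0 := fun o => (hX.lin 1 φ o).map_zero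
  have z3 : ∀ e, X 2 φ (Fin.cons e (Fin.cons (0 : S₁) Fin.elim0)) = 0 := fun e => by
    rw [hT4, z2, neg_zero]
  have z5 : ∀ k : S₀, dirD (fun _ : S₀ => (0 : ℂ)) φ k = 0 := fun k => (hasDD_const _ _ _).dirD_eq
  -- For `ε = 1` the odd direction `d` vanishes and the symmetry is that of second derivatives, for
  -- `ε = -1` the even direction `c` vanishes and it is the antisymmetry of the degree 2 component.
  rcases Int.units_eq_one_or ε with rfl | rfl
  · have hd0 : d = 0 := hz d (by simpa using hd.symm)
    subst hd0
    simp only [hess, evalC, Prod.fst_zero, Prod.snd_zero, Units.val_one, one_smul, z1, z2, z3,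
      mul_zero, add_zero]
    rw [hT1 a.1 c.1, hT1 a.1 c.2, hT1 a.2 c.1, hT1 a.2 c.2]
    ring
  · have hc0 : c = 0 := hz c (by simpa using hc)
    subst hc0
    have n1 : ∀ (v : S₁) k, dirD (fun φ' => X 1 φ' (Fin.cons (-v) Fin.elim0)) φ k =
        -dirD (fun φ' => X 1 φ' (Fin.cons v Fin.elim0)) φ k := by
      intro v k
      rw [← dirD_neg]
      congr 1
      funext φ'
      exact (hX.lin 0 φ' Fin.elim0).map_neg v
    have n2 : ∀ v o, X 2 φ (Fin.cons (-v) o) = -X 2 φ (Fin.cons v o) := fun v o =>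
      (hX.lin 1 φ o).map_neg v
    simp only [hess, evalC, Prod.fst_zero, Prod.snd_zero, Units.val_neg, Units.val_one, neg_smul,
      one_smul, Prod.fst_neg, Prod.snd_neg, n1, n2, z5,
      dirD_zero_dir, mul_zero, add_zero]
    rw [hT4 d.1 b.1, hT4 d.1 b.2, hT4 d.2 b.1, hT4 d.2 b.2]
    ring

theorem tw_vcontract {W : Type*} [AddCommGroup W] [Module ℝ W] [TopologicalSpace W] [LCTVS W]
    (J : W →ₗ[ℝ] W) {X : SFun S₀ S₁ W} (hX : Reg X) (Y : SVec S₀ S₁) (ε : ℤˣ) :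
    tw ε (vcontract J X Y) = vcontract J (tw ε X) (twV ε Y) := by
  funext p φ o
  simp only [tw, vcontract, Finset.smul_sum]
  refine Finset.sum_congr rfl fun x hx => ?_
  rw [Finset.HasAntidiagonal.mem_antidiagonal] at hx
  rw [smul_comm]
  congr 1
  have := wsum_map (W := W) (DistribSMul.toAddMonoidHom W (((ε ^ p : ℤˣ) : ℤ))) (p := p)
    (cterm J X Y φ x.1 x.2) o
  refine this.symm.trans ?_
  congr 1
  funext u v
  have hs : ∀ (s : ℤˣ) h, dirD (fun φ' => X x.1 φ' u) φ ((s : ℤ) • h) =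
      (s : ℤ) • dirD (fun φ' => X x.1 φ' u) φ h := fun s h =>
    map_zsmul (hX.lin_dirD x.1 φ u).mk' (s : ℤ) h
  have hs' : ∀ (s : ℤˣ) e, X (x.1 + 1) φ (Fin.snoc u ((s : ℤ) • e)) =
      (s : ℤ) • X (x.1 + 1) φ (Fin.snoc u e) := fun s e =>
    map_zsmul (hX.lin_snoc x.1 φ u).mk' (s : ℤ) e
  have e1 : (ε : ℤ) ^ (x.1 + 1) * ((ε : ℤ) * (ε : ℤ) ^ x.2) = (ε : ℤ) ^ p := by
    have h2 : (ε : ℤ) * ε = 1 := by rcases Int.units_eq_one_or ε with rfl | rfl <;> rfl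
    rw [← hx, pow_add, pow_succ]; linear_combination ((ε : ℤ) ^ x.1 * (ε : ℤ) ^ x.2) * h2
  simp only [DistribSMul.toAddMonoidHom_apply, cterm, evalJ, twV, tw, Prod.smul_fst, Prod.smul_snd,
    dirD_sign_smul, hs, hs', map_zsmul, smul_add]
  simp only [smul_smul, Units.val_pow_eq_pow_val]
  rw [e1, ← pow_add, hx]

theorem tw_one {W : Type*} [AddCommGroup W] (X : SFun S₀ S₁ W) : tw 1 X = X := by
  funext n φ o; simp [tw]

theorem twV_one (Y : SVec S₀ S₁) : twV 1 Y = Y := by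
  cases Y; simp [twV, tw_one]

theorem twV_twV (ε ε' : ℤˣ) (Y : SVec S₀ S₁) : twV ε (twV ε' Y) = twV (ε * ε') Y := by
  cases Y
  simp only [twV, SVec.mk.injEq]
  constructor
  · funext n φ o
    simp only [tw, smul_smul, mul_pow, Units.val_mul]
  · funext n φ o
    simp only [tw, smul_smul, mul_pow, Units.val_mul]
    congr 1; ring

theorem vcontract_sign {W : Type*} [AddCommGroup W] [Module ℝ W] [TopologicalSpace W] [LCTVS W]
    (J : W →ₗ[ℝ] W) (ε : ℤˣ) {X X' : SFun S₀ S₁ W} (hX : Reg X) {Y Y' : SVec S₀ S₁}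
    (hX' : X' = (ε : ℤ) • X) (hev : Y'.ev = (ε : ℤ) • Y.ev) (hod : Y'.od = (ε : ℤ) • Y.od) :
    vcontract J X' Y' = vcontract J X Y := by
  subst hX'
  rcases Int.units_eq_one_or ε with rfl | rfl
  · obtain ⟨_, _⟩ := Y
    obtain ⟨_, _⟩ := Y'
    simp only [Units.val_one, one_smul] at hev hod ⊢
    subst hev hod
    rfl
  · simp only [Units.val_neg, Units.val_one, neg_smul, one_smul] at hev hod ⊢
    rw [vcontract_neg_left J hX, vcontract_neg_right J hX hev hod, neg_neg]

theorem HasParity.twV_neg_one {ε : ℤˣ} {E : SVec S₀ S₁} (h : HasParity ε E) :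
    (twV (-1) E).ev = (ε : ℤ) • E.ev ∧ (twV (-1) E).od = (ε : ℤ) • E.od := by
  refine ⟨?_, ?_⟩
  · funext n φ o; exact h.ev n φ o
  · funext n φ o
    refine Eq.trans ?_ (h.od n φ o)
    simp only [twV, tw, smul_smul, pow_succ, Units.val_mul]
    rw [mul_comm]

theorem iotaV_twV (w : S₁) (ε : ℤˣ) (Q : SVec S₀ S₁) :
    (iotaV w (twV ε Q)).ev = (ε : ℤ) • (twV ε (iotaV w Q)).ev ∧
      (iotaV w (twV ε Q)).od = (ε : ℤ) • (twV ε (iotaV w Q)).od := by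
  refine ⟨?_, ?_⟩ <;> funext n φ o <;>
    simp only [iotaV, iota, twV, tw, Pi.smul_apply, smul_smul, pow_succ, Units.val_mul, smul_neg]
  · rw [mul_comm]
  · congr 2; ring

theorem RegV.actV {E Q : SVec S₀ S₁} (hE : RegV E) (hQ : RegV Q) : RegV (actV E Q) :=
  ⟨hQ.ev.vcontract continuous_mulICx hE, hQ.od.vcontract continuous_mulICx hE⟩

theorem iotaV_actV {E Q : SVec S₀ S₁} (hE : RegV E) (hQ : RegV Q) (w : S₁) :
    (iotaV w (actV E Q)).ev = (actV E (iotaV w Q)).ev + (actV (iotaV w E) (twV (-1) Q)).ev ∧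
    (iotaV w (actV E Q)).od = (actV E (iotaV w Q)).od + (actV (iotaV w E) (twV (-1) Q)).od := by
  refine ⟨?_, ?_⟩ <;> funext p φ o
  · exact vcontract_cons _ hQ.ev hE.altV p φ w o
  · have h := vcontract_cons (mulICx S₁) hQ.od hE.altV p φ w o
    have h1 := vcontract_neg_left (mulICx S₁) (hQ.od.iota w) E
    have h2 := vcontract_neg_left (mulICx S₁) (hQ.od.tw (-1)) (iotaV w E)
    refine (congrArg Neg.neg h).trans ?_
    rw [neg_add]
    have h1' := congrFun (congrFun (congrFun h1 p) φ) o
    have h2' := congrFun (congrFun (congrFun h2 p) φ) o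
    refine congrArg₂ (· + ·) h1'.symm (h2'.symm.trans ?_)
    simp only [actV, twV, Units.val_neg, Units.val_one, neg_smul, one_smul]
    rfl

/-- The graded commutator of two contractions is the contraction with the graded commutator of the
vector fields. By `vcontract_cons` both sides obey the same recursion in the degree `p`, which leaves
`p = 0`, where the second derivatives cancel by `hess_symm`. -/
theorem vcontract_commutator (p : ℕ) : ∀ {X : SFun S₀ S₁ ℂ}, Reg X → ∀ {ε : ℤˣ} {E Q : SVec S₀ S₁},
    RegV E → RegV Q → HasParity ε E → ∀ φ o,
    vcontract mulIℂ (vcontract mulIℂ X Q) E p φ o -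
        vcontract mulIℂ (vcontract mulIℂ X E) (twV ε Q) p φ o =
      vcontract mulIℂ X (actV E Q) p φ o - vcontract mulIℂ X (actV (twV ε Q) E) p φ o := by
  induction p with
  | zero =>
    intro X hX ε E Q hE hQ hε φ o
    rw [vcontract_vcontract_zero_deg hX hQ, vcontract_vcontract_zero_deg hX hE]
    have h1 := hε.ev 0 φ Fin.elim0
    have h2 := hε.od 0 φ Fin.elim0
    simp only [pow_zero, Units.val_one, one_smul, zero_add, pow_one, Units.val_neg, neg_smul] at h1 h2
    rw [hess_symm hX φ h1 h2]
    simp only [twV, tw, pow_zero, Units.val_one, one_smul]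
    ring
  | succ p ih =>
    intro X hX ε E Q hE hQ hε φ o
    have hQ' := hQ.twV ε
    -- the first slot acts on the functional, on the inner or on the outer vector field
    have key : ∀ {E Q : SVec S₀ S₁}, RegV E → RegV Q → ∀ w o,
        vcontract mulIℂ (vcontract mulIℂ X Q) E (p + 1) φ (Fin.cons w o) =
          vcontract mulIℂ (vcontract mulIℂ (iota w X) Q) E p φ o +
          vcontract mulIℂ (vcontract mulIℂ (tw (-1) X) (iotaV w Q)) E p φ o +
          vcontract mulIℂ (vcontract mulIℂ (tw (-1) X) (twV (-1) Q)) (iotaV w E) p φ o := by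
      intro E Q hE hQ w o
      have h1 : iota w (vcontract mulIℂ X Q) =
          vcontract mulIℂ (iota w X) Q + vcontract mulIℂ (tw (-1) X) (iotaV w Q) := by
        funext n φ o; exact vcontract_cons _ hX hQ.altV n φ w o
      rw [vcontract_cons _ (hX.vcontract continuous_mulIℂ hQ) hE.altV, h1, vcontract_add_left _
        ((hX.iota w).vcontract continuous_mulIℂ hQ)
        ((hX.tw (-1)).vcontract continuous_mulIℂ (hQ.iotaV w)), tw_vcontract _ hX]
      rfl
    rw [← Fin.cons_self_tail o]
    generalize o 0 = w
    generalize Fin.tail o = o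
    have hγ := hX.tw (-1)
    have hγE := hε.twV_neg_one
    have hjQ := iotaV_twV w ε Q
    have e1 : vcontract mulIℂ (vcontract mulIℂ (tw (-1) X) (twV (-1) E)) (iotaV w (twV ε Q)) =
        vcontract mulIℂ (vcontract mulIℂ (tw (-1) X) E) (twV ε (iotaV w Q)) := by
      refine vcontract_sign mulIℂ ε (hγ.vcontract continuous_mulIℂ hE) ?_ hjQ.1 hjQ.2
      rcases Int.units_eq_one_or ε with rfl | rfl
      · simp only [Units.val_one, one_smul] at hγE ⊢
        rw [show twV (-1) E = E from by
          obtain ⟨a, b⟩ := hγE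
          cases h : twV (-1) E; rw [h] at a b; cases E; simp only at a b; rw [a, b]]
      · simp only [Units.val_neg, Units.val_one, neg_smul, one_smul] at hγE ⊢
        exact vcontract_neg_right mulIℂ hγ hγE.1 hγE.2
    have e2 : actV (iotaV w (twV ε Q)) (twV (-1) E) = actV (twV ε (iotaV w Q)) E := by
      rw [actV, actV, vcontract_sign _ ε hE.ev hγE.1 hjQ.1 hjQ.2,
        vcontract_sign _ ε hE.od hγE.2 hjQ.1 hjQ.2]
    have i1 := ih (hX.iota w) hE hQ hε φ o
    have i2 := ih hγ hE (hQ.iotaV w) hε φ o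
    have i3 := ih hγ (hE.iotaV w) (hQ.twV (-1)) (hε.iotaV w) φ o
    rw [twV_twV, neg_mul_neg, mul_one] at i3
    have r1 := vcontract_cons mulIℂ hX (hE.actV hQ).altV p φ w o
    have r2 := vcontract_cons mulIℂ hX (hQ'.actV hE).altV p φ w o
    rw [vcontract_add_right mulIℂ hγ (iotaV_actV hE hQ w).1 (iotaV_actV hE hQ w).2] at r1
    rw [vcontract_add_right mulIℂ hγ (iotaV_actV hQ' hE w).1 (iotaV_actV hQ' hE w).2, e2] at r2
    simp only [Pi.add_apply] at r1 r2
    have k1 := key hE hQ w o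
    have k2 := key hQ' hE w o
    rw [e1] at k2
    linear_combination k1 - k2 + i1 + i2 + i3 - r1 + r2

end Commutator

/-! ### Linear vector fields and pullbacks along linear maps -/

section Linear

variable {S₀ S₁ T₀ T₁ : Type u} {W : Type*} [AddCommGroup S₀] [Module ℝ S₀] [TopologicalSpace S₀]
  [LCTVS S₀] [AddCommGroup S₁] [Module ℝ S₁] [TopologicalSpace S₁] [LCTVS S₁]
  [AddCommGroup T₀] [Module ℝ T₀] [TopologicalSpace T₀]
  [LCTVS T₀] [AddCommGroup T₁] [Module ℝ T₁] [TopologicalSpace T₁] [LCTVS T₁]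
  [AddCommGroup W] [Module ℝ W] [TopologicalSpace W] [LCTVS W]

/-- The pullback of a superfunction along a linear map. -/
def pull (j₀ : T₀ → S₀) (j₁ : T₁ → S₁) (X : SFun S₀ S₁ W) : SFun T₀ T₁ W :=
  fun n φ o => X n (j₀ φ) (j₁ ∘ o)

theorem Reg.pull {X : SFun S₀ S₁ W} (hX : Reg X) (j₀ : T₀ →L[ℝ] S₀) (j₁ : T₁ →L[ℝ] S₁) :
    Reg (pull j₀ j₁ X) where
  anti n φ := fun σ o => by
    simp only [ClassicalBV.pull]
    rw [← hX.anti n (j₀ φ) σ]; rfl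
  lin n φ o := by
    have e : ∀ w, (j₁ ∘ (Fin.cons w o : Fin (n + 1) → T₁)) =
        (Fin.cons (j₁ w) (j₁ ∘ o) : Fin (n + 1) → S₁) := fun w => by
      funext i; refine Fin.cases rfl (fun _ => rfl) i
    simp only [ClassicalBV.pull, e]
    exact ⟨fun a b => by rw [map_add, (hX.lin n _ _).map_add],
      fun c a => by rw [map_smul, (hX.lin n _ _).map_smul]⟩
  smooth n := by
    refine (hX.smooth n).comp (g := fun p : T₀ × (Fin n → T₁) => (j₀ p.1, j₁ ∘ p.2))
      ((SmoothB.id.fst.clm_comp j₀).prodMk (SmoothB.pi fun i => ?_))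
    exact (SmoothB.id.snd.apply i).clm_comp j₁

/-- A superfunction that is concentrated in degree `0` and linear. -/
def linEv (ℓ : S₀ → W) : SFun S₀ S₁ W
  | 0, φ, _ => ℓ φ
  | _ + 1, _, _ => 0

/-- A constant superfunction. -/
def constS (c : W) : SFun S₀ S₁ W
  | 0, _, _ => c
  | _ + 1, _, _ => 0

theorem Reg.constS (c : W) : Reg (constS c : SFun S₀ S₁ W) where
  anti n φ := by
    rcases n with _ | n
    · intro σ o
      have : σ = 1 := Subsingleton.elim _ _
      subst this
      simp
    · exact AntiS.zero
  lin n φ o := ⟨fun _ _ => by simp [ClassicalBV.constS], fun _ _ => by simp [ClassicalBV.constS]⟩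
  smooth n := by
    rcases n with _ | n
    · exact SmoothB.const c
    · exact SmoothB.const 0

theorem vcontract_constS (J : W →ₗ[ℝ] W) (c : W) (Y : SVec S₀ S₁) :
    vcontract J (constS c) Y = 0 := by
  have hz : ∀ φ q r u v, cterm J (constS c : SFun S₀ S₁ W) Y φ q r u v = 0 := by
    intro φ q r u v
    have h : ∀ h, dirD (fun φ' => (constS c : SFun S₀ S₁ W) q φ' u) φ h = 0 := fun h => by
      rcases q with _ | q <;> exact (hasDD_const _ _ _).dirD_eq
    have h' : ∀ e, (constS c : SFun S₀ S₁ W) (q + 1) φ (Fin.snoc u e) = 0 := fun e => rfl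
    simp [cterm, evalJ, h, h']
  funext p φ o
  have := vcontract_congr_add J (X := (constS c : SFun S₀ S₁ W)) (Y := Y)
    (X₁ := constS c) (Y₁ := Y) (X₂ := constS c) (Y₂ := Y) (φ := φ)
    (fun q r u v => by simp [hz]) p o
  simpa using this

/-- A superfunction that is concentrated in degree `1` and constant in the even variables. -/
def linOd (ℓ : S₁ → W) : SFun S₀ S₁ W
  | 1, _, o => ℓ (o 0)
  | _, _, _ => 0

theorem Reg.linEv (ℓ : S₀ →L[ℝ] W) : Reg (linEv ℓ : SFun S₀ S₁ W) where
  anti n φ := by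
    rcases n with _ | n
    · intro σ o
      have : σ = 1 := Subsingleton.elim _ _
      subst this
      simp [ClassicalBV.linEv]
    · exact AntiS.zero
  lin n φ o := ⟨fun _ _ => by simp [ClassicalBV.linEv], fun _ _ => by simp [ClassicalBV.linEv]⟩
  smooth n := by
    rcases n with _ | n
    · exact SmoothB.id.fst.clm_comp ℓ
    · exact SmoothB.const 0

theorem Reg.linOd (ℓ : S₁ →L[ℝ] W) : Reg (linOd ℓ : SFun S₀ S₁ W) where
  anti n φ := by
    rcases n with _ | _ | n
    · exact AntiS.zero
    · intro σ o
      have : σ = 1 := Subsingleton.elim (α := Equiv.Perm (Fin 1)) _ _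
      subst this
      simp
    · exact AntiS.zero
  lin n φ o := by
    rcases n with _ | n
    · exact ⟨fun _ _ => by simp [ClassicalBV.linOd], fun _ _ => by simp [ClassicalBV.linOd]⟩
    · exact ⟨fun _ _ => by simp [ClassicalBV.linOd], fun _ _ => by simp [ClassicalBV.linOd]⟩
  smooth n := by
    rcases n with _ | _ | n
    · exact SmoothB.const 0
    · exact (SmoothB.id.snd.apply 0).clm_comp ℓ
    · exact SmoothB.const 0

theorem vcontract_linEv (J : W →ₗ[ℝ] W) (ℓ : S₀ →L[ℝ] W) (p : ℕ) : ∀ {Y : SVec S₀ S₁}, AltV Y →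
    ∀ φ (o : Fin p → S₁), vcontract J (linEv ℓ) Y p φ o = evalJ J ℓ (Y.ev p φ o) := by
  induction p with
  | zero =>
    intro Y hY φ o
    have h : ∀ h, dirD (fun φ' => linEv ℓ 0 φ' o) φ h = ℓ h := fun h => by
      have := (SmoothB.of_clm ℓ).hasDD φ h
      refine HasDD.dirD_eq ?_
      refine tendsto_const_nhds.congr' ?_
      filter_upwards [self_mem_nhdsWithin] with t ht
      have ht' : t ≠ 0 := ht
      simp only [linEv, map_add, map_smul, add_sub_cancel_left, smul_smul, inv_mul_cancel₀ ht',
        one_smul]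
    rw [vcontract_zero_deg]
    simp only [h]
    simp [evalJ, linEv]
  | succ p ih =>
    intro Y hY φ o
    rw [← Fin.cons_self_tail o]
    generalize o 0 = w
    generalize Fin.tail o = o
    have e1 : iota w (linEv ℓ : SFun S₀ S₁ W) = 0 := rfl
    have e2 : tw (-1) (linEv ℓ : SFun S₀ S₁ W) = linEv ℓ := by
      funext n φ o; rcases n with _ | n <;> simp [tw, linEv]
    rw [vcontract_cons _ (Reg.linEv ℓ) hY, e1, e2, vcontract_zero_left, ih (hY.iotaV w)]
    simp [iotaV, iota]

theorem vcontract_linOd (J : W →ₗ[ℝ] W) (ℓ : S₁ →L[ℝ] W) (p : ℕ) : ∀ {Y : SVec S₀ S₁}, AltV Y →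
    ∀ φ (o : Fin p → S₁), vcontract J (linOd ℓ) Y p φ o = evalJ J ℓ (Y.od p φ o) := by
  induction p with
  | zero =>
    intro Y hY φ o
    have h : ∀ h, dirD (fun φ' => (linOd ℓ : SFun S₀ S₁ W) 0 φ' o) φ h = 0 := fun h =>
      (hasDD_const _ _ _).dirD_eq
    rw [vcontract_zero_deg]
    simp only [h]
    simp [evalJ, linOd, Fin.snoc]
  | succ p ih =>
    intro Y hY φ o
    rw [← Fin.cons_self_tail o]
    generalize o 0 = w
    generalize Fin.tail o = o
    have e1 : iota w (linOd ℓ : SFun S₀ S₁ W) = constS (ℓ w) := by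
      funext n φ o; rcases n with _ | n <;> rfl
    have e2 : tw (-1) (linOd ℓ : SFun S₀ S₁ W) = -linOd ℓ := by
      funext n φ o; rcases n with _ | _ | n <;> simp [tw, linOd]
    rw [vcontract_cons _ (Reg.linOd ℓ) hY, e1, e2, vcontract_neg_left _ (Reg.linOd ℓ),
      vcontract_constS]
    simp only [Pi.neg_apply]
    rw [ih (hY.iotaV w)]
    simp [iotaV, iota, evalJ, add_comm]

/-- The constant vector field in an even direction. -/
def constV (h : S₀) : SVec S₀ S₁ := ⟨constS (h, 0), 0⟩

theorem RegV.constV (h : S₀) : RegV (constV h : SVec S₀ S₁) := ⟨Reg.constS _, Reg.zero⟩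

theorem HasParity.constV (h : S₀) : HasParity 1 (constV h : SVec S₀ S₁) where
  ev n φ o := by rcases n with _ | n <;> simp [ClassicalBV.constV, constS]
  od n φ o := by simp [ClassicalBV.constV]

/-- The contraction with a constant even vector field is the directional derivative. -/
theorem vcontract_constV (J : W →ₗ[ℝ] W) (h : S₀) (p : ℕ) : ∀ {X : SFun S₀ S₁ W}, Reg X →
    ∀ φ (o : Fin p → S₁), vcontract J X (constV h) p φ o = dirD (fun φ' => X p φ' o) φ h := by
  induction p with
  | zero =>
    intro X hX φ o
    have h0 : X 1 φ (Fin.snoc o 0) = 0 := (hX.lin_snoc 0 φ o).map_zero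
    rw [vcontract_zero_deg]
    simp [constV, constS, evalJ, h0, dirD_zero_dir]
  | succ p ih =>
    intro X hX φ o
    rw [← Fin.cons_self_tail o]
    generalize o 0 = w
    generalize Fin.tail o = o
    rw [vcontract_cons _ hX (RegV.constV h).altV, ih (hX.iota w),
      vcontract_zero_right J (hX.tw (-1)) (Y := iotaV w (constV h)) rfl
        (by funext n φ o; simp [iotaV, iota, constV])]
    simp [iota]

end Linear

/-! ### The symmetry of the antibracket -/

section Antibracket

variable {S₀ S₁ : Type u} [AddCommGroup S₀] [Module ℝ S₀] [TopologicalSpace S₀]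
  [LCTVS S₀] [AddCommGroup S₁] [Module ℝ S₁] [TopologicalSpace S₁] [LCTVS S₁]

/-- `Y` is a Hamiltonian vector field of `X` with respect to the odd symplectic form `Ω`. -/
structure IsHam (Ω : S₀ →ₗ[ℝ] S₁ →ₗ[ℝ] ℝ) (X : SFun S₀ S₁ ℂ) (Y : SVec S₀ S₁) : Prop where
  even : ∀ n φ o e, dirD (fun φ' => X n φ' o) φ e = evalC (fun w => (Ω e w : ℂ)) (Y.od n φ o)
  odd : ∀ n φ o w, X (n + 1) φ (Fin.cons w o) = -evalC (fun h => (Ω h w : ℂ)) (Y.ev n φ o)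

/-- Superfunctions of parity `ε`. -/
def FunParity (ε : ℤˣ) (X : SFun S₀ S₁ ℂ) : Prop :=
  ∀ n φ o, (((-1 : ℤˣ) ^ n : ℤˣ) : ℤ) • X n φ o = (ε : ℤ) • X n φ o

theorem FunParity.tw {ε : ℤˣ} {X : SFun S₀ S₁ ℂ} (h : FunParity ε X) :
    tw (-1) X = (ε : ℤ) • X := by
  funext n φ o; exact h n φ o

theorem FunParity.iota {ε : ℤˣ} {X : SFun S₀ S₁ ℂ} (h : FunParity ε X) (w : S₁) :
    FunParity (-ε) (iota w X) := by
  intro n φ o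
  have := h (n + 1) φ (Fin.cons w o)
  rw [pow_succ] at this
  simp only [ClassicalBV.iota]
  rw [Units.val_neg, neg_smul, ← this]
  simp

theorem IsHam.iota {Ω : S₀ →ₗ[ℝ] S₁ →ₗ[ℝ] ℝ} {X : SFun S₀ S₁ ℂ} (hX : Reg X) {Y : SVec S₀ S₁}
    (h : IsHam Ω X Y) (w : S₁) : IsHam Ω (iota w X) ⟨-(iotaV w Y).ev, -(iotaV w Y).od⟩ where
  even n φ o e := by
    simpa [iotaV, ClassicalBV.iota] using h.even (n + 1) φ (Fin.cons w o) e
  odd n φ o w' := by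
    have h1 := (hX.anti (n + 2) φ) (Equiv.swap 0 1) (Fin.cons w' (Fin.cons w o))
    have e2 : (Fin.cons w' (Fin.cons w o) : Fin (n + 2) → S₁) ∘ Equiv.swap 0 1 =
        Fin.cons w (Fin.cons w' o) := by
      funext k
      refine Fin.cases ?_ (fun k => ?_) k
      · simp
      · refine Fin.cases ?_ (fun k => ?_) k
        · simp
        · rw [Function.comp, Equiv.swap_apply_of_ne_of_ne (Fin.succ_ne_zero _)
            (fun h => absurd (congrArg Fin.val h) (by simp))]
          simp
    rw [e2] at h1
    have h2 := h.odd (n + 1) φ (Fin.cons w o) w'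
    simp only [ClassicalBV.iota, h1, h2]
    simp [iotaV, ClassicalBV.iota, evalC]

/-- The sign in the graded symmetry of the antibracket of functionals of parities `ε` and `ε'`. -/
def brSign (ε ε' : ℤˣ) : ℂ := if ε = 1 ∧ ε' = 1 then 1 else -1

/-- The graded symmetry of the antibracket, by induction on the degree `p`: inserting an odd direction
by `vcontract_cons` changes the parity of one of the functionals. -/
theorem antibracket_symm (Ω : S₀ →ₗ[ℝ] S₁ →ₗ[ℝ] ℝ) (p : ℕ) : ∀ {X X' : SFun S₀ S₁ ℂ}
    {Y Y' : SVec S₀ S₁} {ε ε' : ℤˣ}, Reg X → Reg X' → RegV Y → RegV Y' →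
    IsHam Ω X Y → IsHam Ω X' Y' → FunParity ε X → FunParity ε' X' → ∀ φ o,
    vcontract mulIℂ X Y' p φ o = brSign ε ε' * vcontract mulIℂ X' Y p φ o := by
  have d : ¬ ((-1 : ℤˣ) = 1) := by decide
  induction p with
  | zero =>
    intro X X' Y Y' ε ε' hX hX' hY hY' hh hh' hε hε' φ o
    rw [vcontract_zero_deg_elim0, vcontract_zero_deg_elim0]
    simp only [hh.even, hh'.even, hh.odd, hh'.odd]
    -- both functionals even: the components of degree one vanish
    have hz : ∀ {X : SFun S₀ S₁ ℂ} {Y : SVec S₀ S₁}, IsHam Ω X Y → FunParity 1 X → ∀ w,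
        evalC (fun h => (Ω h w : ℂ)) (Y.ev 0 φ Fin.elim0) = 0 := by
      intro X Y h hp w
      have h1 := hp 1 φ (Fin.cons w Fin.elim0)
      have h2 := h.odd 0 φ Fin.elim0 w
      have h3 : -X 1 φ (Fin.cons w Fin.elim0) = X 1 φ (Fin.cons w Fin.elim0) := by simpa using h1
      have h4 : X 1 φ (Fin.cons w Fin.elim0) = 0 := by linear_combination (-1 / 2 : ℂ) * h3
      rw [← neg_eq_zero, ← h2]; exact h4
    have hsw : ∀ (a : Cx S₀) (b : Cx S₁), evalC (fun h => evalC (fun w => (Ω h w : ℂ)) b) a =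
        evalC (fun w => evalC (fun h => (Ω h w : ℂ)) a) b := by
      intro a b; simp only [evalC]; ring
    have hng : ∀ (a : Cx S₀) (b : Cx S₁), evalC (fun w => -evalC (fun h => (Ω h w : ℂ)) a) b =
        -evalC (fun w => evalC (fun h => (Ω h w : ℂ)) a) b := by
      intro a b; simp only [evalC]; ring
    rw [hsw, hsw, hng, hng]
    rcases Int.units_eq_one_or ε with rfl | rfl <;> rcases Int.units_eq_one_or ε' with rfl | rfl
    · simp only [hz hh hε, hz hh' hε']
      simp [evalC]
    all_goals simp [brSign, d]
  | succ p ih =>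
    intro X X' Y Y' ε ε' hX hX' hY hY' hh hh' hε hε' φ o
    rw [← Fin.cons_self_tail o]
    generalize o 0 = w
    generalize Fin.tail o = o
    have hneg : ∀ {Y : SVec S₀ S₁}, RegV Y → RegV ⟨-(iotaV w Y).ev, -(iotaV w Y).od⟩ := fun h =>
      ⟨(h.iotaV w).ev.neg, (h.iotaV w).od.neg⟩
    have i1 := ih (hX.iota w) hX' (hneg hY) hY' (hh.iota hX w) hh' (hε.iota w) hε' φ o
    have i2 := ih hX (hX'.iota w) hY (hneg hY') hh (hh'.iota hX' w) hε (hε'.iota w) φ o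
    rw [vcontract_neg_right mulIℂ hX' (Y := iotaV w Y) rfl rfl] at i1
    rw [vcontract_neg_right mulIℂ hX (Y := iotaV w Y') rfl rfl] at i2
    rw [vcontract_cons _ hX hY'.altV, vcontract_cons _ hX' hY.altV, hε.tw, hε'.tw]
    simp only [Pi.neg_apply] at i1 i2
    rcases Int.units_eq_one_or ε with rfl | rfl <;> rcases Int.units_eq_one_or ε' with rfl | rfl <;>
      simp only [Units.val_neg, Units.val_one, neg_smul, one_smul, vcontract_neg_left mulIℂ hX,
        vcontract_neg_left mulIℂ hX', Pi.neg_apply, brSign, d, neg_neg, and_self, and_true,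
        true_and, if_true, if_false] at i1 i2 ⊢
    · linear_combination i1 - i2
    · linear_combination i1 - i2
    · linear_combination i1 + i2
    · linear_combination i1 + i2

theorem IsHam.constV {Ω : S₀ →ₗ[ℝ] S₁ →ₗ[ℝ] ℝ} (h1 : ∀ h, Continuous (Ω h))
    (h2 : ∀ w, Continuous fun h => Ω h w) {X : SFun S₀ S₁ ℂ} (hX : Reg X) {Y : SVec S₀ S₁}
    (hY : RegV Y) (hh : IsHam Ω X Y) (h : S₀) :
    IsHam Ω (vcontract mulIℂ X (constV h)) (actV (constV h) Y) where
  even n φ o e := by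
    simp only [actV, vcontract_constV mulIℂ h n hX, vcontract_constV (mulICx S₁) h n hY.od]
    rw [(hX.smooth_even n o).second_symm φ h e]
    simp only [hh.even]
    refine HasDD.dirD_eq ?_
    have hd := hY.od.hasDD n φ h o
    have c1 : Continuous fun b : Cx S₁ => evalC (fun w => (Ω e w : ℂ)) b :=
      (Complex.continuous_ofReal.comp ((h1 e).comp continuous_fst)).add
        (continuous_const.mul (Complex.continuous_ofReal.comp ((h1 e).comp continuous_snd)))
    exact hd.clm (⟨⟨⟨fun b => evalC (fun w => (Ω e w : ℂ)) b, fun a b => by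
      simp [evalC]; ring⟩, fun c b => by simp [evalC]; ring⟩, c1⟩ : Cx S₁ →L[ℝ] ℂ)
  odd n φ o w := by
    simp only [actV, vcontract_constV mulIℂ h _ hX, vcontract_constV (mulICx S₀) h n hY.ev, hh.odd]
    rw [dirD_neg]
    congr 1
    refine HasDD.dirD_eq ?_
    have hd := hY.ev.hasDD n φ h o
    have c1 : Continuous fun b : Cx S₀ => evalC (fun e => (Ω e w : ℂ)) b :=
      (Complex.continuous_ofReal.comp ((h2 w).comp continuous_fst)).add
        (continuous_const.mul (Complex.continuous_ofReal.comp ((h2 w).comp continuous_snd)))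
    exact hd.clm (⟨⟨⟨fun b => evalC (fun e => (Ω e w : ℂ)) b, fun a b => by
      simp [evalC]; ring⟩, fun c b => by simp [evalC]; ring⟩, c1⟩ : Cx S₀ →L[ℝ] ℂ)

theorem FunParity.constV {X : SFun S₀ S₁ ℂ} (hX : Reg X) {ε : ℤˣ} (hε : FunParity ε X) (h : S₀) :
    FunParity ε (vcontract mulIℂ X (constV h)) := by
  intro n φ o
  rw [vcontract_constV mulIℂ h n hX, ← dirD_sign_smul, ← dirD_sign_smul]
  congr 1
  funext φ'
  exact hε n φ' o

/-- The master equation implies that the Hamiltonian vector field of the action squares to zero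
(up to the kernel of the symplectic form), order by order in the coupling constant. -/
theorem sum_actV_eq_zero {Ω : S₀ →ₗ[ℝ] S₁ →ₗ[ℝ] ℝ} (h1 : ∀ h, Continuous (Ω h))
    (h2 : ∀ w, Continuous fun h => Ω h w) {S : ℕ → SFun S₀ S₁ ℂ} {Q : ℕ → SVec S₀ S₁} {n : ℕ}
    (hS : ∀ i ≤ n, Reg (S i)) (hQ : ∀ i ≤ n, RegV (Q i)) (hh : ∀ i ≤ n, IsHam Ω (S i) (Q i))
    (hp : ∀ i ≤ n, FunParity 1 (S i))
    (hcme : ∑ x ∈ Finset.HasAntidiagonal.antidiagonal n, vcontract mulIℂ (S x.1) (Q x.2) = 0)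
    (p : ℕ) (φ : S₀) (o : Fin p → S₁) :
    (∀ h, evalC (fun w => (Ω h w : ℂ))
      (∑ x ∈ Finset.HasAntidiagonal.antidiagonal n, (actV (Q x.2) (Q x.1)).od p φ o) = 0) ∧
    ∀ w, evalC (fun h => (Ω h w : ℂ))
      (∑ x ∈ Finset.HasAntidiagonal.antidiagonal n, (actV (Q x.2) (Q x.1)).ev p φ o) = 0 := by
  have hle : ∀ x ∈ Finset.HasAntidiagonal.antidiagonal n, x.1 ≤ n ∧ x.2 ≤ n := fun x hx => by
    rw [Finset.HasAntidiagonal.mem_antidiagonal] at hx; omega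
  have hswap : ∀ f : ℕ × ℕ → ℂ, ∑ x ∈ Finset.HasAntidiagonal.antidiagonal n, f x =
      ∑ x ∈ Finset.HasAntidiagonal.antidiagonal n, f (x.2, x.1) := fun f =>
    (Finset.sum_equiv (Equiv.prodComm ℕ ℕ) (by simp [add_comm]) (by simp))
  constructor
  · intro h
    have c1 : Continuous fun b : Cx S₁ => evalC (fun w => (Ω h w : ℂ)) b :=
      (Complex.continuous_ofReal.comp ((h1 h).comp continuous_fst)).add
        (continuous_const.mul (Complex.continuous_ofReal.comp ((h1 h).comp continuous_snd)))
    let L : Cx S₁ →L[ℝ] ℂ := ⟨⟨⟨fun b => evalC (fun w => (Ω h w : ℂ)) b, fun a b => by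
      simp [evalC]; ring⟩, fun c b => by simp [evalC]; ring⟩, c1⟩
    have hL : ∀ b, L (mulICx S₁ b) = mulIℂ (L b) := fun b => by
      show evalC (fun w => (Ω h w : ℂ)) (mulICx S₁ b) = Complex.I * evalC (fun w => (Ω h w : ℂ)) b
      simp only [evalC, mulICx_apply, map_neg, Complex.ofReal_neg]
      linear_combination -(Ω h b.2 : ℂ) * Complex.I_sq
    show L _ = 0
    rw [map_sum]
    -- the derivative of the master equation along `h`
    have hder : ∑ x ∈ Finset.HasAntidiagonal.antidiagonal n,
        vcontract mulIℂ (vcontract mulIℂ (S x.1) (Q x.2)) (constV h) p φ o = 0 := by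
      have := vcontract_sum_left mulIℂ (Finset.HasAntidiagonal.antidiagonal n)
        (X := fun x => vcontract mulIℂ (S x.1) (Q x.2))
        (fun x hx => (hS _ (hle x hx).1).vcontract continuous_mulIℂ (hQ _ (hle x hx).2)) (constV h)
      rw [hcme, vcontract_zero_left] at this
      have := congrFun (congrFun (congrFun this p) φ) o
      simpa using this.symm
    -- Moving the derivative along `h` inside yields the derivative of `Q` along itself; the remaining
    -- term is brought into the same form by the symmetry of the antibracket, so that the derivative of
    -- the master equation is twice the claim.
    have hterm : ∀ x ∈ Finset.HasAntidiagonal.antidiagonal n,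
        vcontract mulIℂ (vcontract mulIℂ (S x.1) (Q x.2)) (constV h) p φ o =
        L ((actV (Q x.2) (Q x.1)).od p φ o) + L ((actV (Q x.1) (Q x.2)).od p φ o) := by
      intro x hx
      have hle := hle x hx
      have key : ∀ i ≤ n, ∀ j ≤ n, vcontract mulIℂ (vcontract mulIℂ (S i) (constV h)) (Q j) p φ o =
          L ((actV (Q j) (Q i)).od p φ o) := by
        intro i hi j hj
        have e : vcontract mulIℂ (S i) (constV h) = fun n φ o => L ((Q i).od n φ o) := by
          funext n φ o
          rw [vcontract_constV mulIℂ h n (hS i hi), (hh i hi).even]; rfl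
        rw [e]
        exact vcontract_map L hL (hQ i hi).od (Q j) p φ o
      have c := vcontract_commutator p (hS _ hle.1) (RegV.constV h) (hQ _ hle.2)
        (HasParity.constV h) φ o
      have s := antibracket_symm Ω p (hS _ hle.1)
        ((hS _ hle.2).vcontract continuous_mulIℂ (RegV.constV h)) (hQ _ hle.1)
        ((RegV.constV h).actV (hQ _ hle.2)) (hh _ hle.1)
        ((hh _ hle.2).constV h1 h2 (hS _ hle.2) (hQ _ hle.2) h) (hp _ hle.1)
        ((hp _ hle.2).constV (hS _ hle.2) h) φ o
      rw [twV_one, key _ hle.1 _ hle.2, s, key _ hle.2 _ hle.1,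
        vcontract_zero_right mulIℂ (hS _ hle.1) (Y := actV (Q x.2) (constV h))
          (vcontract_constS _ _ _) (vcontract_zero_left _ _)] at c
      simp only [brSign, and_self, if_true, one_mul, Pi.zero_apply, sub_zero] at c
      linear_combination c
    rw [Finset.sum_congr rfl hterm, Finset.sum_add_distrib,
      hswap fun x => L ((actV (Q x.1) (Q x.2)).od p φ o)] at hder
    linear_combination (1 / 2 : ℂ) * hder
  · intro w
    have c1 : Continuous fun b : Cx S₀ => evalC (fun h => (Ω h w : ℂ)) b :=
      (Complex.continuous_ofReal.comp ((h2 w).comp continuous_fst)).add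
        (continuous_const.mul (Complex.continuous_ofReal.comp ((h2 w).comp continuous_snd)))
    let L : Cx S₀ →L[ℝ] ℂ := ⟨⟨⟨fun b => evalC (fun h => (Ω h w : ℂ)) b, fun a b => by
      simp [evalC]; ring⟩, fun c b => by simp [evalC]; ring⟩, c1⟩
    have hL : ∀ b, (-L) (mulICx S₀ b) = mulIℂ ((-L) b) := fun b => by
      show -evalC (fun h => (Ω h w : ℂ)) (mulICx S₀ b) =
        Complex.I * -evalC (fun h => (Ω h w : ℂ)) b
      simp only [evalC, mulICx_apply, map_neg, Complex.ofReal_neg, LinearMap.neg_apply]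
      linear_combination (Ω b.2 w : ℂ) * Complex.I_sq
    show L _ = 0
    rw [map_sum]
    have hder : ∑ x ∈ Finset.HasAntidiagonal.antidiagonal n,
        vcontract mulIℂ (S x.1) (Q x.2) (p + 1) φ (Fin.cons w o) = 0 := by
      have := congrFun (congrFun (congrFun hcme (p + 1)) φ) (Fin.cons w o)
      simpa using this
    have hterm : ∀ x ∈ Finset.HasAntidiagonal.antidiagonal n,
        vcontract mulIℂ (S x.1) (Q x.2) (p + 1) φ (Fin.cons w o) =
        -L ((actV (Q x.2) (Q x.1)).ev p φ o) + -L ((actV (Q x.1) (Q x.2)).ev p φ o) := by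
      intro x hx
      have hle := hle x hx
      have key : ∀ i ≤ n, ∀ j ≤ n, vcontract mulIℂ (iota w (S i)) (Q j) p φ o =
          -L ((actV (Q j) (Q i)).ev p φ o) := by
        intro i hi j hj
        have e : iota w (S i) = fun n φ o => (-L) ((Q i).ev n φ o) := by
          funext n φ o
          exact (hh i hi).odd n φ o w
        rw [e]
        exact vcontract_map (-L) hL (hQ i hi).ev (Q j) p φ o
      have s := antibracket_symm Ω p (hS _ hle.1) ((hS _ hle.2).iota w) (hQ _ hle.1)
        (⟨((hQ _ hle.2).iotaV w).ev.neg, ((hQ _ hle.2).iotaV w).od.neg⟩ :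
          RegV ⟨-(iotaV w (Q x.2)).ev, -(iotaV w (Q x.2)).od⟩) (hh _ hle.1)
        ((hh _ hle.2).iota (hS _ hle.2) w) (hp _ hle.1) ((hp _ hle.2).iota w) φ o
      have d : ¬ ((-1 : ℤˣ) = 1) := by decide
      rw [vcontract_neg_right mulIℂ (hS _ hle.1) (Y := iotaV w (Q x.2)) rfl rfl,
        key _ hle.2 _ hle.1] at s
      simp only [Pi.neg_apply, brSign, d, and_false, if_false] at s
      rw [vcontract_cons mulIℂ (hS _ hle.1) (hQ _ hle.2).altV, (hp _ hle.1).tw, Units.val_one, one_smul,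
        key _ hle.1 _ hle.2]
      linear_combination -s
    rw [Finset.sum_congr rfl hterm, Finset.sum_add_distrib,
      hswap fun x => -L ((actV (Q x.1) (Q x.2)).ev p φ o), Finset.sum_neg_distrib] at hder
    linear_combination (-1 / 2 : ℂ) * hder

end Antibracket

/-! ### Formal power series of superfunctions and of vector fields -/

theorem sum_antidiagonal_assoc {A : Type*} [AddCommMonoid A] (n : ℕ) (f : ℕ → ℕ → ℕ → A) :
    ∑ x ∈ Finset.HasAntidiagonal.antidiagonal n, ∑ y ∈ Finset.HasAntidiagonal.antidiagonal x.1,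
      f y.1 y.2 x.2 = ∑ x ∈ Finset.HasAntidiagonal.antidiagonal n,
        ∑ y ∈ Finset.HasAntidiagonal.antidiagonal x.2, f x.1 y.1 y.2 := by
  rw [Finset.sum_sigma', Finset.sum_sigma']
  refine Finset.sum_nbij' (fun x => ⟨(x.2.1, x.2.2 + x.1.2), (x.2.2, x.1.2)⟩)
    (fun x => ⟨(x.1.1 + x.2.1, x.2.2), (x.1.1, x.2.1)⟩) ?_ ?_ ?_ ?_ ?_
  · rintro ⟨⟨a, b⟩, c, d⟩ h
    simp only [Finset.mem_sigma, Finset.HasAntidiagonal.mem_antidiagonal] at h ⊢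
    exact ⟨by linarith [h.1, h.2], trivial⟩
  · rintro ⟨⟨a, b⟩, c, d⟩ h
    simp only [Finset.mem_sigma, Finset.HasAntidiagonal.mem_antidiagonal] at h ⊢
    exact ⟨by linarith [h.1, h.2], trivial⟩
  · rintro ⟨⟨a, b⟩, c, d⟩ h
    simp only [Finset.mem_sigma, Finset.HasAntidiagonal.mem_antidiagonal] at h ⊢
    obtain ⟨-, rfl⟩ := h
    rfl
  · rintro ⟨⟨a, b⟩, c, d⟩ h
    simp only [Finset.mem_sigma, Finset.HasAntidiagonal.mem_antidiagonal] at h ⊢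
    obtain ⟨-, rfl⟩ := h
    rfl
  · rintro ⟨⟨a, b⟩, c, d⟩ h
    rfl

section Series

variable {S₀ S₁ : Type u} [AddCommGroup S₀] [Module ℝ S₀] [TopologicalSpace S₀]
  [LCTVS S₀] [AddCommGroup S₁] [Module ℝ S₁] [TopologicalSpace S₁] [LCTVS S₁]

theorem contractSeries_eq (X : FSeries S₀ S₁ ℂ) (Y : ℕ → SVec S₀ S₁) (n : ℕ) :
    contractSeries X Y n = ∑ x ∈ Finset.HasAntidiagonal.antidiagonal n,
      vcontract mulIℂ (X x.1) (Y x.2) := by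
  simp only [contractSeries, contract_eq_vcontract]

variable (S₀ S₁) in
/-- The space of formal power series of smooth superfunctions. -/
def regSeries : Submodule ℝ (FSeries S₀ S₁ ℂ) where
  carrier := {X | ∀ k, Reg (X k)}
  add_mem' hX hX' := fun k => (hX k).add (hX' k)
  zero_mem' := fun _ => Reg.zero
  smul_mem' c _ hX := fun k => (hX k).smul c

theorem contractSeries_mem {X : FSeries S₀ S₁ ℂ} (hX : X ∈ regSeries S₀ S₁)
    {Y : ℕ → SVec S₀ S₁} (hY : ∀ k, RegV (Y k)) : contractSeries X Y ∈ regSeries S₀ S₁ := fun n => by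
  rw [contractSeries_eq]
  exact Reg.sum _ fun x _ => (hX _).vcontract continuous_mulIℂ (hY _)

/-- The contraction with a series of vector fields, as a linear operator. -/
def ctr (Y : ℕ → SVec S₀ S₁) (hY : ∀ k, RegV (Y k)) : Module.End ℝ (regSeries S₀ S₁) where
  toFun X := ⟨contractSeries X.1 Y, contractSeries_mem X.2 hY⟩
  map_add' X X' := by
    ext1
    funext n
    show contractSeries (X.1 + X'.1) Y n = contractSeries X.1 Y n + contractSeries X'.1 Y n
    simp only [contractSeries_eq, ← Finset.sum_add_distrib]
    exact Finset.sum_congr rfl fun x _ => vcontract_add_left mulIℂ (X.2 _) (X'.2 _) _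
  map_smul' c X := by
    ext1
    funext n
    show contractSeries (c • X.1) Y n = c • contractSeries X.1 Y n
    simp only [contractSeries_eq, Finset.smul_sum]
    exact Finset.sum_congr rfl fun x _ => vcontract_smul_left mulIℂ (X.2 _) c _

theorem ctr_apply (Y : ℕ → SVec S₀ S₁) (hY : ∀ k, RegV (Y k)) (X : regSeries S₀ S₁) (n : ℕ) :
    (ctr Y hY X).1 n = ∑ x ∈ Finset.HasAntidiagonal.antidiagonal n,
      vcontract mulIℂ (X.1 x.1) (Y x.2) := contractSeries_eq X.1 Y n

theorem ctr_add {Y Y' Z Z' : ℕ → SVec S₀ S₁} (hY : ∀ k, RegV (Y k)) (hY' : ∀ k, RegV (Y' k))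
    (hZ : ∀ k, RegV (Z k)) (hZ' : ∀ k, RegV (Z' k))
    (hev : ∀ k, (Y k).ev + (Y' k).ev = (Z k).ev + (Z' k).ev)
    (hod : ∀ k, (Y k).od + (Y' k).od = (Z k).od + (Z' k).od) :
    ctr Y hY + ctr Y' hY' = ctr Z hZ + ctr Z' hZ' := by
  ext1 X
  ext1
  funext n
  show (ctr Y hY X).1 n + (ctr Y' hY' X).1 n = (ctr Z hZ X).1 n + (ctr Z' hZ' X).1 n
  simp only [ctr_apply, ← Finset.sum_add_distrib]
  refine Finset.sum_congr rfl fun x _ => ?_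
  rw [← vcontract_add_right mulIℂ (X.2 x.1) (Y := ⟨(Y x.2).ev + (Y' x.2).ev, (Y x.2).od + (Y' x.2).od⟩)
    rfl rfl, vcontract_add_right mulIℂ (X.2 x.1) (hev x.2) (hod x.2)]

theorem vcontract_sum_right {W : Type*} [AddCommGroup W] [Module ℝ W] [TopologicalSpace W] [LCTVS W]
    (J : W →ₗ[ℝ] W) {X : SFun S₀ S₁ W} (hX : Reg X) {ι : Type*}
    (s : Finset ι) {Y : SVec S₀ S₁} {Z : ι → SVec S₀ S₁} (hev : Y.ev = ∑ i ∈ s, (Z i).ev)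
    (hod : Y.od = ∑ i ∈ s, (Z i).od) : vcontract J X Y = ∑ i ∈ s, vcontract J X (Z i) := by
  classical
  induction s using Finset.induction_on generalizing Y with
  | empty => exact vcontract_zero_right J hX (by simpa using hev) (by simpa using hod)
  | insert i s hi ih =>
    rw [Finset.sum_insert hi] at hev hod ⊢
    rw [vcontract_add_right J hX (Y₂ := ⟨∑ i ∈ s, (Z i).ev, ∑ i ∈ s, (Z i).od⟩) hev hod,
      ih (Y := ⟨∑ i ∈ s, (Z i).ev, ∑ i ∈ s, (Z i).od⟩) rfl rfl]

/-- The commutator of the contractions with two series of vector fields, the first one of which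
is even. -/
theorem ctr_mul_ctr {E Q R R' : ℕ → SVec S₀ S₁} (hE : ∀ k, RegV (E k)) (hQ : ∀ k, RegV (Q k))
    (hR : ∀ k, RegV (R k)) (hR' : ∀ k, RegV (R' k)) (hp : ∀ k, HasParity 1 (E k))
    (h : ∀ b, (R b).ev = ∑ x ∈ Finset.HasAntidiagonal.antidiagonal b, (actV (E x.2) (Q x.1)).ev ∧
      (R b).od = ∑ x ∈ Finset.HasAntidiagonal.antidiagonal b, (actV (E x.2) (Q x.1)).od)
    (h' : ∀ b, (R' b).ev = ∑ x ∈ Finset.HasAntidiagonal.antidiagonal b, (actV (Q x.1) (E x.2)).ev ∧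
      (R' b).od = ∑ x ∈ Finset.HasAntidiagonal.antidiagonal b, (actV (Q x.1) (E x.2)).od) :
    ctr E hE * ctr Q hQ + ctr R' hR' = ctr Q hQ * ctr E hE + ctr R hR := by
  ext1 X
  ext1
  funext n
  show (ctr E hE (ctr Q hQ X)).1 n + (ctr R' hR' X).1 n =
    (ctr Q hQ (ctr E hE X)).1 n + (ctr R hR X).1 n
  have hc : ∀ {A B : ℕ → SVec S₀ S₁} (hA : ∀ k, RegV (A k)) (hB : ∀ k, RegV (B k)),
      (ctr A hA (ctr B hB X)).1 n = ∑ x ∈ Finset.HasAntidiagonal.antidiagonal n,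
        ∑ y ∈ Finset.HasAntidiagonal.antidiagonal x.2,
          vcontract mulIℂ (vcontract mulIℂ (X.1 x.1) (B y.1)) (A y.2) := by
    intro A B hA hB
    rw [ctr_apply, ← sum_antidiagonal_assoc n fun i j k =>
      vcontract mulIℂ (vcontract mulIℂ (X.1 i) (B j)) (A k)]
    refine Finset.sum_congr rfl fun x _ => ?_
    rw [ctr_apply, vcontract_sum_left mulIℂ _ fun y _ =>
      (X.2 y.1).vcontract continuous_mulIℂ (hB y.2)]
  rw [hc hE hQ, hc hQ hE, ctr_apply, ctr_apply, ← Finset.sum_add_distrib, ← Finset.sum_add_distrib]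
  refine Finset.sum_congr rfl fun x _ => ?_
  rw [vcontract_sum_right mulIℂ (X.2 x.1) _ (h x.2).1 (h x.2).2,
    vcontract_sum_right mulIℂ (X.2 x.1) _ (h' x.2).1 (h' x.2).2]
  have hs : ∑ y ∈ Finset.HasAntidiagonal.antidiagonal x.2,
      vcontract mulIℂ (vcontract mulIℂ (X.1 x.1) (E y.1)) (Q y.2) =
      ∑ y ∈ Finset.HasAntidiagonal.antidiagonal x.2,
      vcontract mulIℂ (vcontract mulIℂ (X.1 x.1) (E y.2)) (Q y.1) :=
    Finset.sum_equiv (Equiv.prodComm ℕ ℕ) (by simp [add_comm]) (by simp)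
  rw [hs, ← Finset.sum_add_distrib, ← Finset.sum_add_distrib]
  refine Finset.sum_congr rfl fun y _ => ?_
  funext p φ o
  have := vcontract_commutator p (X.2 x.1) (hE y.2) (hQ y.1) (hp y.2) φ o
  rw [twV_one] at this
  simp only [Pi.add_apply]
  linear_combination this

end Series

/-! ### Truncated exponentials -/

section Exp

variable {A : Type*} [Ring A] [Algebra ℝ A]

/-- The truncated exponential series. -/
def texp (E : A) (M : ℕ) : A := ∑ m ∈ Finset.range M, ((m.factorial : ℝ))⁻¹ • E ^ m

theorem mul_pow_succ_of_comm {E B R : A} (h : B * E = E * B + R) (hR : Commute E R) (m : ℕ) :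
    B * E ^ (m + 1) = E ^ (m + 1) * B + ((m + 1 : ℕ) : ℝ) • (E ^ m * R) := by
  induction m with
  | zero => simpa using h
  | succ m ih =>
    rw [pow_succ, ← mul_assoc, ih, add_mul, mul_assoc, h, mul_add, ← mul_assoc, ← pow_succ, smul_mul_assoc,
      mul_assoc, hR.symm.eq, ← mul_assoc, ← pow_succ]
    rw [add_assoc]
    congr 1
    push_cast
    module

/-- The commutator with an exponential, when the simple commutator `R` is central. -/
theorem mul_texp {E B R : A} (h : B * E = E * B + R) (hR : Commute E R) (M : ℕ) :
    B * texp E (M + 1) = texp E (M + 1) * B + texp E M * R := by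
  rw [texp, Finset.sum_range_succ', texp, mul_add, Finset.mul_sum, add_mul, Finset.sum_mul,
    Finset.sum_mul]
  have e : ∀ m ∈ Finset.range M, B * ((((m + 1).factorial : ℕ) : ℝ)⁻¹ • E ^ (m + 1)) =
      ((((m + 1).factorial : ℕ) : ℝ)⁻¹ • E ^ (m + 1)) * B + ((m.factorial : ℝ)⁻¹ • E ^ m) * R := by
    intro m _
    have h2 : ((m + 1 : ℕ) : ℝ) ≠ 0 := by positivity
    rw [mul_smul_comm, mul_pow_succ_of_comm h hR, smul_add, smul_smul, smul_mul_assoc, smul_mul_assoc,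
      Nat.factorial_succ, Nat.cast_mul, mul_inv, mul_comm ((m + 1 : ℕ) : ℝ)⁻¹, mul_assoc,
      inv_mul_cancel₀ h2, mul_one, mul_comm ((m.factorial : ℝ)⁻¹) _]
  rw [Finset.sum_congr rfl e, Finset.sum_add_distrib]
  simp
  abel

theorem mul_texp_of_eq {E B R : A} (h : E * B = B * E + R) (hR : Commute E R) (M : ℕ) :
    B * texp E (M + 1) + texp E M * R = texp E (M + 1) * B := by
  have := mul_texp (R := -R) (show B * E = E * B + -R by rw [h, add_neg_cancel_right]) hR.neg_right M
  rw [this, mul_neg, neg_add_cancel_right]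

theorem commute_texp {E B : A} (h : Commute E B) (M : ℕ) : B * texp E M = texp E M * B := by
  rw [texp, Finset.mul_sum, Finset.sum_mul]
  exact Finset.sum_congr rfl fun m _ => by
    rw [mul_smul_comm, smul_mul_assoc, (h.symm.pow_right m).eq]

end Exp

/-! ### Vector fields on the doubled space -/

section Doubled

variable {S₀ S₁ : Type u} [AddCommGroup S₀] [Module ℝ S₀] [TopologicalSpace S₀]
  [LCTVS S₀] [AddCommGroup S₁] [Module ℝ S₁] [TopologicalSpace S₁] [LCTVS S₁]

/-- The inclusion of one of the two factors of `S × S`. -/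
def inj (S : Type u) [AddCommGroup S] [Module ℝ S] [TopologicalSpace S] : Bool → (S →L[ℝ] S × S)
  | false => ContinuousLinearMap.inl ℝ S S
  | true => ContinuousLinearMap.inr ℝ S S

/-- The projection to one of the two factors of `S × S`. -/
def prj (S : Type u) [AddCommGroup S] [Module ℝ S] [TopologicalSpace S] : Bool → (S × S →L[ℝ] S)
  | false => ContinuousLinearMap.fst ℝ S S
  | true => ContinuousLinearMap.snd ℝ S S

theorem prj_inj_self {S : Type u} [AddCommGroup S] [Module ℝ S] [TopologicalSpace S] (a : Bool)
    (s : S) : prj S a (inj S a s) = s := by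
  cases a <;> rfl

theorem prj_inj_ne {S : Type u} [AddCommGroup S] [Module ℝ S] [TopologicalSpace S] {a b : Bool}
    (h : a ≠ b) (s : S) : prj S b (inj S a s) = 0 := by
  cases a <;> cases b <;> first | rfl | exact absurd rfl h

/-- The complex linear extension of a continuous linear map. -/
def cxMap {S T : Type*} [AddCommGroup S] [Module ℝ S] [TopologicalSpace S]
    [AddCommGroup T] [Module ℝ T] [TopologicalSpace T] (ℓ : S →L[ℝ] T) : Cx S →L[ℝ] Cx T :=
  ℓ.prodMap ℓ

theorem cxMap_mulI {S T : Type*} [AddCommGroup S] [Module ℝ S] [TopologicalSpace S]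
    [AddCommGroup T] [Module ℝ T] [TopologicalSpace T] (ℓ : S →L[ℝ] T) (w : Cx S) :
    cxMap ℓ (mulICx S w) = mulICx T (cxMap ℓ w) := by
  simp [cxMap]

/-- The vector field along the factor `a` of the doubled space that depends on the variable in the
factor `b` only, through the vector field `Y`. -/
def fld (a b : Bool) (Y : SVec S₀ S₁) : SVec (S₀ × S₀) (S₁ × S₁) where
  ev n φ o := cxMap (inj S₀ a) (pull (prj S₀ b) (prj S₁ b) Y.ev n φ o)
  od n φ o := cxMap (inj S₁ a) (pull (prj S₀ b) (prj S₁ b) Y.od n φ o)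

theorem RegV.fld {Y : SVec S₀ S₁} (hY : RegV Y) (a b : Bool) : RegV (fld a b Y) :=
  ⟨(hY.ev.pull (prj S₀ b) (prj S₁ b)).clm _, (hY.od.pull (prj S₀ b) (prj S₁ b)).clm _⟩

theorem HasParity.fld {ε : ℤˣ} {Y : SVec S₀ S₁} (h : HasParity ε Y) (a b : Bool) :
    HasParity ε (fld a b Y) where
  ev n φ o := by
    simp only [ClassicalBV.fld, pull, ← map_zsmul, h.ev]
  od n φ o := by
    simp only [ClassicalBV.fld, pull, ← map_zsmul, h.od]

theorem vcontract_pull_fld {W : Type*} [AddCommGroup W] [Module ℝ W] [TopologicalSpace W] [LCTVS W]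
    (J : W →ₗ[ℝ] W) (X : SFun S₀ S₁ W) (Q : SVec S₀ S₁) (b : Bool) :
    vcontract J (pull (prj S₀ b) (prj S₁ b) X) (fld b b Q) =
      pull (prj S₀ b) (prj S₁ b) (vcontract J X Q) := by
  funext p φ o
  refine vcontract_comp J (prj S₀ b).toLinearMap (prj S₁ b).toLinearMap X ?_ ?_
  · intro r v _; exact ⟨prj_inj_self b _, prj_inj_self b _⟩
  · intro r v _; exact ⟨prj_inj_self b _, prj_inj_self b _⟩

theorem vcontract_pull_fld_ne {W : Type*} [AddCommGroup W] [Module ℝ W] [TopologicalSpace W]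
    [LCTVS W] (J : W →ₗ[ℝ] W) {X : SFun S₀ S₁ W} (hX : Reg X) (Q : SVec S₀ S₁) {a b : Bool} (c : Bool)
    (h : a ≠ b) : vcontract J (pull (prj S₀ b) (prj S₁ b) X) (fld a c Q) = 0 := by
  funext p φ o
  have := vcontract_comp J (prj S₀ b).toLinearMap (prj S₁ b).toLinearMap X (Y := ⟨0, 0⟩)
    (Z := fld a c Q) (φ := φ) (o := o)
    (fun r v _ => ⟨prj_inj_ne h _, prj_inj_ne h _⟩) (fun r v _ => ⟨prj_inj_ne h _, prj_inj_ne h _⟩)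
  rw [vcontract_zero_right J hX rfl rfl] at this
  exact this

theorem actV_fld_ne {Y : SVec S₀ S₁} (hY : RegV Y) (Q : SVec S₀ S₁) {a b : Bool} (c e : Bool)
    (h : a ≠ b) : (actV (fld a c Q) (fld e b Y)).ev = 0 ∧ (actV (fld a c Q) (fld e b Y)).od = 0 := by
  constructor <;> funext p φ o
  · refine (vcontract_map (cxMap (inj S₀ e)) (cxMap_mulI _) (hY.ev.pull (prj S₀ b) (prj S₁ b))
      (fld a c Q) p φ o).trans ?_
    rw [vcontract_pull_fld_ne _ hY.ev Q c h]
    exact map_zero _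
  · refine (vcontract_map (cxMap (inj S₁ e)) (cxMap_mulI _) (hY.od.pull (prj S₀ b) (prj S₁ b))
      (fld a c Q) p φ o).trans ?_
    rw [vcontract_pull_fld_ne _ hY.od Q c h]
    exact map_zero _

theorem actV_fld_self {Y : SVec S₀ S₁} (hY : RegV Y) (Q : SVec S₀ S₁) (b e : Bool) :
    (actV (fld b b Q) (fld e b Y)).ev = (fld e b (actV Q Y)).ev ∧
      (actV (fld b b Q) (fld e b Y)).od = (fld e b (actV Q Y)).od := by
  constructor <;> funext p φ o
  · refine (vcontract_map (cxMap (inj S₀ e)) (cxMap_mulI _) (hY.ev.pull (prj S₀ b) (prj S₁ b))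
      (fld b b Q) p φ o).trans ?_
    rw [vcontract_pull_fld]; rfl
  · refine (vcontract_map (cxMap (inj S₁ e)) (cxMap_mulI _) (hY.od.pull (prj S₀ b) (prj S₁ b))
      (fld b b Q) p φ o).trans ?_
    rw [vcontract_pull_fld]; rfl

/-- The odd linear vector field with components `ℓ₁` (even, linear in the odd variable) and `ℓ₀`
(odd, linear in the even variable). -/
def linV (ℓ₀ : S₀ →L[ℝ] Cx S₁) (ℓ₁ : S₁ →L[ℝ] Cx S₀) : SVec S₀ S₁ := ⟨linOd ℓ₁, linEv ℓ₀⟩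

/-- A linear vector field applied to the components of a vector field. -/
def linComp (ℓ₀ : S₀ →L[ℝ] Cx S₁) (ℓ₁ : S₁ →L[ℝ] Cx S₀) (Y : SVec S₀ S₁) : SVec S₀ S₁ :=
  ⟨fun n φ o => extendC ℓ₁ (Y.od n φ o), fun n φ o => extendC ℓ₀ (Y.ev n φ o)⟩

theorem RegV.linV (ℓ₀ : S₀ →L[ℝ] Cx S₁) (ℓ₁ : S₁ →L[ℝ] Cx S₀) : RegV (linV ℓ₀ ℓ₁) :=
  ⟨Reg.linOd ℓ₁, Reg.linEv ℓ₀⟩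

/-- The complex linear extension of a continuous real linear map, as a continuous linear map. -/
def extendCL {S T : Type*} [AddCommGroup S] [Module ℝ S] [TopologicalSpace S]
    [AddCommGroup T] [Module ℝ T] [TopologicalSpace T] [LCTVS T] (ℓ : S →L[ℝ] Cx T) :
    Cx S →L[ℝ] Cx T :=
  ℓ.comp (ContinuousLinearMap.fst ℝ S S) +
    ((⟨mulICx T, continuous_mulICx⟩ : Cx T →L[ℝ] Cx T).comp ℓ).comp (ContinuousLinearMap.snd ℝ S S)

theorem extendCL_apply {S T : Type*} [AddCommGroup S] [Module ℝ S] [TopologicalSpace S]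
    [AddCommGroup T] [Module ℝ T] [TopologicalSpace T] [LCTVS T] (ℓ : S →L[ℝ] Cx T) (w : Cx S) :
    extendCL ℓ w = extendC ℓ w := rfl

theorem extendCL_mulI {S T : Type*} [AddCommGroup S] [Module ℝ S] [TopologicalSpace S]
    [AddCommGroup T] [Module ℝ T] [TopologicalSpace T] [LCTVS T] (ℓ : S →L[ℝ] Cx T) (w : Cx S) :
    extendCL ℓ (mulICx S w) = mulICx T (extendCL ℓ w) := by
  simp only [extendCL_apply, extendC, mulICx_apply, mulI, map_neg]
  ext <;> simp [add_comm]

theorem RegV.linComp (ℓ₀ : S₀ →L[ℝ] Cx S₁) (ℓ₁ : S₁ →L[ℝ] Cx S₀) {Y : SVec S₀ S₁} (hY : RegV Y) :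
    RegV (linComp ℓ₀ ℓ₁ Y) :=
  ⟨hY.od.clm (extendCL ℓ₁), hY.ev.clm (extendCL ℓ₀)⟩

theorem actV_linV (ℓ₀ : S₀ →L[ℝ] Cx S₁) (ℓ₁ : S₁ →L[ℝ] Cx S₀) {Y : SVec S₀ S₁} (hY : RegV Y) :
    (actV (fld false true Y) (fld false false (linV ℓ₀ ℓ₁))).ev =
        (fld false true (linComp ℓ₀ ℓ₁ Y)).ev ∧
      (actV (fld false true Y) (fld false false (linV ℓ₀ ℓ₁))).od =
        (fld false true (linComp ℓ₀ ℓ₁ Y)).od := by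
  have h1 : (fld false false (linV ℓ₀ ℓ₁)).ev =
      linOd ((cxMap (inj S₀ false)).comp (ℓ₁.comp (prj S₁ false))) := by
    funext n φ o
    rcases n with _ | _ | n
    · exact map_zero _
    · rfl
    · exact map_zero _
  have h2 : (fld false false (linV ℓ₀ ℓ₁)).od =
      linEv ((cxMap (inj S₁ false)).comp (ℓ₀.comp (prj S₀ false))) := by
    funext n φ o
    rcases n with _ | n
    · rfl
    · exact map_zero _
  constructor <;> funext p φ o
  · rw [actV, h1]
    refine (vcontract_linOd _ _ p (hY.fld false true).altV φ o).trans ?_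
    show cxMap (inj S₀ false) _ + mulICx _ (cxMap (inj S₀ false) _) = cxMap (inj S₀ false) (_ + _)
    rw [← cxMap_mulI, ← map_add]
    rfl
  · rw [actV, h2]
    refine (vcontract_linEv _ _ p (hY.fld false true).altV φ o).trans ?_
    show cxMap (inj S₁ false) _ + mulICx _ (cxMap (inj S₁ false) _) = cxMap (inj S₁ false) (_ + _)
    rw [← cxMap_mulI, ← map_add]
    rfl

/-- The restriction of a series to the diagonal of the doubled space. -/
def diag (X : FSeries (S₀ × S₀) (S₁ × S₁) ℂ) : FSeries S₀ S₁ ℂ := fun n p φ o =>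
  X n p (φ, φ) fun i => (o i, o i)

theorem diag_mem {X : FSeries (S₀ × S₀) (S₁ × S₁) ℂ} (hX : X ∈ regSeries (S₀ × S₀) (S₁ × S₁)) :
    diag X ∈ regSeries S₀ S₁ := fun n =>
  (hX n).pull ((ContinuousLinearMap.id ℝ S₀).prod (ContinuousLinearMap.id ℝ S₀))
    ((ContinuousLinearMap.id ℝ S₁).prod (ContinuousLinearMap.id ℝ S₁))

theorem liftFst_mem {X : FSeries S₀ S₁ ℂ} (hX : X ∈ regSeries S₀ S₁) :
    liftFst X ∈ regSeries (S₀ × S₀) (S₁ × S₁) := fun n =>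
  (hX n).pull (prj S₀ false) (prj S₁ false)

/-- The restriction to the diagonal intertwines a vector field `Q` with every vector field on the
doubled space that agrees with `(Q, Q)` on the diagonal. -/
theorem vcontract_diag (X : FSeries (S₀ × S₀) (S₁ × S₁) ℂ) (i : ℕ) {Q : SVec S₀ S₁}
    {Z : SVec (S₀ × S₀) (S₁ × S₁)}
    (hev : ∀ r φ (v : Fin r → S₁), Z.ev r (φ, φ) (fun i => (v i, v i)) =
      (((Q.ev r φ v).1, (Q.ev r φ v).1), ((Q.ev r φ v).2, (Q.ev r φ v).2)))
    (hod : ∀ r φ (v : Fin r → S₁), Z.od r (φ, φ) (fun i => (v i, v i)) =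
      (((Q.od r φ v).1, (Q.od r φ v).1), ((Q.od r φ v).2, (Q.od r φ v).2)))
    (p : ℕ) (φ : S₀) (o : Fin p → S₁) :
    vcontract mulIℂ (diag X i) Q p φ o =
      vcontract mulIℂ (X i) Z p (φ, φ) fun i => (o i, o i) := by
  have h := vcontract_comp (T₀ := S₀) (T₁ := S₁) mulIℂ (LinearMap.prod LinearMap.id LinearMap.id)
    (LinearMap.prod LinearMap.id LinearMap.id) (X i) (Y := Z) (Z := Q) (p := p) (φ := φ) (o := o)
    (fun r v _ => ⟨(congrArg Prod.fst (hev r φ v)).symm, (congrArg Prod.snd (hev r φ v)).symm⟩)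
    (fun r v _ => ⟨(congrArg Prod.fst (hod r φ v)).symm, (congrArg Prod.snd (hod r φ v)).symm⟩)
  exact h

/-- Contractions at a point of the diagonal depend only on the restriction of the vector field to
the diagonal. -/
theorem vcontract_congr_diag (X : SFun (S₀ × S₀) (S₁ × S₁) ℂ) {Y Z : SVec (S₀ × S₀) (S₁ × S₁)}
    (hev : ∀ r φ (v : Fin r → S₁), Y.ev r (φ, φ) (fun i => (v i, v i)) =
      Z.ev r (φ, φ) (fun i => (v i, v i)))
    (hod : ∀ r φ (v : Fin r → S₁), Y.od r (φ, φ) (fun i => (v i, v i)) =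
      Z.od r (φ, φ) (fun i => (v i, v i)))
    (p : ℕ) (φ : S₀) (o : Fin p → S₁) :
    vcontract mulIℂ X Y p (φ, φ) (fun i => (o i, o i)) =
      vcontract mulIℂ X Z p (φ, φ) fun i => (o i, o i) := by
  have hd : ∀ (r : ℕ) (v : Fin r → S₁ × S₁), (∀ i, v i ∈ Set.range fun i => (o i, o i)) →
      v = fun i => ((v i).1, (v i).1) := by
    intro r v hv
    funext i
    obtain ⟨j, hj⟩ := hv i
    simp only [← hj]
  refine vcontract_comp mulIℂ LinearMap.id LinearMap.id X ?_ ?_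
  · intro r v hv
    rw [hd r v hv]
    have := hev r φ fun i => (v i).1
    exact ⟨congrArg Prod.fst this, congrArg Prod.snd this⟩
  · intro r v hv
    rw [hd r v hv]
    have := hod r φ fun i => (v i).1
    exact ⟨congrArg Prod.fst this, congrArg Prod.snd this⟩

end Doubled

/-! ### Substitution in formal power series -/

/-- A map of sequences whose `n`-th value differs from the `n`-th argument by a function of the
previous arguments is bijective. -/
theorem bijOn_of_causal {A : Type*} [AddCommGroup A] (P : AddSubgroup A) (T : (ℕ → A) → ℕ → A)
    (hT : ∀ X, (∀ k, X k ∈ P) → ∀ k, T X k ∈ P)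
    (hc : ∀ X X', (∀ k, X k ∈ P) → (∀ k, X' k ∈ P) → ∀ n, (∀ k < n, X k = X' k) →
      T X n - X n = T X' n - X' n) :
    Set.BijOn T {X | ∀ k, X k ∈ P} {X | ∀ k, X k ∈ P} := by
  refine ⟨hT, ?_, ?_⟩
  · intro X hX X' hX' h
    funext n
    induction n using Nat.strong_induction_on with
    | _ n ih =>
      have := hc X X' hX hX' n ih
      rw [h] at this
      exact sub_right_injective this
  · intro Z hZ
    -- The fixed point iteration for `X = Z - (T X - X)` becomes stationary in each order.
    let it : ℕ → ℕ → A := fun j => Nat.rec Z (fun _ Y n => Z n - (T Y n - Y n)) j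
    have it_succ : ∀ j n, it (j + 1) n = Z n - (T (it j) n - it j n) := fun j n => rfl
    have hit : ∀ j k, it j k ∈ P := by
      intro j
      induction j with
      | zero => exact hZ
      | succ j ih => exact fun k => P.sub_mem (hZ k) (P.sub_mem (hT _ ih k) (ih k))
    have h1 : ∀ j n, n < j → it (j + 1) n = it j n := by
      intro j
      induction j with
      | zero => intro n hn; omega
      | succ j ih =>
        intro n hn
        rw [it_succ (j + 1), it_succ j, hc (it (j + 1)) (it j) (hit (j + 1)) (hit j) n
          fun k hk => ih k (by omega)]
    have h2 : ∀ i n, it (n + 1 + i) n = it (n + 1) n := by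
      intro i
      induction i with
      | zero => intro n; rfl
      | succ i ih => intro n; rw [← add_assoc, h1 _ _ (by omega), ih]
    refine ⟨fun n => it (n + 1) n, fun n => hit (n + 1) n, ?_⟩
    funext n
    have h3 := hc (fun n => it (n + 1) n) (it n) (fun n => hit (n + 1) n) (hit n) n fun k hk => by
      obtain ⟨i, rfl⟩ : ∃ i, n = k + 1 + i := ⟨n - (k + 1), by omega⟩
      exact (h2 i k).symm
    have h4 := it_succ n n
    rw [← h3] at h4
    have h5 : T (fun n => it (n + 1) n) n = Z n := by
      rw [eq_sub_iff_add_eq] at h4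
      simpa using h4
    exact h5

section Series

variable {S₀ S₁ : Type u} [AddCommGroup S₀] [Module ℝ S₀] [TopologicalSpace S₀]
  [LCTVS S₀] [AddCommGroup S₁] [Module ℝ S₁] [TopologicalSpace S₁] [LCTVS S₁]

/-- A contraction with vector fields of order `λ` raises the order in `λ`. -/
theorem ctr_pow_eq_zero {Y : ℕ → SVec S₀ S₁} (hY : ∀ k, RegV (Y k)) (h0 : Y 0 = ⟨0, 0⟩)
    {X : regSeries S₀ S₁} {n : ℕ} (hX : ∀ k < n, X.1 k = 0) (m : ℕ) :
    ∀ k < n + m, ((ctr Y hY ^ m) X).1 k = 0 := by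
  induction m with
  | zero => simpa using hX
  | succ m ih =>
    intro k hk
    rw [pow_succ']
    show (ctr Y hY ((ctr Y hY ^ m) X)).1 k = 0
    rw [ctr_apply]
    refine Finset.sum_eq_zero fun x hx => ?_
    rw [Finset.HasAntidiagonal.mem_antidiagonal] at hx
    obtain ⟨a, b⟩ := x
    rcases b with _ | b
    · dsimp only
      rw [h0]
      exact vcontract_zero_right mulIℂ (((ctr Y hY ^ m) X).2 a) rfl rfl
    · dsimp only at hx ⊢
      rw [ih a (by omega), vcontract_zero_left]

theorem coe_sum_apply {ι : Type*} (s : Finset ι) (f : ι → regSeries S₀ S₁) (n : ℕ) :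
    (∑ i ∈ s, f i).1 n = ∑ i ∈ s, (f i).1 n := by
  rw [← Finset.sum_apply n s fun i => (f i).1]
  exact congrFun (map_sum (regSeries S₀ S₁).subtype f s) n

theorem texp_apply (T : Module.End ℝ (regSeries S₀ S₁)) (M : ℕ) (X : regSeries S₀ S₁) (n : ℕ) :
    (texp T M X).1 n = ∑ m ∈ Finset.range M, ((m.factorial : ℝ))⁻¹ • ((T ^ m) X).1 n := by
  rw [texp, LinearMap.sum_apply, coe_sum_apply]
  rfl

theorem texp_apply_eq {Y : ℕ → SVec S₀ S₁} (hY : ∀ k, RegV (Y k)) (h0 : Y 0 = ⟨0, 0⟩)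
    (X : regSeries S₀ S₁) {n M : ℕ} (hM : n + 1 ≤ M) :
    (texp (ctr Y hY) M X).1 n = (texp (ctr Y hY) (n + 1) X).1 n := by
  obtain ⟨i, rfl⟩ := Nat.exists_eq_add_of_le hM
  rw [texp_apply, texp_apply, Finset.sum_range_add, add_eq_left]
  refine Finset.sum_eq_zero fun m _ => ?_
  rw [ctr_pow_eq_zero hY h0 (n := 0) (fun k hk => absurd hk (by omega)) _ n (by omega), smul_zero]

theorem fld_zero (a b : Bool) : fld a b (⟨0, 0⟩ : SVec S₀ S₁) = ⟨0, 0⟩ := by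
  simp only [fld, SVec.mk.injEq]
  constructor <;> funext n φ o <;> exact map_zero _

theorem translate_eq {η : ℕ → SVec S₀ S₁} (hη : ∀ k, RegV (η k)) (h0 : η 0 = ⟨0, 0⟩)
    {X : FSeries S₀ S₁ ℂ} (hX : X ∈ regSeries S₀ S₁) {n M : ℕ} (hM : n + 1 ≤ M) :
    translate η X n = diag (texp (ctr (fun k => fld false true (η k)) fun k => (hη k).fld _ _) M
      ⟨liftFst X, liftFst_mem hX⟩).1 n := by
  have h0' : fld false true (η 0) = ⟨0, 0⟩ := by rw [h0, fld_zero]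
  funext p φ o
  show _ = ((texp (ctr (fun k => fld false true (η k)) fun k => (hη k).fld _ _) M)
    ⟨liftFst X, liftFst_mem hX⟩).1 n p (φ, φ) fun i => (o i, o i)
  rw [texp_apply_eq (fun k => (hη k).fld _ _) h0' _ hM, texp_apply]
  simp only [Finset.sum_apply]
  refine Finset.sum_congr rfl fun m _ => ?_
  have h : ∀ m, ((fun Z => contractSeries Z fun k => frozen (η k))^[m] (liftFst X)) =
      ((ctr (fun k => fld false true (η k)) (fun k => (hη k).fld _ _) ^ m)
        ⟨liftFst X, liftFst_mem hX⟩).1 := by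
    intro m
    induction m with
    | zero => rfl
    | succ m ih => rw [Function.iterate_succ_apply', ih, pow_succ']; rfl
  rw [h]
  simp only [Pi.smul_apply]
  rw [Complex.real_smul, Complex.ofReal_inv, Complex.ofReal_natCast]

theorem translate_mem {η : ℕ → SVec S₀ S₁} (hη : ∀ k, RegV (η k)) (h0 : η 0 = ⟨0, 0⟩)
    {X : FSeries S₀ S₁ ℂ} (hX : X ∈ regSeries S₀ S₁) : translate η X ∈ regSeries S₀ S₁ := fun n => by
  rw [translate_eq hη h0 hX le_rfl]
  exact diag_mem (Subtype.prop _) n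

theorem bijOn_translate {η : ℕ → SVec S₀ S₁} (hη : ∀ k, RegV (η k)) (h0 : η 0 = ⟨0, 0⟩) :
    Set.BijOn (translate η) (regSeries S₀ S₁) (regSeries S₀ S₁) := by
  refine bijOn_of_causal
    ⟨⟨⟨{X : SFun S₀ S₁ ℂ | Reg X}, fun h h' => h.add h'⟩, Reg.zero⟩, fun h => h.neg⟩ (translate η)
    (fun X hX => translate_mem hη h0 hX) ?_
  intro X X' hX hX' n h
  have h0' : fld false true (η 0) = ⟨0, 0⟩ := by rw [h0, fld_zero]
  rw [translate_eq hη h0 hX le_rfl, translate_eq hη h0 hX' le_rfl]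
  set D : regSeries (S₀ × S₀) (S₁ × S₁) :=
    (⟨liftFst X, liftFst_mem hX⟩ : regSeries (S₀ × S₀) (S₁ × S₁)) - ⟨liftFst X', liftFst_mem hX'⟩ with hD
  have hD0 : ∀ k < n, D.1 k = 0 := by
    intro k hk
    funext p φ o
    show X k p _ _ - X' k p _ _ = 0
    rw [h k hk, sub_self]
  set T := texp (ctr (fun k => fld false true (η k)) fun k => (hη k).fld _ _) (n + 1) with hT
  have hTD : (T D).1 n = D.1 n := by
    rw [hT, texp_apply, Finset.sum_range_succ', Finset.sum_eq_zero]
    · simp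
    · intro m _
      rw [ctr_pow_eq_zero _ h0' hD0 (m + 1) n (by omega), smul_zero]
  rw [hD, map_sub] at hTD
  funext p φ o
  have := congrFun (congrFun (congrFun hTD p) (φ, φ)) fun i => (o i, o i)
  have h1 : (T ⟨liftFst X, liftFst_mem hX⟩).1 n p (φ, φ) (fun i => (o i, o i)) -
      (T ⟨liftFst X', liftFst_mem hX'⟩).1 n p (φ, φ) (fun i => (o i, o i)) =
      X n p φ o - X' n p φ o := this
  show (T ⟨liftFst X, liftFst_mem hX⟩).1 n p (φ, φ) (fun i => (o i, o i)) - X n p φ o =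
    (T ⟨liftFst X', liftFst_mem hX'⟩).1 n p (φ, φ) (fun i => (o i, o i)) - X' n p φ o
  linear_combination h1

theorem RegV.zero : RegV (⟨0, 0⟩ : SVec S₀ S₁) := ⟨Reg.zero, Reg.zero⟩

theorem ctr_zero {Y : ℕ → SVec S₀ S₁} (hY : ∀ k, RegV (Y k)) (h : ∀ k, (Y k).ev = 0 ∧ (Y k).od = 0) :
    ctr Y hY = 0 := by
  ext1 X
  ext1
  funext n
  rw [ctr_apply]
  exact Finset.sum_eq_zero fun x _ => vcontract_zero_right mulIℂ (X.2 _) (h _).1 (h _).2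

theorem ctr_fld_liftFst {X : FSeries S₀ S₁ ℂ} (hX : X ∈ regSeries S₀ S₁) {Q : ℕ → SVec S₀ S₁}
    (hQ : ∀ k, RegV (Q k)) : ctr (fun k => fld true true (Q k)) (fun k => (hQ k).fld _ _)
      ⟨liftFst X, liftFst_mem hX⟩ = 0 := by
  ext1; funext k
  rw [ctr_apply]
  refine Finset.sum_eq_zero fun x _ => ?_
  have h : true ≠ false := by decide
  exact vcontract_pull_fld_ne (a := true) (b := false) mulIℂ (hX x.1) (Q x.2) true h

theorem liftFst_contractSeries {X : FSeries S₀ S₁ ℂ} (hX : X ∈ regSeries S₀ S₁) {L : ℕ → SVec S₀ S₁}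
    (hL : ∀ k, RegV (L k)) :
    (⟨liftFst (contractSeries X L), liftFst_mem (contractSeries_mem hX hL)⟩ :
      regSeries (S₀ × S₀) (S₁ × S₁)) = ctr (fun k => fld false false (L k))
        (fun k => (hL k).fld _ _) ⟨liftFst X, liftFst_mem hX⟩ := by
  ext1; funext k
  rw [ctr_apply]
  show pull (prj S₀ false) (prj S₁ false) (contractSeries X L k) = _
  rw [contractSeries_eq]
  funext p φ o
  simp only [pull, Finset.sum_apply]
  refine Finset.sum_congr rfl fun x _ => ?_
  have := vcontract_pull_fld mulIℂ (X x.1) (L x.2) false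
  exact (congrFun (congrFun (congrFun this p) φ) o).symm

/-- The evaluation of a coefficient at a point of the diagonal of the doubled space. -/
def evDiag (n p : ℕ) (φ : S₀) (o : Fin p → S₁) : regSeries (S₀ × S₀) (S₁ × S₁) →ₗ[ℝ] ℂ where
  toFun Z := Z.1 n p (φ, φ) fun i => (o i, o i)
  map_add' Z Z' := by
    rw [Submodule.coe_add, Pi.add_apply, Pi.add_apply, Pi.add_apply, Pi.add_apply]
  map_smul' c Z := by
    rw [Submodule.coe_smul, Pi.smul_apply, Pi.smul_apply, Pi.smul_apply, Pi.smul_apply]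
    rfl

theorem evDiag_apply (n p : ℕ) (φ : S₀) (o : Fin p → S₁) (Z : regSeries (S₀ × S₀) (S₁ × S₁)) :
    evDiag n p φ o Z = Z.1 n p (φ, φ) fun i => (o i, o i) := rfl

set_option maxHeartbeats 1000000 in
/-- The substitution `z ↦ z + η(z)` intertwines the linear vector field `L` with the vector field
`Q`, provided that `Q` maps `z + η(z)` to `L(z + η(z))`, i.e. `Q + Q(η) = L + L ∘ η`. -/
theorem contractSeries_translate {η Q L : ℕ → SVec S₀ S₁} (hη : ∀ k, RegV (η k))
    (hp : ∀ k, HasParity 1 (η k)) (h0 : η 0 = ⟨0, 0⟩) (hQ : ∀ k, RegV (Q k))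
    (ℓ₀ : S₀ →L[ℝ] Cx S₁) (ℓ₁ : S₁ →L[ℝ] Cx S₀) (hL0 : L 0 = linV ℓ₀ ℓ₁)
    (hLs : ∀ k, L (k + 1) = ⟨0, 0⟩)
    (hev : ∀ n, (Q n).ev + ∑ x ∈ Finset.HasAntidiagonal.antidiagonal n, (actV (Q x.1) (η x.2)).ev =
      (L n).ev + (linComp ℓ₀ ℓ₁ (η n)).ev)
    (hod : ∀ n, (Q n).od + ∑ x ∈ Finset.HasAntidiagonal.antidiagonal n, (actV (Q x.1) (η x.2)).od =
      (L n).od + (linComp ℓ₀ ℓ₁ (η n)).od)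
    {X : FSeries S₀ S₁ ℂ} (hX : X ∈ regSeries S₀ S₁) :
    contractSeries (translate η X) Q = translate η (contractSeries X L) := by
  have hL : ∀ k, RegV (L k) := by
    rintro (_ | k)
    · rw [hL0]; exact RegV.linV ℓ₀ ℓ₁
    · rw [hLs]; exact RegV.zero
  -- the derivative of `η` along `Q`
  set P : ℕ → SVec S₀ S₁ := fun n =>
    ⟨∑ x ∈ Finset.HasAntidiagonal.antidiagonal n, (actV (Q x.1) (η x.2)).ev,
      ∑ x ∈ Finset.HasAntidiagonal.antidiagonal n, (actV (Q x.1) (η x.2)).od⟩ with hPdef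
  have hP : ∀ k, RegV (P k) := fun k =>
    ⟨Reg.sum (Finset.HasAntidiagonal.antidiagonal k) fun x _ => ((hQ x.1).actV (hη x.2)).ev,
      Reg.sum (Finset.HasAntidiagonal.antidiagonal k) fun x _ => ((hQ x.1).actV (hη x.2)).od⟩
  have hN : ∀ k, RegV (linComp ℓ₀ ℓ₁ (η k)) := fun k => (hη k).linComp ℓ₀ ℓ₁
  -- On the doubled space, `fld i j Y` moves the factor `i` with the coefficients of `Y` at the factor
  -- `j` (`false` for the first factor). The displacement `E` moves the first factor with coefficients
  -- at the second, so the substitution is `exp E` followed by the restriction to the diagonal.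
  set E := ctr (fun k => fld false true (η k)) (fun k => (hη k).fld _ _) with hE
  -- Fields that move the first factor with coefficients at the second commute.
  have frozen_comm : ∀ {Y : ℕ → SVec S₀ S₁} (hY : ∀ k, RegV (Y k)),
      Commute E (ctr (fun k => fld false true (Y k)) fun k => (hY k).fld _ _) := by
    intro Y hY
    have := ctr_mul_ctr (R := fun _ => ⟨0, 0⟩) (R' := fun _ => ⟨0, 0⟩)
      (fun k => (hη k).fld false true) (fun k => (hY k).fld false true) (fun _ => RegV.zero)
      (fun _ => RegV.zero) (fun k => (hp k).fld _ _)
      (fun b => ⟨(Finset.sum_eq_zero fun x _ => (actV_fld_ne (hY _) _ _ _ (by decide)).1).symm,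
        (Finset.sum_eq_zero fun x _ => (actV_fld_ne (hY _) _ _ _ (by decide)).2).symm⟩)
      (fun b => ⟨(Finset.sum_eq_zero fun x _ => (actV_fld_ne (hη _) _ _ _ (by decide)).1).symm,
        (Finset.sum_eq_zero fun x _ => (actV_fld_ne (hη _) _ _ _ (by decide)).2).symm⟩)
    rw [ctr_zero (Y := fun _ => ⟨0, 0⟩) _ fun _ => ⟨rfl, rfl⟩, add_zero, add_zero] at this
    exact this
  -- On the diagonal, `Q` acts as `A + B`, and `L₁` and `L₂` agree. The commutators of `E` with `B`
  -- and `L₁` are `R`, from the derivative of `η` along `Q`, and `N`, from `L ∘ η`.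
  set A := ctr (fun k => fld false true (Q k)) (fun k => (hQ k).fld _ _) with hA
  set B := ctr (fun k => fld true true (Q k)) (fun k => (hQ k).fld _ _) with hB
  set L₁ := ctr (fun k => fld false false (L k)) (fun k => (hL k).fld _ _) with hL₁
  set L₂ := ctr (fun k => fld false true (L k)) (fun k => (hL k).fld _ _) with hL₂
  set R := ctr (fun k => fld false true (P k)) (fun k => (hP k).fld _ _) with hR
  set N := ctr (fun k => fld false true (linComp ℓ₀ ℓ₁ (η k))) (fun k => (hN k).fld _ _) with hNN
  -- the hypothesis `Q + Q(η) = L + L ∘ η`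
  have hsum : A + R = L₂ + N := by
    refine ctr_add _ _ _ _ (fun k => ?_) fun k => ?_
    · funext p φ o
      have := congrFun (congrFun (congrFun (hev k) p) φ.2) fun i => (o i).2
      show cxMap (inj S₀ false) ((Q k).ev _ _ _) + cxMap (inj S₀ false) ((P k).ev _ _ _) =
        cxMap (inj S₀ false) ((L k).ev _ _ _) + cxMap (inj S₀ false) ((linComp ℓ₀ ℓ₁ (η k)).ev _ _ _)
      rw [← map_add, ← map_add]
      exact congrArg _ this
    · funext p φ o
      have := congrFun (congrFun (congrFun (hod k) p) φ.2) fun i => (o i).2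
      show cxMap (inj S₁ false) ((Q k).od _ _ _) + cxMap (inj S₁ false) ((P k).od _ _ _) =
        cxMap (inj S₁ false) ((L k).od _ _ _) + cxMap (inj S₁ false) ((linComp ℓ₀ ℓ₁ (η k)).od _ _ _)
      rw [← map_add, ← map_add]
      exact congrArg _ this
  have hBE : B * E = E * B + R := by
    have := ctr_mul_ctr (R := fun _ => ⟨0, 0⟩) (R' := fun k => fld false true (P k))
      (fun k => (hη k).fld false true) (fun k => (hQ k).fld true true) (fun _ => RegV.zero)
      (fun k => (hP k).fld _ _) (fun k => (hp k).fld _ _)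
      (fun b => ⟨(Finset.sum_eq_zero fun x _ => (actV_fld_ne (hQ _) _ _ _ (by decide)).1).symm,
        (Finset.sum_eq_zero fun x _ => (actV_fld_ne (hQ _) _ _ _ (by decide)).2).symm⟩)
      (fun b => by
        constructor
        · rw [Finset.sum_congr rfl fun x _ => (actV_fld_self (hη x.2) (Q x.1) true false).1]
          funext p φ o
          simp only [Finset.sum_apply, fld, pull, hPdef, map_sum]
        · rw [Finset.sum_congr rfl fun x _ => (actV_fld_self (hη x.2) (Q x.1) true false).2]
          funext p φ o
          simp only [Finset.sum_apply, fld, pull, hPdef, map_sum])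
    rw [ctr_zero (Y := fun _ => ⟨0, 0⟩) _ fun _ => ⟨rfl, rfl⟩, add_zero] at this
    exact this.symm
  have hLE : E * L₁ = L₁ * E + N := by
    have hz : ∀ k, (fld false false (L (k + 1))) = ⟨0, 0⟩ := fun k => by rw [hLs, fld_zero]
    have hs : ∀ b, ∀ x ∈ Finset.HasAntidiagonal.antidiagonal b, x ≠ (0, b) →
        (actV (fld false true (η x.2)) (fld false false (L x.1))).ev = 0 ∧
        (actV (fld false true (η x.2)) (fld false false (L x.1))).od = 0 := by
      rintro b ⟨i, j⟩ hx hne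
      rw [Finset.HasAntidiagonal.mem_antidiagonal] at hx
      rcases i with _ | i
      · exact absurd (by simpa using hx) (fun h : j = b => hne (by rw [h]))
      · dsimp only
        rw [hz]
        exact ⟨vcontract_zero_left _ _, vcontract_zero_left _ _⟩
    have hm : ∀ b, (0, b) ∈ Finset.HasAntidiagonal.antidiagonal b := fun b => by
      rw [Finset.HasAntidiagonal.mem_antidiagonal, zero_add]
    have := ctr_mul_ctr (R := fun k => fld false true (linComp ℓ₀ ℓ₁ (η k))) (R' := fun _ => ⟨0, 0⟩)
      (fun k => (hη k).fld false true) (fun k => (hL k).fld false false) (fun k => (hN k).fld _ _)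
      (fun _ => RegV.zero) (fun k => (hp k).fld _ _)
      (fun b => by
        rw [Finset.sum_eq_single (0, b) (fun x hx hne => (hs b x hx hne).1) fun h => absurd (hm b) h,
          Finset.sum_eq_single (0, b) (fun x hx hne => (hs b x hx hne).2) fun h => absurd (hm b) h]
        dsimp only
        rw [hL0]
        exact ⟨(actV_linV ℓ₀ ℓ₁ (hη b)).1.symm, (actV_linV ℓ₀ ℓ₁ (hη b)).2.symm⟩)
      (fun b => ⟨(Finset.sum_eq_zero fun x _ => (actV_fld_ne (hη _) _ _ _ (by decide)).1).symm,
        (Finset.sum_eq_zero fun x _ => (actV_fld_ne (hη _) _ _ _ (by decide)).2).symm⟩)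
    rw [ctr_zero (Y := fun _ => ⟨0, 0⟩) _ fun _ => ⟨rfl, rfl⟩, add_zero] at this
    exact this
  have h0' : fld false true (η 0) = ⟨0, 0⟩ := by rw [h0, fld_zero]
  funext n p φ o
  set lX : regSeries (S₀ × S₀) (S₁ × S₁) := ⟨liftFst X, liftFst_mem hX⟩ with hlX
  -- Terms of degree above `n` in `E` are of order above `n` in `λ`, so `exp E` may be truncated; one
  -- more term is kept because a commutator lowers the degree by one.
  set W := texp E (n + 2) lX with hW
  set ev := evDiag (S₀ := S₀) (S₁ := S₁) n p φ o with hevd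
  have hBX : B lX = 0 := ctr_fld_liftFst hX hQ
  have hLX : (⟨liftFst (contractSeries X L), liftFst_mem (contractSeries_mem hX hL)⟩ :
      regSeries (S₀ × S₀) (S₁ × S₁)) = L₁ lX := liftFst_contractSeries hX hL
  have hl : contractSeries (translate η X) Q n p φ o = ev (A W) + ev (B W) := by
    rw [hevd, evDiag_apply, evDiag_apply, contractSeries_eq, hA, hB, ctr_apply, ctr_apply]
    simp only [Finset.sum_apply]
    rw [← Finset.sum_add_distrib]
    refine Finset.sum_congr rfl fun x hx => ?_
    rw [Finset.HasAntidiagonal.mem_antidiagonal] at hx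
    have h1 : translate η X x.1 = diag W.1 x.1 := translate_eq hη h0 hX (by omega)
    rw [h1, vcontract_diag W.1 x.1 (Q := Q x.2)
      (Z := ⟨(fld false true (Q x.2)).ev + (fld true true (Q x.2)).ev,
        (fld false true (Q x.2)).od + (fld true true (Q x.2)).od⟩)
      (fun r φ v => by
        show (((_, 0), (_, 0)) : Cx (S₀ × S₀)) + ((0, _), (0, _)) = _
        simp only [Prod.mk_add_mk, add_zero, zero_add]; rfl)
      (fun r φ v => by
        show (((_, 0), (_, 0)) : Cx (S₁ × S₁)) + ((0, _), (0, _)) = _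
        simp only [Prod.mk_add_mk, add_zero, zero_add]; rfl) p φ o,
      vcontract_add_right mulIℂ (W.2 x.1) rfl rfl]
    rfl
  have hr : translate η (contractSeries X L) n p φ o = ev (texp E (n + 2) (L₁ lX)) := by
    rw [translate_eq hη h0 (contractSeries_mem hX hL) (M := n + 2) (by omega), ← hLX, hevd, evDiag_apply]
    rfl
  have hd : ev (L₁ W) = ev (L₂ W) := by
    rw [hevd, evDiag_apply, evDiag_apply, hL₁, hL₂, ctr_apply, ctr_apply]
    simp only [Finset.sum_apply]
    exact Finset.sum_congr rfl fun x _ =>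
      vcontract_congr_diag (W.1 x.1) (fun r φ v => rfl) (fun r φ v => rfl) p φ o
  have ht : ∀ Z, ev (texp E (n + 2) Z) = ev (texp E (n + 1) Z) := fun Z => by
    have := texp_apply_eq (fun k => (hη k).fld false true) h0' Z (show n + 1 ≤ n + 2 by omega)
    rw [hevd, evDiag_apply, evDiag_apply, this]
  have e1' : A * texp E (n + 2) = texp E (n + 2) * A := commute_texp (frozen_comm hQ) (n + 2)
  have e1 : A W = texp E (n + 2) (A lX) := LinearMap.congr_fun e1' lX
  have e2 : B W = texp E (n + 1) (R lX) := by
    have h1 : B * texp E (n + 1 + 1) = texp E (n + 1 + 1) * B + texp E (n + 1) * R :=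
      mul_texp hBE (frozen_comm hP) (n + 1)
    have h2 : B W = texp E (n + 2) (B lX) + texp E (n + 1) (R lX) := LinearMap.congr_fun h1 lX
    rw [h2, hBX, map_zero, zero_add]
  have e3' : L₁ * texp E (n + 1 + 1) + texp E (n + 1) * N = texp E (n + 1 + 1) * L₁ :=
    mul_texp_of_eq hLE (frozen_comm hN) (n + 1)
  have e3 : L₁ W + texp E (n + 1) (N lX) = texp E (n + 2) (L₁ lX) := LinearMap.congr_fun e3' lX
  have e4' : L₂ * texp E (n + 2) = texp E (n + 2) * L₂ := commute_texp (frozen_comm hL) (n + 2)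
  have e4 : L₂ W = texp E (n + 2) (L₂ lX) := LinearMap.congr_fun e4' lX
  have e5 : A lX + R lX = L₂ lX + N lX := LinearMap.congr_fun hsum lX
  have e6 : ev (texp E (n + 1) (A lX)) + ev (texp E (n + 1) (R lX)) =
      ev (texp E (n + 1) (L₂ lX)) + ev (texp E (n + 1) (N lX)) := by
    rw [← map_add, ← map_add, ← map_add, ← map_add, e5]
  rw [e4, ht (L₂ lX)] at hd
  rw [hl, hr, ← e3, map_add, e1, e2, ht (A lX), e6, hd]

end Series

/-! ### The locally convex space of sections -/

section Sections

variable {d : ℕ} {M : Type*} [TopologicalSpace M] [ChartedSpace (EuclideanSpace ℝ (Fin d)) M]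
  [IsManifold (𝓡 d) ∞ M]
  {F : Type*} [NormedAddCommGroup F] [NormedSpace ℝ F]
  {B : M → Type*} [TopologicalSpace (TotalSpace F B)] [∀ x, TopologicalSpace (B x)]
  [FiberBundle F B] [∀ x, AddCommGroup (B x)] [∀ x, Module ℝ (B x)] [VectorBundle ℝ F B]
  [ContMDiffVectorBundle ∞ F B (𝓡 d)]

theorem isOpen_chartDomain (p : M) : IsOpen (chartDomain d F B p) :=
  (continuousOn_extChartAt_symm p).isOpen_inter_preimage (isOpen_extChartAt_target p)
    (trivializationAt F B p).open_baseSet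

theorem contDiffOn_localRep (p : M) (s : Sec d F B) :
    ContDiffOn ℝ ∞ (localRep p s) (chartDomain d F B p) := by
  rw [← contMDiffOn_iff_contDiffOn]
  have h1 : ContMDiffOn (𝓡 d) 𝓘(ℝ, F) ∞ (fun x => (trivializationAt F B p ⟨x, s x⟩).2)
      (trivializationAt F B p).baseSet :=
    (Trivialization.contMDiffOn_section_baseSet_iff _).1 s.contMDiff.contMDiffOn
  exact h1.comp ((contMDiffOn_extChartAt_symm p).mono inter_subset_left) fun y hy => hy.2

theorem localRep_eq_linearMapAt (p : M) (s : Sec d F B) {y : EuclideanSpace ℝ (Fin d)}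
    (hy : y ∈ chartDomain d F B p) : localRep p s y =
      (trivializationAt F B p).linearMapAt ℝ ((extChartAt (𝓡 d) p).symm y)
        (s ((extChartAt (𝓡 d) p).symm y)) := by
  rw [Trivialization.coe_linearMapAt_of_mem _ hy.2]; rfl

theorem localRep_congr (p : M) {s s' : Sec d F B} {y : EuclideanSpace ℝ (Fin d)}
    (h : s ((extChartAt (𝓡 d) p).symm y) = s' ((extChartAt (𝓡 d) p).symm y)) :
    localRep p s y = localRep p s' y := by
  rw [localRep, localRep, h]

/-- The `k`-th derivative of the coordinate expression near `p`, as a linear map into the space of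
continuous functions. -/
def jetMap (p : M) (k : ℕ) : Sec d F B →ₗ[ℝ]
    C(chartDomain d F B p, ContinuousMultilinearMap ℝ (fun _ : Fin k => EuclideanSpace ℝ (Fin d)) F) where
  toFun s := ⟨fun y => iteratedFDeriv ℝ k (localRep p s) y.1, by
    have h := (contDiffOn_localRep p s).continuousOn_iteratedFDerivWithin
      (m := k) (by exact_mod_cast le_top) (isOpen_chartDomain p).uniqueDiffOn
    refine (continuousOn_iff_continuous_domRestrict.1 (h.congr fun y hy => ?_))
    exact (iteratedFDerivWithin_of_isOpen k (isOpen_chartDomain p) hy).symm⟩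
  map_add' s s' := by
    ext1 y
    show iteratedFDeriv ℝ k (localRep p (s + s')) y.1 =
      iteratedFDeriv ℝ k (localRep p s) y.1 + iteratedFDeriv ℝ k (localRep p s') y.1
    have hs := (contDiffOn_localRep p s).contDiffAt ((isOpen_chartDomain p).mem_nhds y.2)
    have hs' := (contDiffOn_localRep p s').contDiffAt ((isOpen_chartDomain p).mem_nhds y.2)
    have hk : ((k : ℕ∞) : WithTop ℕ∞) ≤ ∞ := by exact_mod_cast le_top
    rw [← iteratedFDeriv_add_apply (hs.of_le hk) (hs'.of_le hk)]
    refine (Filter.EventuallyEq.iteratedFDeriv ℝ ?_ k).eq_of_nhds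
    filter_upwards [(isOpen_chartDomain p).mem_nhds y.2] with z hz
    rw [Pi.add_apply, localRep_eq_linearMapAt p _ hz, localRep_eq_linearMapAt p _ hz,
      localRep_eq_linearMapAt p _ hz, ← map_add]
    rfl
  map_smul' c s := by
    ext1 y
    show iteratedFDeriv ℝ k (localRep p (c • s)) y.1 = c • iteratedFDeriv ℝ k (localRep p s) y.1
    have hs := (contDiffOn_localRep p s).contDiffAt ((isOpen_chartDomain p).mem_nhds y.2)
    have hk : ((k : ℕ∞) : WithTop ℕ∞) ≤ ∞ := by exact_mod_cast le_top
    rw [← iteratedFDeriv_const_smul_apply (hs.of_le hk)]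
    refine (Filter.EventuallyEq.iteratedFDeriv ℝ ?_ k).eq_of_nhds
    filter_upwards [(isOpen_chartDomain p).mem_nhds y.2] with z hz
    rw [Pi.smul_apply, localRep_eq_linearMapAt p _ hz, localRep_eq_linearMapAt p _ hz, ← map_smul]
    rfl

theorem sectionTopology_eq : (sectionTopology : TopologicalSpace (Sec d F B)) =
    ⨅ (p : M) (k : ℕ), TopologicalSpace.induced (jetMap p k) inferInstance := by
  unfold sectionTopology
  refine iInf_congr fun p => iInf_congr fun k => ?_
  have h := (ContinuousMap.isUniformEmbedding_toUniformOnFunIsCompact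
    (α := chartDomain d F B p)
    (β := ContinuousMultilinearMap ℝ (fun _ : Fin k => EuclideanSpace ℝ (Fin d)) F)).isInducing.eq_induced
  exact (induced_compose (f := jetMap p k)).symm.trans (congrArg _ h.symm)

theorem continuous_jetMap (p : M) (k : ℕ) : Continuous (jetMap p k : Sec d F B → _) := by
  rw [continuous_iff_le_induced, sectionTopology_eq]
  exact (iInf_le _ p).trans (iInf_le _ k)

theorem extChartAt_mem_chartDomain {p x : M} (hx : x ∈ (extChartAt (𝓡 d) p).source)
    (hx' : x ∈ (trivializationAt F B p).baseSet) : extChartAt (𝓡 d) p x ∈ chartDomain d F B p :=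
  ⟨(extChartAt (𝓡 d) p).map_source hx, by
    rw [mem_preimage, (extChartAt (𝓡 d) p).left_inv hx]; exact hx'⟩

/-- The value of a section at a point, in the trivialization at a point. -/
theorem localRep_extChartAt {p x : M} (hx : x ∈ (extChartAt (𝓡 d) p).source) (s : Sec d F B) :
    localRep p s (extChartAt (𝓡 d) p x) = (trivializationAt F B p ⟨x, s x⟩).2 := by
  rw [localRep, (extChartAt (𝓡 d) p).left_inv hx]

theorem jetMap_zero_injective {s : Sec d F B} (h : ∀ p : M, jetMap p 0 s = 0) : s = 0 := by
  ext x
  have hx := mem_extChartAt_source (I := 𝓡 d) x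
  have hb := mem_baseSet_trivializationAt F B x
  have h1 := ContinuousMap.congr_fun (h x) ⟨_, extChartAt_mem_chartDomain hx hb⟩
  have h2 : localRep x s (extChartAt (𝓡 d) x x) = 0 := by
    have := congrArg (fun A => A 0) h1
    exact this
  rw [localRep_eq_linearMapAt x s (extChartAt_mem_chartDomain hx hb),
    (extChartAt (𝓡 d) x).left_inv hx] at h2
  have h3 := congrArg ((trivializationAt F B x).symmₗ ℝ x) h2
  rwa [Trivialization.symmₗ_linearMapAt _ hb, map_zero] at h3

instance instLCTVSSection : LCTVS (Sec d F B) := by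
  have e := sectionTopology_eq (d := d) (F := F) (B := B)
  have h1 : IsTopologicalAddGroup (Sec d F B) := by
    rw [e]
    exact topologicalAddGroup_iInf fun p => topologicalAddGroup_iInf fun k =>
      topologicalAddGroup_induced (jetMap p k)
  have h2 : ContinuousSMul ℝ (Sec d F B) := by
    rw [e]
    exact continuousSMul_iInf fun p => continuousSMul_iInf fun k => continuousSMul_induced (jetMap p k)
  have h3 : LocallyConvexSpace ℝ (Sec d F B) := by
    rw [e]
    exact LocallyConvexSpace.iInf fun p => LocallyConvexSpace.iInf fun k =>
      LocallyConvexSpace.induced (jetMap p k)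
  have h4 : T2Space (Sec d F B) := by
    refine T2Space.of_injective_continuous (f := fun s => fun p : M => jetMap p 0 s) ?_
      (continuous_pi fun p => continuous_jetMap p 0)
    intro s s' h
    rw [← sub_eq_zero]
    refine jetMap_zero_injective fun p => ?_
    rw [map_sub, sub_eq_zero]
    exact congrFun h p
  exact {}

/-- A net of sections converges if on every compact set it eventually agrees with the limit. -/
theorem tendsto_section_of_eventually_eq {ι : Type*} {l : Filter ι} {u : ι → Sec d F B} {s : Sec d F B}
    (h : ∀ K : Set M, IsCompact K → ∀ᶠ i in l, ∃ U, IsOpen U ∧ K ⊆ U ∧ ∀ x ∈ U, u i x = s x) :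
    Tendsto u l (𝓝 s) := by
  rw [sectionTopology_eq, nhds_iInf, tendsto_iInf]
  intro p
  rw [nhds_iInf, tendsto_iInf]
  intro k
  rw [nhds_induced, tendsto_comap_iff]
  rw [ContinuousMap.tendsto_iff_forall_isCompact_tendstoUniformlyOn]
  intro K hK
  have hc : ContinuousOn (extChartAt (𝓡 d) p).symm (chartDomain d F B p) :=
    (continuousOn_extChartAt_symm p).mono inter_subset_left
  have hK' : IsCompact ((fun y : chartDomain d F B p => (extChartAt (𝓡 d) p).symm y.1) '' K) :=
    hK.image (continuousOn_iff_continuous_domRestrict.1 hc)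
  rw [Metric.tendstoUniformlyOn_iff]
  intro ε hε
  -- equality near the image of `K` in the manifold gives equality of all jets on `K`
  filter_upwards [h _ hK'] with i hi y hy
  obtain ⟨U, hU, hKU, hUe⟩ := hi
  have : jetMap p k s y = jetMap p k (u i) y := by
    show iteratedFDeriv ℝ k (localRep p s) y.1 = iteratedFDeriv ℝ k (localRep p (u i)) y.1
    refine (Filter.EventuallyEq.iteratedFDeriv ℝ ?_ k).eq_of_nhds
    have ho := hc.isOpen_inter_preimage (isOpen_chartDomain p) hU
    filter_upwards [ho.mem_nhds ⟨y.2, hKU ⟨y, hy, rfl⟩⟩] with z hz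
    exact localRep_congr p (hUe _ hz.2).symm
  rw [Function.comp, this, dist_self]
  exact hε

end Sections

/-! ### Supports and cutoffs -/

section Supports

variable {d : ℕ} {M : Type*} [TopologicalSpace M] [ChartedSpace (EuclideanSpace ℝ (Fin d)) M]
  [IsManifold (𝓡 d) ∞ M]
  {F : Type*} [NormedAddCommGroup F] [NormedSpace ℝ F]
  {B : M → Type*} [TopologicalSpace (TotalSpace F B)] [∀ x, TopologicalSpace (B x)]
  [FiberBundle F B] [∀ x, AddCommGroup (B x)] [∀ x, Module ℝ (B x)] [VectorBundle ℝ F B]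
  [ContMDiffVectorBundle ∞ F B (𝓡 d)]

/-- The sections that vanish outside of `K`. For a closed set `K` these are the sections supported
in `K`. -/
def secIn (d : ℕ) {M : Type*} [TopologicalSpace M] [ChartedSpace (EuclideanSpace ℝ (Fin d)) M]
    (F : Type*) [NormedAddCommGroup F] [NormedSpace ℝ F]
    (B : M → Type*) [TopologicalSpace (TotalSpace F B)] [∀ x, TopologicalSpace (B x)]
    [FiberBundle F B] [∀ x, AddCommGroup (B x)] [∀ x, Module ℝ (B x)] [VectorBundle ℝ F B]
    (K : Set M) : Submodule ℝ (Sec d F B) where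
  carrier := {s | ∀ x ∉ K, s x = 0}
  zero_mem' _ _ := rfl
  add_mem' {s s'} hs hs' x hx := by
    show s x + s' x = 0
    rw [hs x hx, hs' x hx, add_zero]
  smul_mem' c s hs x hx := by
    show c • s x = 0
    rw [hs x hx, smul_zero]

theorem mem_secIn_iff {K : Set M} (hK : IsClosed K) {s : Sec d F B} :
    s ∈ secIn d F B K ↔ sSupport s ⊆ K := by
  rw [sSupport, hK.closure_subset_iff]
  exact ⟨fun h x hx => by_contra fun hxK => hx (h x hxK), fun h x hx => by_contra fun h' => hx (h h')⟩

theorem secIn_mono {K L : Set M} (h : K ⊆ L) : secIn d F B K ≤ secIn d F B L :=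
  fun _ hs x hx => hs x fun h' => hx (h h')

theorem isCompactlySupported_iff [T2Space M] {s : Sec d F B} :
    IsCompactlySupported s ↔ ∃ K, IsCompact K ∧ s ∈ secIn d F B K :=
  ⟨fun h => ⟨_, h, (mem_secIn_iff isClosed_closure).2 subset_rfl⟩,
    fun ⟨_, hK, hs⟩ => hK.of_isClosed_subset isClosed_closure ((mem_secIn_iff hK.isClosed).1 hs)⟩

theorem IsCompactlySupported.add [T2Space M] {s s' : Sec d F B} (h : IsCompactlySupported s)
    (h' : IsCompactlySupported s') : IsCompactlySupported (s + s') := by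
  obtain ⟨K, hK, hs⟩ := isCompactlySupported_iff.1 h
  obtain ⟨L, hL, hs'⟩ := isCompactlySupported_iff.1 h'
  exact isCompactlySupported_iff.2 ⟨K ∪ L, hK.union hL,
    add_mem (secIn_mono subset_union_left hs) (secIn_mono subset_union_right hs')⟩

theorem isCompactlySupported_zero [T2Space M] : IsCompactlySupported (0 : Sec d F B) :=
  isCompactlySupported_iff.2 ⟨∅, isCompact_empty, zero_mem _⟩

/-- A linear local operator only depends on the germ of its argument. -/
theorem IsLocalOp.eq_of_eqOn {F' : Type*} [NormedAddCommGroup F'] [NormedSpace ℝ F']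
    {B' : M → Type*} [TopologicalSpace (TotalSpace F' B')] [∀ x, TopologicalSpace (B' x)]
    [FiberBundle F' B'] [∀ x, AddCommGroup (B' x)] [∀ x, Module ℝ (B' x)] [VectorBundle ℝ F' B']
    [ContMDiffVectorBundle ∞ F' B' (𝓡 d)]
    {A : Sec d F B →L[ℝ] Cx (Sec d F' B')} (hA : IsLocalOp A) {U : Set M} (hU : IsOpen U)
    {s s' : Sec d F B} (h : ∀ x ∈ U, s x = s' x) {x : M} (hx : x ∈ U) :
    (A s).1 x = (A s').1 x ∧ (A s).2 x = (A s').2 x := by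
  have h1 : s - s' ∈ secIn d F B Uᶜ := fun y hy => by
    show s y - s' y = 0
    rw [h y (not_not.1 hy), sub_self]
  have h2 := (mem_secIn_iff hU.isClosed_compl).1 h1
  have h3 := hA (s - s')
  rw [map_sub] at h3
  have h4 := (mem_secIn_iff hU.isClosed_compl).2 (h3.1.trans h2) x (not_not.2 hx)
  have h5 := (mem_secIn_iff hU.isClosed_compl).2 (h3.2.trans h2) x (not_not.2 hx)
  exact ⟨sub_eq_zero.1 h4, sub_eq_zero.1 h5⟩

theorem IsLocalOp.mem_secIn {F' : Type*} [NormedAddCommGroup F'] [NormedSpace ℝ F']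
    {B' : M → Type*} [TopologicalSpace (TotalSpace F' B')] [∀ x, TopologicalSpace (B' x)]
    [FiberBundle F' B'] [∀ x, AddCommGroup (B' x)] [∀ x, Module ℝ (B' x)] [VectorBundle ℝ F' B']
    [ContMDiffVectorBundle ∞ F' B' (𝓡 d)]
    {A : Sec d F B → Cx (Sec d F' B')} (hA : IsLocalOp A) {K : Set M} (hK : IsClosed K)
    {s : Sec d F B} (h : s ∈ secIn d F B K) :
    (A s).1 ∈ secIn d F' B' K ∧ (A s).2 ∈ secIn d F' B' K := by
  have h1 := (mem_secIn_iff hK).1 h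
  exact ⟨(mem_secIn_iff hK).2 ((hA s).1.trans h1), (mem_secIn_iff hK).2 ((hA s).2.trans h1)⟩

/-- Evaluation of a section at a point, in a local trivialization. -/
def evalAt (x : M) : Sec d F B →L[ℝ] F where
  toFun s := (trivializationAt F B x).linearMapAt ℝ x (s x)
  map_add' s s' := map_add _ _ _
  map_smul' c s := map_smul _ _ _
  cont := by
    have hx := mem_extChartAt_source (I := 𝓡 d) x
    have hb := mem_baseSet_trivializationAt F B x
    have h := (continuous_eval_const (F := C(chartDomain d F B x, _))
      ⟨_, extChartAt_mem_chartDomain hx hb⟩).comp (continuous_jetMap (F := F) (B := B) x 0)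
    refine ((continuous_eval_const (F := ContinuousMultilinearMap ℝ _ F) 0).comp h).congr fun s => ?_
    show localRep x s (extChartAt (𝓡 d) x x) = _
    rw [localRep_eq_linearMapAt x s (extChartAt_mem_chartDomain hx hb),
      (extChartAt (𝓡 d) x).left_inv hx]

theorem evalAt_eq_zero {x : M} {s : Sec d F B} : evalAt x s = 0 ↔ s x = 0 := by
  have hb := mem_baseSet_trivializationAt F B x
  constructor
  · intro h
    have h3 := congrArg ((trivializationAt F B x).symmₗ ℝ x) h
    rw [map_zero] at h3
    rwa [← Trivialization.symmₗ_linearMapAt (R := ℝ) (trivializationAt F B x) hb (s x)]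
  · intro h
    show (trivializationAt F B x).linearMapAt ℝ x (s x) = 0
    rw [h, map_zero]

theorem isClosed_secIn (K : Set M) : IsClosed (secIn d F B K : Set (Sec d F B)) := by
  have : (secIn d F B K : Set (Sec d F B)) = ⋂ x ∈ Kᶜ, {s | evalAt x s = 0} := by
    ext s
    simp only [mem_iInter, mem_ofPred_eq, evalAt_eq_zero]
    rfl
  rw [this]
  exact isClosed_biInter fun x _ => isClosed_eq (evalAt x).continuous continuous_const

/-- The product of a function and a section. -/
def mulSec (χ : C^∞⟮𝓡 d, M; 𝓘(ℝ, ℝ), ℝ⟯) (s : Sec d F B) : Sec d F B :=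
  ⟨fun x => χ x • s x, χ.contMDiff.smul_section s.contMDiff⟩

variable [T2Space M] [SecondCountableTopology M]

theorem exists_cutoff {K : Set M} (hK : IsCompact K) :
    ∃ χ : C^∞⟮𝓡 d, M; 𝓘(ℝ, ℝ), ℝ⟯, ∃ L, IsCompact L ∧ (∀ x ∉ L, χ x = 0) ∧
      ∃ U, IsOpen U ∧ K ⊆ U ∧ ∀ x ∈ U, χ x = 1 := by
  have := ChartedSpace.locallyCompactSpace (EuclideanSpace ℝ (Fin d)) M
  obtain ⟨L, hL, hKL⟩ := exists_compact_superset hK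
  obtain ⟨χ, h1, h0, -⟩ := exists_contMDiffMap_one_nhds_of_subset_interior (𝓡 d) (n := (⊤ : ℕ∞))
    hK.isClosed hKL
  obtain ⟨U, hU, hKU, hU1⟩ := eventually_nhdsSet_iff_exists.1 h1
  exact ⟨χ, L, hL, h0, U, hU, hKU, hU1⟩

/-- Every section agrees with a compactly supported one near a given compact set. -/
theorem exists_compact_eqOn {K : Set M} (hK : IsCompact K) (s : Sec d F B) :
    ∃ s' : Sec d F B, IsCompactlySupported s' ∧ ∃ U, IsOpen U ∧ K ⊆ U ∧ ∀ x ∈ U, s' x = s x := by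
  obtain ⟨χ, L, hL, h0, U, hU, hKU, h1⟩ := exists_cutoff (d := d) hK
  refine ⟨mulSec χ s, isCompactlySupported_iff.2 ⟨L, hL, fun x hx => ?_⟩, U, hU, hKU, fun x hx => ?_⟩
  · show χ x • s x = 0
    rw [h0 x hx, zero_smul]
  · show χ x • s x = s x
    rw [h1 x hx, one_smul]

theorem dense_compactlySupported : Dense {s : Sec d F B | IsCompactlySupported s} := by
  have := ChartedSpace.locallyCompactSpace (EuclideanSpace ℝ (Fin d)) M
  intro s
  let E := CompactExhaustion.choice M
  choose u hu U hU hKU he using fun n => exists_compact_eqOn (E.isCompact n) s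
  refine mem_closure_of_tendsto (tendsto_section_of_eventually_eq (u := u) (l := atTop) fun K hK => ?_)
    (Eventually.of_forall hu)
  obtain ⟨n, hn⟩ := E.exists_superset_of_isCompact hK
  filter_upwards [eventually_ge_atTop n] with m hm
  exact ⟨U m, hU m, hn.trans ((E.subset hm).trans (hKU m)), he m⟩

/-- Compactly supported sections take arbitrary values at a given point. -/
theorem exists_section_eq (x : M) (v : B x) :
    ∃ s : Sec d F B, IsCompactlySupported s ∧ s x = v := by
  have := ChartedSpace.locallyCompactSpace (EuclideanSpace ℝ (Fin d)) M
  obtain ⟨t, ht, hs⟩ := FiberBundle.exists_contMDiffOn_extend (k := ∞) (𝓡 d) F v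
  obtain ⟨L, hL, hxL, hLt⟩ := exists_compact_subset isOpen_interior (mem_interior_iff_mem_nhds.2 ht)
  obtain ⟨χ, h1, h0, -⟩ := exists_contMDiffMap_one_nhds_of_subset_interior (𝓡 d) (n := (⊤ : ℕ∞))
    (isClosed_singleton (x := x)) (singleton_subset_iff.2 hxL)
  have hsupp : tsupport χ ⊆ L := closure_minimal
    (fun y hy => by_contra fun hyL => hy (h0 y hyL)) hL.isClosed
  refine ⟨⟨(χ : M → ℝ) • FiberBundle.extend F v, ContMDiffOn.smul_section_of_tsupport χ.contMDiff.contMDiffOn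
    isOpen_interior (hsupp.trans hLt) (hs.mono interior_subset)⟩,
    isCompactlySupported_iff.2 ⟨L, hL, fun y hy => ?_⟩, ?_⟩
  · show χ y • FiberBundle.extend F v y = 0
    rw [h0 y hy, zero_smul]
  · show χ x • FiberBundle.extend F v x = v
    rw [h1.self_of_nhdsSet x rfl, one_smul, FiberBundle.extend_apply_self]

end Supports

/-! ### The pairing of sections with sections of the dual bundle -/

section Eval

variable {d : ℕ} {M : Type*} [TopologicalSpace M] [ChartedSpace (EuclideanSpace ℝ (Fin d)) M]
  [IsManifold (𝓡 d) ∞ M]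
  {F : Type*} [NormedAddCommGroup F] [NormedSpace ℝ F]
  {B : M → Type*} [TopologicalSpace (TotalSpace F B)] [∀ x, TopologicalSpace (B x)]
  [FiberBundle F B] [∀ x, AddCommGroup (B x)] [∀ x, Module ℝ (B x)] [VectorBundle ℝ F B]
  [ContMDiffVectorBundle ∞ F B (𝓡 d)]

/-- In a local trivialization, the evaluation of sections is jointly continuous. -/
theorem continuousOn_eval (p : M) :
    ContinuousOn (fun q : Sec d F B × M => (trivializationAt F B p ⟨q.2, q.1 q.2⟩).2)
      (univ ×ˢ ((extChartAt (𝓡 d) p).source ∩ (trivializationAt F B p).baseSet)) := by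
  have hl : LocallyCompactSpace (chartDomain d F B p) :=
    (isOpen_chartDomain p).locallyCompactSpace
  rw [continuousOn_iff_continuous_domRestrict]
  set S := (univ : Set (Sec d F B)) ×ˢ
    ((extChartAt (𝓡 d) p).source ∩ (trivializationAt F B p).baseSet)
  have h1 : Continuous fun q : S => jetMap p 0 q.1.1 :=
    (continuous_jetMap p 0).comp (continuous_fst.comp continuous_subtype_val)
  have h2 : Continuous fun q : S => extChartAt (𝓡 d) p q.1.2 :=
    (continuousOn_extChartAt p).comp_continuous (continuous_snd.comp continuous_subtype_val)
      fun q => q.2.2.1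
  have h3 : Continuous fun q : S => (⟨extChartAt (𝓡 d) p q.1.2,
      extChartAt_mem_chartDomain q.2.2.1 q.2.2.2⟩ : chartDomain d F B p) := h2.subtype_mk _
  refine ((continuous_eval_const (F := ContinuousMultilinearMap ℝ _ F) 0).comp
    (h1.eval h3)).congr fun q => ?_
  exact localRep_extChartAt q.2.2.1 q.1.1

variable [∀ x, IsTopologicalAddGroup (B x)] [∀ x, ContinuousSMul ℝ (B x)]

theorem trivialization_dual_apply {p x : M} (hx : x ∈ (trivializationAt F B p).baseSet)
    (ξ : B x →L[ℝ] ℝ) (v : B x) :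
    (trivializationAt (F →L[ℝ] ℝ) (fun x => B x →L[ℝ] ℝ) p ⟨x, ξ⟩).2
      (trivializationAt F B p ⟨x, v⟩).2 = ξ v := by
  rw [hom_trivializationAt_apply]
  show ContinuousLinearMap.inCoordinates F B ℝ (fun _ => ℝ) p x p x ξ _ = _
  rw [ContinuousLinearMap.inCoordinates_eq hx (mem_univ _)]
  have : (trivializationAt F B p ⟨x, v⟩).2 =
    Trivialization.continuousLinearEquivAt ℝ (trivializationAt F B p) x hx v := rfl
  rw [this]
  simp [Trivialization.symm_apply_apply_mk _ hx]

theorem mem_baseSet_dual {p x : M} (hx : x ∈ (trivializationAt F B p).baseSet) :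
    x ∈ (trivializationAt (F →L[ℝ] ℝ) (fun x => B x →L[ℝ] ℝ) p).baseSet := by
  rw [hom_trivializationAt_baseSet]
  exact ⟨hx, mem_univ _⟩

/-- The pointwise pairing is jointly continuous. -/
theorem continuous_fiberPair :
    Continuous fun q : (CoSec d F B × Sec d F B) × M => q.1.1 q.2 (q.1.2 q.2) := by
  rw [continuous_iff_continuousAt]
  rintro ⟨⟨ξ, u⟩, p⟩
  set W := (extChartAt (𝓡 d) p).source ∩ (trivializationAt F B p).baseSet
  have hW : IsOpen W := (isOpen_extChartAt_source p).inter (trivializationAt F B p).open_baseSet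
  have hp : p ∈ W := ⟨mem_extChartAt_source p, mem_baseSet_trivializationAt F B p⟩
  have hS : IsOpen ((univ : Set (CoSec d F B × Sec d F B)) ×ˢ W) := isOpen_univ.prod hW
  refine ContinuousOn.continuousAt (s := univ ×ˢ W) ?_ (hS.mem_nhds ⟨mem_univ _, hp⟩)
  have h1 := (continuousOn_eval (d := d) (F := F) (B := B) p).comp
    (f := fun q : (CoSec d F B × Sec d F B) × M => (q.1.2, q.2)) (s := univ ×ˢ W)
    (by fun_prop) fun q hq => ⟨mem_univ _, hq.2⟩
  have h2 := (continuousOn_eval (d := d) (F := F →L[ℝ] ℝ) (B := fun x => B x →L[ℝ] ℝ) p).comp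
    (f := fun q : (CoSec d F B × Sec d F B) × M => (q.1.1, q.2)) (s := univ ×ˢ W)
    (by fun_prop) fun q hq => ⟨mem_univ _, hq.2.1, mem_baseSet_dual hq.2.2⟩
  refine (h2.clm_apply h1).congr fun q hq => ?_
  exact (trivialization_dual_apply hq.2.2 _ _).symm

theorem contMDiff_fiberPair (ξ : CoSec d F B) (u : Sec d F B) :
    ContMDiff (𝓡 d) 𝓘(ℝ, ℝ) ∞ fun x => ξ x (u x) := by
  have h : ContMDiff (𝓡 d) ((𝓡 d).prod 𝓘(ℝ, ℝ)) ∞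
      fun x => TotalSpace.mk' ℝ (E := fun _ : M => ℝ) x (ξ x (u x)) :=
    ContMDiff.clm_bundle_apply ξ.contMDiff u.contMDiff
  intro x
  exact (Bundle.contMDiffAt_section (F := ℝ) (E := fun _ : M => ℝ) x).1 (h x)

variable [MeasurableSpace M] (μ : Measure M)

/-- The pairing of a real covector field and a real field. -/
def rpair (ξ : CoSec d F B) (u : Sec d F B) : ℝ := ∫ x, ξ x (u x) ∂μ

variable {μ}

theorem rpair_eq_setIntegral {L : Set M} {ξ : CoSec d F B} {u : Sec d F B}
    (h : ξ ∈ secIn d _ _ L ∨ u ∈ secIn d F B L) : rpair μ ξ u = ∫ x in L, ξ x (u x) ∂μ := by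
  refine (setIntegral_eq_integral_of_forall_compl_eq_zero fun x hx => ?_).symm
  rcases h with h | h
  · rw [h x hx]; rfl
  · rw [h x hx, map_zero]

variable [T2Space M] [BorelSpace M] [IsFiniteMeasureOnCompacts μ]

theorem continuous_setIntegral_fiberPair {L : Set M} (hL : IsCompact L) :
    Continuous fun q : CoSec d F B × Sec d F B => ∫ x in L, q.1 x (q.2 x) ∂μ := by
  let f : CoSec d F B × Sec d F B → C(M, ℝ) := fun q =>
    ⟨fun x => q.1 x (q.2 x), continuous_fiberPair.comp (Continuous.prodMk_right q)⟩
  have hf : Continuous f := ContinuousMap.continuous_of_continuous_uncurry f continuous_fiberPair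
  rw [continuous_iff_continuousAt]
  intro q
  have h1 := (ContinuousMap.tendsto_iff_forall_isCompact_tendstoUniformlyOn.1
    (hf.continuousAt (x := q)) L hL)
  rw [Metric.tendstoUniformlyOn_iff] at h1
  rw [ContinuousAt, Metric.tendsto_nhds]
  intro ε hε
  have hi : ∀ q, IntegrableOn (f q) L μ := fun q => (f q).continuous.continuousOn.integrableOn_compact hL
  set C := μ.real L + 1
  have hC : 0 < C := add_pos_of_nonneg_of_pos measureReal_nonneg one_pos
  filter_upwards [h1 (ε / C) (div_pos hε hC)] with r hr
  rw [dist_eq_norm]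
  have e : (∫ x in L, r.1 x (r.2 x) ∂μ) - ∫ x in L, q.1 x (q.2 x) ∂μ =
      ∫ x in L, (f r x - f q x) ∂μ := (integral_sub (hi r) (hi q)).symm
  rw [e]
  refine (norm_setIntegral_le_of_norm_le_const (hL.measure_lt_top) (C := ε / C) fun x hx => ?_).trans_lt ?_
  · rw [← dist_eq_norm, dist_comm]
    exact (hr x hx).le
  · rw [div_mul_eq_mul_div, div_lt_iff₀ hC]
    exact mul_lt_mul_of_pos_left (lt_add_one _) hε

theorem hasCompactSupport_fiberPair {ξ : CoSec d F B} {u : Sec d F B}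
    (h : IsCompactlySupported ξ ∨ IsCompactlySupported u) :
    HasCompactSupport fun x => ξ x (u x) := by
  rcases h with h | h
  · obtain ⟨K, hK, hs⟩ := isCompactlySupported_iff.1 h
    exact HasCompactSupport.intro hK fun x hx => by rw [hs x hx]; rfl
  · obtain ⟨K, hK, hs⟩ := isCompactlySupported_iff.1 h
    exact HasCompactSupport.intro hK fun x hx => by rw [hs x hx, map_zero]

theorem integrable_fiberPair {ξ : CoSec d F B} {u : Sec d F B}
    (h : IsCompactlySupported ξ ∨ IsCompactlySupported u) :
    Integrable (fun x => ξ x (u x)) μ :=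
  (contMDiff_fiberPair ξ u).continuous.integrable_of_hasCompactSupport (hasCompactSupport_fiberPair h)

theorem rpair_add_left {ξ ξ' : CoSec d F B} {u : Sec d F B}
    (h : (IsCompactlySupported ξ ∧ IsCompactlySupported ξ') ∨ IsCompactlySupported u) :
    rpair μ (ξ + ξ') u = rpair μ ξ u + rpair μ ξ' u :=
  integral_add (integrable_fiberPair (h.imp And.left id)) (integrable_fiberPair (h.imp And.right id))

theorem rpair_smul_left (c : ℝ) (ξ : CoSec d F B) (u : Sec d F B) :
    rpair μ (c • ξ) u = c * rpair μ ξ u :=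
  integral_const_mul c _

variable [SecondCountableTopology M] [μ.IsOpenPosMeasure]

theorem fiberPair_eq_zero {ξ : CoSec d F B} {u : Sec d F B}
    (h : IsCompactlySupported ξ ∨ IsCompactlySupported u)
    (h0 : ∫ x, ξ x (u x) * ξ x (u x) ∂μ = 0) (x : M) : ξ x (u x) = 0 := by
  by_contra hx
  have hc := (contMDiff_fiberPair ξ u).continuous
  have := (hc.mul hc).integral_pos_of_hasCompactSupport_nonneg_nonzero (μ := μ) (x := x)
    (hasCompactSupport_fiberPair h).mul_right (fun x => mul_self_nonneg _) (mul_self_ne_zero.2 hx)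
  exact this.ne' h0

/-- The pairing with compactly supported sections is nondegenerate on covector fields. -/
theorem eq_zero_of_rpair_left {ξ : CoSec d F B}
    (h : ∀ u : Sec d F B, IsCompactlySupported u → rpair μ ξ u = 0) : ξ = 0 := by
  ext x v
  obtain ⟨u, hu, rfl⟩ := exists_section_eq (d := d) (F := F) x v
  refine fiberPair_eq_zero (μ := μ) (Or.inr hu) ?_ x
  obtain ⟨K, hK, hs⟩ := isCompactlySupported_iff.1 hu
  -- test with the section `u` multiplied by the function `ξ(u)`
  have h1 := h (mulSec ⟨_, contMDiff_fiberPair ξ u⟩ u) (isCompactlySupported_iff.2 ⟨K, hK,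
    fun x hx => by show ξ x (u x) • u x = 0; rw [hs x hx, smul_zero]⟩)
  rw [← h1, rpair]
  refine integral_congr_ae (Eventually.of_forall fun x => ?_)
  exact (map_smul (ξ x) _ (u x)).symm

/-- The pairing with compactly supported covector fields is nondegenerate on fields. -/
theorem eq_zero_of_rpair_right {u : Sec d F B}
    (h : ∀ ξ : CoSec d F B, IsCompactlySupported ξ → rpair μ ξ u = 0) : u = 0 := by
  ext x
  have key : ∀ ℓ : B x →L[ℝ] ℝ, ℓ (u x) = 0 := by
    intro ℓ
    obtain ⟨ξ, hξ, rfl⟩ := exists_section_eq (d := d) (F := F →L[ℝ] ℝ)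
      (B := fun x => B x →L[ℝ] ℝ) x ℓ
    refine fiberPair_eq_zero (μ := μ) (Or.inl hξ) ?_ x
    obtain ⟨K, hK, hs⟩ := isCompactlySupported_iff.1 hξ
    have h1 := h (mulSec ⟨_, contMDiff_fiberPair ξ u⟩ ξ) (isCompactlySupported_iff.2 ⟨K, hK,
      fun x hx => by show ξ x (u x) • ξ x = 0; rw [hs x hx, smul_zero]⟩)
    rw [← h1, rpair]
    rfl
  have hx := mem_baseSet_trivializationAt F B x
  let e := Trivialization.continuousLinearEquivAt ℝ (trivializationAt F B x) x hx
  refine e.injective (Eq.trans ?_ (map_zero e).symm)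
  refine SeparatingDual.eq_zero_of_forall_dual_eq_zero (R := ℝ) fun f => ?_
  exact key (f ∘L (e : B x →L[ℝ] F))

end Eval

/-! ### Uniqueness for Green hyperbolic operators -/

section Pairing

variable {d : ℕ} {M : Type*} [TopologicalSpace M] [ChartedSpace (EuclideanSpace ℝ (Fin d)) M]
  [IsManifold (𝓡 d) ∞ M]
  {F : Type*} [NormedAddCommGroup F] [NormedSpace ℝ F]
  {B : M → Type*} [TopologicalSpace (TotalSpace F B)] [∀ x, TopologicalSpace (B x)]
  [FiberBundle F B] [∀ x, AddCommGroup (B x)] [∀ x, Module ℝ (B x)] [VectorBundle ℝ F B]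
  [ContMDiffVectorBundle ∞ F B (𝓡 d)]

/-- Complex sections with compact support. -/
def CxCompact (w : Cx (Sec d F B)) : Prop := IsCompactlySupported w.1 ∧ IsCompactlySupported w.2

theorem IsCompactlySupported.neg [T2Space M] {s : Sec d F B} (h : IsCompactlySupported s) :
    IsCompactlySupported (-s) := by
  obtain ⟨K, hK, hs⟩ := isCompactlySupported_iff.1 h
  exact isCompactlySupported_iff.2 ⟨K, hK, neg_mem hs⟩

theorem CxCompact.add [T2Space M] {w w' : Cx (Sec d F B)} (h : CxCompact w) (h' : CxCompact w') :
    CxCompact (w + w') := ⟨h.1.add h'.1, h.2.add h'.2⟩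

theorem CxCompact.mulI [T2Space M] {w : Cx (Sec d F B)} (h : CxCompact w) : CxCompact (mulI w) :=
  ⟨h.2.neg, h.1⟩

theorem sSupport_mono {s : Sec d F B} {K : Set M} (hK : IsClosed K) (h : ∀ x ∉ K, s x = 0) :
    sSupport s ⊆ K := (mem_secIn_iff hK).1 h

theorem eq_zero_of_notMem_sSupport {s : Sec d F B} {x : M} (hx : x ∉ sSupport s) : s x = 0 :=
  by_contra fun h => hx (subset_closure h)

theorem sSupport_add_subset (s s' : Sec d F B) : sSupport (s + s') ⊆ sSupport s ∪ sSupport s' :=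
  sSupport_mono (isClosed_closure.union isClosed_closure) fun x hx => by
    show s x + s' x = 0
    rw [eq_zero_of_notMem_sSupport fun h => hx (Or.inl h),
      eq_zero_of_notMem_sSupport fun h => hx (Or.inr h), add_zero]

theorem sSupport_neg_subset (s : Sec d F B) : sSupport (-s) ⊆ sSupport s :=
  sSupport_mono isClosed_closure fun x hx => by
    show -s x = 0
    rw [eq_zero_of_notMem_sSupport hx, neg_zero]

theorem IsLocalOp.cxCompact {F' : Type*} [NormedAddCommGroup F'] [NormedSpace ℝ F']
    {B' : M → Type*} [TopologicalSpace (TotalSpace F' B')] [∀ x, TopologicalSpace (B' x)]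
    [FiberBundle F' B'] [∀ x, AddCommGroup (B' x)] [∀ x, Module ℝ (B' x)] [VectorBundle ℝ F' B']
    [ContMDiffVectorBundle ∞ F' B' (𝓡 d)] [T2Space M]
    {A : Sec d F B → Cx (Sec d F' B')} (hA : IsLocalOp A) {s : Sec d F B}
    (h : IsCompactlySupported s) : CxCompact (A s) :=
  ⟨h.of_isClosed_subset isClosed_closure (hA s).1, h.of_isClosed_subset isClosed_closure (hA s).2⟩

theorem IsLocalOp.cxCompact_extendC {F' : Type*} [NormedAddCommGroup F'] [NormedSpace ℝ F']
    {B' : M → Type*} [TopologicalSpace (TotalSpace F' B')] [∀ x, TopologicalSpace (B' x)]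
    [FiberBundle F' B'] [∀ x, AddCommGroup (B' x)] [∀ x, Module ℝ (B' x)] [VectorBundle ℝ F' B']
    [ContMDiffVectorBundle ∞ F' B' (𝓡 d)] [T2Space M]
    {A : Sec d F B → Cx (Sec d F' B')} (hA : IsLocalOp A) {w : Cx (Sec d F B)}
    (h : CxCompact w) : CxCompact (extendC A w) :=
  (hA.cxCompact h.1).add (hA.cxCompact h.2).mulI

variable [∀ x, IsTopologicalAddGroup (B x)] [∀ x, ContinuousSMul ℝ (B x)]
  [MeasurableSpace M] [T2Space M] [BorelSpace M] {μ : Measure M} [IsFiniteMeasureOnCompacts μ]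

theorem pair_eq (ξ : Cx (CoSec d F B)) (u : Sec d F B) :
    pair μ ξ u = (rpair μ ξ.1 u : ℂ) + Complex.I * (rpair μ ξ.2 u : ℂ) := rfl

theorem copair_eq (ξ : CoSec d F B) (u : Cx (Sec d F B)) :
    copair μ ξ u = (rpair μ ξ u.1 : ℂ) + Complex.I * (rpair μ ξ u.2 : ℂ) := rfl

theorem rpair_neg_left (ξ : CoSec d F B) (u : Sec d F B) : rpair μ (-ξ) u = -rpair μ ξ u := by
  rw [← neg_one_smul ℝ ξ, rpair_smul_left, neg_one_mul]

theorem pair_mulI (ξ : Cx (CoSec d F B)) (u : Sec d F B) :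
    pair μ (mulI ξ) u = Complex.I * pair μ ξ u := by
  rw [pair_eq, pair_eq, mulI, rpair_neg_left]
  push_cast
  linear_combination -(rpair μ ξ.2 u : ℂ) * Complex.I_mul_I

theorem pair_add_left {ξ ξ' : Cx (CoSec d F B)} {u : Sec d F B}
    (h : (CxCompact ξ ∧ CxCompact ξ') ∨ IsCompactlySupported u) :
    pair μ (ξ + ξ') u = pair μ ξ u + pair μ ξ' u := by
  rw [pair_eq, pair_eq, pair_eq, Prod.fst_add, Prod.snd_add,
    rpair_add_left (h.imp_left fun h => ⟨h.1.1, h.2.1⟩),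
    rpair_add_left (h.imp_left fun h => ⟨h.1.2, h.2.2⟩)]
  push_cast
  ring

theorem pair_congr {ξ ξ' : Cx (CoSec d F B)} {u u' : Sec d F B}
    (h : ∀ x, ξ.1 x (u x) = ξ'.1 x (u' x) ∧ ξ.2 x (u x) = ξ'.2 x (u' x)) :
    pair μ ξ u = pair μ ξ' u' := by
  simp only [pair, h]

variable [SecondCountableTopology M]

/-- Formal (skew) symmetry extends to the case that only one of the arguments is compactly
supported. -/
theorem pair_symm_of_local {P : Sec d F B →L[ℝ] Cx (CoSec d F B)} (hP : IsLocalOp P) {ε : ℂ}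
    (hs : ∀ u v, IsCompactlySupported u → IsCompactlySupported v →
      pair μ (P u) v = ε * pair μ (P v) u)
    {u : Sec d F B} (hu : IsCompactlySupported u) (v : Sec d F B) :
    pair μ (P v) u = ε * pair μ (P u) v := by
  obtain ⟨v', hv', U, hU, hKU, he⟩ := exists_compact_eqOn hu v
  have h1 : pair μ (P v) u = pair μ (P v') u := pair_congr fun x => by
    by_cases hx : x ∈ sSupport u
    · have := hP.eq_of_eqOn hU he (hKU hx)
      rw [this.1, this.2]; exact ⟨rfl, rfl⟩
    · rw [eq_zero_of_notMem_sSupport hx, map_zero, map_zero, map_zero, map_zero]; exact ⟨rfl, rfl⟩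
  have h2 : pair μ (P u) v = pair μ (P u) v' := pair_congr fun x => by
    by_cases hx : x ∈ sSupport u
    · rw [he x (hKU hx)]; exact ⟨rfl, rfl⟩
    · rw [eq_zero_of_notMem_sSupport fun h => hx ((hP u).1 h),
        eq_zero_of_notMem_sSupport fun h => hx ((hP u).2 h)]; exact ⟨rfl, rfl⟩
  rw [h1, h2, hs v' u hv' hu]

variable [μ.IsOpenPosMeasure]

/-- A solution of `P u = 0` with support in the future of a compact set vanishes: pairing it with
`f = P Δᴬ f` and integrating by parts gives zero, as the supports of `u` and `Δᴬ f` have compact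
intersection. -/
theorem green_unique {Jp Jm : Set M → Set M}
    (hJ : ∀ K L, IsCompact K → IsCompact L → IsCompact (Jp K ∩ Jm L))
    {P : Sec d F B →L[ℝ] Cx (CoSec d F B)} (hP : IsLocalOp P) {ε : ℂ}
    (hs : ∀ u v, IsCompactlySupported u → IsCompactlySupported v →
      pair μ (P u) v = ε * pair μ (P v) u)
    {Δ : CoSec d F B → Cx (Sec d F B)} (hΔ : IsGreenOperator Jm P Δ)
    {K : Set M} (hK : IsCompact K) {u : Cx (Sec d F B)} (h1 : sSupport u.1 ⊆ Jp K)
    (h2 : sSupport u.2 ⊆ Jp K) (h0 : extendC P u = 0) : u = 0 := by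
  have key : ∀ f : CoSec d F B, IsCompactlySupported f → rpair μ f u.1 = 0 ∧ rpair μ f u.2 = 0 := by
    intro f hf
    -- A cutoff that is one near `Jp K ∩ Jm (supp f)` and near `supp f` makes `u` compactly supported,
    -- as the formal symmetry of `P` requires.
    obtain ⟨χ, L, hL, hχ0, U, hU, hCU, hχ1⟩ := exists_cutoff (d := d) ((hJ K _ hK hf).union hf)
    set v := Δ f
    have hv := hΔ.support f hf
    have hfv := hΔ.right_inv f hf
    set a := mulSec χ u.1
    set b := mulSec χ u.2
    have hc : ∀ s : Sec d F B, IsCompactlySupported (mulSec χ s) := fun s =>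
      isCompactlySupported_iff.2 ⟨L, hL, fun x hx => by
        show χ x • s x = 0
        rw [hχ0 x hx, zero_smul]⟩
    have hχs : ∀ s : Sec d F B, sSupport (mulSec χ s) ⊆ sSupport s := fun s =>
      sSupport_mono isClosed_closure fun x hx => by
        show χ x • s x = 0
        rw [eq_zero_of_notMem_sSupport hx, smul_zero]
    have hχe : ∀ s : Sec d F B, ∀ x ∈ U, mulSec χ s x = s x := fun s x hx => by
      show χ x • s x = s x
      rw [hχ1 x hx, one_smul]
    have hfa : ∀ s : Sec d F B, rpair μ f (mulSec χ s) = rpair μ f s := fun s => by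
      rw [rpair, rpair]
      refine integral_congr_ae (Eventually.of_forall fun x => ?_)
      by_cases hx : x ∈ sSupport f
      · show f x (mulSec χ s x) = f x (s x)
        rw [hχe s x (hCU (Or.inr hx))]
      · show f x (mulSec χ s x) = f x (s x)
        rw [eq_zero_of_notMem_sSupport hx]; rfl
    have hf1 : ∀ s : Sec d F B, (rpair μ f s : ℂ) =
        pair μ (P v.1) (mulSec χ s) + Complex.I * pair μ (P v.2) (mulSec χ s) := fun s => by
      rw [← pair_mulI, ← pair_add_left (Or.inr (hc s))]
      have : P v.1 + mulI (P v.2) = (f, 0) := hfv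
      rw [this, pair_eq, hfa]
      simp [rpair]
    -- where `v` does not vanish, the cutoff has no effect on `P u`
    have hz : ∀ w, sSupport w ⊆ Jm (sSupport f) →
        pair μ (P a) w + Complex.I * pair μ (P b) w = 0 := fun w hw => by
      rw [← pair_mulI, ← pair_add_left (Or.inl ⟨hP.cxCompact (hc _), (hP.cxCompact (hc _)).mulI⟩)]
      rw [pair_congr (ξ' := 0) (u' := 0)]
      · simp [pair]
      · intro x
        have hx0 : (P a + mulI (P b)).1 x = 0 ∧ (P a + mulI (P b)).2 x = 0 ∨ w x = 0 := by
          by_cases hxw : x ∈ sSupport w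
          · left
            by_cases hxu : x ∈ Jp K
            · have hxU := hCU (Or.inl ⟨hxu, hw hxw⟩)
              have e1 := hP.eq_of_eqOn hU (hχe u.1) hxU
              have e2 := hP.eq_of_eqOn hU (hχe u.2) hxU
              constructor
              · show (P a).1 x + -((P b).2 x) = 0
                rw [e1.1, e2.2]
                exact congrArg (fun z : Cx (CoSec d F B) => z.1 x) h0
              · show (P a).2 x + (P b).1 x = 0
                rw [e1.2, e2.1]
                exact congrArg (fun z : Cx (CoSec d F B) => z.2 x) h0
            · have z : ∀ s : Sec d F B, sSupport s ⊆ Jp K →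
                  (P (mulSec χ s)).1 x = 0 ∧ (P (mulSec χ s)).2 x = 0 := fun s hs =>
                ⟨eq_zero_of_notMem_sSupport fun h => hxu (hs (hχs s ((hP _).1 h))),
                  eq_zero_of_notMem_sSupport fun h => hxu (hs (hχs s ((hP _).2 h)))⟩
              constructor
              · show (P a).1 x + -((P b).2 x) = 0
                rw [(z _ h1).1, (z _ h2).2, neg_zero, add_zero]
              · show (P a).2 x + (P b).1 x = 0
                rw [(z _ h1).2, (z _ h2).1, add_zero]
          · right
            exact eq_zero_of_notMem_sSupport hxw
        rcases hx0 with h | h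
        · rw [h.1, h.2]; exact ⟨rfl, rfl⟩
        · rw [h, map_zero, map_zero]; exact ⟨rfl, rfl⟩
    have e1 := hf1 u.1
    have e2 := hf1 u.2
    rw [pair_symm_of_local hP hs (hc _), pair_symm_of_local hP hs (hc _)] at e1 e2
    have z1 := hz v.1 hv.1
    have z2 := hz v.2 hv.2
    have e : (rpair μ f u.1 : ℂ) + Complex.I * (rpair μ f u.2 : ℂ) = 0 := by
      rw [e1, e2]
      linear_combination ε * z1 + ε * Complex.I * z2
    constructor
    · simpa using congrArg Complex.re e
    · simpa using congrArg Complex.im e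
  exact Prod.ext (eq_zero_of_rpair_right fun f hf => (key f hf).1)
    (eq_zero_of_rpair_right fun f hf => (key f hf).2)

end Pairing

/-! ### Composition with Green operators -/

section CodRestrict

variable {W : Type*} [AddCommGroup W] [Module ℝ W] [TopologicalSpace W] [LCTVS W]

theorem CkB.codRestrict (S : Submodule ℝ W) (hS : IsClosed (S : Set W)) (n : ℕ) :
    ∀ {E : Type u} [AddCommGroup E] [Module ℝ E] [TopologicalSpace E] {f : E → W}
      (_ : CkB n f) (h : ∀ x, f x ∈ S), CkB n fun x => (⟨f x, h x⟩ : S) := by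
  induction n with
  | zero => intro E _ _ _ f hf h; exact Continuous.subtype_mk hf _
  | succ n ih =>
    intro E _ _ _ f hf h
    -- difference quotients lie in `S`, hence so do their limits
    have hd : ∀ x v, dirD f x v ∈ S := fun x v =>
      hS.mem_of_tendsto (hf.2.1 x v) (Eventually.of_forall fun t =>
        S.smul_mem _ (S.sub_mem (h _) (h _)))
    refine CkB.intro (fun p => (⟨dirD f p.1 p.2, hd _ _⟩ : S)) (hf.1.subtype_mk _) (fun x v => ?_)
      (ih hf.2.2 fun p => hd p.1 p.2)
    exact tendsto_subtype_rng.2 (hf.2.1 x v)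

theorem Reg.codRestrict {S₀ S₁ : Type u} [AddCommGroup S₀] [Module ℝ S₀] [TopologicalSpace S₀]
    [LCTVS S₀] [AddCommGroup S₁] [Module ℝ S₁] [TopologicalSpace S₁] [LCTVS S₁]
    {X : SFun S₀ S₁ W} (hX : Reg X) (S : Submodule ℝ W) (hS : IsClosed (S : Set W))
    (h : ∀ n φ o, X n φ o ∈ S) : Reg fun n φ o => (⟨X n φ o, h n φ o⟩ : S) where
  anti n φ := fun σ o => Subtype.ext (hX.anti n φ σ o)
  lin n φ o := ⟨fun a b => Subtype.ext ((hX.lin n φ o).map_add a b),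
    fun c a => Subtype.ext ((hX.lin n φ o).map_smul c a)⟩
  smooth n m := (hX.smooth n m).codRestrict S hS m fun p => h n p.1 p.2

end CodRestrict

section Algebra

variable {W W' W'' : Type*} [AddCommGroup W] [Module ℝ W] [TopologicalSpace W]
  [AddCommGroup W'] [Module ℝ W'] [TopologicalSpace W'] [AddCommGroup W''] [Module ℝ W'']
  [TopologicalSpace W'']

theorem extendC_add_mulI (A : W →L[ℝ] Cx W') (v w : Cx W) :
    extendC A (v + mulI w) = extendC A v + mulI (extendC A w) := by
  apply Prod.ext
  · simp [extendC, mulI]; abel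
  · simp [extendC, mulI]; abel

theorem extendC_sub (A : W →L[ℝ] Cx W') (v w : Cx W) :
    extendC A (v - w) = extendC A v - extendC A w := by
  apply Prod.ext
  · simp [extendC, mulI]; abel
  · simp [extendC, mulI]; abel

theorem extendC_fst_zero {A : W → Cx W'} (h : A 0 = 0) (w : W) : extendC A (w, 0) = A w := by
  simp [extendC, h, mulI]

theorem extendC_clm_fst_zero (A : W →L[ℝ] Cx W') (w : W) : extendC A (w, 0) = A w :=
  extendC_fst_zero (map_zero A) w

theorem mk_zero_add_mulI (w : Cx W) : ((w.1, 0) : Cx W) + mulI (w.2, 0) = w := by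
  apply Prod.ext <;> simp [mulI]

theorem extendC_comp_eq {W₃ : Type*} [AddCommGroup W₃] [Module ℝ W₃] [TopologicalSpace W₃]
    {A : W →L[ℝ] Cx W'} {A' : W' →L[ℝ] Cx W''} {D : W →L[ℝ] Cx W₃} {D' : W₃ →L[ℝ] Cx W''}
    (h : ∀ u, extendC A' (A u) = extendC D' (D u)) (w : Cx W) :
    extendC A' (extendC A w) = extendC D' (extendC D w) := by
  refine (extendC_add_mulI A' (A w.1) (A w.2)).trans ?_
  rw [h, h]
  exact (extendC_add_mulI D' (D w.1) (D w.2)).symm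

/-- A map that is linear and continuous on a subspace, as a continuous linear map. -/
def clmOfOn (S : Submodule ℝ W) (Δ : W → W')
    (hl : ∀ (a b : ℝ), ∀ x ∈ S, ∀ y ∈ S, Δ (a • x + b • y) = a • Δ x + b • Δ y)
    (hc : ContinuousOn Δ S) : S →L[ℝ] W' where
  toFun x := Δ x.1
  map_add' x y := by
    have h := hl 1 1 x.1 x.2 y.1 y.2
    rwa [one_smul, one_smul, one_smul, one_smul] at h
  map_smul' c x := by
    have h := hl c 0 x.1 x.2 x.1 x.2
    rwa [zero_smul, zero_smul, add_zero, add_zero] at h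
  cont := continuousOn_iff_continuous_domRestrict.1 hc

/-- A map that is linear and continuous on a closed subspace may be applied to the values of smooth
superfunctions with values in this subspace, and this commutes with contractions. -/
theorem reg_extendC_comp {S₀ S₁ : Type u} [AddCommGroup S₀]
    [Module ℝ S₀] [TopologicalSpace S₀] [LCTVS S₀] [AddCommGroup S₁] [Module ℝ S₁]
    [TopologicalSpace S₁] [LCTVS S₁] [LCTVS W] [LCTVS W'] {f : SFun S₀ S₁ (Cx W)} (hf : Reg f)
    {S : Submodule ℝ W} (hS : IsClosed (S : Set W)) (D : S →L[ℝ] Cx W') {Δ : W → Cx W'}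
    (hD : ∀ x : S, Δ x.1 = D x) (h1 : ∀ n φ o, (f n φ o).1 ∈ S) (h2 : ∀ n φ o, (f n φ o).2 ∈ S) :
    Reg (fun n φ o => extendC Δ (f n φ o)) ∧ ∀ Q : SVec S₀ S₁, ∀ n φ o,
      ((vcontract (mulICx W) f Q n φ o).1 ∈ S ∧ (vcontract (mulICx W) f Q n φ o).2 ∈ S) ∧
      vcontract (mulICx W') (fun n φ o => extendC Δ (f n φ o)) Q n φ o =
        extendC Δ (vcontract (mulICx W) f Q n φ o) := by
  have h3 := ((hf.clm (ContinuousLinearMap.fst ℝ W W)).codRestrict S hS h1).prodMk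
    ((hf.clm (ContinuousLinearMap.snd ℝ W W)).codRestrict S hS h2)
  have hΔ : ∀ w : Cx S, extendC Δ (w.1.1, w.2.1) = extendCL D w := fun w => by
    rw [extendC, hD, hD]; rfl
  have e0 : (fun n φ o => extendC Δ (f n φ o)) = fun n φ o =>
      extendCL D (⟨(f n φ o).1, h1 n φ o⟩, ⟨(f n φ o).2, h2 n φ o⟩) := by
    funext n φ o
    exact hΔ (⟨(f n φ o).1, h1 n φ o⟩, ⟨(f n φ o).2, h2 n φ o⟩)
  rw [e0]
  refine ⟨h3.clm (extendCL D), fun Q n φ o => ?_⟩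
  have e1 := vcontract_map (J := mulICx S) (J' := mulICx W)
    ((Submodule.subtypeL S).prodMap (Submodule.subtypeL S)) (fun w => rfl) h3 Q n φ o
  have e2 := vcontract_map (J := mulICx S) (J' := mulICx W') (extendCL D) (extendCL_mulI D) h3 Q n φ o
  have e3 : vcontract (mulICx W) f Q n φ o = _ := e1
  rw [e3]
  exact ⟨⟨Subtype.property _, Subtype.property _⟩, e2.trans (hΔ _).symm⟩

end Algebra

section Green

variable {d : ℕ} {M : Type*} [TopologicalSpace M] [ChartedSpace (EuclideanSpace ℝ (Fin d)) M]
  [IsManifold (𝓡 d) ∞ M] [T2Space M]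
  {F : Type*} [NormedAddCommGroup F] [NormedSpace ℝ F]
  {B : M → Type*} [TopologicalSpace (TotalSpace F B)] [∀ x, TopologicalSpace (B x)]
  [FiberBundle F B] [∀ x, AddCommGroup (B x)] [∀ x, Module ℝ (B x)] [VectorBundle ℝ F B]
  [ContMDiffVectorBundle ∞ F B (𝓡 d)]
  [∀ x, IsTopologicalAddGroup (B x)] [∀ x, ContinuousSMul ℝ (B x)]

theorem cxCompact_of_mem {K : Set M} (hK : IsCompact K) {w : Cx (Sec d F B)}
    (h1 : w.1 ∈ secIn d F B K) (h2 : w.2 ∈ secIn d F B K) : CxCompact w :=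
  ⟨isCompactlySupported_iff.2 ⟨K, hK, h1⟩, isCompactlySupported_iff.2 ⟨K, hK, h2⟩⟩

variable {J : Set M → Set M} {P : Sec d F B →L[ℝ] Cx (CoSec d F B)} {Δ : CoSec d F B → Cx (Sec d F B)}

/-- The restriction of a Green operator to the sections supported in a compact set, as a continuous
linear map. -/
def IsGreenOperator.restrict (hΔ : IsGreenOperator J P Δ) {K : Set M} (hK : IsCompact K) :
    secIn d (F →L[ℝ] ℝ) (fun x => B x →L[ℝ] ℝ) K →L[ℝ] Cx (Sec d F B) :=
  clmOfOn _ Δ (fun a b x hx y hy => hΔ.linear a b x y (isCompactlySupported_iff.2 ⟨K, hK, hx⟩)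
    (isCompactlySupported_iff.2 ⟨K, hK, hy⟩)) (by
    have h := hΔ.continuousOn K hK
    have e : {ξ : CoSec d F B | sSupport ξ ⊆ K} =
        (secIn d (F →L[ℝ] ℝ) (fun x => B x →L[ℝ] ℝ) K : Set (CoSec d F B)) := by
      ext ξ; exact (mem_secIn_iff hK.isClosed).symm
    rwa [e] at h)

theorem exists_cx_lift {w : Cx (Sec d F B)} (h : CxCompact w) :
    ∃ K, IsCompact K ∧ w.1 ∈ secIn d F B K ∧ w.2 ∈ secIn d F B K := by
  obtain ⟨K, hK, h1⟩ := isCompactlySupported_iff.1 h.1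
  obtain ⟨L, hL, h2⟩ := isCompactlySupported_iff.1 h.2
  exact ⟨K ∪ L, hK.union hL, secIn_mono subset_union_left h1, secIn_mono subset_union_right h2⟩

theorem IsGreenOperator.extendC_add (hΔ : IsGreenOperator J P Δ) {ξ ζ : Cx (CoSec d F B)}
    (hξ : CxCompact ξ) (hζ : CxCompact ζ) :
    extendC Δ (ξ + ζ) = extendC Δ ξ + extendC Δ ζ := by
  obtain ⟨K, hK, h1, h2⟩ := exists_cx_lift hξ
  obtain ⟨L, hL, h3, h4⟩ := exists_cx_lift hζ
  have := (extendCL (hΔ.restrict (hK.union hL))).map_add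
    (⟨_, secIn_mono subset_union_left h1⟩, ⟨_, secIn_mono subset_union_left h2⟩)
    (⟨_, secIn_mono subset_union_right h3⟩, ⟨_, secIn_mono subset_union_right h4⟩)
  exact this

theorem IsGreenOperator.extendC_mulI (hΔ : IsGreenOperator J P Δ) {ξ : Cx (CoSec d F B)}
    (hξ : CxCompact ξ) : extendC Δ (mulI ξ) = mulI (extendC Δ ξ) := by
  obtain ⟨K, hK, h1, h2⟩ := exists_cx_lift hξ
  exact extendCL_mulI (hΔ.restrict hK) (⟨_, h1⟩, ⟨_, h2⟩)

theorem IsGreenOperator.right_inv_extendC (hΔ : IsGreenOperator J P Δ) {ξ : Cx (CoSec d F B)}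
    (hξ : CxCompact ξ) : extendC P (extendC Δ ξ) = ξ := by
  refine (extendC_add_mulI P (Δ ξ.1) (Δ ξ.2)).trans ?_
  rw [hΔ.right_inv _ hξ.1, hΔ.right_inv _ hξ.2]
  exact mk_zero_add_mulI ξ

theorem IsGreenOperator.left_inv_extendC (hΔ : IsGreenOperator J P Δ) (hP : IsLocalOp P)
    {w : Cx (Sec d F B)} (hw : CxCompact w) : extendC Δ (extendC P w) = w := by
  have h1 : extendC Δ (P w.1 + mulI (P w.2)) = (w.1, 0) + mulI (w.2, 0) := by
    rw [hΔ.extendC_add (hP.cxCompact hw.1) (hP.cxCompact hw.2).mulI,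
      hΔ.extendC_mulI (hP.cxCompact hw.2), hΔ.left_inv _ hw.1, hΔ.left_inv _ hw.2]
  exact h1.trans (mk_zero_add_mulI w)

/-- Green operators may be applied to the values of superfunctions with supports in a fixed compact
set; this commutes with contractions. -/
theorem IsGreenOperator.comp_reg (hΔ : IsGreenOperator J P Δ) {S₀ S₁ : Type u} [AddCommGroup S₀]
    [Module ℝ S₀] [TopologicalSpace S₀] [LCTVS S₀] [AddCommGroup S₁] [Module ℝ S₁]
    [TopologicalSpace S₁] [LCTVS S₁] {f : SFun S₀ S₁ (Cx (CoSec d F B))} (hf : Reg f) {K : Set M}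
    (hK : IsCompact K) (h : ∀ n φ o, sSupport (f n φ o).1 ⊆ K ∧ sSupport (f n φ o).2 ⊆ K) :
    Reg (fun n φ o => extendC Δ (f n φ o)) ∧ ∀ Q : SVec S₀ S₁, ∀ n φ o,
      CxCompact (vcontract (mulICx (CoSec d F B)) f Q n φ o) ∧
      vcontract (mulICx (Sec d F B)) (fun n φ o => extendC Δ (f n φ o)) Q n φ o =
        extendC Δ (vcontract (mulICx (CoSec d F B)) f Q n φ o) := by
  have h1 := reg_extendC_comp hf (isClosed_secIn K) (hΔ.restrict hK) (Δ := Δ) (fun x => rfl)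
    (fun n φ o => (mem_secIn_iff hK.isClosed).2 (h n φ o).1)
    (fun n φ o => (mem_secIn_iff hK.isClosed).2 (h n φ o).2)
  refine ⟨h1.1, fun Q n φ o => ⟨?_, (h1.2 Q n φ o).2⟩⟩
  exact cxCompact_of_mem hK (h1.2 Q n φ o).1.1 (h1.2 Q n φ o).1.2

end Green

section Intertwine

variable {d : ℕ} {M : Type*} [TopologicalSpace M] [ChartedSpace (EuclideanSpace ℝ (Fin d)) M]
  [IsManifold (𝓡 d) ∞ M] [T2Space M] [SecondCountableTopology M] [MeasurableSpace M] [BorelSpace M]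
  {μ : Measure M} [IsFiniteMeasureOnCompacts μ] [μ.IsOpenPosMeasure]
  {F : Type*} [NormedAddCommGroup F] [NormedSpace ℝ F]
  {B : M → Type*} [TopologicalSpace (TotalSpace F B)] [∀ x, TopologicalSpace (B x)]
  [FiberBundle F B] [∀ x, AddCommGroup (B x)] [∀ x, Module ℝ (B x)] [VectorBundle ℝ F B]
  [ContMDiffVectorBundle ∞ F B (𝓡 d)]
  [∀ x, IsTopologicalAddGroup (B x)] [∀ x, ContinuousSMul ℝ (B x)]
  {F' : Type*} [NormedAddCommGroup F'] [NormedSpace ℝ F']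
  {B' : M → Type*} [TopologicalSpace (TotalSpace F' B')] [∀ x, TopologicalSpace (B' x)]
  [FiberBundle F' B'] [∀ x, AddCommGroup (B' x)] [∀ x, Module ℝ (B' x)] [VectorBundle ℝ F' B']
  [ContMDiffVectorBundle ∞ F' B' (𝓡 d)]
  [∀ x, IsTopologicalAddGroup (B' x)] [∀ x, ContinuousSMul ℝ (B' x)]

/-- If the local operators `k`, `k'` intertwine `P'` and `P`, then they intertwine the retarded Green
operators: both sides are solutions of the same equation with support in the future of a compact
set. -/
theorem green_intertwine {Jp Jm : Set M → Set M} (hmono : ∀ K L, K ⊆ L → Jp K ⊆ Jp L)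
    (hJ : ∀ K L, IsCompact K → IsCompact L → IsCompact (Jp K ∩ Jm L))
    {P : Sec d F B →L[ℝ] Cx (CoSec d F B)} (hP : IsLocalOp P) {ε : ℂ}
    (hs : ∀ u v, IsCompactlySupported u → IsCompactlySupported v →
      pair μ (P u) v = ε * pair μ (P v) u)
    {Δ ΔA : CoSec d F B → Cx (Sec d F B)} (hΔ : IsGreenOperator Jp P Δ)
    (hΔA : IsGreenOperator Jm P ΔA)
    {P' : Sec d F' B' →L[ℝ] Cx (CoSec d F' B')} {Δ' : CoSec d F' B' → Cx (Sec d F' B')}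
    (hΔ' : IsGreenOperator Jp P' Δ')
    {k : Sec d F' B' →L[ℝ] Cx (Sec d F B)} {k' : CoSec d F' B' →L[ℝ] Cx (CoSec d F B)}
    (hk : IsLocalOp k) (hk' : IsLocalOp k') (h : ∀ u, extendC P (k u) = extendC k' (P' u))
    {ξ : Cx (CoSec d F' B')} (hξ : CxCompact ξ) :
    extendC k (extendC Δ' ξ) = extendC Δ (extendC k' ξ) := by
  have hc := extendC_comp_eq h
  -- real sources suffice, as both sides are complex linear
  have real : ∀ f : CoSec d F' B', IsCompactlySupported f →
      extendC k (Δ' f) = extendC Δ (k' f) := by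
    intro f hf
    have hkf := hk'.cxCompact hf
    obtain ⟨e1, e2⟩ := hΔ'.support f hf
    rw [← sub_eq_zero]
    have hS1 := hk (Δ' f).1
    have hS2 := hk (Δ' f).2
    have hT1 := hΔ.support _ hkf.1
    have hT2 := hΔ.support _ hkf.2
    have hm1 := hmono _ _ (hk' f).1
    have hm2 := hmono _ _ (hk' f).2
    refine green_unique hJ hP hs hΔA (K := sSupport f) hf (u := extendC k (Δ' f) - extendC Δ (k' f))
      ?_ ?_ ?_
    · show sSupport (((k (Δ' f).1).1 + -(k (Δ' f).2).2) - ((Δ (k' f).1).1 + -(Δ (k' f).2).2)) ⊆ _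
      rw [sub_eq_add_neg]
      refine (sSupport_add_subset _ _).trans (union_subset ((sSupport_add_subset _ _).trans
        (union_subset (hS1.1.trans e1) ((sSupport_neg_subset _).trans (hS2.2.trans e2))))
        ((sSupport_neg_subset _).trans ((sSupport_add_subset _ _).trans (union_subset
        (hT1.1.trans hm1) ((sSupport_neg_subset _).trans (hT2.2.trans hm2))))))
    · show sSupport (((k (Δ' f).1).2 + (k (Δ' f).2).1) - ((Δ (k' f).1).2 + (Δ (k' f).2).1)) ⊆ _
      rw [sub_eq_add_neg]
      refine (sSupport_add_subset _ _).trans (union_subset ((sSupport_add_subset _ _).trans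
        (union_subset (hS1.2.trans e1) (hS2.1.trans e2)))
        ((sSupport_neg_subset _).trans ((sSupport_add_subset _ _).trans (union_subset
        (hT1.2.trans hm1) (hT2.1.trans hm2)))))
    · rw [extendC_sub, hc, hΔ'.right_inv f hf, extendC_clm_fst_zero, hΔ.right_inv_extendC hkf,
        sub_self]
  have e1 : extendC k (extendC Δ' ξ) = extendC k (Δ' ξ.1) + mulI (extendC k (Δ' ξ.2)) :=
    extendC_add_mulI k _ _
  have e2 : extendC Δ (extendC k' ξ) = extendC Δ (k' ξ.1) + mulI (extendC Δ (k' ξ.2)) := by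
    rw [← hΔ.extendC_mulI (hk'.cxCompact hξ.2)]
    exact hΔ.extendC_add (hk'.cxCompact hξ.1) (hk'.cxCompact hξ.2).mulI
  rw [e1, e2, real _ hξ.1, real _ hξ.2]

end Intertwine

/-! ### Restriction to invariant subspaces -/

section Restrict

variable {S₀ S₁ : Type u} [AddCommGroup S₀] [Module ℝ S₀] [TopologicalSpace S₀]
  [LCTVS S₀] [AddCommGroup S₁] [Module ℝ S₁] [TopologicalSpace S₁] [LCTVS S₁]

/-- The vector field `Q` is tangent to the super subspace `T₀ ⊕ T₁`. -/
structure Preserves (Q : SVec S₀ S₁) (T₀ : Submodule ℝ S₀) (T₁ : Submodule ℝ S₁) : Prop where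
  ev : ∀ n (φ : T₀) (o : Fin n → T₁), (Q.ev n (T₀.subtypeL φ) (T₁.subtypeL ∘ o)).1 ∈ T₀ ∧
    (Q.ev n (T₀.subtypeL φ) (T₁.subtypeL ∘ o)).2 ∈ T₀
  od : ∀ n (φ : T₀) (o : Fin n → T₁), (Q.od n (T₀.subtypeL φ) (T₁.subtypeL ∘ o)).1 ∈ T₁ ∧
    (Q.od n (T₀.subtypeL φ) (T₁.subtypeL ∘ o)).2 ∈ T₁

/-- The restriction of a vector field to a super subspace to which it is tangent. -/
def resV {Q : SVec S₀ S₁} {T₀ : Submodule ℝ S₀} {T₁ : Submodule ℝ S₁} (h : Preserves Q T₀ T₁) :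
    SVec T₀ T₁ where
  ev n φ o := (⟨_, (h.ev n φ o).1⟩, ⟨_, (h.ev n φ o).2⟩)
  od n φ o := (⟨_, (h.od n φ o).1⟩, ⟨_, (h.od n φ o).2⟩)

theorem RegV.resV {Q : SVec S₀ S₁} (hQ : RegV Q) {T₀ : Submodule ℝ S₀} {T₁ : Submodule ℝ S₁}
    (h0 : IsClosed (T₀ : Set S₀)) (h1 : IsClosed (T₁ : Set S₁)) (h : Preserves Q T₀ T₁) :
    RegV (resV h) :=
  ⟨Reg.prodMk
      (((hQ.ev.pull T₀.subtypeL T₁.subtypeL).clm (ContinuousLinearMap.fst ℝ S₀ S₀)).codRestrict T₀ h0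
        fun n φ o => (h.ev n φ o).1)
      (((hQ.ev.pull T₀.subtypeL T₁.subtypeL).clm (ContinuousLinearMap.snd ℝ S₀ S₀)).codRestrict T₀ h0
        fun n φ o => (h.ev n φ o).2),
    Reg.prodMk
      (((hQ.od.pull T₀.subtypeL T₁.subtypeL).clm (ContinuousLinearMap.fst ℝ S₁ S₁)).codRestrict T₁ h1
        fun n φ o => (h.od n φ o).1)
      (((hQ.od.pull T₀.subtypeL T₁.subtypeL).clm (ContinuousLinearMap.snd ℝ S₁ S₁)).codRestrict T₁ h1
        fun n φ o => (h.od n φ o).2)⟩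

theorem vcontract_resV {W : Type*} [AddCommGroup W] [Module ℝ W] [TopologicalSpace W] [LCTVS W]
    (J : W →ₗ[ℝ] W) (X : SFun S₀ S₁ W) {Q : SVec S₀ S₁} {T₀ : Submodule ℝ S₀}
    {T₁ : Submodule ℝ S₁} (h : Preserves Q T₀ T₁) (p : ℕ) (φ : T₀) (o : Fin p → T₁) :
    vcontract J (pull T₀.subtypeL T₁.subtypeL X) (resV h) p φ o =
      vcontract J X Q p (T₀.subtypeL φ) (T₁.subtypeL ∘ o) :=
  vcontract_comp J T₀.subtypeL.toLinearMap T₁.subtypeL.toLinearMap X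
    (fun _ _ _ => ⟨rfl, rfl⟩) fun _ _ _ => ⟨rfl, rfl⟩

theorem actV_resV {E Q : SVec S₀ S₁} (hQ : RegV Q) {T₀ : Submodule ℝ S₀}
    {T₁ : Submodule ℝ S₁} (h0 : IsClosed (T₀ : Set S₀)) (h1 : IsClosed (T₁ : Set S₁))
    (hE' : Preserves E T₀ T₁) (hQ' : Preserves Q T₀ T₁) (p : ℕ) (φ : T₀) (o : Fin p → T₁) :
    T₀.subtypeL.prodMap T₀.subtypeL ((actV (resV hE') (resV hQ')).ev p φ o) =
        (actV E Q).ev p (T₀.subtypeL φ) (T₁.subtypeL ∘ o) ∧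
      T₁.subtypeL.prodMap T₁.subtypeL ((actV (resV hE') (resV hQ')).od p φ o) =
        (actV E Q).od p (T₀.subtypeL φ) (T₁.subtypeL ∘ o) := by
  constructor
  · have e1 := vcontract_map (J := mulICx T₀) (J' := mulICx S₀) (T₀.subtypeL.prodMap T₀.subtypeL)
      (fun w => rfl) (hQ.resV h0 h1 hQ').ev (resV hE') p φ o
    exact e1.symm.trans (vcontract_resV (mulICx S₀) Q.ev hE' p φ o)
  · have e1 := vcontract_map (J := mulICx T₁) (J' := mulICx S₁) (T₁.subtypeL.prodMap T₁.subtypeL)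
      (fun w => rfl) (hQ.resV h0 h1 hQ').od (resV hE') p φ o
    exact e1.symm.trans (vcontract_resV (mulICx S₁) Q.od hE' p φ o)

/-- The vanishing of the square of the Hamiltonian vector field on a super subspace on which the
action is a smooth functional and satisfies the master equation. -/
theorem sum_actV_eq_zero_on {Ω : S₀ →ₗ[ℝ] S₁ →ₗ[ℝ] ℝ} (h1 : ∀ h, Continuous (Ω h))
    (h2 : ∀ w, Continuous fun h => Ω h w) {S : ℕ → SFun S₀ S₁ ℂ} {Q : ℕ → SVec S₀ S₁} {n : ℕ}
    {T₀ : Submodule ℝ S₀} {T₁ : Submodule ℝ S₁} (hT₀ : IsClosed (T₀ : Set S₀))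
    (hT₁ : IsClosed (T₁ : Set S₁))
    (hS : ∀ i ≤ n, Reg (pull T₀.subtypeL T₁.subtypeL (S i))) (hQ : ∀ i, RegV (Q i))
    (hT : ∀ i ≤ n, Preserves (Q i) T₀ T₁)
    (hev : ∀ i ≤ n, ∀ m (φ : T₀) (o : Fin m → T₁) (e : T₀),
      dirD (fun φ' : T₀ => S i m (T₀.subtypeL φ') (T₁.subtypeL ∘ o)) φ e =
        evalC (fun w => (Ω e w : ℂ)) ((Q i).od m (T₀.subtypeL φ) (T₁.subtypeL ∘ o)))
    (hod : ∀ i ≤ n, ∀ m (φ : T₀) (o : Fin m → T₁) (w : T₁),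
      S i (m + 1) (T₀.subtypeL φ) (T₁.subtypeL ∘ (Fin.cons w o : Fin (m + 1) → T₁)) =
        -evalC (fun h => (Ω h w : ℂ)) ((Q i).ev m (T₀.subtypeL φ) (T₁.subtypeL ∘ o)))
    (hp : ∀ i ≤ n, FunParity 1 (S i))
    (hcme : ∀ p (φ : T₀) (o : Fin p → T₁), ∑ x ∈ Finset.HasAntidiagonal.antidiagonal n,
      vcontract mulIℂ (S x.1) (Q x.2) p (T₀.subtypeL φ) (T₁.subtypeL ∘ o) = 0)
    (p : ℕ) (φ : T₀) (o : Fin p → T₁) :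
    (∀ h : T₀, evalC (fun w => (Ω h w : ℂ)) (∑ x ∈ Finset.HasAntidiagonal.antidiagonal n,
      (actV (Q x.2) (Q x.1)).od p (T₀.subtypeL φ) (T₁.subtypeL ∘ o)) = 0) ∧
    ∀ w : T₁, evalC (fun h => (Ω h w : ℂ)) (∑ x ∈ Finset.HasAntidiagonal.antidiagonal n,
      (actV (Q x.2) (Q x.1)).ev p (T₀.subtypeL φ) (T₁.subtypeL ∘ o)) = 0 := by
  classical
  have hle : ∀ x ∈ Finset.HasAntidiagonal.antidiagonal n, x.1 ≤ n ∧ x.2 ≤ n := fun x hx => by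
    rw [Finset.HasAntidiagonal.mem_antidiagonal] at hx; omega
  let R : ℕ → SVec T₀ T₁ := fun i => if h : i ≤ n then resV (hT i h) else ⟨0, 0⟩
  have hR : ∀ i (h : i ≤ n), R i = resV (hT i h) := fun i h => dif_pos h
  have key := sum_actV_eq_zero (Ω := Ω.compl₁₂ T₀.subtype T₁.subtype) (n := n) (Q := R)
    (S := fun i => pull T₀.subtypeL T₁.subtypeL (S i))
    (fun h => (h1 h).comp continuous_subtype_val) (fun w => (h2 w).comp continuous_subtype_val)
    hS (fun i hi => by rw [hR i hi]; exact (hQ i).resV hT₀ hT₁ _)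
    (fun i hi => by
      rw [hR i hi]
      exact ⟨fun m φ o e => hev i hi m φ o e, fun m φ o w => hod i hi m φ o w⟩)
    (fun i hi m φ o => hp i hi m _ _)
    (by
      funext p φ o
      refine Eq.trans ?_ (hcme p φ o)
      simp only [Finset.sum_apply]
      refine Finset.sum_congr rfl fun x hx => ?_
      rw [hR x.2 (hle x hx).2]
      exact vcontract_resV _ _ _ _ _ _) p φ o
  have hact : ∀ x ∈ Finset.HasAntidiagonal.antidiagonal n,
      T₀.subtypeL.prodMap T₀.subtypeL ((actV (R x.2) (R x.1)).ev p φ o) =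
        (actV (Q x.2) (Q x.1)).ev p (T₀.subtypeL φ) (T₁.subtypeL ∘ o) ∧
      T₁.subtypeL.prodMap T₁.subtypeL ((actV (R x.2) (R x.1)).od p φ o) =
        (actV (Q x.2) (Q x.1)).od p (T₀.subtypeL φ) (T₁.subtypeL ∘ o) := fun x hx => by
    rw [hR x.1 (hle x hx).1, hR x.2 (hle x hx).2]
    exact actV_resV (hQ _) hT₀ hT₁ _ _ p φ o
  constructor
  · intro h
    have e := Finset.sum_congr rfl fun x hx => ((hact x hx).2).symm
    rw [e, ← map_sum]
    exact key.1 h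
  · intro w
    have e := Finset.sum_congr rfl fun x hx => ((hact x hx).1).symm
    rw [e, ← map_sum]
    exact key.2 w

end Restrict

/-! ### Quadratic functionals -/

section Quadratic

variable {S₀ S₁ : Type u} [AddCommGroup S₀] [Module ℝ S₀] [TopologicalSpace S₀]
  [LCTVS S₀] [AddCommGroup S₁] [Module ℝ S₁] [TopologicalSpace S₁] [LCTVS S₁]

/-- The even quadratic functional given by bilinear forms `b` and `c` on the even and the odd part. -/
def quadS (b : S₀ →ₗ[ℝ] S₀ →ₗ[ℝ] ℂ) (c : S₁ →ₗ[ℝ] S₁ →ₗ[ℝ] ℂ) : SFun S₀ S₁ ℂ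
  | 0, φ, _ => b φ φ
  | 2, _, o => c (o 0) (o 1) - c (o 1) (o 0)
  | _, _, _ => 0

theorem Reg.quadS {b : S₀ →ₗ[ℝ] S₀ →ₗ[ℝ] ℂ} {c : S₁ →ₗ[ℝ] S₁ →ₗ[ℝ] ℂ}
    (hb : Continuous fun p : S₀ × S₀ => b p.1 p.2) (hc : Continuous fun p : S₁ × S₁ => c p.1 p.2) :
    Reg (quadS b c) where
  anti n φ := by
    match n with
    | 0 => intro σ o; rw [Subsingleton.elim σ 1]; simp [ClassicalBV.quadS]
    | 1 => exact AntiS.zero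
    | 2 =>
      intro σ o
      have : σ = 1 ∨ σ = Equiv.swap 0 1 := by revert σ; decide
      rcases this with rfl | rfl
      · simp [ClassicalBV.quadS]
      · simp [ClassicalBV.quadS]
    | n + 3 => exact AntiS.zero
  lin n φ o := by
    match n with
    | 0 => exact ⟨fun _ _ => (add_zero (0 : ℂ)).symm, fun _ _ => (smul_zero _).symm⟩
    | 1 =>
      exact ⟨fun x y => by simp [ClassicalBV.quadS]; ring,
        fun a x => by simp [ClassicalBV.quadS]; ring⟩
    | n + 2 => exact ⟨fun _ _ => (add_zero (0 : ℂ)).symm, fun _ _ => (smul_zero _).symm⟩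
  smooth n := by
    match n with
    | 0 => exact (SmoothB.bilin b hb).comp (SmoothB.id.fst.prodMk SmoothB.id.fst)
    | 1 => exact SmoothB.const 0
    | 2 =>
      have h0 : SmoothB fun p : S₀ × (Fin 2 → S₁) => p.2 0 := SmoothB.id.snd.apply 0
      have h1 : SmoothB fun p : S₀ × (Fin 2 → S₁) => p.2 1 := SmoothB.id.snd.apply 1
      have h2 := (SmoothB.bilin c hc).comp (h0.prodMk h1)
      have h3 := ((SmoothB.bilin c hc).comp (h1.prodMk h0)).clm_comp (-ContinuousLinearMap.id ℝ ℂ)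
      exact h2.add h3
    | n + 3 => exact SmoothB.const 0

theorem dirD_quadS {b : S₀ →ₗ[ℝ] S₀ →ₗ[ℝ] ℂ} (c : S₁ →ₗ[ℝ] S₁ →ₗ[ℝ] ℂ) (φ e : S₀)
    (o : Fin 0 → S₁) : dirD (fun φ' => quadS b c 0 φ' o) φ e = b φ e + b e φ := by
  refine HasDD.dirD_eq ?_
  have h : Tendsto (fun t : ℝ => b φ e + b e φ + t • b e e) (𝓝[≠] 0) (𝓝 (b φ e + b e φ)) := by
    have : Continuous fun t : ℝ => b φ e + b e φ + t • b e e := by fun_prop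
    simpa using (this.tendsto 0).mono_left nhdsWithin_le_nhds
  refine h.congr' ?_
  filter_upwards [self_mem_nhdsWithin] with t ht
  have ht' : t ≠ 0 := ht
  have e1 : quadS b c 0 (φ + t • e) o - quadS b c 0 φ o = t • (b φ e + b e φ + t • b e e) := by
    simp only [ClassicalBV.quadS, map_add, map_smul, LinearMap.add_apply, LinearMap.smul_apply,
      smul_add]
    abel
  rw [e1, smul_smul, inv_mul_cancel₀ ht', one_smul]

end Quadratic

/-! ### Hamiltonian vector fields on a sum of two spaces -/

section HamPair

variable {S₀ S₁ : Type u} [AddCommGroup S₀] [Module ℝ S₀] [TopologicalSpace S₀]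
  [LCTVS S₀] [AddCommGroup S₁] [Module ℝ S₁] [TopologicalSpace S₁] [LCTVS S₁]
  {A B : Type*} [AddCommGroup A] [Module ℝ A] [TopologicalSpace A] [LCTVS A]
  [AddCommGroup B] [Module ℝ B] [TopologicalSpace B] [LCTVS B]

/-- The complex vector with components `a` and `-f`, which occurs in Hamiltonian vector fields. -/
def hamPair (a : Cx A) (f : Cx B) : Cx (A × B) := ((a.1, -f.1), (a.2, -f.2))

theorem hamPair_add (a a' : Cx A) (f f' : Cx B) :
    hamPair (a + a') (f + f') = hamPair a f + hamPair a' f' := by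
  simp only [hamPair, Prod.fst_add, Prod.snd_add, neg_add, Prod.mk_add_mk]

variable (A B) in
/-- `hamPair` as a continuous linear map. -/
def hamPairL : Cx A × Cx B →L[ℝ] Cx (A × B) where
  toFun p := hamPair p.1 p.2
  map_add' p q := hamPair_add _ _ _ _
  map_smul' c p := by
    simp only [hamPair, Prod.smul_fst, Prod.smul_snd, Prod.smul_mk, smul_neg, RingHom.id_apply]
  cont := by unfold hamPair; fun_prop

theorem hamPair_mulI (a : Cx A) (f : Cx B) : hamPair (mulI a) (mulI f) = mulI (hamPair a f) := by
  simp only [hamPair, mulI, Prod.neg_mk]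

theorem hamPair_eq_zero {a : Cx A} {f : Cx B} : hamPair a f = 0 ↔ a = 0 ∧ f = 0 := by
  simp only [hamPair, Prod.ext_iff, Prod.fst_zero, Prod.snd_zero, neg_eq_zero]
  tauto

theorem Reg.hamPair {a : SFun S₀ S₁ (Cx A)} {f : SFun S₀ S₁ (Cx B)} (ha : Reg a) (hf : Reg f) :
    Reg fun n φ o => hamPair (a n φ o) (f n φ o) :=
  (ha.prodMk hf).clm (hamPairL A B)

theorem vcontract_hamPair {a : SFun S₀ S₁ (Cx A)} {f : SFun S₀ S₁ (Cx B)} (ha : Reg a) (hf : Reg f)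
    (Q : SVec S₀ S₁) (p : ℕ) (φ : S₀) (o : Fin p → S₁) :
    vcontract (mulICx (A × B)) (fun n φ o => hamPair (a n φ o) (f n φ o)) Q p φ o =
      hamPair (vcontract (mulICx A) a Q p φ o) (vcontract (mulICx B) f Q p φ o) := by
  have h := ha.prodMk hf
  have e := vcontract_map (J := (mulICx A).prodMap (mulICx B)) (J' := mulICx (A × B)) (hamPairL A B)
    (fun w => hamPair_mulI _ _) h Q p φ o
  have e1 := vcontract_map (J := (mulICx A).prodMap (mulICx B)) (J' := mulICx A)
    (ContinuousLinearMap.fst ℝ (Cx A) (Cx B)) (fun w => rfl) h Q p φ o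
  have e2 := vcontract_map (J := (mulICx A).prodMap (mulICx B)) (J' := mulICx B)
    (ContinuousLinearMap.snd ℝ (Cx A) (Cx B)) (fun w => rfl) h Q p φ o
  refine e.trans ?_
  show hamPair _ _ = _
  exact congrArg₂ hamPair e1.symm e2.symm

theorem extendC_hamPairL {S : Type*} [AddCommGroup S] [Module ℝ S] [TopologicalSpace S]
    (k : S →L[ℝ] Cx A) (f : S →L[ℝ] Cx B) (w : Cx S) :
    extendC ((hamPairL A B).comp (k.prod f)) w = hamPair (extendC k w) (extendC f w) := by
  refine Eq.trans ?_ (hamPair_add (k w.1) (mulI (k w.2)) (f w.1) (mulI (f w.2))).symm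
  rw [hamPair_mulI]
  rfl

theorem hamPair_linOd (k : S₁ →L[ℝ] Cx A) (f : S₁ →L[ℝ] Cx B) :
    (fun n φ o => hamPair (linOd k n φ o) (linOd f n φ o) : SFun S₀ S₁ (Cx (A × B))) =
      linOd ((hamPairL A B).comp (k.prod f)) := by
  funext n φ o
  rcases n with _ | _ | n
  · exact map_zero (hamPairL A B)
  · rfl
  · exact map_zero (hamPairL A B)

theorem hamPair_linEv (k : S₀ →L[ℝ] Cx A) (f : S₀ →L[ℝ] Cx B) :
    (fun n φ o => hamPair (linEv k n φ o) (linEv f n φ o) : SFun S₀ S₁ (Cx (A × B))) =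
      linEv ((hamPairL A B).comp (k.prod f)) := by
  funext n φ o
  rcases n with _ | n
  · rfl
  · exact map_zero (hamPairL A B)

end HamPair

/-! ### The odd symplectic form of the antibracket -/

section Symplectic

variable {A A' B B' : Type*} [AddCommGroup A] [Module ℝ A] [AddCommGroup A'] [Module ℝ A']
  [AddCommGroup B] [Module ℝ B] [AddCommGroup B'] [Module ℝ B']

/-- The odd symplectic form on `(A ⊕ B') ⊕ (B ⊕ A')`, given by pairings of `A'` with `A` and of `B'`
with `B`. -/
def oddForm (β : A' →ₗ[ℝ] A →ₗ[ℝ] ℝ) (β' : B' →ₗ[ℝ] B →ₗ[ℝ] ℝ) :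
    A × B' →ₗ[ℝ] B × A' →ₗ[ℝ] ℝ :=
  LinearMap.mk₂ ℝ (fun e w => β' e.2 w.1 - β w.2 e.1)
    (fun e e' w => by simp only [Prod.fst_add, Prod.snd_add, map_add, LinearMap.add_apply]; ring)
    (fun c e w => by
      simp only [Prod.smul_fst, Prod.smul_snd, map_smul, LinearMap.smul_apply, smul_eq_mul]; ring)
    (fun e w w' => by simp only [Prod.fst_add, Prod.snd_add, map_add, LinearMap.add_apply]; ring)
    (fun c e w => by
      simp only [Prod.smul_fst, Prod.smul_snd, map_smul, LinearMap.smul_apply, smul_eq_mul]; ring)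

/-- The complex linear extension of a real bilinear form in the first argument. -/
def cxL (β : A' →ₗ[ℝ] A →ₗ[ℝ] ℝ) (ξ : Cx A') (u : A) : ℂ := (β ξ.1 u : ℂ) + Complex.I * (β ξ.2 u : ℂ)

/-- The complex linear extension of a real bilinear form in the second argument. -/
def cxR (β : A' →ₗ[ℝ] A →ₗ[ℝ] ℝ) (ξ : A') (u : Cx A) : ℂ := (β ξ u.1 : ℂ) + Complex.I * (β ξ u.2 : ℂ)

theorem evalC_oddForm_left (β : A' →ₗ[ℝ] A →ₗ[ℝ] ℝ) (β' : B' →ₗ[ℝ] B →ₗ[ℝ] ℝ) (e : A × B')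
    (a : Cx B) (f : Cx A') :
    evalC (fun w => (oddForm β β' e w : ℂ)) (hamPair a f) = cxR β' e.2 a + cxL β f e.1 := by
  simp only [evalC, oddForm, hamPair, cxR, cxL, LinearMap.mk₂_apply, map_neg, LinearMap.neg_apply]
  push_cast
  ring

theorem evalC_oddForm_right (β : A' →ₗ[ℝ] A →ₗ[ℝ] ℝ) (β' : B' →ₗ[ℝ] B →ₗ[ℝ] ℝ) (w : B × A')
    (a : Cx A) (f : Cx B') :
    -evalC (fun e => (oddForm β β' e w : ℂ)) (hamPair a f) = cxL β' f w.1 + cxR β w.2 a := by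
  simp only [evalC, oddForm, hamPair, cxR, cxL, LinearMap.mk₂_apply, map_neg, LinearMap.neg_apply]
  push_cast
  ring

/-- The quadratic form of a free action: `½ ⟨P y, x⟩ + ⟨ξ, k y⟩` for `x = (x, ξ)`. -/
def actionForm (β : A' →ₗ[ℝ] A →ₗ[ℝ] ℝ) (β' : B' →ₗ[ℝ] B →ₗ[ℝ] ℝ) (P : A →ₗ[ℝ] Cx A')
    (k : A →ₗ[ℝ] Cx B) : A × B' →ₗ[ℝ] A × B' →ₗ[ℝ] ℂ :=
  LinearMap.mk₂ ℝ (fun x y => (1 / 2) * cxL β (P y.1) x.1 + cxR β' x.2 (k y.1))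
    (fun x x' y => by
      simp only [cxL, cxR, Prod.fst_add, Prod.snd_add, map_add, LinearMap.add_apply]
      push_cast; ring)
    (fun c x y => by
      simp only [cxL, cxR, Prod.smul_fst, Prod.smul_snd, map_smul, LinearMap.smul_apply, smul_eq_mul,
        Complex.real_smul]
      push_cast; ring)
    (fun x y y' => by
      simp only [cxL, cxR, Prod.fst_add, Prod.snd_add, map_add, LinearMap.add_apply]
      push_cast; ring)
    (fun c x y => by
      simp only [cxL, cxR, Prod.smul_fst, Prod.smul_snd, map_smul, LinearMap.smul_apply, smul_eq_mul,
        Complex.real_smul]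
      push_cast; ring)

theorem actionForm_apply (β : A' →ₗ[ℝ] A →ₗ[ℝ] ℝ) (β' : B' →ₗ[ℝ] B →ₗ[ℝ] ℝ) (P : A →ₗ[ℝ] Cx A')
    (k : A →ₗ[ℝ] Cx B) (x y : A × B') :
    actionForm β β' P k x y = (1 / 2) * cxL β (P y.1) x.1 + cxR β' x.2 (k y.1) := rfl

variable [TopologicalSpace A] [TopologicalSpace A'] [TopologicalSpace B] [TopologicalSpace B']

theorem continuous_actionForm {β : A' →ₗ[ℝ] A →ₗ[ℝ] ℝ} {β' : B' →ₗ[ℝ] B →ₗ[ℝ] ℝ}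
    (hβ : Continuous fun p : A' × A => β p.1 p.2) (hβ' : Continuous fun p : B' × B => β' p.1 p.2)
    (P : A →L[ℝ] Cx A') (k : A →L[ℝ] Cx B) :
    Continuous fun p : (A × B') × (A × B') => actionForm β β' (P : A →ₗ[ℝ] Cx A') (k : A →ₗ[ℝ] Cx B) p.1 p.2 := by
  simp only [actionForm_apply, cxL, cxR, ContinuousLinearMap.coe_coe]
  have h1 : Continuous fun p : (A × B') × (A × B') => β (P p.2.1).1 p.1.1 :=
    hβ.comp (f := fun p : (A × B') × (A × B') => ((P p.2.1).1, p.1.1)) (by fun_prop)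
  have h2 : Continuous fun p : (A × B') × (A × B') => β (P p.2.1).2 p.1.1 :=
    hβ.comp (f := fun p : (A × B') × (A × B') => ((P p.2.1).2, p.1.1)) (by fun_prop)
  have h3 : Continuous fun p : (A × B') × (A × B') => β' p.1.2 (k p.2.1).1 :=
    hβ'.comp (f := fun p : (A × B') × (A × B') => (p.1.2, (k p.2.1).1)) (by fun_prop)
  have h4 : Continuous fun p : (A × B') × (A × B') => β' p.1.2 (k p.2.1).2 :=
    hβ'.comp (f := fun p : (A × B') × (A × B') => (p.1.2, (k p.2.1).2)) (by fun_prop)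
  fun_prop

theorem continuous_oddForm_left {β : A' →ₗ[ℝ] A →ₗ[ℝ] ℝ} {β' : B' →ₗ[ℝ] B →ₗ[ℝ] ℝ}
    (hβ : Continuous fun p : A' × A => β p.1 p.2) (hβ' : Continuous fun p : B' × B => β' p.1 p.2)
    (e : A × B') : Continuous (oddForm β β' e) :=
  (hβ'.comp (f := fun w : B × A' => (e.2, w.1)) (by fun_prop)).sub
    (hβ.comp (f := fun w : B × A' => (w.2, e.1)) (by fun_prop))

theorem continuous_oddForm_right {β : A' →ₗ[ℝ] A →ₗ[ℝ] ℝ} {β' : B' →ₗ[ℝ] B →ₗ[ℝ] ℝ}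
    (hβ : Continuous fun p : A' × A => β p.1 p.2) (hβ' : Continuous fun p : B' × B => β' p.1 p.2)
    (w : B × A') : Continuous fun e => oddForm β β' e w :=
  (hβ'.comp (f := fun e : A × B' => (e.2, w.1)) (by fun_prop)).sub
    (hβ.comp (f := fun e : A × B' => (w.2, e.1)) (by fun_prop))

end Symplectic

/-! ### The action on configurations supported in a fixed compact set -/

section CompactPairing

variable {d : ℕ} {M : Type*} [TopologicalSpace M] [ChartedSpace (EuclideanSpace ℝ (Fin d)) M]
  [IsManifold (𝓡 d) ∞ M]
  {F : Type*} [NormedAddCommGroup F] [NormedSpace ℝ F]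
  {B : M → Type*} [TopologicalSpace (TotalSpace F B)] [∀ x, TopologicalSpace (B x)]
  [FiberBundle F B] [∀ x, AddCommGroup (B x)] [∀ x, Module ℝ (B x)] [VectorBundle ℝ F B]
  [ContMDiffVectorBundle ∞ F B (𝓡 d)]
  [∀ x, IsTopologicalAddGroup (B x)] [∀ x, ContinuousSMul ℝ (B x)]
  [MeasurableSpace M] [T2Space M] [BorelSpace M] (μ : Measure M) [IsFiniteMeasureOnCompacts μ]

variable (F B) in
/-- The pairing of covector fields with fields by integration over a compact set `L`. It is defined
on all sections, and agrees with the pairing over `M` if one of them is supported in `L`. -/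
def lp {L : Set M} (hL : IsCompact L) : CoSec d F B →ₗ[ℝ] Sec d F B →ₗ[ℝ] ℝ :=
  have hi : ∀ (ξ : CoSec d F B) (u : Sec d F B), IntegrableOn (fun x => ξ x (u x)) L μ := fun ξ u =>
    (contMDiff_fiberPair ξ u).continuous.continuousOn.integrableOn_compact hL
  LinearMap.mk₂ ℝ (fun ξ u => ∫ x in L, ξ x (u x) ∂μ)
    (fun _ _ _ => integral_add (hi _ _) (hi _ _))
    (fun c _ _ => integral_const_mul c _)
    (fun ξ _ _ => (integral_congr_ae (Eventually.of_forall fun x => map_add (ξ x) _ _)).trans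
      (integral_add (hi _ _) (hi _ _)))
    (fun c ξ _ => (integral_congr_ae (Eventually.of_forall fun x => map_smul (ξ x) c _)).trans
      (integral_const_mul c _))

variable {μ}

theorem continuous_lp {L : Set M} (hL : IsCompact L) :
    Continuous fun q : CoSec d F B × Sec d F B => lp F B μ hL q.1 q.2 :=
  continuous_setIntegral_fiberPair hL

theorem cxL_lp {L : Set M} (hL : IsCompact L) (ξ : Cx (CoSec d F B)) {u : Sec d F B}
    (hu : u ∈ secIn d F B L) : cxL (lp F B μ hL) ξ u = pair μ ξ u := by
  rw [pair_eq, rpair_eq_setIntegral (Or.inr hu), rpair_eq_setIntegral (Or.inr hu)]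
  rfl

theorem cxR_lp {L : Set M} (hL : IsCompact L) {ξ : CoSec d F B} (hξ : ξ ∈ secIn d _ _ L)
    (u : Cx (Sec d F B)) : cxR (lp F B μ hL) ξ u = copair μ ξ u := by
  rw [copair_eq, rpair_eq_setIntegral (Or.inl hξ), rpair_eq_setIntegral (Or.inl hξ)]
  rfl

theorem pair_zero_left (u : Sec d F B) : pair μ 0 u = 0 := by simp [pair]

theorem copair_zero_right (ξ : CoSec d F B) : copair μ ξ 0 = 0 := by simp [copair]

theorem pair_neg_left (ξ : Cx (CoSec d F B)) (u : Sec d F B) : pair μ (-ξ) u = -pair μ ξ u := by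
  rw [pair_eq, pair_eq, Prod.fst_neg, Prod.snd_neg, rpair_neg_left, rpair_neg_left]
  push_cast
  ring

theorem isCompactlySupported_of_mem {L : Set M} (hL : IsCompact L) {s : Sec d F B}
    (h : s ∈ secIn d F B L) : IsCompactlySupported s := isCompactlySupported_iff.2 ⟨L, hL, h⟩

end CompactPairing

section QuadraticRestrict

variable {S₀ S₁ : Type u} [AddCommGroup S₀] [Module ℝ S₀] [TopologicalSpace S₀]
  [LCTVS S₀] [AddCommGroup S₁] [Module ℝ S₁] [TopologicalSpace S₁] [LCTVS S₁]
  {T₀ : Submodule ℝ S₀} {T₁ : Submodule ℝ S₁}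

theorem dirD_pull {W : Type*} [AddCommGroup W] [Module ℝ W] [TopologicalSpace W] [LCTVS W]
    (X : SFun S₀ S₁ W) (n : ℕ) (φ e : T₀) (o : Fin n → T₁) :
    dirD (fun φ' => pull T₀.subtypeL T₁.subtypeL X n φ' o) φ e =
      dirD (fun φ' => X n φ' (T₁.subtypeL ∘ o)) φ.1 e.1 :=
  dirD_congr_line fun _ => rfl

theorem dirD_pull_quadS_zero (b : S₀ →ₗ[ℝ] S₀ →ₗ[ℝ] ℂ) (c : S₁ →ₗ[ℝ] S₁ →ₗ[ℝ] ℂ) (φ e : T₀)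
    (o : Fin 0 → T₁) :
    dirD (fun φ' => pull T₀.subtypeL T₁.subtypeL (quadS b c) 0 φ' o) φ e = b φ.1 e.1 + b e.1 φ.1 :=
  (dirD_pull _ _ _ _ _).trans (dirD_quadS _ _ _ _)

theorem dirD_pull_quadS_succ (b : S₀ →ₗ[ℝ] S₀ →ₗ[ℝ] ℂ) (c : S₁ →ₗ[ℝ] S₁ →ₗ[ℝ] ℂ) {n : ℕ}
    (φ e : T₀) (o : Fin (n + 1) → T₁) :
    dirD (fun φ' => pull T₀.subtypeL T₁.subtypeL (quadS b c) (n + 1) φ' o) φ e = 0 := by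
  refine HasDD.dirD_eq ?_
  refine tendsto_const_nhds.congr fun t => ?_
  match n with
  | 0 => exact ((congrArg (t⁻¹ • ·) (sub_self (0 : ℂ))).trans (smul_zero _)).symm
  | 1 => exact ((congrArg (t⁻¹ • ·) (sub_self _)).trans (smul_zero _)).symm
  | n + 2 => exact ((congrArg (t⁻¹ • ·) (sub_self (0 : ℂ))).trans (smul_zero _)).symm

end QuadraticRestrict

section BV

variable {d : ℕ} {M : Type*} [TopologicalSpace M] [ChartedSpace (EuclideanSpace ℝ (Fin d)) M]
  [IsManifold (𝓡 d) ∞ M]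
  {F₀ : Type*} [NormedAddCommGroup F₀] [NormedSpace ℝ F₀]
  {B₀ : M → Type*} [TopologicalSpace (TotalSpace F₀ B₀)] [∀ x, TopologicalSpace (B₀ x)]
  [FiberBundle F₀ B₀] [∀ x, AddCommGroup (B₀ x)] [∀ x, Module ℝ (B₀ x)] [VectorBundle ℝ F₀ B₀]
  [ContMDiffVectorBundle ∞ F₀ B₀ (𝓡 d)]
  [∀ x, IsTopologicalAddGroup (B₀ x)] [∀ x, ContinuousSMul ℝ (B₀ x)]
  {F₁ : Type*} [NormedAddCommGroup F₁] [NormedSpace ℝ F₁]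
  {B₁ : M → Type*} [TopologicalSpace (TotalSpace F₁ B₁)] [∀ x, TopologicalSpace (B₁ x)]
  [FiberBundle F₁ B₁] [∀ x, AddCommGroup (B₁ x)] [∀ x, Module ℝ (B₁ x)] [VectorBundle ℝ F₁ B₁]
  [ContMDiffVectorBundle ∞ F₁ B₁ (𝓡 d)]
  [∀ x, IsTopologicalAddGroup (B₁ x)] [∀ x, ContinuousSMul ℝ (B₁ x)]

variable (d F₀ B₀ F₁ B₁) in
/-- The even parts of the configurations which are supported in `L`. -/
def evIn (L : Set M) : Submodule ℝ (EvenPart d F₀ B₀ F₁ B₁) :=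
  (secIn d F₀ B₀ L).prod (secIn d _ _ L)

variable (d F₀ B₀ F₁ B₁) in
/-- The odd parts of the configurations which are supported in `L`. -/
def odIn (L : Set M) : Submodule ℝ (OddPart d F₀ B₀ F₁ B₁) :=
  (secIn d F₁ B₁ L).prod (secIn d _ _ L)

theorem isClosed_evIn (L : Set M) : IsClosed (evIn d F₀ B₀ F₁ B₁ L : Set (EvenPart d F₀ B₀ F₁ B₁)) :=
  (isClosed_secIn L).prod (isClosed_secIn L)

theorem isClosed_odIn (L : Set M) : IsClosed (odIn d F₀ B₀ F₁ B₁ L : Set (OddPart d F₀ B₀ F₁ B₁)) :=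
  (isClosed_secIn L).prod (isClosed_secIn L)

variable [MeasurableSpace M] {μ : Measure M}

theorem IsGradient.dirD_eq {V : SFun (EvenPart d F₀ B₀ F₁ B₁) (OddPart d F₀ B₀ F₁ B₁) ℂ}
    {G : Grad d F₀ B₀ F₁ B₁} (hG : IsGradient μ V G) (hV : Reg V) (n : ℕ)
    (φ e : EvenPart d F₀ B₀ F₁ B₁) (o : Fin n → OddPart d F₀ B₀ F₁ B₁) :
    dirD (fun φ' => V n φ' o) φ e = pair μ (G.f₀ n φ o) e.1 + copair μ e.2 (G.a₁ n φ o) := by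
  have h := (hV.lin_dirD n φ o).map_add (e.1, 0) (0, e.2)
  rw [Prod.mk_add_mk, add_zero, zero_add] at h
  rw [← (hG n φ o).1, ← (hG n φ o).2.2.2, lineDeriv_eq_dirD, lineDeriv_eq_dirD]
  exact h

theorem IsGradient.cons_eq {V : SFun (EvenPart d F₀ B₀ F₁ B₁) (OddPart d F₀ B₀ F₁ B₁) ℂ}
    {G : Grad d F₀ B₀ F₁ B₁} (hG : IsGradient μ V G) (hV : Reg V) (n : ℕ)
    (φ : EvenPart d F₀ B₀ F₁ B₁) (o : Fin n → OddPart d F₀ B₀ F₁ B₁)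
    (w : OddPart d F₀ B₀ F₁ B₁) :
    V (n + 1) φ (Fin.cons w o) = pair μ (G.f₁ n φ o) w.1 + copair μ w.2 (G.a₀ n φ o) := by
  have h := (hV.lin n φ o).map_add (w.1, 0) (0, w.2)
  rw [Prod.mk_add_mk, add_zero, zero_add] at h
  rw [← (hG n φ o).2.1, ← (hG n φ o).2.2.1]
  exact h

variable [T2Space M] [BorelSpace M] [IsFiniteMeasureOnCompacts μ]

variable (S₀ : FreeAction d F₀ B₀ F₁ B₁ μ)

/-- On the configurations supported in a compact set, the free action is a quadratic functional on
a topological vector space. -/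
theorem FreeAction.pull_toFun {L : Set M} (hL : IsCompact L) :
    pull (evIn d F₀ B₀ F₁ B₁ L).subtypeL (odIn d F₀ B₀ F₁ B₁ L).subtypeL S₀.toFun =
      pull (evIn d F₀ B₀ F₁ B₁ L).subtypeL (odIn d F₀ B₀ F₁ B₁ L).subtypeL
        (quadS (actionForm (lp F₀ B₀ μ hL) (lp F₁ B₁ μ hL) (S₀.P₀ : _ →ₗ[ℝ] _) (S₀.K₁₀ : _ →ₗ[ℝ] _))
          (actionForm (lp F₁ B₁ μ hL) (lp F₀ B₀ μ hL) (S₀.P₁ : _ →ₗ[ℝ] _)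
            (S₀.K₀₁ : _ →ₗ[ℝ] _))) := by
  funext n φ o
  match n with
  | 0 =>
    show _ = (1 / 2) * cxL (lp F₀ B₀ μ hL) (S₀.P₀ φ.1.1) φ.1.1 +
      cxR (lp F₁ B₁ μ hL) φ.1.2 (S₀.K₁₀ φ.1.1)
    rw [cxL_lp hL _ φ.2.1, cxR_lp hL φ.2.2]
    rfl
  | 1 => rfl
  | 2 =>
    show _ = ((1 / 2) * cxL (lp F₁ B₁ μ hL) (S₀.P₁ (o 1).1.1) (o 0).1.1 +
      cxR (lp F₀ B₀ μ hL) (o 0).1.2 (S₀.K₀₁ (o 1).1.1)) -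
      ((1 / 2) * cxL (lp F₁ B₁ μ hL) (S₀.P₁ (o 0).1.1) (o 1).1.1 +
      cxR (lp F₀ B₀ μ hL) (o 1).1.2 (S₀.K₀₁ (o 0).1.1))
    rw [cxL_lp hL _ (o 0).2.1, cxL_lp hL _ (o 1).2.1, cxR_lp hL (o 0).2.2, cxR_lp hL (o 1).2.2]
    show (1 / 2) * (pair μ (S₀.P₁ (o 1).1.1) (o 0).1.1 - pair μ (S₀.P₁ (o 0).1.1) (o 1).1.1) +
      (copair μ (o 0).1.2 (S₀.K₀₁ (o 1).1.1) - copair μ (o 1).1.2 (S₀.K₀₁ (o 0).1.1)) = _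
    ring
  | n + 3 => rfl

theorem FreeAction.reg_pull_toFun {L : Set M} (hL : IsCompact L) :
    Reg (pull (evIn d F₀ B₀ F₁ B₁ L).subtypeL (odIn d F₀ B₀ F₁ B₁ L).subtypeL S₀.toFun) := by
  rw [S₀.pull_toFun hL]
  exact (Reg.quadS (continuous_actionForm (continuous_lp hL) (continuous_lp hL) S₀.P₀ S₀.K₁₀)
    (continuous_actionForm (continuous_lp hL) (continuous_lp hL) S₀.P₁ S₀.K₀₁)).pull _ _

theorem FreeAction.dirD_toFun {L : Set M} (hL : IsCompact L) (n : ℕ)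
    (φ e : evIn d F₀ B₀ F₁ B₁ L) (o : Fin n → odIn d F₀ B₀ F₁ B₁ L) :
    dirD (fun φ' => pull (evIn d F₀ B₀ F₁ B₁ L).subtypeL (odIn d F₀ B₀ F₁ B₁ L).subtypeL
        S₀.toFun n φ' o) φ e =
      pair μ (S₀.grad.f₀ n φ.1 ((odIn d F₀ B₀ F₁ B₁ L).subtypeL ∘ o)) e.1.1 +
      copair μ e.1.2 (S₀.grad.a₁ n φ.1 ((odIn d F₀ B₀ F₁ B₁ L).subtypeL ∘ o)) := by
  rw [S₀.pull_toFun hL]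
  match n with
  | 0 =>
    refine (dirD_pull_quadS_zero _ _ φ e o).trans ?_
    rw [actionForm_apply, actionForm_apply, cxL_lp hL _ φ.2.1,
      cxL_lp hL _ e.2.1, cxR_lp hL φ.2.2, cxR_lp hL e.2.2]
    show (1 / 2) * pair μ (S₀.P₀ e.1.1) φ.1.1 + copair μ φ.1.2 (S₀.K₁₀ e.1.1) +
      ((1 / 2) * pair μ (S₀.P₀ φ.1.1) e.1.1 + copair μ e.1.2 (S₀.K₁₀ φ.1.1)) =
      pair μ (S₀.P₀ φ.1.1 + S₀.K₁₀t φ.1.2) e.1.1 + copair μ e.1.2 (S₀.K₁₀ φ.1.1)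
    rw [pair_add_left (Or.inr (isCompactlySupported_of_mem hL e.2.1)),
      S₀.symm_P₀ e.1.1 φ.1.1 (isCompactlySupported_of_mem hL e.2.1)
        (isCompactlySupported_of_mem hL φ.2.1),
      S₀.transpose_K₁₀ φ.1.2 e.1.1 (isCompactlySupported_of_mem hL φ.2.2)
        (isCompactlySupported_of_mem hL e.2.1)]
    ring
  | n + 1 =>
    refine (dirD_pull_quadS_succ _ _ φ e o).trans ?_
    show _ = pair μ 0 _ + copair μ _ 0
    rw [pair_zero_left, copair_zero_right, add_zero]

theorem FreeAction.cons_toFun {L : Set M} (hL : IsCompact L) (n : ℕ)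
    (φ : evIn d F₀ B₀ F₁ B₁ L) (o : Fin n → odIn d F₀ B₀ F₁ B₁ L) (w : odIn d F₀ B₀ F₁ B₁ L) :
    S₀.toFun (n + 1) φ.1 (Fin.cons w.1 ((odIn d F₀ B₀ F₁ B₁ L).subtypeL ∘ o)) =
      pair μ (S₀.grad.f₁ n φ.1 ((odIn d F₀ B₀ F₁ B₁ L).subtypeL ∘ o)) w.1.1 +
      copair μ w.1.2 (S₀.grad.a₀ n φ.1 ((odIn d F₀ B₀ F₁ B₁ L).subtypeL ∘ o)) := by
  match n with
  | 0 =>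
    show (0 : ℂ) = pair μ 0 _ + copair μ _ 0
    rw [pair_zero_left, copair_zero_right, add_zero]
  | 1 =>
    set v := o 0
    have hv : pair μ (S₀.P₁ v.1.1 - S₀.K₀₁t v.1.2) w.1.1 =
        pair μ (S₀.P₁ v.1.1) w.1.1 - pair μ (S₀.K₀₁t v.1.2) w.1.1 := by
      rw [sub_eq_add_neg, pair_add_left (Or.inr (isCompactlySupported_of_mem hL w.2.1)),
        pair_neg_left, sub_eq_add_neg]
    show (1 / 2) * (pair μ (S₀.P₁ v.1.1) w.1.1 - pair μ (S₀.P₁ w.1.1) v.1.1) +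
      (copair μ w.1.2 (S₀.K₀₁ v.1.1) - copair μ v.1.2 (S₀.K₀₁ w.1.1)) =
      pair μ (S₀.P₁ v.1.1 - S₀.K₀₁t v.1.2) w.1.1 + copair μ w.1.2 (S₀.K₀₁ v.1.1)
    rw [hv, S₀.skew_P₁ w.1.1 v.1.1 (isCompactlySupported_of_mem hL w.2.1)
        (isCompactlySupported_of_mem hL v.2.1),
      S₀.transpose_K₀₁ v.1.2 w.1.1 (isCompactlySupported_of_mem hL v.2.2)
        (isCompactlySupported_of_mem hL w.2.1)]
    ring
  | n + 2 =>
    show (0 : ℂ) = pair μ 0 _ + copair μ _ 0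
    rw [pair_zero_left, copair_zero_right, add_zero]

end BV

/-! ### The square of the Hamiltonian vector field of the action -/

theorem evalC_ofReal_eq_zero {W : Type*} {f : W → ℝ} {w : Cx W}
    (h : evalC (fun x => (f x : ℂ)) w = 0) : f w.1 = 0 ∧ f w.2 = 0 := by
  unfold evalC at h
  exact ⟨by simpa using congrArg Complex.re h, by simpa using congrArg Complex.im h⟩

/-- A superfunction with values in a Hausdorff space vanishes if it does so for arguments in
dense sets. -/
theorem Reg.eq_zero_of_dense {S₀ S₁ W : Type*} [AddCommGroup S₀] [Module ℝ S₀] [TopologicalSpace S₀]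
    [AddCommGroup S₁] [Module ℝ S₁] [TopologicalSpace S₁]
    [AddCommGroup W] [Module ℝ W] [TopologicalSpace W] [T2Space W] {X : SFun S₀ S₁ W} (hX : Reg X)
    {D₀ : Set S₀} {D₁ : Set S₁} (h0 : Dense D₀) (h1 : Dense D₁)
    (h : ∀ n, ∀ φ ∈ D₀, ∀ o : Fin n → S₁, (∀ i, o i ∈ D₁) → X n φ o = 0) : X = 0 := by
  funext n φ o
  have hd : Dense (D₀ ×ˢ Set.pi univ fun _ : Fin n => D₁) :=
    h0.prod (dense_pi univ fun _ _ => h1)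
  have hc : Continuous fun p : S₀ × (Fin n → S₁) => X n p.1 p.2 := (hX.smooth n).continuous
  exact congrFun (hc.ext_on hd (g := fun _ => 0) continuous_const fun p hp =>
    h n p.1 hp.1 p.2 fun i => hp.2 i (mem_univ i)) (φ, o)

section CoprodL

variable {A B W : Type*} [AddCommGroup A] [Module ℝ A] [TopologicalSpace A]
  [AddCommGroup B] [Module ℝ B] [TopologicalSpace B]
  [AddCommGroup W] [Module ℝ W] [TopologicalSpace W] [IsTopologicalAddGroup W]

/-- The linear map `(x, y) ↦ P x + K y`. -/
def coprodL (P : A →L[ℝ] W) (K : B →L[ℝ] W) : A × B →L[ℝ] W := P.coprod K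

/-- The negative of a linear map. -/
def negL (K : B →L[ℝ] W) : B →L[ℝ] W := -K

end CoprodL

section BV

variable {d : ℕ} {M : Type*} [TopologicalSpace M] [ChartedSpace (EuclideanSpace ℝ (Fin d)) M]
  [IsManifold (𝓡 d) ∞ M]
  {F₀ : Type*} [NormedAddCommGroup F₀] [NormedSpace ℝ F₀]
  {B₀ : M → Type*} [TopologicalSpace (TotalSpace F₀ B₀)] [∀ x, TopologicalSpace (B₀ x)]
  [FiberBundle F₀ B₀] [∀ x, AddCommGroup (B₀ x)] [∀ x, Module ℝ (B₀ x)] [VectorBundle ℝ F₀ B₀]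
  [ContMDiffVectorBundle ∞ F₀ B₀ (𝓡 d)]
  [∀ x, IsTopologicalAddGroup (B₀ x)] [∀ x, ContinuousSMul ℝ (B₀ x)]
  {F₁ : Type*} [NormedAddCommGroup F₁] [NormedSpace ℝ F₁]
  {B₁ : M → Type*} [TopologicalSpace (TotalSpace F₁ B₁)] [∀ x, TopologicalSpace (B₁ x)]
  [FiberBundle F₁ B₁] [∀ x, AddCommGroup (B₁ x)] [∀ x, Module ℝ (B₁ x)] [VectorBundle ℝ F₁ B₁]
  [ContMDiffVectorBundle ∞ F₁ B₁ (𝓡 d)]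
  [∀ x, IsTopologicalAddGroup (B₁ x)] [∀ x, ContinuousSMul ℝ (B₁ x)]

variable [MeasurableSpace M] {μ : Measure M} (S₀ : FreeAction d F₀ B₀ F₁ B₁ μ)

/-- The derivative of the free action with respect to the even fields. -/
def FreeAction.f₀L : EvenPart d F₀ B₀ F₁ B₁ →L[ℝ] Cx (CoSec d F₀ B₀) :=
  coprodL S₀.P₀ S₀.K₁₀t

/-- The derivative of the free action with respect to the odd fields. -/
def FreeAction.f₁L : OddPart d F₀ B₀ F₁ B₁ →L[ℝ] Cx (CoSec d F₁ B₁) :=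
  coprodL S₀.P₁ (negL S₀.K₀₁t)

/-- The derivative of the free action with respect to the antifields of the even fields. -/
def FreeAction.a₀L : OddPart d F₀ B₀ F₁ B₁ →L[ℝ] Cx (Sec d F₀ B₀) :=
  S₀.K₀₁.comp (ContinuousLinearMap.fst ℝ (Sec d F₁ B₁) (CoSec d F₀ B₀))

/-- The derivative of the free action with respect to the antifields of the odd fields. -/
def FreeAction.a₁L : EvenPart d F₀ B₀ F₁ B₁ →L[ℝ] Cx (Sec d F₁ B₁) :=
  S₀.K₁₀.comp (ContinuousLinearMap.fst ℝ (Sec d F₀ B₀) (CoSec d F₁ B₁))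

/-- The action of the free Hamiltonian vector field on the even variables. -/
def FreeAction.evOp : EvenPart d F₀ B₀ F₁ B₁ →L[ℝ] Cx (OddPart d F₀ B₀ F₁ B₁) :=
  (hamPairL (Sec d F₁ B₁) (CoSec d F₀ B₀)).comp (S₀.a₁L.prod S₀.f₀L)

/-- The action of the free Hamiltonian vector field on the odd variables. -/
def FreeAction.odOp : OddPart d F₀ B₀ F₁ B₁ →L[ℝ] Cx (EvenPart d F₀ B₀ F₁ B₁) :=
  (hamPairL (Sec d F₀ B₀) (CoSec d F₁ B₁)).comp (S₀.a₀L.prod S₀.f₁L)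

theorem FreeAction.grad_f₀ : S₀.grad.f₀ = linEv S₀.f₀L := by
  funext n; rcases n with _ | n <;> rfl

theorem FreeAction.grad_f₁ : S₀.grad.f₁ = linOd S₀.f₁L := by
  funext n φ o
  rcases n with _ | _ | n
  · rfl
  · exact sub_eq_add_neg _ _
  · rfl

theorem FreeAction.grad_a₀ : S₀.grad.a₀ = linOd S₀.a₀L := by
  funext n; rcases n with _ | _ | n <;> rfl

theorem FreeAction.grad_a₁ : S₀.grad.a₁ = linEv S₀.a₁L := by
  funext n; rcases n with _ | n <;> rfl

theorem FreeAction.ham_grad : ham S₀.grad = linV S₀.evOp S₀.odOp := by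
  have h1 := hamPair_linOd (S₀ := EvenPart d F₀ B₀ F₁ B₁) S₀.a₀L S₀.f₁L
  have h2 := hamPair_linEv (S₁ := OddPart d F₀ B₀ F₁ B₁) S₀.a₁L S₀.f₀L
  rw [← S₀.grad_a₀, ← S₀.grad_f₁] at h1
  rw [← S₀.grad_a₁, ← S₀.grad_f₀] at h2
  exact congrArg₂ SVec.mk h1 h2

/-- The gradient of a functional is regular. -/
structure RegG (G : Grad d F₀ B₀ F₁ B₁) : Prop where
  f₀ : Reg G.f₀
  f₁ : Reg G.f₁
  a₀ : Reg G.a₀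
  a₁ : Reg G.a₁

theorem RegG.ham {G : Grad d F₀ B₀ F₁ B₁} (h : RegG G) : RegV (ham G) :=
  ⟨h.a₀.hamPair h.f₁, h.a₁.hamPair h.f₀⟩

theorem FreeAction.regG_grad : RegG S₀.grad :=
  ⟨S₀.grad_f₀ ▸ Reg.linEv _, S₀.grad_f₁ ▸ Reg.linOd _, S₀.grad_a₀ ▸ Reg.linOd _,
    S₀.grad_a₁ ▸ Reg.linEv _⟩

theorem IsInteraction.regG {V : SFun (EvenPart d F₀ B₀ F₁ B₁) (OddPart d F₀ B₀ F₁ B₁) ℂ}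
    {G : Grad d F₀ B₀ F₁ B₁} (h : IsInteraction μ V G) : RegG G :=
  ⟨isSmooth_iff_reg.1 h.smooth_f₀, isSmooth_iff_reg.1 h.smooth_f₁, isSmooth_iff_reg.1 h.smooth_a₀,
    isSmooth_iff_reg.1 h.smooth_a₁⟩

variable {S₀} {V : FSeries (EvenPart d F₀ B₀ F₁ B₁) (OddPart d F₀ B₀ F₁ B₁) ℂ}
  {G : ℕ → Grad d F₀ B₀ F₁ B₁}

theorem FreeAction.regG_totalGrad (hV : ∀ k, IsInteraction μ (V k) (G k)) :
    ∀ k, RegG (S₀.totalGrad G k)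
  | 0 => S₀.regG_grad
  | k + 1 => (hV k).regG

theorem FreeAction.funParity_totalAction (hV : ∀ k, IsInteraction μ (V k) (G k)) (k n : ℕ)
    (φ : EvenPart d F₀ B₀ F₁ B₁) (o : Fin n → OddPart d F₀ B₀ F₁ B₁) :
    (((-1 : ℤˣ) ^ n : ℤˣ) : ℤ) • S₀.totalAction V k n φ o =
      ((1 : ℤˣ) : ℤ) • S₀.totalAction V k n φ o := by
  rcases Nat.even_or_odd n with hn | hn
  · rw [hn.neg_one_pow]
  · have h0 : S₀.totalAction V k n φ o = 0 := by
      match k with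
      | 0 =>
        match n with
        | 1 => rfl
        | 2 => exact absurd hn (by decide)
        | n + 3 => rfl
      | k + 1 => exact (hV k).even n hn φ o
    rw [h0, smul_zero, smul_zero]

variable [T2Space M] [BorelSpace M] [IsFiniteMeasureOnCompacts μ]

/-- On configurations supported in a compact set, the Hamiltonian vector field consists of the
derivatives of the action. -/
theorem FreeAction.dirD_totalAction (hV : ∀ k, IsInteraction μ (V k) (G k)) {L : Set M}
    (hL : IsCompact L) (i n : ℕ) (φ e : evIn d F₀ B₀ F₁ B₁ L) (o : Fin n → odIn d F₀ B₀ F₁ B₁ L) :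
    dirD (fun φ' : evIn d F₀ B₀ F₁ B₁ L => S₀.totalAction V i n
        ((evIn d F₀ B₀ F₁ B₁ L).subtypeL φ') ((odIn d F₀ B₀ F₁ B₁ L).subtypeL ∘ o)) φ e =
      evalC (fun w => (oddForm (lp F₀ B₀ μ hL) (lp F₁ B₁ μ hL) e.1 w : ℂ))
        ((ham (S₀.totalGrad G i)).od n φ.1 ((odIn d F₀ B₀ F₁ B₁ L).subtypeL ∘ o)) := by
  refine Eq.trans ?_ (evalC_oddForm_left _ _ _ _ _).symm
  rw [cxR_lp hL e.2.2, cxL_lp hL _ e.2.1, add_comm]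
  match i with
  | 0 => exact S₀.dirD_toFun hL n φ e o
  | i + 1 =>
    exact (dirD_pull (V i) n φ e o).trans
      ((hV i).gradient.dirD_eq (isSmooth_iff_reg.1 (hV i).smooth) n φ.1 e.1 _)

theorem FreeAction.cons_totalAction (hV : ∀ k, IsInteraction μ (V k) (G k)) {L : Set M}
    (hL : IsCompact L) (i n : ℕ) (φ : evIn d F₀ B₀ F₁ B₁ L) (o : Fin n → odIn d F₀ B₀ F₁ B₁ L)
    (w : odIn d F₀ B₀ F₁ B₁ L) :
    S₀.totalAction V i (n + 1) φ.1
        ((odIn d F₀ B₀ F₁ B₁ L).subtypeL ∘ (Fin.cons w o : Fin (n + 1) → odIn d F₀ B₀ F₁ B₁ L)) =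
      -evalC (fun h => (oddForm (lp F₀ B₀ μ hL) (lp F₁ B₁ μ hL) h w.1 : ℂ))
        ((ham (S₀.totalGrad G i)).ev n φ.1 ((odIn d F₀ B₀ F₁ B₁ L).subtypeL ∘ o)) := by
  refine Eq.trans ?_ (evalC_oddForm_right _ _ _ _ _).symm
  rw [cxL_lp hL _ w.2.1, cxR_lp hL w.2.2]
  have hc : (odIn d F₀ B₀ F₁ B₁ L).subtypeL ∘
      (Fin.cons w o : Fin (n + 1) → odIn d F₀ B₀ F₁ B₁ L) =
      Fin.cons w.1 ((odIn d F₀ B₀ F₁ B₁ L).subtypeL ∘ o) := by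
    funext i; refine Fin.cases rfl (fun _ => rfl) i
  rw [hc]
  match i with
  | 0 => exact S₀.cons_toFun hL n φ o w
  | i + 1 => exact (hV i).gradient.cons_eq (isSmooth_iff_reg.1 (hV i).smooth) n φ.1 _ w.1

theorem FreeAction.reg_pull_totalAction (hV : ∀ k, IsInteraction μ (V k) (G k)) {L : Set M}
    (hL : IsCompact L) : ∀ i, Reg (pull (evIn d F₀ B₀ F₁ B₁ L).subtypeL
      (odIn d F₀ B₀ F₁ B₁ L).subtypeL (S₀.totalAction V i))
  | 0 => S₀.reg_pull_toFun hL
  | i + 1 => (isSmooth_iff_reg.1 (hV i).smooth).pull _ _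

end BV

section Square

variable {S₀ S₁ : Type u} [AddCommGroup S₀] [Module ℝ S₀] [TopologicalSpace S₀]
  [LCTVS S₀] [AddCommGroup S₁] [Module ℝ S₁] [TopologicalSpace S₁] [LCTVS S₁]

/-- The square of a formal power series of odd vector fields. -/
def sqV (Q : ℕ → SVec S₀ S₁) (n : ℕ) : SVec S₀ S₁ :=
  ⟨∑ x ∈ Finset.HasAntidiagonal.antidiagonal n, (actV (Q x.2) (Q x.1)).ev,
    ∑ x ∈ Finset.HasAntidiagonal.antidiagonal n, (actV (Q x.2) (Q x.1)).od⟩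

theorem RegV.sqV {Q : ℕ → SVec S₀ S₁} (hQ : ∀ k, RegV (Q k)) (n : ℕ) : RegV (sqV Q n) :=
  ⟨Reg.sum (Finset.HasAntidiagonal.antidiagonal n) fun x _ => ((hQ x.2).actV (hQ x.1)).ev,
    Reg.sum (Finset.HasAntidiagonal.antidiagonal n) fun x _ => ((hQ x.2).actV (hQ x.1)).od⟩

/-- `sum_actV_eq_zero_on` in terms of `contractSeries` and `sqV`, which keep the sums over the
antidiagonal out of statements about sections. -/
theorem sqV_eq_zero_on {Ω : S₀ →ₗ[ℝ] S₁ →ₗ[ℝ] ℝ} (h1 : ∀ h, Continuous (Ω h))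
    (h2 : ∀ w, Continuous fun h => Ω h w) {S : ℕ → SFun S₀ S₁ ℂ} {Q : ℕ → SVec S₀ S₁} {n : ℕ}
    {T₀ : Submodule ℝ S₀} {T₁ : Submodule ℝ S₁} (hT₀ : IsClosed (T₀ : Set S₀))
    (hT₁ : IsClosed (T₁ : Set S₁))
    (hS : ∀ i ≤ n, Reg (pull T₀.subtypeL T₁.subtypeL (S i))) (hQ : ∀ i, RegV (Q i))
    (hT : ∀ i ≤ n, Preserves (Q i) T₀ T₁)
    (hev : ∀ i ≤ n, ∀ m (φ : T₀) (o : Fin m → T₁) (e : T₀),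
      dirD (fun φ' : T₀ => S i m (T₀.subtypeL φ') (T₁.subtypeL ∘ o)) φ e =
        evalC (fun w => (Ω e w : ℂ)) ((Q i).od m (T₀.subtypeL φ) (T₁.subtypeL ∘ o)))
    (hod : ∀ i ≤ n, ∀ m (φ : T₀) (o : Fin m → T₁) (w : T₁),
      S i (m + 1) (T₀.subtypeL φ) (T₁.subtypeL ∘ (Fin.cons w o : Fin (m + 1) → T₁)) =
        -evalC (fun h => (Ω h w : ℂ)) ((Q i).ev m (T₀.subtypeL φ) (T₁.subtypeL ∘ o)))
    (hp : ∀ i ≤ n, FunParity 1 (S i))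
    (hcme : ∀ p (φ : T₀) (o : Fin p → T₁),
      contractSeries S Q n p (T₀.subtypeL φ) (T₁.subtypeL ∘ o) = 0)
    (p : ℕ) (φ : T₀) (o : Fin p → T₁) :
    (∀ h : T₀, evalC (fun w => (Ω h w : ℂ))
      ((sqV Q n).od p (T₀.subtypeL φ) (T₁.subtypeL ∘ o)) = 0) ∧
    ∀ w : T₁, evalC (fun h => (Ω h w : ℂ))
      ((sqV Q n).ev p (T₀.subtypeL φ) (T₁.subtypeL ∘ o)) = 0 := by
  simp only [sqV, Finset.sum_apply]
  refine sum_actV_eq_zero_on h1 h2 hT₀ hT₁ hS hQ hT hev hod hp (fun p φ o => ?_) p φ o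
  have h := hcme p φ o
  rw [contractSeries_eq] at h
  simpa only [Finset.sum_apply] using h

end Square

section MasterEquation

variable {d : ℕ} {M : Type*} [TopologicalSpace M] [ChartedSpace (EuclideanSpace ℝ (Fin d)) M]
  [IsManifold (𝓡 d) ∞ M]
  {F₀ : Type*} [NormedAddCommGroup F₀] [NormedSpace ℝ F₀]
  {B₀ : M → Type*} [TopologicalSpace (TotalSpace F₀ B₀)] [∀ x, TopologicalSpace (B₀ x)]
  [FiberBundle F₀ B₀] [∀ x, AddCommGroup (B₀ x)] [∀ x, Module ℝ (B₀ x)] [VectorBundle ℝ F₀ B₀]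
  [ContMDiffVectorBundle ∞ F₀ B₀ (𝓡 d)]
  [∀ x, IsTopologicalAddGroup (B₀ x)] [∀ x, ContinuousSMul ℝ (B₀ x)]
  {F₁ : Type*} [NormedAddCommGroup F₁] [NormedSpace ℝ F₁]
  {B₁ : M → Type*} [TopologicalSpace (TotalSpace F₁ B₁)] [∀ x, TopologicalSpace (B₁ x)]
  [FiberBundle F₁ B₁] [∀ x, AddCommGroup (B₁ x)] [∀ x, Module ℝ (B₁ x)] [VectorBundle ℝ F₁ B₁]
  [ContMDiffVectorBundle ∞ F₁ B₁ (𝓡 d)]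
  [∀ x, IsTopologicalAddGroup (B₁ x)] [∀ x, ContinuousSMul ℝ (B₁ x)]

/-- The derivatives along configurations supported in `L` are supported in `L`. -/
structure GradIn (G : Grad d F₀ B₀ F₁ B₁) (L : Set M) : Prop where
  f₀ : ∀ n (φ : evIn d F₀ B₀ F₁ B₁ L) (o : Fin n → odIn d F₀ B₀ F₁ B₁ L),
    (G.f₀ n φ.1 ((odIn d F₀ B₀ F₁ B₁ L).subtypeL ∘ o)).1 ∈ secIn d _ _ L ∧
    (G.f₀ n φ.1 ((odIn d F₀ B₀ F₁ B₁ L).subtypeL ∘ o)).2 ∈ secIn d _ _ L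
  f₁ : ∀ n (φ : evIn d F₀ B₀ F₁ B₁ L) (o : Fin n → odIn d F₀ B₀ F₁ B₁ L),
    (G.f₁ n φ.1 ((odIn d F₀ B₀ F₁ B₁ L).subtypeL ∘ o)).1 ∈ secIn d _ _ L ∧
    (G.f₁ n φ.1 ((odIn d F₀ B₀ F₁ B₁ L).subtypeL ∘ o)).2 ∈ secIn d _ _ L
  a₀ : ∀ n (φ : evIn d F₀ B₀ F₁ B₁ L) (o : Fin n → odIn d F₀ B₀ F₁ B₁ L),
    (G.a₀ n φ.1 ((odIn d F₀ B₀ F₁ B₁ L).subtypeL ∘ o)).1 ∈ secIn d _ _ L ∧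
    (G.a₀ n φ.1 ((odIn d F₀ B₀ F₁ B₁ L).subtypeL ∘ o)).2 ∈ secIn d _ _ L
  a₁ : ∀ n (φ : evIn d F₀ B₀ F₁ B₁ L) (o : Fin n → odIn d F₀ B₀ F₁ B₁ L),
    (G.a₁ n φ.1 ((odIn d F₀ B₀ F₁ B₁ L).subtypeL ∘ o)).1 ∈ secIn d _ _ L ∧
    (G.a₁ n φ.1 ((odIn d F₀ B₀ F₁ B₁ L).subtypeL ∘ o)).2 ∈ secIn d _ _ L

theorem GradIn.preserves {G : Grad d F₀ B₀ F₁ B₁} {L : Set M} (h : GradIn G L) :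
    Preserves (ham G) (evIn d F₀ B₀ F₁ B₁ L) (odIn d F₀ B₀ F₁ B₁ L) where
  ev n φ o := ⟨⟨(h.a₀ n φ o).1, neg_mem (h.f₁ n φ o).1⟩, ⟨(h.a₀ n φ o).2, neg_mem (h.f₁ n φ o).2⟩⟩
  od n φ o := ⟨⟨(h.a₁ n φ o).1, neg_mem (h.f₀ n φ o).1⟩, ⟨(h.a₁ n φ o).2, neg_mem (h.f₀ n φ o).2⟩⟩

variable [MeasurableSpace M] {μ : Measure M}

theorem FreeAction.gradIn_grad (S₀ : FreeAction d F₀ B₀ F₁ B₁ μ) {L : Set M} (hL : IsClosed L) :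
    GradIn S₀.grad L where
  f₀ n φ o := by
    match n with
    | 0 =>
      have h1 := S₀.local_P₀.mem_secIn hL φ.2.1
      have h2 := S₀.local_K₁₀t.mem_secIn hL φ.2.2
      exact ⟨add_mem h1.1 h2.1, add_mem h1.2 h2.2⟩
    | n + 1 => exact ⟨zero_mem (secIn d _ _ L), zero_mem (secIn d _ _ L)⟩
  f₁ n φ o := by
    match n with
    | 1 =>
      have h1 := S₀.local_P₁.mem_secIn hL (o 0).2.1
      have h2 := S₀.local_K₀₁t.mem_secIn hL (o 0).2.2
      exact ⟨sub_mem h1.1 h2.1, sub_mem h1.2 h2.2⟩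
    | 0 => exact ⟨zero_mem (secIn d _ _ L), zero_mem (secIn d _ _ L)⟩
    | n + 2 => exact ⟨zero_mem (secIn d _ _ L), zero_mem (secIn d _ _ L)⟩
  a₀ n φ o := by
    match n with
    | 1 => exact S₀.local_K₀₁.mem_secIn hL (o 0).2.1
    | 0 => exact ⟨zero_mem (secIn d _ _ L), zero_mem (secIn d _ _ L)⟩
    | n + 2 => exact ⟨zero_mem (secIn d _ _ L), zero_mem (secIn d _ _ L)⟩
  a₁ n φ o := by
    match n with
    | 0 => exact S₀.local_K₁₀.mem_secIn hL φ.2.1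
    | n + 1 => exact ⟨zero_mem (secIn d _ _ L), zero_mem (secIn d _ _ L)⟩

/-- All derivatives are supported in `K`. -/
def SuppG (G : Grad d F₀ B₀ F₁ B₁) (K : Set M) : Prop := ∀ n φ o,
    (sSupport (G.f₀ n φ o).1 ⊆ K ∧ sSupport (G.f₀ n φ o).2 ⊆ K) ∧
    (sSupport (G.f₁ n φ o).1 ⊆ K ∧ sSupport (G.f₁ n φ o).2 ⊆ K) ∧
    (sSupport (G.a₀ n φ o).1 ⊆ K ∧ sSupport (G.a₀ n φ o).2 ⊆ K) ∧
    (sSupport (G.a₁ n φ o).1 ⊆ K ∧ sSupport (G.a₁ n φ o).2 ⊆ K)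

theorem SuppG.gradIn {G : Grad d F₀ B₀ F₁ B₁} {K L : Set M} (h : SuppG G K) (hL : IsClosed L)
    (hKL : K ⊆ L) : GradIn G L where
  f₀ n _ _ := ⟨(mem_secIn_iff hL).2 ((h n _ _).1.1.trans hKL),
    (mem_secIn_iff hL).2 ((h n _ _).1.2.trans hKL)⟩
  f₁ n _ _ := ⟨(mem_secIn_iff hL).2 ((h n _ _).2.1.1.trans hKL),
    (mem_secIn_iff hL).2 ((h n _ _).2.1.2.trans hKL)⟩
  a₀ n _ _ := ⟨(mem_secIn_iff hL).2 ((h n _ _).2.2.1.1.trans hKL),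
    (mem_secIn_iff hL).2 ((h n _ _).2.2.1.2.trans hKL)⟩
  a₁ n _ _ := ⟨(mem_secIn_iff hL).2 ((h n _ _).2.2.2.1.trans hKL),
    (mem_secIn_iff hL).2 ((h n _ _).2.2.2.2.trans hKL)⟩

variable {S₀ : FreeAction d F₀ B₀ F₁ B₁ μ}
  {V : FSeries (EvenPart d F₀ B₀ F₁ B₁) (OddPart d F₀ B₀ F₁ B₁) ℂ}
  {G : ℕ → Grad d F₀ B₀ F₁ B₁}

variable [T2Space M] [BorelSpace M] [IsFiniteMeasureOnCompacts μ]

theorem FreeAction.exists_compact_gradIn (hV : ∀ k, IsInteraction μ (V k) (G k)) (n : ℕ) {L : Set M}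
    (hL : IsCompact L) : ∃ L', IsCompact L' ∧ L ⊆ L' ∧ ∀ i ≤ n, GradIn (S₀.totalGrad G i) L' := by
  choose K hK hKG using fun k => (hV k).compact
  have hc : IsCompact (L ∪ ⋃ k ∈ Finset.range n, K k) :=
    hL.union ((Finset.range n).isCompact_biUnion fun k _ => hK k)
  refine ⟨_, hc, subset_union_left, fun i hi => ?_⟩
  match i with
  | 0 => exact S₀.gradIn_grad hc.isClosed
  | i + 1 =>
    exact SuppG.gradIn (hKG i) hc.isClosed (Subset.trans
      (subset_biUnion_of_mem (u := K) (Finset.mem_coe.2 (Finset.mem_range.2 hi))) subset_union_right)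

/-- The even parts of the compactly supported configurations. -/
def csEv (φ : EvenPart d F₀ B₀ F₁ B₁) : Prop := IsCompactlySupported φ.1 ∧ IsCompactlySupported φ.2

/-- The odd configurations of compact support. -/
def csOd (o : OddPart d F₀ B₀ F₁ B₁) : Prop := IsCompactlySupported o.1 ∧ IsCompactlySupported o.2

theorem csEv.mem {φ : EvenPart d F₀ B₀ F₁ B₁} (h : csEv φ) :
    ∃ K, IsCompact K ∧ ∀ L, K ⊆ L → φ ∈ evIn d F₀ B₀ F₁ B₁ L := by
  refine ⟨sSupport φ.1 ∪ sSupport φ.2, h.1.union h.2, fun L hL => ?_⟩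
  exact ⟨secIn_mono (subset_union_left.trans hL) ((mem_secIn_iff isClosed_closure).2 Subset.rfl),
    secIn_mono (subset_union_right.trans hL) ((mem_secIn_iff isClosed_closure).2 Subset.rfl)⟩

theorem csOd.mem {o : OddPart d F₀ B₀ F₁ B₁} (h : csOd o) :
    ∃ K, IsCompact K ∧ ∀ L, K ⊆ L → o ∈ odIn d F₀ B₀ F₁ B₁ L := by
  refine ⟨sSupport o.1 ∪ sSupport o.2, h.1.union h.2, fun L hL => ?_⟩
  exact ⟨secIn_mono (subset_union_left.trans hL) ((mem_secIn_iff isClosed_closure).2 Subset.rfl),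
    secIn_mono (subset_union_right.trans hL) ((mem_secIn_iff isClosed_closure).2 Subset.rfl)⟩

variable [SecondCountableTopology M]

theorem dense_csEv : Dense {φ : EvenPart d F₀ B₀ F₁ B₁ | csEv φ} :=
  dense_compactlySupported.prod dense_compactlySupported

theorem dense_csOd : Dense {o : OddPart d F₀ B₀ F₁ B₁ | csOd o} :=
  dense_compactlySupported.prod dense_compactlySupported

variable [μ.IsOpenPosMeasure]

/-- The antibracket is nondegenerate. -/
theorem eq_zero_of_oddForm_left {Z : Cx (OddPart d F₀ B₀ F₁ B₁)}
    (h : ∀ e : EvenPart d F₀ B₀ F₁ B₁, csEv e → ∃ (L : Set M) (hL : IsCompact L),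
      e ∈ evIn d F₀ B₀ F₁ B₁ L ∧
      evalC (fun w => (oddForm (lp F₀ B₀ μ hL) (lp F₁ B₁ μ hL) e w : ℂ)) Z = 0) : Z = 0 := by
  have k0 : ∀ u : Sec d F₀ B₀, IsCompactlySupported u → rpair μ Z.1.2 u = 0 ∧ rpair μ Z.2.2 u = 0 := by
    intro u hu
    obtain ⟨L, hL, he, h0⟩ := h (u, 0) ⟨hu, isCompactlySupported_zero⟩
    have hz : ∀ w : OddPart d F₀ B₀ F₁ B₁,
        oddForm (lp F₀ B₀ μ hL) (lp F₁ B₁ μ hL) (u, 0) w = -rpair μ w.2 u := fun w => by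
      rw [rpair_eq_setIntegral (Or.inr he.1)]
      show lp F₁ B₁ μ hL 0 w.1 - _ = _
      rw [map_zero, LinearMap.zero_apply, zero_sub]
      rfl
    have h1 := evalC_ofReal_eq_zero h0
    rw [hz, hz, neg_eq_zero, neg_eq_zero] at h1
    exact h1
  have k1 : ∀ ξ : CoSec d F₁ B₁, IsCompactlySupported ξ →
      rpair μ ξ Z.1.1 = 0 ∧ rpair μ ξ Z.2.1 = 0 := by
    intro ξ hξ
    obtain ⟨L, hL, he, h0⟩ := h (0, ξ) ⟨isCompactlySupported_zero, hξ⟩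
    have hz : ∀ w : OddPart d F₀ B₀ F₁ B₁,
        oddForm (lp F₀ B₀ μ hL) (lp F₁ B₁ μ hL) (0, ξ) w = rpair μ ξ w.1 := fun w => by
      rw [rpair_eq_setIntegral (Or.inl he.2)]
      show _ - lp F₀ B₀ μ hL w.2 0 = _
      rw [map_zero, sub_zero]
      rfl
    have h1 := evalC_ofReal_eq_zero h0
    rw [hz, hz] at h1
    exact h1
  refine Prod.ext (Prod.ext ?_ ?_) (Prod.ext ?_ ?_)
  · exact eq_zero_of_rpair_right fun ξ hξ => (k1 ξ hξ).1
  · exact eq_zero_of_rpair_left fun u hu => (k0 u hu).1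
  · exact eq_zero_of_rpair_right fun ξ hξ => (k1 ξ hξ).2
  · exact eq_zero_of_rpair_left fun u hu => (k0 u hu).2

theorem eq_zero_of_oddForm_right {Z : Cx (EvenPart d F₀ B₀ F₁ B₁)}
    (h : ∀ w : OddPart d F₀ B₀ F₁ B₁, csOd w → ∃ (L : Set M) (hL : IsCompact L),
      w ∈ odIn d F₀ B₀ F₁ B₁ L ∧
      evalC (fun e => (oddForm (lp F₀ B₀ μ hL) (lp F₁ B₁ μ hL) e w : ℂ)) Z = 0) : Z = 0 := by
  have k0 : ∀ u : Sec d F₁ B₁, IsCompactlySupported u → rpair μ Z.1.2 u = 0 ∧ rpair μ Z.2.2 u = 0 := by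
    intro u hu
    obtain ⟨L, hL, he, h0⟩ := h (u, 0) ⟨hu, isCompactlySupported_zero⟩
    have hz : ∀ e : EvenPart d F₀ B₀ F₁ B₁,
        oddForm (lp F₀ B₀ μ hL) (lp F₁ B₁ μ hL) e (u, 0) = rpair μ e.2 u := fun e => by
      rw [rpair_eq_setIntegral (Or.inr he.1)]
      show _ - lp F₀ B₀ μ hL 0 e.1 = _
      rw [map_zero, LinearMap.zero_apply, sub_zero]
      rfl
    have h1 := evalC_ofReal_eq_zero h0
    rw [hz, hz] at h1
    exact h1
  have k1 : ∀ ξ : CoSec d F₀ B₀, IsCompactlySupported ξ →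
      rpair μ ξ Z.1.1 = 0 ∧ rpair μ ξ Z.2.1 = 0 := by
    intro ξ hξ
    obtain ⟨L, hL, he, h0⟩ := h (0, ξ) ⟨isCompactlySupported_zero, hξ⟩
    have hz : ∀ e : EvenPart d F₀ B₀ F₁ B₁,
        oddForm (lp F₀ B₀ μ hL) (lp F₁ B₁ μ hL) e (0, ξ) = -rpair μ ξ e.1 := fun e => by
      rw [rpair_eq_setIntegral (Or.inl he.2)]
      show lp F₁ B₁ μ hL e.2 0 - _ = _
      rw [map_zero, zero_sub]
      rfl
    have h1 := evalC_ofReal_eq_zero h0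
    rw [hz, hz, neg_eq_zero, neg_eq_zero] at h1
    exact h1
  refine Prod.ext (Prod.ext ?_ ?_) (Prod.ext ?_ ?_)
  · exact eq_zero_of_rpair_right fun ξ hξ => (k1 ξ hξ).1
  · exact eq_zero_of_rpair_left fun u hu => (k0 u hu).1
  · exact eq_zero_of_rpair_right fun ξ hξ => (k1 ξ hξ).2
  · exact eq_zero_of_rpair_left fun u hu => (k0 u hu).2

/-- The master equation says that the Hamiltonian vector field of the action squares to zero. It
does so first on compactly supported configurations and, by density, everywhere. -/
theorem FreeAction.sqV_ham_eq_zero (hV : ∀ k, IsInteraction μ (V k) (G k))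
    (hcme : S₀.ClassicalMasterEquation V G) (n : ℕ) :
    (sqV (fun k => ham (S₀.totalGrad G k)) n).ev = 0 ∧
      (sqV (fun k => ham (S₀.totalGrad G k)) n).od = 0 := by
  have hQ : ∀ k, RegV (ham (S₀.totalGrad G k)) := fun k => (FreeAction.regG_totalGrad hV k).ham
  -- The configurations supported in `L` form a space on which the integrals that define the action
  -- and the symplectic form exist; the derivatives of the interaction stay in it for `L` large.
  have key : ∀ {K : Set M}, IsCompact K → ∃ (L : Set M) (hL : IsCompact L), K ⊆ L ∧
      ∀ p (φ : evIn d F₀ B₀ F₁ B₁ L) (o : Fin p → odIn d F₀ B₀ F₁ B₁ L), (∀ h : evIn d F₀ B₀ F₁ B₁ L,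
        evalC (fun w => (oddForm (lp F₀ B₀ μ hL) (lp F₁ B₁ μ hL) h.1 w : ℂ))
          ((sqV (fun k => ham (S₀.totalGrad G k)) n).od p φ.1
              ((odIn d F₀ B₀ F₁ B₁ L).subtypeL ∘ o)) = 0) ∧
        ∀ w : odIn d F₀ B₀ F₁ B₁ L,
        evalC (fun h => (oddForm (lp F₀ B₀ μ hL) (lp F₁ B₁ μ hL) h w.1 : ℂ))
          ((sqV (fun k => ham (S₀.totalGrad G k)) n).ev p φ.1
              ((odIn d F₀ B₀ F₁ B₁ L).subtypeL ∘ o)) = 0 := by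
    intro K hK
    obtain ⟨L, hL, hKL, hG⟩ := FreeAction.exists_compact_gradIn (S₀ := S₀) hV n hK
    refine ⟨L, hL, hKL, fun p φ o => ?_⟩
    exact sqV_eq_zero_on (S := S₀.totalAction V) (n := n) (Q := fun k => ham (S₀.totalGrad G k))
      (Ω := oddForm (lp F₀ B₀ μ hL) (lp F₁ B₁ μ hL))
      (T₀ := evIn d F₀ B₀ F₁ B₁ L) (T₁ := odIn d F₀ B₀ F₁ B₁ L)
      (continuous_oddForm_left (continuous_lp hL) (continuous_lp hL))
      (continuous_oddForm_right (continuous_lp hL) (continuous_lp hL))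
      (isClosed_evIn L) (isClosed_odIn L)
      (fun i _ => FreeAction.reg_pull_totalAction hV hL i) hQ (fun i hi => (hG i hi).preserves)
      (fun i _ m φ o e => FreeAction.dirD_totalAction hV hL i m φ e o)
      (fun i _ m φ o w => FreeAction.cons_totalAction hV hL i m φ o w)
      (fun i _ => FreeAction.funParity_totalAction hV i)
      (fun p φ o => hcme n p φ.1 ((odIn d F₀ B₀ F₁ B₁ L).subtypeL ∘ o)
          (isCompactlySupported_of_mem hL φ.2.1) (isCompactlySupported_of_mem hL φ.2.2)
          fun i => ⟨isCompactlySupported_of_mem hL (o i).2.1,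
            isCompactlySupported_of_mem hL (o i).2.2⟩) p φ o
  have hex : ∀ (p : ℕ) (φ : EvenPart d F₀ B₀ F₁ B₁) (o : Fin p → OddPart d F₀ B₀ F₁ B₁), csEv φ →
      (∀ i, csOd (o i)) → ∃ K, IsCompact K ∧ ∀ L, K ⊆ L → φ ∈ evIn d F₀ B₀ F₁ B₁ L ∧
        ∀ i, o i ∈ odIn d F₀ B₀ F₁ B₁ L := by
    intro p φ o hφ ho
    obtain ⟨K, hK, hKφ⟩ := hφ.mem
    choose K' hK' hKo using fun i => (ho i).mem
    exact ⟨K ∪ ⋃ i, K' i, hK.union (isCompact_iUnion hK'), fun L hL =>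
      ⟨hKφ L (subset_union_left.trans hL), fun i => hKo i L
        ((subset_iUnion K' i).trans (subset_union_right.trans hL))⟩⟩
  constructor
  · refine (RegV.sqV hQ n).ev.eq_zero_of_dense dense_csEv dense_csOd
      fun p φ hφ o ho => ?_
    obtain ⟨K, hK, hKL⟩ := hex p φ o hφ ho
    refine eq_zero_of_oddForm_right (μ := μ) fun w hw => ?_
    obtain ⟨K', hK', hw'⟩ := hw.mem
    obtain ⟨L, hL, hKK, h⟩ := key (hK.union hK')
    have hm := hKL L (subset_union_left.trans hKK)
    have hwm := hw' L (subset_union_right.trans hKK)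
    exact ⟨L, hL, hwm, (h p ⟨φ, hm.1⟩ fun i => ⟨o i, hm.2 i⟩).2 ⟨w, hwm⟩⟩
  · refine (RegV.sqV hQ n).od.eq_zero_of_dense dense_csEv dense_csOd
      fun p φ hφ o ho => ?_
    obtain ⟨K, hK, hKL⟩ := hex p φ o hφ ho
    refine eq_zero_of_oddForm_left (μ := μ) fun e he => ?_
    obtain ⟨K', hK', he'⟩ := he.mem
    obtain ⟨L, hL, hKK, h⟩ := key (hK.union hK')
    have hm := hKL L (subset_union_left.trans hKK)
    have hem := he' L (subset_union_right.trans hKK)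
    exact ⟨L, hL, hem, (h p ⟨φ, hm.1⟩ fun i => ⟨o i, hm.2 i⟩).1 ⟨e, hem⟩⟩

end MasterEquation

/-! ### The derivative of the displacement along the interacting vector field -/

section Displacement

variable {S₀ S₁ : Type u} [AddCommGroup S₀] [Module ℝ S₀] [TopologicalSpace S₀]
  [LCTVS S₀] [AddCommGroup S₁] [Module ℝ S₁] [TopologicalSpace S₁] [LCTVS S₁]

theorem sFun_add_eq_add {W : Type*} [AddCommGroup W] {a b c e : SFun S₀ S₁ W}
    (h : ∀ p φ o, a p φ o + b p φ o = c p φ o + e p φ o) : a + b = c + e :=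
  funext fun p => funext fun φ => funext fun o => h p φ o

theorem hasParity_one {Y : SVec S₀ S₁} (h0 : ∀ n, Odd n → ∀ φ o, Y.ev n φ o = 0)
    (h1 : ∀ n, Even n → ∀ φ o, Y.od n φ o = 0) : HasParity 1 Y where
  ev n φ o := by
    rcases Nat.even_or_odd n with hn | hn
    · rw [hn.neg_one_pow]
    · rw [h0 n hn, smul_zero, smul_zero]
  od n φ o := by
    rcases Nat.even_or_odd n with hn | hn
    · rw [h1 n hn, smul_zero, smul_zero]
    · rw [hn.add_one.neg_one_pow]

variable {A B : Type*} [AddCommGroup A] [Module ℝ A] [TopologicalSpace A] [LCTVS A]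
  [AddCommGroup B] [Module ℝ B] [TopologicalSpace B] [LCTVS B]

/-- If the derivatives of a series of Hamiltonian vector fields along `Q` sum to zero, so do those of
their components. -/
theorem sum_vcontract_of_hamPair {a : ℕ → SFun S₀ S₁ (Cx A)} {f : ℕ → SFun S₀ S₁ (Cx B)}
    (ha : ∀ k, Reg (a k)) (hf : ∀ k, Reg (f k)) (Q : ℕ → SVec S₀ S₁) {n : ℕ}
    (h : ∑ x ∈ Finset.HasAntidiagonal.antidiagonal n, vcontract (mulICx (A × B))
      (fun n φ o => hamPair (a x.1 n φ o) (f x.1 n φ o)) (Q x.2) = 0)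
    (p : ℕ) (φ : S₀) (o : Fin p → S₁) :
    ∑ x ∈ Finset.HasAntidiagonal.antidiagonal n, vcontract (mulICx A) (a x.1) (Q x.2) p φ o = 0 ∧
    ∑ x ∈ Finset.HasAntidiagonal.antidiagonal n, vcontract (mulICx B) (f x.1) (Q x.2) p φ o = 0 := by
  have h' := congrFun (congrFun (congrFun h p) φ) o
  simp only [Finset.sum_apply] at h'
  rw [Finset.sum_congr rfl fun x _ => vcontract_hamPair (ha x.1) (hf x.1) (Q x.2) p φ o] at h'
  have e := map_sum (hamPairL A B) (fun x : ℕ × ℕ => (vcontract (mulICx A) (a x.1) (Q x.2) p φ o,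
    vcontract (mulICx B) (f x.1) (Q x.2) p φ o)) (Finset.HasAntidiagonal.antidiagonal n)
  have e2 := hamPair_eq_zero.1 (e.trans h')
  rw [Prod.fst_sum, Prod.snd_sum] at e2
  exact e2

variable (A B) in
/-- The inclusion of the complexified first summand. -/
def inlCx : Cx A →L[ℝ] Cx (A × B) where
  toFun w := ((w.1, 0), (w.2, 0))
  map_add' _ _ := by simp
  map_smul' _ _ := by simp
  cont := by fun_prop

theorem inlCx_apply (w : Cx A) : inlCx A B w = ((w.1, 0), (w.2, 0)) := rfl

theorem sum_vcontract_inlCx {f : ℕ → SFun S₀ S₁ (Cx A)} (hf : ∀ k, Reg (f k))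
    {g : ℕ → SFun S₀ S₁ (Cx (A × B))} (h0 : g 0 = 0)
    (hs : ∀ k, g (k + 1) = fun n φ o => ((((f k n φ o).1, 0), ((f k n φ o).2, 0)) : Cx (A × B)))
    (Q : ℕ → SVec S₀ S₁) (k p : ℕ) (φ : S₀) (o : Fin p → S₁) :
    (∑ x ∈ Finset.HasAntidiagonal.antidiagonal (k + 1),
      vcontract (mulICx (A × B)) (g x.2) (Q x.1)) p φ o =
    inlCx A B (∑ x ∈ Finset.HasAntidiagonal.antidiagonal k,
      vcontract (mulICx A) (f x.1) (Q x.2) p φ o) := by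
  rw [← Finset.Nat.sum_antidiagonal_swap, Finset.Nat.sum_antidiagonal_succ]
  simp only [Prod.fst_swap, Prod.snd_swap, h0, hs]
  rw [vcontract_zero_left, zero_add, map_sum]
  simp only [Finset.sum_apply]
  refine Finset.sum_congr rfl fun x _ => ?_
  exact vcontract_map (J := mulICx A) (J' := mulICx (A × B)) (inlCx A B)
    (fun w => by simp [inlCx, mulICx_apply]) (hf x.1) (Q x.2) p φ o

/-- The order zero term of a sum over the antidiagonal, when it is linear in the even variables. -/
theorem sum_vcontract_succ_linEv {f : ℕ → SFun S₀ S₁ (Cx A)} {ℓ : S₀ →L[ℝ] Cx A}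
    (h0 : f 0 = linEv ℓ) {Q : ℕ → SVec S₀ S₁} (hQ : ∀ k, RegV (Q k)) (k p : ℕ) (φ : S₀)
    (o : Fin p → S₁) :
    ∑ x ∈ Finset.HasAntidiagonal.antidiagonal (k + 1), vcontract (mulICx A) (f x.1) (Q x.2) p φ o =
      extendC ℓ ((Q (k + 1)).ev p φ o) +
      ∑ x ∈ Finset.HasAntidiagonal.antidiagonal k,
        vcontract (mulICx A) (f (x.1 + 1)) (Q x.2) p φ o := by
  rw [Finset.Nat.sum_antidiagonal_succ]
  refine congrArg (· + _) ?_
  rw [h0]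
  exact vcontract_linEv _ ℓ p (hQ _).altV φ o

theorem sum_vcontract_succ_linOd {f : ℕ → SFun S₀ S₁ (Cx A)} {ℓ : S₁ →L[ℝ] Cx A}
    (h0 : f 0 = linOd ℓ) {Q : ℕ → SVec S₀ S₁} (hQ : ∀ k, RegV (Q k)) (k p : ℕ) (φ : S₀)
    (o : Fin p → S₁) :
    ∑ x ∈ Finset.HasAntidiagonal.antidiagonal (k + 1), vcontract (mulICx A) (f x.1) (Q x.2) p φ o =
      extendC ℓ ((Q (k + 1)).od p φ o) +
      ∑ x ∈ Finset.HasAntidiagonal.antidiagonal k,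
        vcontract (mulICx A) (f (x.1 + 1)) (Q x.2) p φ o := by
  rw [Finset.Nat.sum_antidiagonal_succ]
  refine congrArg (· + _) ?_
  rw [h0]
  exact vcontract_linOd _ ℓ p (hQ _).altV φ o

theorem extendC_coprodL {W : Type*} [AddCommGroup W] [Module ℝ W] [TopologicalSpace W]
    [IsTopologicalAddGroup W] (P : A →L[ℝ] Cx W) (K : B →L[ℝ] Cx W) (a : Cx A) (f : Cx B) :
    extendC (coprodL P K) (hamPair a f) = extendC P a - extendC K f := by
  have h : ∀ x y, coprodL P K (x, -y) = P x - K y := fun x y => by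
    show P x + K (-y) = _
    rw [map_neg, sub_eq_add_neg]
  show coprodL P K (a.1, -f.1) + mulI (coprodL P K (a.2, -f.2)) = _
  rw [h, h]
  show _ = P a.1 + mulI (P a.2) - (K f.1 + mulI (K f.2))
  refine Prod.ext ?_ ?_
  · simp only [mulI, Prod.fst_add, Prod.fst_sub, Prod.snd_sub]; abel
  · simp only [mulI, Prod.snd_add, Prod.fst_sub, Prod.snd_sub]; abel

theorem extendC_comp_fst_inlCx {W : Type*} [AddCommGroup W] [Module ℝ W] [TopologicalSpace W]
    [LCTVS W] (K : A →L[ℝ] Cx W) (w : Cx A) :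
    extendC (K.comp (ContinuousLinearMap.fst ℝ A B)) (inlCx A B w) = extendC K w := rfl

theorem extendC_coprodL_inlCx {W : Type*} [AddCommGroup W] [Module ℝ W] [TopologicalSpace W]
    [IsTopologicalAddGroup W] (P : A →L[ℝ] Cx W) (K : B →L[ℝ] Cx W) (w : Cx A) :
    extendC (coprodL P K) (inlCx A B w) = extendC P w := by
  have h : ∀ x, coprodL P K (x, 0) = P x := fun x => by
    show P x + K 0 = _
    rw [map_zero, add_zero]
  show coprodL P K (w.1, 0) + mulI (coprodL P K (w.2, 0)) = _
  rw [h, h]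
  rfl

theorem hamPair_add_inlCx (a c : Cx A) (f : Cx B) :
    hamPair a f + inlCx A B (c - a) = hamPair c f := by
  simp [hamPair, inlCx_apply]

end Displacement

section Intertwining

universe a b

variable {A A' : Type a} {B B' : Type b}
  [AddCommGroup A] [Module ℝ A] [TopologicalSpace A] [LCTVS A]
  [AddCommGroup A'] [Module ℝ A'] [TopologicalSpace A'] [LCTVS A']
  [AddCommGroup B] [Module ℝ B] [TopologicalSpace B] [LCTVS B]
  [AddCommGroup B'] [Module ℝ B'] [TopologicalSpace B'] [LCTVS B']

/-- The case of `contractSeries_translate` in which only the variables in `A` and `B` are displaced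
and the vector field `Q` starts with the linear vector field `L`. -/
theorem contractSeries_translate_inl {η Q L : ℕ → SVec (A × B') (B × A')}
    {f : ℕ → SFun (A × B') (B × A') (Cx A)} {g : ℕ → SFun (A × B') (B × A') (Cx B)}
    (hf : ∀ k, Reg (f k)) (hg : ∀ k, Reg (g k)) (h0 : η 0 = ⟨0, 0⟩)
    (hs : ∀ k, η (k + 1) = ⟨fun n φ o => inlCx A B' (f k n φ o), fun n φ o => inlCx B A' (g k n φ o)⟩)
    (hf0 : ∀ k n, Odd n → ∀ φ o, f k n φ o = 0) (hg0 : ∀ k n, Even n → ∀ φ o, g k n φ o = 0)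
    (hQ : ∀ k, RegV (Q k)) (ℓ₀ : A × B' →L[ℝ] Cx (B × A')) (ℓ₁ : B × A' →L[ℝ] Cx (A × B'))
    (hQ0 : Q 0 = linV ℓ₀ ℓ₁) (hL0 : L 0 = linV ℓ₀ ℓ₁) (hLs : ∀ k, L (k + 1) = ⟨0, 0⟩)
    (hev : ∀ k p φ o, (Q (k + 1)).ev p φ o +
      inlCx A B' (∑ x ∈ Finset.HasAntidiagonal.antidiagonal k,
        vcontract (mulICx A) (f x.1) (Q x.2) p φ o) = extendC ℓ₁ (inlCx B A' (g k p φ o)))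
    (hod : ∀ k p φ o, (Q (k + 1)).od p φ o +
      inlCx B A' (∑ x ∈ Finset.HasAntidiagonal.antidiagonal k,
        vcontract (mulICx B) (g x.1) (Q x.2) p φ o) = extendC ℓ₀ (inlCx A B' (f k p φ o)))
    {X : FSeries (A × B') (B × A') ℂ} (hX : X ∈ regSeries (A × B') (B × A')) :
    contractSeries (translate η X) Q = translate η (contractSeries X L) := by
  have hη : ∀ k, RegV (η k)
    | 0 => by rw [h0]; exact RegV.zero
    | k + 1 => by rw [hs]; exact ⟨(hf k).clm (inlCx A B'), (hg k).clm (inlCx B A')⟩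
  have hp : ∀ k, HasParity 1 (η k)
    | 0 => by rw [h0]; exact hasParity_one (fun _ _ _ _ => rfl) fun _ _ _ _ => rfl
    | k + 1 => by
      rw [hs]
      exact hasParity_one (fun n hn φ o => (congrArg _ (hf0 k n hn φ o)).trans (map_zero _))
        fun n hn φ o => (congrArg _ (hg0 k n hn φ o)).trans (map_zero _)
  have hz : ∀ {S T : Type _} [AddCommGroup S] [Module ℝ S] [TopologicalSpace S]
      [AddCommGroup T] [Module ℝ T] [TopologicalSpace T] (ℓ : S →L[ℝ] Cx T),
      extendC ℓ (0 : Cx S) = 0 := fun ℓ => by simp [extendC, mulI]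
  refine contractSeries_translate hη hp h0 hQ ℓ₀ ℓ₁ hL0 hLs (fun n => ?_) (fun n => ?_) hX
  · match n with
    | 0 =>
      rw [Finset.Nat.antidiagonal_zero, Finset.sum_singleton, h0, hQ0, hL0]
      refine congrArg ((linV ℓ₀ ℓ₁).ev + ·) ((vcontract_zero_left _ _).trans ?_)
      funext p φ o
      exact (hz ℓ₁).symm
    | k + 1 =>
      refine sFun_add_eq_add fun p φ o => ?_
      have e := sum_vcontract_inlCx (g := fun j => (η j).ev) hf (congrArg SVec.ev h0)
        (fun k => congrArg SVec.ev (hs k)) Q k p φ o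
      refine (congrArg (_ + ·) e).trans ((hev k p φ o).trans ?_)
      rw [hLs, hs]
      exact (zero_add _).symm
  · match n with
    | 0 =>
      rw [Finset.Nat.antidiagonal_zero, Finset.sum_singleton, h0, hQ0, hL0]
      refine congrArg ((linV ℓ₀ ℓ₁).od + ·) ((vcontract_zero_left _ _).trans ?_)
      funext p φ o
      exact (hz ℓ₀).symm
    | k + 1 =>
      refine sFun_add_eq_add fun p φ o => ?_
      have e := sum_vcontract_inlCx (g := fun j => (η j).od) hg (congrArg SVec.od h0)
        (fun k => congrArg SVec.od (hs k)) Q k p φ o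
      refine (congrArg (_ + ·) e).trans ((hod k p φ o).trans ?_)
      rw [hLs, hs]
      exact (zero_add _).symm

end Intertwining

section Green

variable {d : ℕ} {M : Type*} [TopologicalSpace M] [ChartedSpace (EuclideanSpace ℝ (Fin d)) M]
  [IsManifold (𝓡 d) ∞ M] [T2Space M]
  {F : Type*} [NormedAddCommGroup F] [NormedSpace ℝ F]
  {B : M → Type*} [TopologicalSpace (TotalSpace F B)] [∀ x, TopologicalSpace (B x)]
  [FiberBundle F B] [∀ x, AddCommGroup (B x)] [∀ x, Module ℝ (B x)] [VectorBundle ℝ F B]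
  [ContMDiffVectorBundle ∞ F B (𝓡 d)]
  [∀ x, IsTopologicalAddGroup (B x)] [∀ x, ContinuousSMul ℝ (B x)]
  {J : Set M → Set M} {P : Sec d F B →L[ℝ] Cx (CoSec d F B)} {Δ : CoSec d F B → Cx (Sec d F B)}

theorem cxCompact_zero : CxCompact (0 : Cx (Sec d F B)) :=
  ⟨isCompactlySupported_zero, isCompactlySupported_zero⟩

theorem eq_sub_of_add_eq' {W : Type*} [AddCommGroup W] {x y z : W} (h : x + y = z) : y = z - x :=
  (sub_eq_of_eq_add' h.symm).symm

theorem IsGreenOperator.extendC_zero (hΔ : IsGreenOperator J P Δ) :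
    extendC Δ (0 : Cx (CoSec d F B)) = 0 :=
  left_eq_add.1 ((congrArg (extendC Δ) (add_zero 0).symm).trans
    (hΔ.extendC_add cxCompact_zero cxCompact_zero))

theorem IsGreenOperator.extendC_sum (hΔ : IsGreenOperator J P Δ) {ι : Type*} (s : Finset ι)
    {ξ : ι → Cx (CoSec d F B)} (hξ : ∀ i ∈ s, CxCompact (ξ i)) :
    CxCompact (∑ i ∈ s, ξ i) ∧ extendC Δ (∑ i ∈ s, ξ i) = ∑ i ∈ s, extendC Δ (ξ i) := by
  classical
  induction s using Finset.induction_on with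
  | empty => exact ⟨cxCompact_zero, hΔ.extendC_zero⟩
  | insert i s hi ih =>
    have h1 := ih fun j hj => hξ j (Finset.mem_insert_of_mem hj)
    have h2 := hξ i (Finset.mem_insert_self i s)
    rw [Finset.sum_insert hi, Finset.sum_insert hi, ← h1.2]
    exact ⟨h2.add h1.1, hΔ.extendC_add h2 h1.1⟩

/-- If the sum of the derivatives of the source terms is `b - P a`, then that of the solutions is
`Δ b - a`. -/
theorem IsGreenOperator.sum_vcontract (hΔ : IsGreenOperator J P Δ) (hP : IsLocalOp P)
    {S₀ S₁ : Type u} [AddCommGroup S₀]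
    [Module ℝ S₀] [TopologicalSpace S₀] [LCTVS S₀] [AddCommGroup S₁] [Module ℝ S₁]
    [TopologicalSpace S₁] [LCTVS S₁] {f : ℕ → SFun S₀ S₁ (Cx (CoSec d F B))} (hf : ∀ k, Reg (f k))
    (hK : ∀ k, ∃ K : Set M, IsCompact K ∧
      ∀ n φ o, sSupport (f k n φ o).1 ⊆ K ∧ sSupport (f k n φ o).2 ⊆ K)
    (Q : ℕ → SVec S₀ S₁) {k p : ℕ} {φ : S₀} {o : Fin p → S₁} {a : Cx (Sec d F B)}
    {b : Cx (CoSec d F B)} (ha : CxCompact a)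
    (h : extendC P a + ∑ x ∈ Finset.HasAntidiagonal.antidiagonal k,
      vcontract (mulICx (CoSec d F B)) (f x.1) (Q x.2) p φ o = b) :
    ∑ x ∈ Finset.HasAntidiagonal.antidiagonal k,
      vcontract (mulICx (Sec d F B)) (fun n φ o => extendC Δ (f x.1 n φ o)) (Q x.2) p φ o =
        extendC Δ b - a := by
  choose K hK hK' using hK
  have hc := fun k => (hΔ.comp_reg (hf k) (hK k) (hK' k)).2
  have hs := hΔ.extendC_sum (Finset.HasAntidiagonal.antidiagonal k) (fun x _ => (hc x.1 (Q x.2) p φ o).1)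
  rw [Finset.sum_congr rfl fun x _ => (hc x.1 (Q x.2) p φ o).2]
  refine hs.2.symm.trans (eq_sub_of_add_eq' ?_)
  rw [← h, hΔ.extendC_add (hP.cxCompact_extendC ha) hs.1, hΔ.left_inv_extendC hP ha]

end Green

theorem add_eq_of_sub_add_eq_zero {W : Type*} [AddCommGroup W] {x y z : W} (h : x - y + z = 0) :
    x + z = y := by
  rw [← sub_eq_zero, ← h]; abel

theorem clm_add_apply_zero {A W : Type*} [AddCommGroup A] [Module ℝ A] [TopologicalSpace A]
    [AddCommGroup W] [Module ℝ W] [TopologicalSpace W] (K : A →L[ℝ] W) (w : W) : w + K 0 = w := by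
  rw [map_zero, add_zero]

theorem clm_sub_apply_zero {A W : Type*} [AddCommGroup A] [Module ℝ A] [TopologicalSpace A]
    [AddCommGroup W] [Module ℝ W] [TopologicalSpace W] (K : A →L[ℝ] W) (w : W) : w - K 0 = w := by
  rw [map_zero, sub_zero]

/-! ### The master equation in components -/

section Intertwine

variable {d : ℕ} {M : Type*} [TopologicalSpace M] [ChartedSpace (EuclideanSpace ℝ (Fin d)) M]
  [IsManifold (𝓡 d) ∞ M]
  {F₀ : Type*} [NormedAddCommGroup F₀] [NormedSpace ℝ F₀]
  {B₀ : M → Type*} [TopologicalSpace (TotalSpace F₀ B₀)] [∀ x, TopologicalSpace (B₀ x)]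
  [FiberBundle F₀ B₀] [∀ x, AddCommGroup (B₀ x)] [∀ x, Module ℝ (B₀ x)] [VectorBundle ℝ F₀ B₀]
  [ContMDiffVectorBundle ∞ F₀ B₀ (𝓡 d)]
  [∀ x, IsTopologicalAddGroup (B₀ x)] [∀ x, ContinuousSMul ℝ (B₀ x)]
  {F₁ : Type*} [NormedAddCommGroup F₁] [NormedSpace ℝ F₁]
  {B₁ : M → Type*} [TopologicalSpace (TotalSpace F₁ B₁)] [∀ x, TopologicalSpace (B₁ x)]
  [FiberBundle F₁ B₁] [∀ x, AddCommGroup (B₁ x)] [∀ x, Module ℝ (B₁ x)] [VectorBundle ℝ F₁ B₁]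
  [ContMDiffVectorBundle ∞ F₁ B₁ (𝓡 d)]
  [∀ x, IsTopologicalAddGroup (B₁ x)] [∀ x, ContinuousSMul ℝ (B₁ x)]

theorem ham_zero : ham (⟨0, 0, 0, 0⟩ : Grad d F₀ B₀ F₁ B₁) = ⟨0, 0⟩ := by
  have h0 : hamPair (0 : Cx (Sec d F₀ B₀)) (0 : Cx (CoSec d F₁ B₁)) = 0 :=
    hamPair_eq_zero.2 ⟨rfl, rfl⟩
  have h1 : hamPair (0 : Cx (Sec d F₁ B₁)) (0 : Cx (CoSec d F₀ B₀)) = 0 :=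
    hamPair_eq_zero.2 ⟨rfl, rfl⟩
  exact congrArg₂ SVec.mk (funext fun _ => funext fun _ => funext fun _ => h0)
    (funext fun _ => funext fun _ => funext fun _ => h1)

variable [MeasurableSpace M] {μ : Measure M} [T2Space M] [BorelSpace M]
  [IsFiniteMeasureOnCompacts μ] [SecondCountableTopology M] [μ.IsOpenPosMeasure]
  {S₀ : FreeAction d F₀ B₀ F₁ B₁ μ}
  {V : FSeries (EvenPart d F₀ B₀ F₁ B₁) (OddPart d F₀ B₀ F₁ B₁) ℂ}
  {G : ℕ → Grad d F₀ B₀ F₁ B₁}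

theorem eq_zero_of_pair {ξ : Cx (CoSec d F₀ B₀)} (h : ∀ u, pair μ ξ u = 0) : ξ = 0 := by
  have h' : ∀ u, rpair μ ξ.1 u = 0 ∧ rpair μ ξ.2 u = 0 := fun u =>
    evalC_ofReal_eq_zero (f := fun ζ => rpair μ ζ u) (h u)
  exact Prod.ext (eq_zero_of_rpair_left fun u _ => (h' u).1)
    (eq_zero_of_rpair_left fun u _ => (h' u).2)

theorem IsInteraction.f₀_eq_zero {W : SFun (EvenPart d F₀ B₀ F₁ B₁) (OddPart d F₀ B₀ F₁ B₁) ℂ}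
    {H : Grad d F₀ B₀ F₁ B₁} (h : IsInteraction μ W H) {n : ℕ} (hn : Odd n)
    (φ : EvenPart d F₀ B₀ F₁ B₁) (o : Fin n → OddPart d F₀ B₀ F₁ B₁) : H.f₀ n φ o = 0 := by
  refine eq_zero_of_pair (μ := μ) fun u => ?_
  rw [← (h.gradient n φ o).1, lineDeriv_eq_dirD]
  refine HasDD.dirD_eq (tendsto_const_nhds.congr fun t => ?_)
  show 0 = t⁻¹ • (W n (φ + t • (u, 0)) o - W n φ o)
  rw [h.even n hn, h.even n hn, sub_zero, smul_zero]

theorem IsInteraction.f₁_eq_zero {W : SFun (EvenPart d F₀ B₀ F₁ B₁) (OddPart d F₀ B₀ F₁ B₁) ℂ}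
    {H : Grad d F₀ B₀ F₁ B₁} (h : IsInteraction μ W H) {n : ℕ} (hn : Even n)
    (φ : EvenPart d F₀ B₀ F₁ B₁) (o : Fin n → OddPart d F₀ B₀ F₁ B₁) : H.f₁ n φ o = 0 :=
  eq_zero_of_pair (μ := μ) fun u => by
    rw [← (h.gradient n φ o).2.1, h.even (n + 1) hn.add_one]

/-- The master equation for the derivatives of the action with respect to the fields. -/
theorem FreeAction.sum_vcontract_grad (hV : ∀ k, IsInteraction μ (V k) (G k))
    (hcme : S₀.ClassicalMasterEquation V G) (n p : ℕ)
    (φ : EvenPart d F₀ B₀ F₁ B₁) (o : Fin p → OddPart d F₀ B₀ F₁ B₁) :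
    ∑ x ∈ Finset.HasAntidiagonal.antidiagonal n, vcontract (mulICx (CoSec d F₀ B₀))
      (S₀.totalGrad G x.1).f₀ (ham (S₀.totalGrad G x.2)) p φ o = 0 ∧
    ∑ x ∈ Finset.HasAntidiagonal.antidiagonal n, vcontract (mulICx (CoSec d F₁ B₁))
      (S₀.totalGrad G x.1).f₁ (ham (S₀.totalGrad G x.2)) p φ o = 0 := by
  have h := FreeAction.sqV_ham_eq_zero hV hcme n
  have hr := FreeAction.regG_totalGrad (S₀ := S₀) hV
  exact ⟨(sum_vcontract_of_hamPair (a := fun k => (S₀.totalGrad G k).a₁)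
      (f := fun k => (S₀.totalGrad G k).f₀) (fun k => (hr k).a₁) (fun k => (hr k).f₀)
      (fun k => ham (S₀.totalGrad G k)) h.2 p φ o).2,
    (sum_vcontract_of_hamPair (a := fun k => (S₀.totalGrad G k).a₀)
      (f := fun k => (S₀.totalGrad G k).f₁) (fun k => (hr k).a₀) (fun k => (hr k).f₁)
      (fun k => ham (S₀.totalGrad G k)) h.1 p φ o).2⟩

/-- The master equation, differentiated in the even fields: in `Q(δS/δφ⁰) = 0`, where `Q` is the
Hamiltonian vector field of `S`, the quadratic part of `S` contributes `P₀ a₀ - K₁₀ᵗ f₁`. -/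
theorem FreeAction.grad_identity₀ (hV : ∀ k, IsInteraction μ (V k) (G k))
    (hcme : S₀.ClassicalMasterEquation V G) (k p : ℕ)
    (φ : EvenPart d F₀ B₀ F₁ B₁) (o : Fin p → OddPart d F₀ B₀ F₁ B₁) :
    extendC S₀.P₀ ((G k).a₀ p φ o) + ∑ x ∈ Finset.HasAntidiagonal.antidiagonal k,
      vcontract (mulICx (CoSec d F₀ B₀)) (G x.1).f₀ (ham (S₀.totalGrad G x.2)) p φ o =
    extendC S₀.K₁₀t ((G k).f₁ p φ o) := by
  have h := (FreeAction.sum_vcontract_grad hV hcme (k + 1) p φ o).1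
  rw [sum_vcontract_succ_linEv (f := fun k => (S₀.totalGrad G k).f₀) S₀.grad_f₀
    (fun k => (FreeAction.regG_totalGrad hV k).ham) k p φ o] at h
  have e : extendC S₀.f₀L ((ham (S₀.totalGrad G (k + 1))).ev p φ o) =
    extendC S₀.P₀ ((G k).a₀ p φ o) - extendC S₀.K₁₀t ((G k).f₁ p φ o) :=
    extendC_coprodL S₀.P₀ S₀.K₁₀t _ _
  rw [e] at h
  exact add_eq_of_sub_add_eq_zero h

/-- The counterpart of `FreeAction.grad_identity₀` for the odd fields. -/
theorem FreeAction.grad_identity₁ (hV : ∀ k, IsInteraction μ (V k) (G k))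
    (hcme : S₀.ClassicalMasterEquation V G) (k p : ℕ)
    (φ : EvenPart d F₀ B₀ F₁ B₁) (o : Fin p → OddPart d F₀ B₀ F₁ B₁) :
    extendC S₀.P₁ ((G k).a₁ p φ o) + ∑ x ∈ Finset.HasAntidiagonal.antidiagonal k,
      vcontract (mulICx (CoSec d F₁ B₁)) (G x.1).f₁ (ham (S₀.totalGrad G x.2)) p φ o =
    extendC (negL S₀.K₀₁t) ((G k).f₀ p φ o) := by
  have h := (FreeAction.sum_vcontract_grad hV hcme (k + 1) p φ o).2
  rw [sum_vcontract_succ_linOd (f := fun k => (S₀.totalGrad G k).f₁) S₀.grad_f₁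
    (fun k => (FreeAction.regG_totalGrad hV k).ham) k p φ o] at h
  have e : extendC S₀.f₁L ((ham (S₀.totalGrad G (k + 1))).od p φ o) =
    extendC S₀.P₁ ((G k).a₁ p φ o) - extendC (negL S₀.K₀₁t) ((G k).f₀ p φ o) :=
    extendC_coprodL S₀.P₁ (negL S₀.K₀₁t) _ _
  rw [e] at h
  exact add_eq_of_sub_add_eq_zero h

/-- The free part of the master equation: `P₀ K₀₁ = K₁₀ᵗ P₁`. -/
theorem FreeAction.intertwine₀ (hV : ∀ k, IsInteraction μ (V k) (G k))
    (hcme : S₀.ClassicalMasterEquation V G) (u : Sec d F₁ B₁) :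
    extendC S₀.P₀ (S₀.K₀₁ u) = extendC S₀.K₁₀t (S₀.P₁ u) := by
  have h := (FreeAction.sum_vcontract_grad hV hcme 0 1 (0, 0) fun _ => (u, 0)).1
  rw [Finset.Nat.antidiagonal_zero, Finset.sum_singleton] at h
  have e1 := vcontract_linEv (mulICx (CoSec d F₀ B₀)) S₀.f₀L 1 S₀.regG_grad.ham.altV (0, 0)
    fun _ => (u, 0)
  have e2 : extendC S₀.f₀L (hamPair (S₀.K₀₁ u) (S₀.P₁ u)) = _ :=
    extendC_coprodL S₀.P₀ S₀.K₁₀t _ _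
  rw [← S₀.grad_f₀] at e1
  have e3 : (ham S₀.grad).ev 1 (0, 0) (fun _ => (u, 0)) =
      hamPair (S₀.K₀₁ u) (S₀.P₁ u) :=
    congrArg (hamPair (S₀.K₀₁ u)) (clm_sub_apply_zero S₀.K₀₁t (S₀.P₁ u))
  rw [e3] at e1
  exact sub_eq_zero.1 (e2.symm.trans (e1.symm.trans h))

/-- The free part of the master equation: `P₁ K₁₀ = -K₀₁ᵗ P₀`. -/
theorem FreeAction.intertwine₁ (hV : ∀ k, IsInteraction μ (V k) (G k))
    (hcme : S₀.ClassicalMasterEquation V G) (u : Sec d F₀ B₀) :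
    extendC S₀.P₁ (S₀.K₁₀ u) = extendC (negL S₀.K₀₁t) (S₀.P₀ u) := by
  have h := (FreeAction.sum_vcontract_grad hV hcme 0 0 (u, 0) Fin.elim0).2
  rw [Finset.Nat.antidiagonal_zero, Finset.sum_singleton] at h
  have e1 := vcontract_linOd (mulICx (CoSec d F₁ B₁)) S₀.f₁L 0 S₀.regG_grad.ham.altV (u, 0)
    Fin.elim0
  have e2 : extendC S₀.f₁L (hamPair (S₀.K₁₀ u) (S₀.P₀ u)) = _ :=
    extendC_coprodL S₀.P₁ (negL S₀.K₀₁t) _ _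
  rw [← S₀.grad_f₁] at e1
  have e3 : (ham S₀.grad).od 0 (u, 0) Fin.elim0 =
      hamPair (S₀.K₁₀ u) (S₀.P₀ u) :=
    congrArg (hamPair (S₀.K₁₀ u)) (clm_add_apply_zero S₀.K₁₀t (S₀.P₀ u))
  rw [e3] at e1
  exact sub_eq_zero.1 (e2.symm.trans (e1.symm.trans h))

end Intertwine

/-! ### The Møller map and the BV differentials -/

section Moller

variable {d : ℕ} {M : Type*} [TopologicalSpace M] [ChartedSpace (EuclideanSpace ℝ (Fin d)) M]
  [IsManifold (𝓡 d) ∞ M]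
  {F₀ : Type*} [NormedAddCommGroup F₀] [NormedSpace ℝ F₀]
  {B₀ : M → Type*} [TopologicalSpace (TotalSpace F₀ B₀)] [∀ x, TopologicalSpace (B₀ x)]
  [FiberBundle F₀ B₀] [∀ x, AddCommGroup (B₀ x)] [∀ x, Module ℝ (B₀ x)] [VectorBundle ℝ F₀ B₀]
  [ContMDiffVectorBundle ∞ F₀ B₀ (𝓡 d)]
  [∀ x, IsTopologicalAddGroup (B₀ x)] [∀ x, ContinuousSMul ℝ (B₀ x)]
  {F₁ : Type*} [NormedAddCommGroup F₁] [NormedSpace ℝ F₁]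
  {B₁ : M → Type*} [TopologicalSpace (TotalSpace F₁ B₁)] [∀ x, TopologicalSpace (B₁ x)]
  [FiberBundle F₁ B₁] [∀ x, AddCommGroup (B₁ x)] [∀ x, Module ℝ (B₁ x)] [VectorBundle ℝ F₁ B₁]
  [ContMDiffVectorBundle ∞ F₁ B₁ (𝓡 d)]
  [∀ x, IsTopologicalAddGroup (B₁ x)] [∀ x, ContinuousSMul ℝ (B₁ x)]

variable [MeasurableSpace M] {μ : Measure M} [T2Space M] [BorelSpace M]
  [IsFiniteMeasureOnCompacts μ] [SecondCountableTopology M] [μ.IsOpenPosMeasure]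
  {S₀ : FreeAction d F₀ B₀ F₁ B₁ μ}
  {V : FSeries (EvenPart d F₀ B₀ F₁ B₁) (OddPart d F₀ B₀ F₁ B₁) ℂ}
  {G : ℕ → Grad d F₀ B₀ F₁ B₁}

theorem IsLocalOp.negL {K : CoSec d F₀ B₀ →L[ℝ] Cx (CoSec d F₁ B₁)} (hK : IsLocalOp K) :
    IsLocalOp (negL K) := fun s =>
  ⟨(sSupport_neg_subset (K s).1).trans (hK s).1, (sSupport_neg_subset (K s).2).trans (hK s).2⟩

theorem cxCompact_of_sSupport {K : Set M} (hK : IsCompact K) {w : Cx (Sec d F₀ B₀)}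
    (h : sSupport w.1 ⊆ K ∧ sSupport w.2 ⊆ K) : CxCompact w :=
  ⟨hK.of_isClosed_subset isClosed_closure h.1, hK.of_isClosed_subset isClosed_closure h.2⟩

theorem FreeAction.regV_gradSeries : ∀ k, RegV (ham (S₀.gradSeries k))
  | 0 => S₀.regG_grad.ham
  | k + 1 => by
    show RegV (ham (⟨0, 0, 0, 0⟩ : Grad d F₀ B₀ F₁ B₁))
    rw [ham_zero]
    exact RegV.zero

section Displacement

variable {Jp Jm : Set M → Set M} {ΔR₀ : CoSec d F₀ B₀ → Cx (Sec d F₀ B₀)}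
  {ΔR₁ : CoSec d F₁ B₁ → Cx (Sec d F₁ B₁)}

theorem reg_green_f₀ (hR₀ : IsGreenOperator Jp S₀.P₀ ΔR₀)
    (hV : ∀ k, IsInteraction μ (V k) (G k)) (k : ℕ) :
    Reg fun n φ o => extendC ΔR₀ ((G k).f₀ n φ o) := by
  obtain ⟨K, hK, h⟩ := (hV k).compact
  exact (hR₀.comp_reg (hV k).regG.f₀ hK fun n φ o => (h n φ o).1).1

theorem reg_green_f₁ (hR₁ : IsGreenOperator Jp S₀.P₁ ΔR₁)
    (hV : ∀ k, IsInteraction μ (V k) (G k)) (k : ℕ) :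
    Reg fun n φ o => extendC ΔR₁ ((G k).f₁ n φ o) := by
  obtain ⟨K, hK, h⟩ := (hV k).compact
  exact (hR₁.comp_reg (hV k).regG.f₁ hK fun n φ o => (h n φ o).2.1).1

theorem regV_displacement (hR₀ : IsGreenOperator Jp S₀.P₀ ΔR₀)
    (hR₁ : IsGreenOperator Jp S₀.P₁ ΔR₁) (hV : ∀ k, IsInteraction μ (V k) (G k)) :
    ∀ k, RegV (displacement ΔR₀ ΔR₁ G k)
  | 0 => RegV.zero
  | k + 1 => ⟨(reg_green_f₀ hR₀ hV k).clm (inlCx (Sec d F₀ B₀) (CoSec d F₁ B₁)),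
      (reg_green_f₁ hR₁ hV k).clm (inlCx (Sec d F₁ B₁) (CoSec d F₀ B₀))⟩

/-- The substitution of `φ + Δᴿ δV/δφ` for `φ` intertwines `{·, S₀}` with `{·, S₀ + V}`. -/
theorem FreeAction.contractSeries_translate_displacement
    (hmono : ∀ K L, K ⊆ L → Jp K ⊆ Jp L)
    (hJ : ∀ K L, IsCompact K → IsCompact L → IsCompact (Jp K ∩ Jm L))
    {ΔA₀ : CoSec d F₀ B₀ → Cx (Sec d F₀ B₀)} {ΔA₁ : CoSec d F₁ B₁ → Cx (Sec d F₁ B₁)}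
    (hR₀ : IsGreenOperator Jp S₀.P₀ ΔR₀) (hA₀ : IsGreenOperator Jm S₀.P₀ ΔA₀)
    (hR₁ : IsGreenOperator Jp S₀.P₁ ΔR₁) (hA₁ : IsGreenOperator Jm S₀.P₁ ΔA₁)
    (hV : ∀ k, IsInteraction μ (V k) (G k)) (hcme : S₀.ClassicalMasterEquation V G)
    {X : FSeries (EvenPart d F₀ B₀ F₁ B₁) (OddPart d F₀ B₀ F₁ B₁) ℂ}
    (hX : X ∈ regSeries (EvenPart d F₀ B₀ F₁ B₁) (OddPart d F₀ B₀ F₁ B₁)) :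
    contractSeries (translate (displacement ΔR₀ ΔR₁ G) X) (fun k => ham (S₀.totalGrad G k)) =
      translate (displacement ΔR₀ ΔR₁ G) (contractSeries X fun k => ham (S₀.gradSeries k)) := by
  choose K hK hKG using fun k => (hV k).compact
  refine contractSeries_translate_inl (reg_green_f₀ hR₀ hV) (reg_green_f₁ hR₁ hV) rfl
    (fun k => rfl) (fun k n hn φ o => ?_) (fun k n hn φ o => ?_)
    (fun k => (FreeAction.regG_totalGrad hV k).ham) S₀.evOp S₀.odOp S₀.ham_grad S₀.ham_grad
    (fun k => ham_zero) (fun k p φ o => ?_) (fun k p φ o => ?_) hX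
  · exact (congrArg (extendC ΔR₀) ((hV k).f₀_eq_zero hn φ o)).trans hR₀.extendC_zero
  · exact (congrArg (extendC ΔR₁) ((hV k).f₁_eq_zero hn φ o)).trans hR₁.extendC_zero
  · have hf := cxCompact_of_sSupport (hK k) (hKG k p φ o).2.1
    -- `Q(Δᴿ f₀) = Δᴿ (K₁₀ᵗ f₁) - a₀`
    have e1 := hR₀.sum_vcontract S₀.local_P₀ (f := fun k => (G k).f₀) (fun k => (hV k).regG.f₀)
      (fun k => ⟨K k, hK k, fun n φ o => (hKG k n φ o).1⟩) (fun k => ham (S₀.totalGrad G k))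
      (cxCompact_of_sSupport (hK k) (hKG k p φ o).2.2.1)
      (FreeAction.grad_identity₀ hV hcme k p φ o)
    -- `K₀₁ Δᴿ f₁ = Δᴿ K₁₀ᵗ f₁`
    have e2 := green_intertwine hmono hJ S₀.local_P₀ (ε := 1)
      (fun u v hu hv => (S₀.symm_P₀ u v hu hv).trans (one_mul _).symm) hR₀ hA₀ hR₁ S₀.local_K₀₁
      S₀.local_K₁₀t (FreeAction.intertwine₀ hV hcme) hf
    -- the linear vector field at the displacement `Δᴿ f₁`
    have e3 := (extendC_hamPairL S₀.a₀L S₀.f₁L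
      (inlCx (Sec d F₁ B₁) (CoSec d F₀ B₀) (extendC ΔR₁ ((G k).f₁ p φ o)))).trans
      (congrArg₂ hamPair (extendC_comp_fst_inlCx S₀.K₀₁ _)
        ((extendC_coprodL_inlCx S₀.P₁ (negL S₀.K₀₁t) _).trans (hR₁.right_inv_extendC hf)))
    refine (congrArg (_ + inlCx (Sec d F₀ B₀) (CoSec d F₁ B₁) ·) e1).trans
      ((hamPair_add_inlCx _ _ _).trans ?_)
    rw [← e2]
    exact e3.symm
  · have hf := cxCompact_of_sSupport (hK k) (hKG k p φ o).1
    have e1 := hR₁.sum_vcontract S₀.local_P₁ (f := fun k => (G k).f₁) (fun k => (hV k).regG.f₁)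
      (fun k => ⟨K k, hK k, fun n φ o => (hKG k n φ o).2.1⟩) (fun k => ham (S₀.totalGrad G k))
      (cxCompact_of_sSupport (hK k) (hKG k p φ o).2.2.2)
      (FreeAction.grad_identity₁ hV hcme k p φ o)
    have e2 := green_intertwine hmono hJ S₀.local_P₁ (ε := -1)
      (fun u v hu hv => (S₀.skew_P₁ u v hu hv).trans (neg_one_mul _).symm) hR₁ hA₁ hR₀ S₀.local_K₁₀
      S₀.local_K₀₁t.negL (FreeAction.intertwine₁ hV hcme) hf
    have e3 := (extendC_hamPairL S₀.a₁L S₀.f₀L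
      (inlCx (Sec d F₀ B₀) (CoSec d F₁ B₁) (extendC ΔR₀ ((G k).f₀ p φ o)))).trans
      (congrArg₂ hamPair (extendC_comp_fst_inlCx S₀.K₁₀ _)
        ((extendC_coprodL_inlCx S₀.P₀ S₀.K₁₀t _).trans (hR₀.right_inv_extendC hf)))
    refine (congrArg (_ + inlCx (Sec d F₁ B₁) (CoSec d F₀ B₀) ·) e1).trans
      ((hamPair_add_inlCx _ _ _).trans ?_)
    rw [← e2]
    exact e3.symm

theorem smoothSeries_eq : smoothSeries (EvenPart d F₀ B₀ F₁ B₁) (OddPart d F₀ B₀ F₁ B₁) =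
    regSeries (EvenPart d F₀ B₀ F₁ B₁) (OddPart d F₀ B₀ F₁ B₁) := by
  ext X
  exact forall_congr' fun k => isSmooth_iff_reg

theorem mapsTo_antibracket {H : ℕ → Grad d F₀ B₀ F₁ B₁} (hH : ∀ k, RegV (ham (H k))) :
    MapsTo (fun X => antibracket X H)
      (smoothSeries (EvenPart d F₀ B₀ F₁ B₁) (OddPart d F₀ B₀ F₁ B₁))
      (smoothSeries (EvenPart d F₀ B₀ F₁ B₁) (OddPart d F₀ B₀ F₁ B₁)) := by
  rw [smoothSeries_eq]
  exact fun X hX => contractSeries_mem hX hH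

theorem bijOn_mollerInv (hR₀ : IsGreenOperator Jp S₀.P₀ ΔR₀)
    (hR₁ : IsGreenOperator Jp S₀.P₁ ΔR₁) (hV : ∀ k, IsInteraction μ (V k) (G k)) :
    BijOn (mollerInv ΔR₀ ΔR₁ G)
      (smoothSeries (EvenPart d F₀ B₀ F₁ B₁) (OddPart d F₀ B₀ F₁ B₁))
      (smoothSeries (EvenPart d F₀ B₀ F₁ B₁) (OddPart d F₀ B₀ F₁ B₁)) := by
  rw [smoothSeries_eq]
  exact bijOn_translate (regV_displacement hR₀ hR₁ hV) rfl

end Displacement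

end Moller

theorem eqOn_conj_of_bijOn {α : Type*} [Nonempty α] {A : Set α} {r s s₀ : α → α} (hr : BijOn r A A)
    (h : ∀ X ∈ A, s (r X) = r (s₀ X)) : EqOn s (r ∘ s₀ ∘ Function.invFunOn r A) A := fun X hX => by
  have h1 := h _ (Function.invFunOn_mem (hr.surjOn hX))
  rwa [Function.invFunOn_eq (hr.surjOn hX)] at h1

end ClassicalBV

end

theorem mainTheorem2 {d : ℕ} {M : Type*} [TopologicalSpace M] [T2Space M]
    [SecondCountableTopology M] [ChartedSpace (EuclideanSpace ℝ (Fin d)) M]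
    [IsManifold (𝓡 d) ∞ M]
    (g : ClassicalBV.Spacetime d M) (hg : g.GloballyHyperbolic)
    [MeasurableSpace M] [BorelSpace M] (μ : Measure M) [IsLocallyFiniteMeasure μ]
    [μ.IsOpenPosMeasure]
    {F₀ : Type*} [NormedAddCommGroup F₀] [NormedSpace ℝ F₀] [FiniteDimensional ℝ F₀]
    {B₀ : M → Type*} [TopologicalSpace (TotalSpace F₀ B₀)] [∀ x, TopologicalSpace (B₀ x)]
    [FiberBundle F₀ B₀] [∀ x, AddCommGroup (B₀ x)] [∀ x, Module ℝ (B₀ x)]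
    [VectorBundle ℝ F₀ B₀] [ContMDiffVectorBundle ∞ F₀ B₀ (𝓡 d)]
    [∀ x, IsTopologicalAddGroup (B₀ x)] [∀ x, ContinuousSMul ℝ (B₀ x)]
    {F₁ : Type*} [NormedAddCommGroup F₁] [NormedSpace ℝ F₁] [FiniteDimensional ℝ F₁]
    {B₁ : M → Type*} [TopologicalSpace (TotalSpace F₁ B₁)] [∀ x, TopologicalSpace (B₁ x)]
    [FiberBundle F₁ B₁] [∀ x, AddCommGroup (B₁ x)] [∀ x, Module ℝ (B₁ x)]
    [VectorBundle ℝ F₁ B₁] [ContMDiffVectorBundle ∞ F₁ B₁ (𝓡 d)]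
    [∀ x, IsTopologicalAddGroup (B₁ x)] [∀ x, ContinuousSMul ℝ (B₁ x)]
    (S₀ : ClassicalBV.FreeAction d F₀ B₀ F₁ B₁ μ)
    (ΔR₀ ΔA₀ : ClassicalBV.CoSec d F₀ B₀ → ClassicalBV.Cx (ClassicalBV.Sec d F₀ B₀))
    (ΔR₁ ΔA₁ : ClassicalBV.CoSec d F₁ B₁ → ClassicalBV.Cx (ClassicalBV.Sec d F₁ B₁))
    (hR₀ : ClassicalBV.IsGreenOperator g.Jplus S₀.P₀ ΔR₀)
    (hA₀ : ClassicalBV.IsGreenOperator g.Jminus S₀.P₀ ΔA₀)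
    (hR₁ : ClassicalBV.IsGreenOperator g.Jplus S₀.P₁ ΔR₁)
    (hA₁ : ClassicalBV.IsGreenOperator g.Jminus S₀.P₁ ΔA₁)
    (V : ClassicalBV.FSeries (ClassicalBV.EvenPart d F₀ B₀ F₁ B₁)
      (ClassicalBV.OddPart d F₀ B₀ F₁ B₁) ℂ)
    (G : ℕ → ClassicalBV.Grad d F₀ B₀ F₁ B₁)
    (hV : ∀ k, ClassicalBV.IsInteraction μ (V k) (G k))
    (hcme : S₀.ClassicalMasterEquation V G) :
    Set.MapsTo S₀.freeBV
      (ClassicalBV.smoothSeries (ClassicalBV.EvenPart d F₀ B₀ F₁ B₁)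
        (ClassicalBV.OddPart d F₀ B₀ F₁ B₁))
      (ClassicalBV.smoothSeries (ClassicalBV.EvenPart d F₀ B₀ F₁ B₁)
        (ClassicalBV.OddPart d F₀ B₀ F₁ B₁)) ∧
    Set.MapsTo (S₀.fullBV G)
      (ClassicalBV.smoothSeries (ClassicalBV.EvenPart d F₀ B₀ F₁ B₁)
        (ClassicalBV.OddPart d F₀ B₀ F₁ B₁))
      (ClassicalBV.smoothSeries (ClassicalBV.EvenPart d F₀ B₀ F₁ B₁)
        (ClassicalBV.OddPart d F₀ B₀ F₁ B₁)) ∧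
    Set.BijOn (ClassicalBV.mollerInv ΔR₀ ΔR₁ G)
      (ClassicalBV.smoothSeries (ClassicalBV.EvenPart d F₀ B₀ F₁ B₁)
        (ClassicalBV.OddPart d F₀ B₀ F₁ B₁))
      (ClassicalBV.smoothSeries (ClassicalBV.EvenPart d F₀ B₀ F₁ B₁)
        (ClassicalBV.OddPart d F₀ B₀ F₁ B₁)) ∧
    Set.EqOn (S₀.fullBV G)
      (ClassicalBV.mollerInv ΔR₀ ΔR₁ G ∘ S₀.freeBV ∘ ClassicalBV.moller ΔR₀ ΔR₁ G)
      (ClassicalBV.smoothSeries (ClassicalBV.EvenPart d F₀ B₀ F₁ B₁)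
        (ClassicalBV.OddPart d F₀ B₀ F₁ B₁)) := by
  have hbij := ClassicalBV.bijOn_mollerInv hR₀ hR₁ hV
  refine ⟨ClassicalBV.mapsTo_antibracket ClassicalBV.FreeAction.regV_gradSeries,
    ClassicalBV.mapsTo_antibracket fun k => (ClassicalBV.FreeAction.regG_totalGrad hV k).ham,
    hbij, ClassicalBV.eqOn_conj_of_bijOn hbij fun X hX => ?_⟩
  rw [ClassicalBV.smoothSeries_eq] at hX
  exact ClassicalBV.FreeAction.contractSeries_translate_displacement (Jp := g.Jplus) (Jm := g.Jminus)
    (fun K L hKL q ⟨p, hp, hpq⟩ => ⟨p, hKL hp, hpq⟩) hg.2 hR₀ hA₀ hR₁ hA₁ hV hcme hX
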